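/- Work with unoriented tame links in $\mathbb{R}^3$ with at least one component (subsets of $\mathbb{R}^3$ ambient isotopic to a disjoint union of finitely many, at least one, simple closed polygons). A skein quadruple $(L_+,L_-,L_\infty,L_0)$ consists of four links that, up to one common ambient isotopy, are polygonal links that coincide outside a fixed ball and whose intersections with this ball, seen in projection along a fixed direction as two arcs with the four endpoints SW, SE, NW, NE, are: for $L_+$, the crossing in which the strand from SW to NE passes over the strand from SE to NW; for $L_-$, the same crossing with over and under exchanged; for $L_\infty$, the smoothing with two disjoint arcs SW–NW and SE–NE; for $L_0$, the smoothing with two disjoint arcs SW–SE and NW–NE. Let $R$ be a commutative ring, let $a,b,c,d\in R$ be invertible, and let $f$ and $f'$ be two $R$-valued functions on links that are invariant under ambient isotopy, such that \[ a\,f(L_+)+b\,f(L_-)+c\,f(L_\infty)+d\,f(L_0)=0 \quad\text{and}\quad a\,f'(L_+)+b\,f'(L_-)+c\,f'(L_\infty)+d\,f'(L_0)=0 \] for every skein quadruple $(L_+,L_-,L_\infty,L_0)$. If $f(U)=f'(U)$ for the unknot $U$, then $f(L)=f'(L)$ for every link $L$. -/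

import Mathlib

/-! Unoriented tame links in Euclidean three-space, ambient isotopy, and skein quadruples. -/

/-- Euclidean three-space. -/
abbrev E3 : Type := EuclideanSpace ℝ (Fin 3)

/-- The homeomorphism `h` of three-space is the final map of an isotopy of three-space, that is, of
a continuous one-parameter family of homeomorphisms starting at the identity. -/
def IsFinalMapOfIsotopy (h : E3 ≃ₜ E3) : Prop :=
  ∃ H : unitInterval → (E3 ≃ₜ E3),
    Continuous (fun p : unitInterval × E3 => H p.1 p.2) ∧ H 0 = Homeomorph.refl E3 ∧ H 1 = h

/-- Ambient isotopy of subsets of three-space. -/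
def AmbientIsotopic (L L' : Set E3) : Prop :=
  ∃ h : E3 ≃ₜ E3, IsFinalMapOfIsotopy h ∧ h '' L = L'

/-- The straight segment spanned by an unordered pair of points. -/
def edgeSegment (e : Sym2 E3) : Set E3 := convexHull ℝ {x | x ∈ e}

/-- A finite non-empty set of non-degenerate straight edges in three-space such that two different
edges meet at most in common endpoints, and every vertex lies on exactly two edges. Such a set
decomposes into finitely many (at least one) pairwise disjoint simple closed polygons. -/
structure IsClosedPolygonSystem (S : Set (Sym2 E3)) : Prop where
  finite : S.Finite
  nonempty : S.Nonempty
  not_isDiag : ∀ e ∈ S, ¬ e.IsDiag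
  inter_subset : ∀ e ∈ S, ∀ e' ∈ S, e ≠ e' →
    edgeSegment e ∩ edgeSegment e' ⊆ {x | x ∈ e ∧ x ∈ e'}
  degree_eq_two : ∀ e ∈ S, ∀ v ∈ e, {e' | e' ∈ S ∧ v ∈ e'}.ncard = 2

/-- A polygonal link: a disjoint union of finitely many (at least one) simple closed polygons. -/
def IsPolygonalLink (L : Set E3) : Prop :=
  ∃ S : Set (Sym2 E3), IsClosedPolygonSystem S ∧ L = ⋃ e ∈ S, edgeSegment e

/-- A (tame, unoriented, non-empty) link in three-space: a subset that is ambient isotopic to a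
polygonal link. -/
def IsLink (L : Set E3) : Prop :=
  ∃ P : Set E3, IsPolygonalLink P ∧ AmbientIsotopic L P

/-- The type of links in three-space. -/
abbrev Link : Type := {L : Set E3 // IsLink L}

/-- A link invariant: a function on links that is constant on ambient isotopy classes. -/
def IsLinkInvariant {R : Type*} (f : Link → R) : Prop :=
  ∀ L L' : Link, AmbientIsotopic L.1 L'.1 → f L = f L'

/-! The four standard local pictures, in the ball of radius `√2` about the origin. They have the
same endpoints `(±1, ±1, 0)`, and are viewed from above: the third coordinate is the height over
the plane of projection, the first coordinate points to the right, the second one upwards. -/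

/-- The ball that contains the local pictures. -/
noncomputable def skeinBall : Set E3 := Metric.closedBall 0 (Real.sqrt 2)

/-- The positive picture: the strand from bottom left to top right passes over the other one. -/
def tanglePos : Set E3 :=
  segment ℝ !₂[-1, -1, 0] !₂[0, 0, 1] ∪ segment ℝ !₂[0, 0, 1] !₂[1, 1, 0] ∪
    segment ℝ !₂[1, -1, 0] !₂[-1, 1, 0]

/-- The negative picture: the strand from bottom right to top left passes over the other one. -/
def tangleNeg : Set E3 :=
  segment ℝ !₂[1, -1, 0] !₂[0, 0, 1] ∪ segment ℝ !₂[0, 0, 1] !₂[-1, 1, 0] ∪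
    segment ℝ !₂[-1, -1, 0] !₂[1, 1, 0]

/-- The smoothing `∞`: a left arc and a right arc, each joining bottom to top. -/
noncomputable def tangleInfty : Set E3 :=
  (segment ℝ !₂[-1, -1, 0] !₂[-1 / 2, 0, 0] ∪ segment ℝ !₂[-1 / 2, 0, 0] !₂[-1, 1, 0]) ∪
    (segment ℝ !₂[1, -1, 0] !₂[1 / 2, 0, 0] ∪ segment ℝ !₂[1 / 2, 0, 0] !₂[1, 1, 0])

/-- The smoothing `0`: a bottom arc and a top arc, each joining left to right. -/
noncomputable def tangleZero : Set E3 :=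
  (segment ℝ !₂[-1, -1, 0] !₂[0, -1 / 2, 0] ∪ segment ℝ !₂[0, -1 / 2, 0] !₂[1, -1, 0]) ∪
    (segment ℝ !₂[-1, 1, 0] !₂[0, 1 / 2, 0] ∪ segment ℝ !₂[0, 1 / 2, 0] !₂[1, 1, 0])

/-- Four links form a skein quadruple if one and the same ambient isotopy brings them to polygonal
links that coincide outside the standard ball and that are, inside it, the positive crossing, the
negative crossing, the smoothing `∞` and the smoothing `0`. -/
def IsSkeinQuadruple (Lpos Lneg Linf Lzero : Link) : Prop :=
  ∃ h : E3 ≃ₜ E3, IsFinalMapOfIsotopy h ∧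
    (IsPolygonalLink (h '' Lpos.1) ∧ IsPolygonalLink (h '' Lneg.1) ∧
      IsPolygonalLink (h '' Linf.1) ∧ IsPolygonalLink (h '' Lzero.1)) ∧
    (h '' Lpos.1 ∩ skeinBall = tanglePos ∧ h '' Lneg.1 ∩ skeinBall = tangleNeg ∧
      h '' Linf.1 ∩ skeinBall = tangleInfty ∧ h '' Lzero.1 ∩ skeinBall = tangleZero) ∧
    (h '' Lneg.1 \ skeinBall = h '' Lpos.1 \ skeinBall ∧
      h '' Linf.1 \ skeinBall = h '' Lpos.1 \ skeinBall ∧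
      h '' Lzero.1 \ skeinBall = h '' Lpos.1 \ skeinBall)

/-- The four-term skein relation with coefficients `a`, `b`, `c`, `d`. -/
def SatisfiesSkein {R : Type*} [CommRing R] (a b c d : R) (f : Link → R) : Prop :=
  ∀ Lpos Lneg Linf Lzero : Link, IsSkeinQuadruple Lpos Lneg Linf Lzero →
    a * f Lpos + b * f Lneg + c * f Linf + d * f Lzero = 0

/-- The edges of a planar triangle. -/
def triangleEdges : Set (Sym2 E3) :=
  {s(!₂[0, 0, 0], !₂[1, 0, 0]), s(!₂[1, 0, 0], !₂[0, 1, 0]), s(!₂[0, 1, 0], !₂[0, 0, 0])}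

theorem edgeSegment_mk (p q : E3) : edgeSegment s(p, q) = segment ℝ p q := by
  have : {x | x ∈ s(p, q)} = ({p, q} : Set E3) := by ext x; simp
  rw [edgeSegment, this, convexHull_pair]

theorem segment_inter_subset_of_linearIndependent (p q r : E3)
    (h : ∀ s t : ℝ, s • (p - q) + t • (r - q) = 0 → s = 0 ∧ t = 0) :
    edgeSegment s(p, q) ∩ edgeSegment s(q, r) ⊆ {x | x ∈ s(p, q) ∧ x ∈ s(q, r)} := by
  rw [edgeSegment_mk, edgeSegment_mk]
  rintro x ⟨⟨a, b, ha, hb, hab, rfl⟩, ⟨c, d, hc, hd, hcd, hx⟩⟩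
  have hb' : b = 1 - a := by linarith
  have hc' : c = 1 - d := by linarith
  subst hb' hc'
  have key : a • (p - q) + (-d) • (r - q) = 0 := by
    have : a • (p - q) + (-d) • (r - q) =
      (a • p + (1 - a) • q) - ((1 - d) • q + d • r) := by module
    rw [this, hx, sub_self]
  obtain ⟨h1, -⟩ := h _ _ key
  subst h1
  simp

theorem isClosedPolygonSystem_triangle (A B C : E3)
    (h : ∀ s t : ℝ, s • (B - A) + t • (C - A) = 0 → s = 0 ∧ t = 0) :
    IsClosedPolygonSystem {s(A, B), s(B, C), s(C, A)} := by
  have hAB : A ≠ B := by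
    rintro rfl
    have := (h 1 0 (by simp)).1
    norm_num at this
  have hCA : C ≠ A := by
    rintro rfl
    have := (h 0 1 (by simp)).2
    norm_num at this
  have hBC : B ≠ C := by
    rintro rfl
    have := (h 1 (-1) (by module)).1
    norm_num at this
  have hA : edgeSegment s(C, A) ∩ edgeSegment s(A, B) ⊆ {x | x ∈ s(C, A) ∧ x ∈ s(A, B)} := by
    refine segment_inter_subset_of_linearIndependent _ _ _ fun s t hst => ?_
    exact (h t s (by rw [← hst]; module)).symm
  have hB : edgeSegment s(A, B) ∩ edgeSegment s(B, C) ⊆ {x | x ∈ s(A, B) ∧ x ∈ s(B, C)} := by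
    refine segment_inter_subset_of_linearIndependent _ _ _ fun s t hst => ?_
    obtain ⟨h1, h2⟩ := h (-(s + t)) t (by rw [← hst]; module)
    exact ⟨by linarith, h2⟩
  have hC : edgeSegment s(B, C) ∩ edgeSegment s(C, A) ⊆ {x | x ∈ s(B, C) ∧ x ∈ s(C, A)} := by
    refine segment_inter_subset_of_linearIndependent _ _ _ fun s t hst => ?_
    obtain ⟨h1, h2⟩ := h s (-(s + t)) (by rw [← hst]; module)
    exact ⟨h1, by linarith⟩
  refine ⟨by simp, by simp, ?_, ?_, ?_⟩
  · rintro e (rfl | rfl | rfl) <;> simpa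
  · have swap : ∀ {e e' : Sym2 E3},
        edgeSegment e ∩ edgeSegment e' ⊆ {x | x ∈ e ∧ x ∈ e'} →
        edgeSegment e' ∩ edgeSegment e ⊆ {x | x ∈ e' ∧ x ∈ e} :=
      fun hs x hx => (hs hx.symm).symm
    rintro e (rfl | rfl | rfl) e' (rfl | rfl | rfl) hne
    · exact absurd rfl hne
    · exact hB
    · exact swap hA
    · exact swap hB
    · exact absurd rfl hne
    · exact hC
    · exact hA
    · exact swap hC
    · exact absurd rfl hne
  · have dA : {e' | e' ∈ ({s(A, B), s(B, C), s(C, A)} : Set (Sym2 E3)) ∧ A ∈ e'} =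
        {s(A, B), s(C, A)} := by
      ext e'
      constructor
      · rintro ⟨rfl | rfl | rfl, hm⟩ <;> simp_all
      · rintro (rfl | rfl) <;> simp
    have dB : {e' | e' ∈ ({s(A, B), s(B, C), s(C, A)} : Set (Sym2 E3)) ∧ B ∈ e'} =
        {s(A, B), s(B, C)} := by
      ext e'
      constructor
      · rintro ⟨rfl | rfl | rfl, hm⟩ <;> simp_all
      · rintro (rfl | rfl) <;> simp
    have dC : {e' | e' ∈ ({s(A, B), s(B, C), s(C, A)} : Set (Sym2 E3)) ∧ C ∈ e'} =
        {s(B, C), s(C, A)} := by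
      ext e'
      constructor
      · rintro ⟨rfl | rfl | rfl, hm⟩ <;> simp_all
      · rintro (rfl | rfl) <;> simp
    have nA : ({s(A, B), s(C, A)} : Set (Sym2 E3)).ncard = 2 :=
      Set.ncard_pair (by simp [hCA.symm, hBC])
    have nB : ({s(A, B), s(B, C)} : Set (Sym2 E3)).ncard = 2 :=
      Set.ncard_pair (by simp [hCA.symm, hBC, hAB])
    have nC : ({s(B, C), s(C, A)} : Set (Sym2 E3)).ncard = 2 :=
      Set.ncard_pair (by simp [hBC, hAB.symm])
    rintro e (rfl | rfl | rfl) v hv <;> rcases Sym2.mem_iff.1 hv with rfl | rfl <;>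
      first
        | (rw [dA]; exact nA)
        | (rw [dB]; exact nB)
        | (rw [dC]; exact nC)

theorem isClosedPolygonSystem_triangleEdges : IsClosedPolygonSystem triangleEdges := by
  refine isClosedPolygonSystem_triangle _ _ _ fun s t hst => ?_
  have h0 := congrArg (fun v : E3 => v 0) hst
  have h1 := congrArg (fun v : E3 => v 1) hst
  exact ⟨by simpa using h0, by simpa using h1⟩

theorem isLink_triangle : IsLink (⋃ e ∈ triangleEdges, edgeSegment e) :=
  ⟨_, ⟨triangleEdges, isClosedPolygonSystem_triangleEdges, rfl⟩, Homeomorph.refl E3,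
    ⟨fun _ => Homeomorph.refl E3, continuous_snd, rfl, rfl⟩, by simp⟩

/-- The unknot, as the boundary of a planar triangle. -/
def unknot : Link := ⟨⋃ e ∈ triangleEdges, edgeSegment e, isLink_triangle⟩

/-! Subtracting the two skein relations shows that the class `Z` of links on which `f` and `f'`
agree has the following properties, collected in `SkeinClosed`. It is closed under ambient isotopy
and contains the unknot. If it contains both smoothings of a crossing, it contains one of the two
crossings if and only if it contains the other, because `a` and `b` are units. If it contains both
crossings and the smoothing `∞`, it contains the smoothing `0`, because `d` is a unit. It remains to
show that such a class contains every polygonal link (`SkeinClosed.polySys`).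

This is an induction on the number of crossings of a projection and, for equal numbers, on the
number of edges. A small perturbation makes the projection generic without increasing either number
(`PolySys.exists_generic`). Both smoothings of a crossing have fewer crossings
(`exists_standardQuadruple`), so by induction crossings may be switched at will: over a fixed
generic diagram, membership in `Z` does not depend on the heights (`Gen.height_change`). Heights can
thus be chosen for which one component lies over all others and climbs along its way round, apart
from a closing edge that runs above it. Such a component contracts to a triangle above the rest
(`Gen.exists_top_triangle`). The rest has no more crossings and fewer edges, so it is in `Z` by
induction, unless it is empty.

A triangle above a link of `Z` is split off by a curl (`SkeinClosed.curl`): in a kink at the top of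
a link `R`, both crossings and the smoothing `∞` are isotopic to `R`, while the smoothing `0` is `R`
together with a separate trivial circle. Hence this union is in `Z`. If the rest is empty, the link
is the unknot.

All isotopies except affine changes of coordinates come from motions of the vertices of a straight
graph. A small displacement of the vertices of an embedded graph extends to a perturbation of the
identity with Lipschitz constant less than one (`Emb.exists_perturb`), and connectedness of the time
interval then treats any motion through embedded graphs (`ambientIsotopic_of_motion`). The
replacement of an edge by the other two sides of a triangle (`delta_add`), changes of height over a
diagram (`height_motion`) and motions of a triangle above a link (`tri_motion`) are instances. -/

section
open Set Topology Filter
open scoped unitInterval NNReal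

/-! ### Ambient isotopies -/

theorem IsFinalMapOfIsotopy.refl : IsFinalMapOfIsotopy (Homeomorph.refl E3) :=
  ⟨fun _ => Homeomorph.refl E3, continuous_snd, rfl, rfl⟩

theorem IsFinalMapOfIsotopy.trans {h k : E3 ≃ₜ E3} (hh : IsFinalMapOfIsotopy h)
    (hk : IsFinalMapOfIsotopy k) : IsFinalMapOfIsotopy (h.trans k) := by
  obtain ⟨H, cH, H0, H1⟩ := hh
  obtain ⟨K, cK, K0, K1⟩ := hk
  refine ⟨fun t => (H t).trans (K t), ?_, ?_, ?_⟩
  · exact cK.comp (continuous_fst.prodMk cH)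
  · simp only [H0, K0]; rfl
  · simp only [H1, K1]

/-- The isotopy is `h⁻¹ ∘ H (1 - t)`. With this choice joint continuity of the inverse maps of `H`
is not needed. -/
theorem IsFinalMapOfIsotopy.symm {h : E3 ≃ₜ E3} (hh : IsFinalMapOfIsotopy h) :
    IsFinalMapOfIsotopy h.symm := by
  obtain ⟨H, cH, H0, H1⟩ := hh
  refine ⟨fun t => (H (σ t)).trans h.symm, ?_, ?_, ?_⟩
  · exact h.symm.continuous.comp
      (cH.comp ((unitInterval.continuous_symm.comp continuous_fst).prodMk continuous_snd))
  · ext1 x; simp [H1]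
  · ext1 x; simp [H0]

theorem AmbientIsotopic.refl (L : Set E3) : AmbientIsotopic L L :=
  ⟨_, IsFinalMapOfIsotopy.refl, by simp⟩

theorem AmbientIsotopic.symm {L L' : Set E3} (h : AmbientIsotopic L L') :
    AmbientIsotopic L' L := by
  obtain ⟨k, hk, rfl⟩ := h
  exact ⟨k.symm, hk.symm, by rw [image_image]; simp⟩

theorem AmbientIsotopic.trans {L L' L'' : Set E3} (h : AmbientIsotopic L L')
    (h' : AmbientIsotopic L' L'') : AmbientIsotopic L L'' := by
  obtain ⟨k, hk, rfl⟩ := h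
  obtain ⟨k', hk', rfl⟩ := h'
  exact ⟨k.trans k', hk.trans hk', by rw [image_image]; rfl⟩

/-- A perturbation of the identity by a map with Lipschitz constant less than one is the final map
of an isotopy. -/
theorem exists_isFinalMapOfIsotopy_of_lipschitz {w : E3 → E3} {c : ℝ≥0} (hw : LipschitzWith c w)
    (hc : c < 1) : ∃ h : E3 ≃ₜ E3, IsFinalMapOfIsotopy h ∧ ∀ x, h x = x + w x := by
  -- Every intermediate map `x + t w(x)` differs from the identity by a map with Lipschitz constant
  -- at most `c < 1`, hence is a homeomorphism.
  have key : ∀ t : I, ApproximatesLinearOn (fun x => x + (t : ℝ) • w x)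
      ((ContinuousLinearEquiv.refl ℝ E3 : E3 ≃L[ℝ] E3) : E3 →L[ℝ] E3) univ c := by
    intro t x _ y _
    have h1 : x + (t : ℝ) • w x - (y + (t : ℝ) • w y) -
        ((ContinuousLinearEquiv.refl ℝ E3 : E3 ≃L[ℝ] E3) : E3 →L[ℝ] E3) (x - y)
        = (t : ℝ) • (w x - w y) := by
      simp only [ContinuousLinearEquiv.coe_refl, ContinuousLinearMap.id_apply]
      module
    rw [h1, norm_smul, Real.norm_of_nonneg t.2.1]
    have h2 := hw.dist_le_mul x y
    rw [dist_eq_norm, dist_eq_norm] at h2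
    calc (t : ℝ) * ‖w x - w y‖ ≤ 1 * ‖w x - w y‖ := by gcongr; exact t.2.2
      _ ≤ _ := by rw [one_mul]; exact h2
  have hN : Subsingleton E3 ∨ c <
      ‖((ContinuousLinearEquiv.refl ℝ E3).symm : E3 →L[ℝ] E3)‖₊⁻¹ := by
    right
    have : ‖((ContinuousLinearEquiv.refl ℝ E3).symm : E3 →L[ℝ] E3)‖₊ = 1 := by
      apply NNReal.coe_injective
      simp only [coe_nnnorm, NNReal.coe_one]
      exact ContinuousLinearMap.norm_id
    rw [this, inv_one]
    exact hc
  have hcoe : ∀ t x, (key t).toHomeomorph _ hN x = x + (t : ℝ) • w x := fun t x => rfl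
  refine ⟨(key 1).toHomeomorph _ hN, ⟨fun t => (key t).toHomeomorph _ hN, ?_, ?_, rfl⟩, ?_⟩
  · simp only [hcoe]
    have := hw.continuous
    fun_prop
  · ext1 x
    rw [hcoe]
    simp
  · intro x
    rw [hcoe]
    simp

/-! ### Straight graphs -/

/-- The segment spanned by an unordered pair of points of a real vector space. -/
def eseg {E : Type*} [AddCommGroup E] [Module ℝ E] (e : Sym2 E) : Set E := convexHull ℝ {x | x ∈ e}

section eseg
variable {E F : Type*} [AddCommGroup E] [Module ℝ E] [AddCommGroup F] [Module ℝ F]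

theorem eseg_mk (p q : E) : eseg s(p, q) = segment ℝ p q := by
  have : {x | x ∈ s(p, q)} = ({p, q} : Set E) := by ext x; simp
  rw [eseg, this, convexHull_pair]

theorem mem_eseg_mk {p q x : E} : x ∈ eseg s(p, q) ↔ ∃ t : ℝ, 0 ≤ t ∧ t ≤ 1 ∧
    x = (1 - t) • p + t • q := by
  rw [eseg_mk, segment_eq_image]
  constructor
  · rintro ⟨t, ⟨h0, h1⟩, rfl⟩; exact ⟨t, h0, h1, rfl⟩
  · rintro ⟨t, h0, h1, rfl⟩; exact ⟨t, ⟨h0, h1⟩, rfl⟩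

theorem mem_eseg_of_mem {e : Sym2 E} {x : E} (h : x ∈ e) : x ∈ eseg e :=
  subset_convexHull ℝ _ h

theorem eseg_map (f : E →ᵃ[ℝ] F) (e : Sym2 E) : eseg (e.map f) = f '' eseg e := by
  induction e with | _ a b => simp only [Sym2.map_mk, eseg_mk, image_segment]

theorem convex_eseg (e : Sym2 E) : Convex ℝ (eseg e) := convex_convexHull _ _

theorem eseg_subset {e : Sym2 E} {s : Set E} (hs : Convex ℝ s) (h : ∀ x ∈ e, x ∈ s) :
    eseg e ⊆ s := convexHull_min h hs

end eseg

theorem isCompact_eseg {E : Type*} [NormedAddCommGroup E] [NormedSpace ℝ E]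
    (e : Sym2 E) : IsCompact (eseg e) := by
  induction e with | _ a b =>
  rw [eseg_mk, segment_eq_image]
  exact isCompact_Icc.image (by fun_prop)

theorem eseg_nonempty {E : Type*} [AddCommGroup E] [Module ℝ E] (e : Sym2 E) :
    (eseg e).Nonempty := by
  induction e with | _ a b => exact ⟨a, mem_eseg_of_mem (by simp)⟩

/-- The union of the edges of a straight graph with vertex positions `p`. -/
def carrier {V : Type*} (E : Finset (Sym2 V)) (p : V → E3) : Set E3 := ⋃ e ∈ E, eseg (e.map p)

/-- The straight graph with edge set `E` and vertex positions `p` is embedded. -/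
structure Emb {V : Type*} (E : Finset (Sym2 V)) (p : V → E3) : Prop where
  nd : ∀ e ∈ E, ¬ (e.map p).IsDiag
  meet : ∀ e ∈ E, ∀ e' ∈ E, e ≠ e' → ∀ x ∈ eseg (e.map p), x ∈ eseg (e'.map p) →
    ∃ v ∈ e, v ∈ e' ∧ p v = x

/-- Two vertices with the same position lie either on one edge, which would then be degenerate, or
on two edges whose meeting point has to be the position of a common vertex of both. -/
theorem Emb.injOn {V : Type*} {E : Finset (Sym2 V)} {p : V → E3} (h : Emb E p) :
    InjOn p {v | ∃ e ∈ E, v ∈ e} := by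
  rintro v ⟨e, he, hv⟩ w ⟨e', he', hw⟩ hvw
  have nd : ∀ e ∈ E, ∀ a ∈ e, ∀ b ∈ e, p a = p b → a = b := by
    intro e he a ha b hb hab
    by_contra hne
    obtain rfl : e = s(a, b) := (Sym2.mem_and_mem_iff hne).1 ⟨ha, hb⟩
    exact h.nd _ he (by simpa using hab)
  by_cases hee : e = e'
  · subst hee; exact nd e he v hv w hw hvw
  · obtain ⟨u, hu, hu', hpu⟩ := h.meet e he e' he' hee (p v)
      (mem_eseg_of_mem (Sym2.mem_map.2 ⟨v, hv, rfl⟩))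
      (hvw ▸ mem_eseg_of_mem (Sym2.mem_map.2 ⟨w, hw, rfl⟩))
    rw [nd e he v hv u hu hpu.symm, nd e' he' w hw u hu' (hvw.symm.trans hpu.symm)]

/-! ### Lipschitz extension of piecewise linear functions on a graph -/

/-- The function is given by its graph `Γ`, so that its values on the edges need not be matched at
common vertices beforehand. The estimate shows that `Γ` is single-valued and Lipschitz over its
projection, and real Lipschitz functions extend. -/
theorem exists_lipschitz_of_rel {X : Type*} [PseudoMetricSpace X] (Γ : Set (X × ℝ)) (C : ℝ≥0)
    (h : ∀ a ∈ Γ, ∀ b ∈ Γ, dist a.2 b.2 ≤ C * dist a.1 b.1) :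
    ∃ g : X → ℝ, LipschitzWith C g ∧ ∀ a ∈ Γ, g a.1 = a.2 := by
  classical
  let g0 : X → ℝ := fun x => if hx : ∃ r, (x, r) ∈ Γ then hx.choose else 0
  have hg0 : ∀ a ∈ Γ, g0 a.1 = a.2 := by
    intro a ha
    have hx : ∃ r, (a.1, r) ∈ Γ := ⟨a.2, ha⟩
    have h1 : g0 a.1 = hx.choose := dif_pos hx
    have h2 := h _ hx.choose_spec a ha
    rw [h1]
    apply dist_le_zero.1
    simpa using h2
  have hL : LipschitzOnWith C g0 (Prod.fst '' Γ) := by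
    apply LipschitzOnWith.of_dist_le_mul
    rintro _ ⟨a, ha, rfl⟩ _ ⟨b, hb, rfl⟩
    rw [hg0 a ha, hg0 b hb]
    exact h a ha b hb
  obtain ⟨g, hg, hgg⟩ := hL.extend_real
  exact ⟨g, hg, fun a ha => by rw [← hgg ⟨a, ha, rfl⟩, hg0 a ha]⟩

/-- The norm has a positive minimum on the compact segment `s + t = 1`, and homogeneity gives the
rest. It measures how fast two edges with a common end diverge. -/
theorem exists_pos_mul_add_le_norm_sub {α β : E3}
    (h : ∀ s t : ℝ, 0 ≤ s → 0 ≤ t → s + t = 1 → s • α ≠ t • β) :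
    ∃ c : ℝ, 0 < c ∧ ∀ s t : ℝ, 0 ≤ s → 0 ≤ t → c * (s + t) ≤ ‖s • α - t • β‖ := by
  have hcont : Continuous fun s : ℝ => ‖s • α - (1 - s) • β‖ := by fun_prop
  obtain ⟨s0, hs0, hmin⟩ := isCompact_Icc.exists_isMinOn (nonempty_Icc.2 (zero_le_one' ℝ))
    hcont.continuousOn
  refine ⟨_, norm_pos_iff.2 (sub_ne_zero.2 (h s0 (1 - s0) hs0.1 (by linarith [hs0.2]) (by ring))),
    fun s t hs ht => ?_⟩
  rcases (add_nonneg hs ht).eq_or_lt with h0 | h0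
  · rw [← h0, mul_zero]; exact norm_nonneg _
  · have h1 : s / (s + t) ∈ Icc (0 : ℝ) 1 :=
      ⟨by positivity, by rw [div_le_one h0]; linarith⟩
    have h2 := hmin h1
    have h3 : s • α - t • β = (s + t) • ((s / (s + t)) • α - (1 - s / (s + t)) • β) := by
      have e1 : (s + t) * (s / (s + t)) = s := by field_simp
      have e2 : (s + t) * (1 - s / (s + t)) = t := by field_simp; ring
      rw [smul_sub, smul_smul, smul_smul, e1, e2]
    rw [h3, norm_smul, Real.norm_of_nonneg h0.le, mul_comm]
    exact mul_le_mul_of_nonneg_left h2 h0.le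

theorem exists_pos_le_dist_of_disjoint {X : Type*} [PseudoMetricSpace X] [T2Space X] {s t : Set X}
    (hs : IsCompact s) (ht : IsCompact t) (h : Disjoint s t) :
    ∃ r : ℝ, 0 < r ∧ ∀ x ∈ s, ∀ y ∈ t, r ≤ dist x y := by
  obtain ⟨r, hr, H⟩ := Metric.exists_pos_forall_lt_edist hs ht.isClosed h
  refine ⟨r, hr, fun x hx y hy => ?_⟩
  have := H x hx y hy
  rw [edist_nndist, ENNReal.coe_lt_coe] at this
  exact_mod_cast this.le

/-- Piecewise linear functions on a pair of edges of an embedded graph are Lipschitz. -/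
theorem exists_lipschitz_pair {V : Type*} {E : Finset (Sym2 V)} {p : V → E3} (h : Emb E p)
    (χ : V → ℝ) {e e' : Sym2 V} (he : e ∈ E) (he' : e' ∈ E) :
    ∃ C : ℝ, 0 ≤ C ∧ ∀ a ∈ eseg (e.map fun v => (p v, χ v)),
      ∀ b ∈ eseg (e'.map fun v => (p v, χ v)), dist a.2 b.2 ≤ C * dist a.1 b.1 := by
  by_cases hee : e = e'
  · subst hee
    induction e with | _ i j =>
    have hij : 0 < ‖p j - p i‖ := norm_pos_iff.2
      (sub_ne_zero.2 fun hh => h.nd _ he (by simp [hh]))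
    -- On a single edge the constant is the slope.
    refine ⟨‖χ j - χ i‖ / ‖p j - p i‖, by positivity, ?_⟩
    simp only [Sym2.map_mk, mem_eseg_mk]
    rintro _ ⟨s, hs0, hs1, rfl⟩ _ ⟨t, ht0, ht1, rfl⟩
    simp only [Prod.fst_add, Prod.smul_fst, Prod.snd_add, Prod.smul_snd, dist_eq_norm]
    have e1 : (1 - s) • p i + s • p j - ((1 - t) • p i + t • p j) = (s - t) • (p j - p i) := by
      module
    have e2 : (1 - s) • χ i + s • χ j - ((1 - t) • χ i + t • χ j) = (s - t) • (χ j - χ i) := by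
      module
    rw [e1, e2, norm_smul, norm_smul]
    apply le_of_eq
    field_simp
  by_cases hsh : ∃ v ∈ e, v ∈ e'
  · obtain ⟨v, hv, hv'⟩ := hsh
    obtain ⟨j, rfl⟩ := Sym2.mem_iff_exists.1 hv
    obtain ⟨l, rfl⟩ := Sym2.mem_iff_exists.1 hv'
    have hjl : j ≠ l := fun hh => hee (by rw [hh])
    have hvj : p v ≠ p j := fun hh => h.nd _ he (by simpa using hh)
    have hvl : p v ≠ p l := fun hh => h.nd _ he' (by simpa using hh)
    -- Edges with a common end `v`: an equality `s • α = t • β` with `s + t = 1` would be a meeting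
    -- point of the two edges. Such a point is `p v`, which forces `s = 0` and then `β = 0`.
    obtain ⟨c, hc, hcc⟩ := exists_pos_mul_add_le_norm_sub (α := p j - p v) (β := p l - p v) (by
      intro s t hs ht hst heq
      obtain ⟨u, hu, hu', hpu⟩ := h.meet _ he _ he' hee ((1 - s) • p v + s • p j)
        (by simp only [Sym2.map_mk, mem_eseg_mk]; exact ⟨s, hs, by linarith, rfl⟩)
        (by
          simp only [Sym2.map_mk, mem_eseg_mk]; refine ⟨t, ht, by linarith, ?_⟩
          have : s • p j = t • (p l - p v) + s • p v := by rw [← heq]; module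
          rw [this]; module)
      have huv : u = v := by
        rcases Sym2.mem_iff.1 hu with rfl | rfl
        · rfl
        · rcases Sym2.mem_iff.1 hu' with rfl | rfl
          · rfl
          · exact absurd rfl hjl
      subst huv
      have hs0 : s • (p j - p u) = 0 := by
        have : s • (p j - p u) = ((1 - s) • p u + s • p j) - p u := by module
        rw [this, ← hpu, sub_self]
      have hs1 : s = 0 := by
        rcases smul_eq_zero.1 hs0 with h | h
        · exact h
        · exact absurd (sub_eq_zero.1 h).symm hvj
      subst hs1
      have ht1 : t = 1 := by linarith
      subst ht1
      rw [zero_smul, one_smul] at heq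
      exact hvl (sub_eq_zero.1 heq.symm).symm)
    refine ⟨(|χ j - χ v| + |χ l - χ v|) / c, by positivity, ?_⟩
    simp only [Sym2.map_mk, mem_eseg_mk]
    rintro _ ⟨s, hs0, hs1, rfl⟩ _ ⟨t, ht0, ht1, rfl⟩
    simp only [Prod.fst_add, Prod.smul_fst, Prod.snd_add, Prod.smul_snd, dist_eq_norm]
    have e1 : (1 - s) • p v + s • p j - ((1 - t) • p v + t • p l) =
        s • (p j - p v) - t • (p l - p v) := by module
    have e2 : (1 - s) • χ v + s • χ j - ((1 - t) • χ v + t • χ l) =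
        s * (χ j - χ v) - t * (χ l - χ v) := by simp only [smul_eq_mul]; ring
    rw [e1, e2, Real.norm_eq_abs]
    have h3 := hcc s t hs0 ht0
    have h4 : |s * (χ j - χ v) - t * (χ l - χ v)| ≤ s * |χ j - χ v| + t * |χ l - χ v| := by
      refine (abs_sub _ _).trans ?_
      rw [abs_mul, abs_mul, abs_of_nonneg hs0, abs_of_nonneg ht0]
    have h5 : s * |χ j - χ v| + t * |χ l - χ v| ≤ (|χ j - χ v| + |χ l - χ v|) * (s + t) := by
      nlinarith [abs_nonneg (χ j - χ v), abs_nonneg (χ l - χ v)]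
    calc _ ≤ _ := h4
      _ ≤ _ := h5
      _ = (|χ j - χ v| + |χ l - χ v|) / c * (c * (s + t)) := by field_simp
      _ ≤ _ := mul_le_mul_of_nonneg_left h3 (by positivity)
  -- Edges without common vertex are at distance at least `r`, while the values differ by a bounded
  -- amount `M`.
  · have hdisj : Disjoint (eseg (e.map p)) (eseg (e'.map p)) := by
      rw [Set.disjoint_left]
      intro x hx hx'
      obtain ⟨v, hv, hv', -⟩ := h.meet _ he _ he' hee x hx hx'
      exact hsh ⟨v, hv, hv'⟩
    obtain ⟨r, hr, hrr⟩ := exists_pos_le_dist_of_disjoint (isCompact_eseg _) (isCompact_eseg _) hdisj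
    obtain ⟨M, hM⟩ := Metric.isBounded_iff.1 ((isCompact_eseg (e.map fun v => (p v, χ v))).union
      (isCompact_eseg (e'.map fun v => (p v, χ v)))).isBounded
    have hfst : ∀ (e : Sym2 V), ∀ a ∈ eseg (e.map fun v => (p v, χ v)), a.1 ∈ eseg (e.map p) := by
      intro e a ha
      have := eseg_map (LinearMap.fst ℝ E3 ℝ).toAffineMap (e.map fun v => (p v, χ v))
      rw [Sym2.map_map] at this
      have h2 : e.map p = e.map (⇑(LinearMap.fst ℝ E3 ℝ).toAffineMap ∘ fun v => (p v, χ v)) := rfl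
      rw [h2, this]
      exact ⟨a, ha, rfl⟩
    refine ⟨|M| / r, by positivity, fun a ha b hb => ?_⟩
    have h1 := hM (Or.inl ha) (Or.inr hb)
    have h2 := hrr _ (hfst _ a ha) _ (hfst _ b hb)
    calc dist a.2 b.2 ≤ dist a b := le_max_right _ _
      _ ≤ |M| := h1.trans (le_abs_self _)
      _ = |M| / r * r := by field_simp
      _ ≤ _ := mul_le_mul_of_nonneg_left h2 (by positivity)

/-- Piecewise linear functions on an embedded graph extend to Lipschitz functions. -/
theorem Emb.exists_lipschitz {V : Type*} {E : Finset (Sym2 V)} {p : V → E3} (h : Emb E p)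
    (χ : V → ℝ) : ∃ (C : ℝ≥0) (g : E3 → ℝ), LipschitzWith C g ∧
      ∀ e ∈ E, ∀ a ∈ eseg (e.map fun v => (p v, χ v)), g a.1 = a.2 := by
  have h1 : ∀ x : Sym2 V × Sym2 V, ∃ C : ℝ, x ∈ E ×ˢ E → 0 ≤ C ∧
      ∀ a ∈ eseg (x.1.map fun v => (p v, χ v)),
      ∀ b ∈ eseg (x.2.map fun v => (p v, χ v)), dist a.2 b.2 ≤ C * dist a.1 b.1 := by
    intro x
    by_cases hx : x ∈ E ×ˢ E
    · obtain ⟨C, hC⟩ := exists_lipschitz_pair h χ (Finset.mem_product.1 hx).1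
        (Finset.mem_product.1 hx).2
      exact ⟨C, fun _ => hC⟩
    · exact ⟨0, fun hh => absurd hh hx⟩
  choose C hC using h1
  -- The sum over all pairs of edges is a constant that serves every pair.
  have hS : 0 ≤ ∑ x ∈ E ×ˢ E, C x := Finset.sum_nonneg fun x hx => (hC x hx).1
  obtain ⟨g, hg, hgg⟩ := exists_lipschitz_of_rel
    {a | ∃ e ∈ E, a ∈ eseg (e.map fun v => (p v, χ v))} ⟨_, hS⟩ (by
      rintro a ⟨e, he, ha⟩ b ⟨e', he', hb⟩
      have hm : (e, e') ∈ E ×ˢ E := Finset.mem_product.2 ⟨he, he'⟩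
      refine ((hC (e, e') hm).2 a ha b hb).trans (mul_le_mul_of_nonneg_right ?_ dist_nonneg)
      exact Finset.single_le_sum (f := C) (fun x hx => (hC x hx).1) hm)
  exact ⟨_, g, hg, fun e he a ha => hgg a ⟨e, he, ha⟩⟩

/-- Small displacements of the vertices of an embedded straight graph are realized by ambient
isotopies that carry edges to edges. -/
theorem Emb.exists_perturb {V : Type*} {E : Finset (Sym2 V)} {p : V → E3} (h : Emb E p) :
    ∃ δ : ℝ, 0 < δ ∧ ∀ p' : V → E3, (∀ e ∈ E, ∀ v ∈ e, ‖p' v - p v‖ < δ) →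
      ∃ k : E3 ≃ₜ E3, IsFinalMapOfIsotopy k ∧ (∀ e ∈ E, ∀ v ∈ e, k (p v) = p' v) ∧
        ∀ e ∈ E, k '' eseg (e.map p) = eseg (e.map p') := by
  classical
  -- `g v` is the hat function of `v`: on the graph it is piecewise linear, equal to one at `v` and
  -- to zero at the other vertices.
  choose C g hg hgg using fun v => h.exists_lipschitz (Pi.single v 1)
  set W : Finset V := E.biUnion fun e => e.toFinset with hW
  have memW : ∀ e ∈ E, ∀ v ∈ e, v ∈ W := fun e he v hv =>
    Finset.mem_biUnion.2 ⟨e, he, Sym2.mem_toFinset.2 hv⟩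
  have hS : 0 ≤ ∑ v ∈ W, (C v : ℝ) := Finset.sum_nonneg fun v _ => (C v).2
  -- With this bound on the displacements, the field `∑ g v • (p' v - p v)` has Lipschitz constant
  -- at most `1 / 2`.
  refine ⟨1 / (2 * (1 + ∑ v ∈ W, (C v : ℝ))), by positivity, fun p' hp' => ?_⟩
  set δ := 1 / (2 * (1 + ∑ v ∈ W, (C v : ℝ))) with hδ
  have hδ0 : 0 ≤ δ := by positivity
  have hlip : LipschitzWith (1 / 2) fun x => ∑ v ∈ W, g v x • (p' v - p v) := by
    apply LipschitzWith.of_dist_le_mul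
    intro x y
    rw [dist_eq_norm, ← Finset.sum_sub_distrib]
    calc ‖∑ v ∈ W, (g v x • (p' v - p v) - g v y • (p' v - p v))‖
        ≤ ∑ v ∈ W, C v * dist x y * δ := by
          refine norm_sum_le_of_le _ fun v hv => ?_
          rw [← sub_smul, norm_smul]
          obtain ⟨e, he, hve⟩ := Finset.mem_biUnion.1 hv
          exact mul_le_mul ((hg v).dist_le_mul x y) (hp' e he v (Sym2.mem_toFinset.1 hve)).le
            (norm_nonneg _) (by positivity)
      _ = (∑ v ∈ W, (C v : ℝ)) * δ * dist x y := by
          rw [Finset.sum_mul, Finset.sum_mul]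
          exact Finset.sum_congr rfl fun v _ => by ring
      _ ≤ ((1 / 2 : ℝ≥0) : ℝ) * dist x y := by
          refine mul_le_mul_of_nonneg_right ?_ dist_nonneg
          rw [hδ]
          push_cast
          rw [mul_one_div, div_le_div_iff₀ (by positivity) (by norm_num)]
          linarith
  obtain ⟨k, hk, hkk⟩ := exists_isFinalMapOfIsotopy_of_lipschitz hlip
    (by rw [← NNReal.coe_lt_coe]; norm_num)
  have key : ∀ i j, s(i, j) ∈ E → ∀ t : ℝ, 0 ≤ t → t ≤ 1 →
      k ((1 - t) • p i + t • p j) = (1 - t) • p' i + t • p' j := by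
    intro i j hij t ht0 ht1
    rw [hkk]
    have h1 : ∀ v, g v ((1 - t) • p i + t • p j) =
        (1 - t) * Pi.single (M := fun _ => ℝ) v 1 i + t * Pi.single (M := fun _ => ℝ) v 1 j := by
      intro v
      exact hgg v _ hij ((1 - t) • p i + t • p j, _) (by
        rw [Sym2.map_mk, mem_eseg_mk]; exact ⟨t, ht0, ht1, by ext1 <;> simp⟩)
    -- On an edge only the hat functions of its two ends contribute, so the displacement is the
    -- linear interpolation of the displacements of the ends.
    simp only [h1, add_smul, Finset.sum_add_distrib, mul_smul, ← Finset.smul_sum]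
    have h2 : ∀ i ∈ W, ∑ v ∈ W, Pi.single (M := fun _ => ℝ) v 1 i • (p' v - p v) = p' i - p i := by
      intro i hi
      rw [Finset.sum_eq_single i]
      · simp
      · intro b _ hb; rw [Pi.single_eq_of_ne hb.symm]; simp
      · exact fun hh => absurd hi hh
    rw [h2 i (memW _ hij i (by simp)), h2 j (memW _ hij j (by simp))]
    module
  refine ⟨k, hk, ?_, ?_⟩
  · intro e he v hv
    obtain ⟨j, rfl⟩ := Sym2.mem_iff_exists.1 hv
    simpa using key v j he 0 le_rfl zero_le_one
  · intro e he
    induction e with | _ i j =>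
    ext x
    simp only [Sym2.map_mk, mem_image, mem_eseg_mk]
    constructor
    · rintro ⟨_, ⟨t, h0, h1, rfl⟩, rfl⟩
      exact ⟨t, h0, h1, key i j he t h0 h1⟩
    · rintro ⟨t, h0, h1, rfl⟩
      exact ⟨_, ⟨t, h0, h1, rfl⟩, key i j he t h0 h1⟩

/-- Small displacements of the vertices preserve embeddedness and the ambient isotopy class. -/
theorem Emb.exists_stable {V : Type*} {E : Finset (Sym2 V)} {p : V → E3} (h : Emb E p) :
    ∃ δ : ℝ, 0 < δ ∧ ∀ p' : V → E3, (∀ e ∈ E, ∀ v ∈ e, ‖p' v - p v‖ < δ) →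
      Emb E p' ∧ AmbientIsotopic (carrier E p) (carrier E p') := by
  obtain ⟨δ, hδ, H⟩ := h.exists_perturb
  refine ⟨δ, hδ, fun p' hp' => ?_⟩
  obtain ⟨k, hk, hv, he⟩ := H p' hp'
  refine ⟨⟨?_, ?_⟩, k, hk, ?_⟩
  · intro e hE
    have h1 := h.nd e hE
    have h2 := hv e hE
    induction e with | _ i j =>
    simp only [Sym2.map_mk, Sym2.mk_isDiag_iff] at h1 ⊢
    rw [← h2 i (by simp), ← h2 j (by simp)]
    exact fun hh => h1 (k.injective hh)
  · intro e hE e' hE' hne x hx hx'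
    rw [← he e hE] at hx
    rw [← he e' hE'] at hx'
    obtain ⟨y, hy, rfl⟩ := hx
    obtain ⟨y', hy', hyy⟩ := hx'
    obtain rfl := k.injective hyy
    obtain ⟨v, hv1, hv2, rfl⟩ := h.meet e hE e' hE' hne _ hy hy'
    exact ⟨v, hv1, hv2, (hv e hE v hv1).symm⟩
  · rw [carrier, carrier, image_iUnion₂]
    exact iUnion₂_congr he

/-! ### Continuous motions of the vertices -/

theorem exists_pos_forall_norm_sub_lt {V : Type*} (E : Finset (Sym2 V)) (p : ℝ → V → E3)
    (hp : ∀ v, Continuous fun t => p t v) (t : ℝ) {δ : ℝ} (hδ : 0 < δ) :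
    ∀ᶠ s in 𝓝 t, ∀ e ∈ E, ∀ v ∈ e, ‖p s v - p t v‖ < δ := by
  have h1 : ∀ v, ∀ᶠ s in 𝓝 t, ‖p s v - p t v‖ < δ := fun v => by
    have := (hp v).tendsto t
    rw [Metric.tendsto_nhds] at this
    simpa [dist_eq_norm] using this δ hδ
  rw [Filter.eventually_all_finset]
  intro e _
  induction e with | _ i j =>
  filter_upwards [h1 i, h1 j] with s hi hj v hv
  rcases Sym2.mem_iff.1 hv with rfl | rfl <;> assumption

/-- A continuous motion of the vertices through embedded straight graphs does not change the
ambient isotopy class. -/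
theorem ambientIsotopic_of_motion {V : Type*} (E : Finset (Sym2 V)) (p : ℝ → V → E3)
    (hp : ∀ v, Continuous fun t => p t v) (hE : ∀ t ∈ Icc (0 : ℝ) 1, Emb E (p t)) :
    AmbientIsotopic (carrier E (p 0)) (carrier E (p 1)) := by
  -- Isotopy is a transitive relation between times that holds for any two sufficiently close times,
  -- so it holds on the whole connected interval.
  refine isPreconnected_Icc.induction₂' (s := Icc (0 : ℝ) 1)
    (fun s t => AmbientIsotopic (carrier E (p s)) (carrier E (p t))) ?_ ?_
    (left_mem_Icc.2 zero_le_one) (right_mem_Icc.2 zero_le_one)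
  · intro t ht
    obtain ⟨δ, hδ, H⟩ := (hE t ht).exists_stable
    filter_upwards [mem_nhdsWithin_of_mem_nhds (exists_pos_forall_norm_sub_lt E p hp t hδ)] with s hs
    exact ⟨(H _ hs).2, (H _ hs).2.symm⟩
  · intro x y z _ _ _ h1 h2
    exact h1.trans h2

end

section
open Set Topology Filter
open scoped Classical

/-! ### Polygon systems as finite sets of edges -/

noncomputable section

/-- Classical decidability of the equality of edges. -/
@[reducible]
def sym2DecEq (V : Type*) : DecidableEq (Sym2 V) := Classical.decEq _

attribute [local instance] sym2DecEq

/-- The number of times `v` occurs as an endpoint of `e`. -/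
def mult {V : Type*} (e : Sym2 V) (v : V) : ℕ :=
  Sym2.lift ⟨fun a b => (if v = a then 1 else 0) + (if v = b then 1 else 0),
    fun _ _ => add_comm _ _⟩ e

/-- The degree of a vertex in a finite graph. -/
def deg {V : Type*} (E : Finset (Sym2 V)) (v : V) : ℕ := ∑ e ∈ E, mult e v

/-- The union of a finite set of edges. -/
def body (S : Finset (Sym2 E3)) : Set E3 := ⋃ e ∈ S, eseg e

/-- A finite set of edges that is a closed polygon system. -/
structure PolySys (S : Finset (Sym2 E3)) : Prop where
  ne : S.Nonempty
  emb : Emb S id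
  deg : ∀ v, deg S v = 0 ∨ deg S v = 2

section combinatorics
variable {V W : Type*}

theorem mult_mk (a b v : V) :
    mult s(a, b) v = (if v = a then 1 else 0) + (if v = b then 1 else 0) := rfl

theorem mult_pos {e : Sym2 V} {v : V} : 0 < mult e v ↔ v ∈ e := by
  induction e with | _ a b =>
  rw [mult_mk, Sym2.mem_iff]
  by_cases h1 : v = a <;> by_cases h2 : v = b <;> simp [h1, h2]

theorem mult_eq_ite {e : Sym2 V} (he : ¬ e.IsDiag) (v : V) : mult e v = if v ∈ e then 1 else 0 := by
  induction e with | _ a b =>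
  rw [Sym2.mk_isDiag_iff] at he
  by_cases h1 : v = a
  · subst h1; simp [mult_mk, he]
  · simp [mult_mk, h1]

theorem deg_eq_zero {E : Finset (Sym2 V)} {v : V} : deg E v = 0 ↔ ∀ e ∈ E, v ∉ e := by
  rw [deg, Finset.sum_eq_zero_iff]
  refine forall₂_congr fun e _ => ?_
  rw [← mult_pos, Nat.pos_iff_ne_zero, not_not]

theorem deg_eq_card {E : Finset (Sym2 V)} (h : ∀ e ∈ E, ¬ e.IsDiag) (v : V) :
    deg E v = {e | e ∈ E ∧ v ∈ e}.ncard := by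
  have : {e | e ∈ E ∧ v ∈ e} = ((E.filter fun e => v ∈ e : Finset (Sym2 V)) : Set (Sym2 V)) := by
    ext; simp
  rw [this, Set.ncard_coe_finset, Finset.card_filter, deg]
  exact Finset.sum_congr rfl fun e he => mult_eq_ite (h e he) v

theorem deg_insert {E : Finset (Sym2 V)} {e : Sym2 V} (he : e ∉ E) (v : V) :
    deg (insert e E) v = mult e v + deg E v := Finset.sum_insert he

theorem deg_singleton (e : Sym2 V) (v : V) : deg {e} v = mult e v := Finset.sum_singleton _ _

theorem deg_union {E F : Finset (Sym2 V)} (h : Disjoint E F) (v : V) :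
    deg (E ∪ F) v = deg E v + deg F v := Finset.sum_union h

theorem sym2_map_injOn {E : Finset (Sym2 V)} {p : V → W} (h : InjOn p {v | ∃ e ∈ E, v ∈ e}) :
    InjOn (Sym2.map p) (E : Set (Sym2 V)) := by
  have aux : ∀ e ∈ E, ∀ e' ∈ E, e.map p = e'.map p → ∀ v ∈ e, v ∈ e' := by
    intro e he e' he' hee v hv
    have h1 : p v ∈ e'.map p := hee ▸ Sym2.mem_map.2 ⟨v, hv, rfl⟩
    obtain ⟨w, hw, hwv⟩ := Sym2.mem_map.1 h1
    rwa [← h ⟨e', he', hw⟩ ⟨e, he, hv⟩ hwv]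
  intro e he e' he' hee
  exact Sym2.ext fun v => ⟨aux e he e' he' hee v, aux e' he' e he hee.symm v⟩

theorem mult_map {e : Sym2 V} {p : V → W} {v : V} (h : ∀ w ∈ e, p w = p v → w = v) :
    mult (e.map p) (p v) = mult e v := by
  induction e with | _ a b =>
  have ha : p v = p a ↔ v = a := ⟨fun hh => (h a (by simp) hh.symm).symm, fun hh => hh ▸ rfl⟩
  have hb : p v = p b ↔ v = b := ⟨fun hh => (h b (by simp) hh.symm).symm, fun hh => hh ▸ rfl⟩
  simp only [Sym2.map_mk, mult_mk, ha, hb]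

theorem deg_image {E : Finset (Sym2 V)} {p : V → W} (h : InjOn p {v | ∃ e ∈ E, v ∈ e})
    (hd : ∀ v, deg E v = 0 ∨ deg E v = 2) (w : W) :
    deg (E.image (Sym2.map p)) w = 0 ∨ deg (E.image (Sym2.map p)) w = 2 := by
  by_cases hw : ∃ e ∈ E, w ∈ e.map p
  · obtain ⟨e, he, hwe⟩ := hw
    obtain ⟨v, hv, rfl⟩ := Sym2.mem_map.1 hwe
    have : deg (E.image (Sym2.map p)) (p v) = deg E v := by
      rw [deg, Finset.sum_image (sym2_map_injOn h), deg]
      exact Finset.sum_congr rfl fun e' he' => mult_map fun w hw hpw =>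
        h ⟨e', he', hw⟩ ⟨e, he, hv⟩ hpw
    rw [this]; exact hd v
  · left
    rw [deg_eq_zero]
    intro e he
    obtain ⟨e', he', rfl⟩ := Finset.mem_image.1 he
    exact fun hh => hw ⟨e', he', hh⟩

end combinatorics

theorem body_image {V : Type*} (E : Finset (Sym2 V)) (p : V → E3) :
    body (E.image (Sym2.map p)) = carrier E p := by
  simp [carrier, body]

theorem body_insert (e : Sym2 E3) (S : Finset (Sym2 E3)) : body (insert e S) = eseg e ∪ body S := by
  simp [body]

theorem body_union (S S' : Finset (Sym2 E3)) : body (S ∪ S') = body S ∪ body S' := by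
  rw [body, Finset.set_biUnion_union]; rfl

theorem Emb.image {V : Type*} {E : Finset (Sym2 V)} {p : V → E3} (h : Emb E p) :
    Emb (E.image (Sym2.map p)) id := by
  constructor
  · intro _ he1
    obtain ⟨e, he, rfl⟩ := Finset.mem_image.1 he1
    simpa using h.nd e he
  · intro _ he1 _ he2 hne x hx hx'
    obtain ⟨e, he, rfl⟩ := Finset.mem_image.1 he1
    obtain ⟨e', he', rfl⟩ := Finset.mem_image.1 he2
    rw [show Sym2.map id (Sym2.map p e) = Sym2.map p e by simp] at hx
    rw [show Sym2.map id (Sym2.map p e') = Sym2.map p e' by simp] at hx'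
    obtain ⟨v, hv, hv', rfl⟩ := h.meet e he e' he' (fun hh => hne (by rw [hh])) x hx hx'
    exact ⟨p v, Sym2.mem_map.2 ⟨v, hv, rfl⟩, Sym2.mem_map.2 ⟨v, hv', rfl⟩, rfl⟩

theorem Emb.of_image {V : Type*} {E : Finset (Sym2 V)} {p : V → E3}
    (hp : InjOn p {v | ∃ e ∈ E, v ∈ e}) (h : Emb (E.image (Sym2.map p)) id) : Emb E p := by
  constructor
  · intro e he
    simpa using h.nd _ (Finset.mem_image_of_mem _ he)
  · intro e he e' he' hne x hx hx'
    obtain ⟨w, hw, hw', rfl⟩ := h.meet _ (Finset.mem_image_of_mem _ he) _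
      (Finset.mem_image_of_mem _ he') (fun hh => hne (sym2_map_injOn hp he he' hh)) x
      (by simpa using hx) (by simpa using hx')
    obtain ⟨v, hv, rfl⟩ := Sym2.mem_map.1 hw
    obtain ⟨v', hv', hvv⟩ := Sym2.mem_map.1 hw'
    obtain rfl := hp ⟨e', he', hv'⟩ ⟨e, he, hv⟩ hvv
    exact ⟨v', hv, hv', rfl⟩

theorem Emb.poly_image {V : Type*} {E : Finset (Sym2 V)} {p : V → E3} (h : Emb E p)
    (hne : E.Nonempty) (hd : ∀ v, _root_.deg E v = 0 ∨ _root_.deg E v = 2) :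
    PolySys (E.image (Sym2.map p)) :=
  ⟨hne.image _, h.image, deg_image h.injOn hd⟩

namespace PolySys

variable {S : Finset (Sym2 E3)}

theorem nd (h : PolySys S) {e : Sym2 E3} (he : e ∈ S) : ¬ e.IsDiag := by
  simpa using h.emb.nd e he

theorem meet (h : PolySys S) {e e' : Sym2 E3} (he : e ∈ S) (he' : e' ∈ S) (hne : e ≠ e') {x : E3}
    (hx : x ∈ eseg e) (hx' : x ∈ eseg e') : x ∈ e ∧ x ∈ e' := by
  obtain ⟨v, h1, h2, rfl⟩ := h.emb.meet e he e' he' hne x (by simpa using hx) (by simpa using hx')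
  exact ⟨h1, h2⟩

theorem isPolygonalLink (h : PolySys S) : IsPolygonalLink (body S) := by
  refine ⟨S, ⟨S.finite_toSet, by simpa using h.ne, fun e he => h.nd he, ?_, ?_⟩, by
    simp [body, eseg, edgeSegment]⟩
  · intro e he e' he' hne x hx
    exact h.meet he he' hne hx.1 hx.2
  · intro e he v hv
    have := deg_eq_card (fun e he => h.nd he) v (E := S)
    rcases h.deg v with h0 | h2
    · exact absurd hv (deg_eq_zero.1 h0 e he)
    · rw [h2] at this; exact this.symm

theorem of_isClosedPolygonSystem {S : Set (Sym2 E3)} (h : IsClosedPolygonSystem S) :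
    PolySys h.finite.toFinset := by
  refine ⟨by simpa using h.nonempty, ⟨fun e he => ?_, ?_⟩, fun v => ?_⟩
  · simpa using h.not_isDiag e (by simpa using he)
  · intro e he e' he' hne x hx hx'
    have := h.inter_subset e (by simpa using he) e' (by simpa using he') hne
      ⟨show x ∈ eseg e by simpa using hx, show x ∈ eseg e' by simpa using hx'⟩
    exact ⟨x, this.1, this.2, rfl⟩
  · rw [deg_eq_card (fun e he => h.not_isDiag e (by simpa using he))]
    by_cases hv : ∃ e ∈ S, v ∈ e
    · obtain ⟨e, he, hv⟩ := hv
      right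
      simpa using h.degree_eq_two e he v hv
    · left
      have : {e | e ∈ h.finite.toFinset ∧ v ∈ e} = ∅ := by
        ext e; simp only [Finite.mem_toFinset, mem_ofPred_eq, mem_empty_iff_false, iff_false]
        exact fun hh => hv ⟨e, hh⟩
      rw [this, ncard_empty]

/-- Replacing a part of a polygon system by other edges with the same ends. -/
theorem surgery {A N R : Finset (Sym2 E3)} (h : PolySys (A ∪ R)) (hAR : Disjoint A R)
    (hNR : Disjoint N R) (hne : N.Nonempty) (nd : ∀ e ∈ N, ¬ e.IsDiag)
    (hN : ∀ e ∈ N, ∀ e' ∈ N, e ≠ e' → ∀ x ∈ eseg e, x ∈ eseg e' → x ∈ e ∧ x ∈ e')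
    (hR : ∀ e ∈ N, ∀ e' ∈ R, ∀ x ∈ eseg e, x ∈ eseg e' → x ∈ e ∧ x ∈ e')
    (hd : ∀ v, _root_.deg N v = _root_.deg A v ∨ (_root_.deg N v = 2 ∧ _root_.deg R v = 0) ∨
      (_root_.deg N v = 0 ∧ _root_.deg A v = 2)) : PolySys (N ∪ R) := by
  refine ⟨hne.mono Finset.subset_union_left, ⟨fun e he => ?_, ?_⟩, fun v => ?_⟩
  · rcases Finset.mem_union.1 he with he | he
    · simpa using nd e he
    · simpa using h.nd (Finset.mem_union_right _ he)
  · intro e he e' he' hee x hx hx'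
    rw [Sym2.map_id] at hx hx'
    suffices x ∈ e ∧ x ∈ e' from ⟨x, this.1, this.2, rfl⟩
    rcases Finset.mem_union.1 he with he | he <;> rcases Finset.mem_union.1 he' with he' | he'
    · exact hN e he e' he' hee x hx hx'
    · exact hR e he e' he' x hx hx'
    · exact (hR e' he' e he x hx' hx).symm
    · exact h.meet (Finset.mem_union_right _ he) (Finset.mem_union_right _ he') hee hx hx'
  -- In the last alternative the total degree was zero or two and `A` alone accounts for two, so `v`
  -- does not lie on an edge of `R` either.
  · have h1 := h.deg v
    rw [deg_union hAR] at h1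
    rw [deg_union hNR]
    rcases hd v with h2 | h2 | h2 <;> omega

/-- A continuous motion of the vertices through polygon systems is an ambient isotopy. -/
theorem ambientIsotopic_of_motion {E : Finset (Sym2 E3)} (p : ℝ → E3 → E3)
    (hp : ∀ v, Continuous fun t => p t v) (hp0 : ∀ e ∈ E, ∀ v ∈ e, p 0 v = v)
    (hE : ∀ t ∈ Icc (0 : ℝ) 1, PolySys (E.image (Sym2.map (p t))))
    (hinj : ∀ t ∈ Icc (0 : ℝ) 1, InjOn (p t) {v | ∃ e ∈ E, v ∈ e}) :
    AmbientIsotopic (body E) (body (E.image (Sym2.map (p 1)))) := by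
  have h1 := _root_.ambientIsotopic_of_motion E p hp
    fun t ht => Emb.of_image (hinj t ht) (hE t ht).emb
  have h2 : carrier E (p 0) = body E := by
    rw [carrier, body]
    refine iUnion₂_congr fun e he => ?_
    congr 1
    calc e.map (p 0) = e.map id := Sym2.map_congr fun v hv => hp0 e he v hv
      _ = e := by simp
  rw [← h2, body_image]
  exact h1

end PolySys

/-! ### Triangle moves -/

/-- Linear forms that increase along a path serve throughout as certificates that its edges meet
only in common ends. -/
theorem linear_lt_of_mem_segment {ℓ : E3 →ₗ[ℝ] ℝ} {P Q x : E3} (h : ℓ P < ℓ Q)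
    (hx : x ∈ eseg s(P, Q)) : (x = P ∨ ℓ P < ℓ x) ∧ (x = Q ∨ ℓ x < ℓ Q) := by
  obtain ⟨t, h0, h1, rfl⟩ := mem_eseg_mk.1 hx
  simp only [map_add, map_smul, smul_eq_mul]
  constructor
  · rcases h0.eq_or_lt with rfl | h0
    · left; simp
    · right; nlinarith
  · rcases h1.eq_or_lt with rfl | h1
    · left; simp
    · right; nlinarith

theorem eseg_subset_tri {P Q T a b : E3} (ha : a ∈ ({P, Q, T} : Set E3))
    (hb : b ∈ ({P, Q, T} : Set E3)) : eseg s(a, b) ⊆ convexHull ℝ {P, Q, T} := by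
  refine eseg_subset (convex_convexHull _ _) fun x hx => subset_convexHull _ _ ?_
  rcases Sym2.mem_iff.1 hx with rfl | rfl <;> assumption

theorem eseg_union (P T : E3) {μ : ℝ} (h0 : 0 < μ) (h1 : μ < 1) :
    eseg s(P, (1 - μ) • P + μ • T) ∪ eseg s((1 - μ) • P + μ • T, T) = eseg s(P, T) := by
  have hM : (1 - μ) • P + μ • T ∈ eseg s(P, T) := mem_eseg_mk.2 ⟨μ, h0.le, h1.le, rfl⟩
  apply subset_antisymm
  · refine union_subset ?_ ?_ <;> refine eseg_subset (convex_eseg _) fun x hx => ?_ <;>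
      rcases Sym2.mem_iff.1 hx with rfl | rfl <;>
      first | exact hM | exact mem_eseg_of_mem (by simp)
  · intro x hx
    obtain ⟨t, ht0, ht1, rfl⟩ := mem_eseg_mk.1 hx
    rcases le_total t μ with h | h
    · left
      refine mem_eseg_mk.2 ⟨t / μ, by positivity, by rwa [div_le_one h0], ?_⟩
      have : t / μ * μ = t := by field_simp
      rw [smul_add, smul_smul, smul_smul, this]
      rw [← add_assoc, ← add_smul]
      congr 2
      linear_combination this
    · right
      have h2 : 0 < 1 - μ := by linarith
      refine mem_eseg_mk.2 ⟨(t - μ) / (1 - μ), div_nonneg (by linarith) h2.le, ?_, ?_⟩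
      · rw [div_le_one h2]; linarith
      have : (t - μ) / (1 - μ) * (1 - μ) = t - μ := by field_simp
      rw [smul_add, smul_smul, smul_smul, add_assoc, ← add_smul]
      congr 2
      · linear_combination this
      · linear_combination (-1 : ℝ) * this

section triangle
variable {R : Finset (Sym2 E3)} {P Q T : E3} {ℓ : E3 →ₗ[ℝ] ℝ}

/-- The form `ℓ` keeps the two new sides apart except at `Q`, and `htri` keeps them apart from the
rest. The triangle may be degenerate, with `Q` on the edge `P T`, so subdivision of an edge is
included. -/
theorem poly_insert_of_tri (h : PolySys (insert s(P, T) R)) (hPQ : ℓ P < ℓ Q) (hQT : ℓ Q < ℓ T)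
    (htri : ∀ e ∈ R, ∀ x ∈ eseg e, x ∈ convexHull ℝ {P, Q, T} → x = P ∨ x = T) :
    PolySys (insert s(P, Q) (insert s(Q, T) R)) := by
  have hQP : Q ≠ P := fun hh => hPQ.ne (by rw [hh])
  have hQT' : Q ≠ T := fun hh => hQT.ne (by rw [hh])
  have hPT' : P ≠ T := fun hh => (hPQ.trans hQT).ne (by rw [hh])
  have hQ : ∀ e ∈ R, Q ∉ e := by
    intro e he hQe
    rcases htri e he Q (mem_eseg_of_mem hQe) (subset_convexHull _ _ (by simp)) with hh | hh
    · exact hQP hh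
    · exact hQT' hh
  have hPT : s(P, T) ∉ R := by
    intro hh
    -- The midpoint of the edge lies in the triangle, and `ℓ` distinguishes it from both ends.
    have hm : ((1 - 1 / 2 : ℝ)) • P + (1 / 2 : ℝ) • T ∈ eseg s(P, T) :=
      mem_eseg_mk.2 ⟨1 / 2, by norm_num, by norm_num, rfl⟩
    have h3 := htri _ hh _ hm (eseg_subset_tri (by simp) (by simp) hm)
    have h4 : ∀ y, (1 - 1 / 2 : ℝ) • P + (1 / 2 : ℝ) • T = y → ℓ y = (ℓ P + ℓ T) / 2 := by
      rintro y rfl; simp only [map_add, map_smul, smul_eq_mul]; ring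
    rcases h3 with h3 | h3 <;> have := h4 _ h3 <;> linarith
  have e1 : insert s(P, Q) (insert s(Q, T) R) = {s(P, Q), s(Q, T)} ∪ R := by ext; simp
  have hne : s(P, Q) ≠ s(Q, T) := by
    intro hh
    have : P ∈ s(Q, T) := hh ▸ (by simp)
    rcases Sym2.mem_iff.1 this with hh | hh
    · exact hQP hh.symm
    · exact hPT' hh
  have hP : ∀ e ∈ R, P ∈ eseg e → P ∈ e := fun e he hx =>
    (h.meet (e := e) (e' := s(P, T)) (Finset.mem_insert_of_mem he) (Finset.mem_insert_self _ _)
      (fun hh => hPT (hh ▸ he)) hx (mem_eseg_of_mem (by simp))).1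
  have hT : ∀ e ∈ R, T ∈ eseg e → T ∈ e := fun e he hx =>
    (h.meet (e := e) (e' := s(P, T)) (Finset.mem_insert_of_mem he) (Finset.mem_insert_self _ _)
      (fun hh => hPT (hh ▸ he)) hx (mem_eseg_of_mem (by simp))).1
  have hmid : ∀ x, x ∈ eseg s(P, Q) → x ∈ eseg s(Q, T) → x = Q := by
    intro x hx hx'
    rcases (linear_lt_of_mem_segment hPQ hx).2 with h1 | h1
    · exact h1
    rcases (linear_lt_of_mem_segment hQT hx').1 with h2 | h2
    · exact h2
    · linarith
  rw [e1]
  rw [Finset.insert_eq] at h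
  refine h.surgery ?_ ?_ (by simp) ?_ ?_ ?_ ?_
  · simpa using hPT
  · rw [Finset.disjoint_left]
    intro e he heR
    rcases Finset.mem_insert.1 he with rfl | he
    · exact hQ _ heR (by simp)
    · rw [Finset.mem_singleton.1 he] at heR
      exact hQ _ heR (by simp)
  · simp [hQP.symm, hQT']
  · intro e he e' he' hee x hx hx'
    simp only [Finset.mem_insert, Finset.mem_singleton] at he he'
    rcases he with rfl | rfl <;> rcases he' with rfl | rfl
    · exact absurd rfl hee
    · rw [hmid x hx hx']; simp
    · rw [hmid x hx' hx]; simp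
    · exact absurd rfl hee
  · intro e he e' he' x hx hx'
    simp only [Finset.mem_insert, Finset.mem_singleton] at he
    rcases he with rfl | rfl
    · rcases htri e' he' x hx' (eseg_subset_tri (by simp) (by simp) hx) with rfl | rfl
      · exact ⟨by simp, hP e' he' hx'⟩
      · rcases (linear_lt_of_mem_segment hPQ hx).2 with h1 | h1
        · exact absurd h1.symm hQT'
        · linarith
    · rcases htri e' he' x hx' (eseg_subset_tri (by simp) (by simp) hx) with rfl | rfl
      · rcases (linear_lt_of_mem_segment hQT hx).1 with h1 | h1
        · exact absurd h1.symm hQP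
        · linarith
      · exact ⟨by simp, hT e' he' hx'⟩
  · intro v
    rw [deg_insert (by simpa using hne), deg_singleton, deg_singleton, mult_mk, mult_mk, mult_mk]
    by_cases hv : v = Q
    · subst hv
      right; left
      exact ⟨by simp [hQP, hQT'], deg_eq_zero.2 hQ⟩
    · left; simp [hv]

/-- An edge may be replaced by the two other sides of a triangle that meets the rest only in the
two ends of the edge. -/
theorem delta_add (h : PolySys (insert s(P, T) R)) (hPQ : ℓ P < ℓ Q) (hQT : ℓ Q < ℓ T)
    (htri : ∀ e ∈ R, ∀ x ∈ eseg e, x ∈ convexHull ℝ {P, Q, T} → x = P ∨ x = T) :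
    PolySys (insert s(P, Q) (insert s(Q, T) R)) ∧
      AmbientIsotopic (body (insert s(P, T) R)) (body (insert s(P, Q) (insert s(Q, T) R))) := by
  refine ⟨poly_insert_of_tri h hPQ hQT htri, ?_⟩
  -- `μ` is chosen so that the point `M` of the edge has the same value of `ℓ` as `Q`. While a
  -- vertex moves straight from `M` to `Q`, its value of `ℓ` is constant, so `poly_insert_of_tri`
  -- applies at all times.
  set μ := (ℓ Q - ℓ P) / (ℓ T - ℓ P) with hμ
  have hpos : 0 < ℓ T - ℓ P := by linarith
  have hμ0 : 0 < μ := div_pos (by linarith) hpos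
  have hμ1 : μ < 1 := by rw [hμ, div_lt_one hpos]; linarith
  set M := (1 - μ) • P + μ • T with hM
  have hℓM : ℓ M = ℓ Q := by
    simp only [hM, map_add, map_smul, smul_eq_mul, hμ]; field_simp; ring
  have hMseg : M ∈ eseg s(P, T) := mem_eseg_mk.2 ⟨μ, hμ0.le, hμ1.le, rfl⟩
  have hMtri : M ∈ convexHull ℝ {P, Q, T} := eseg_subset_tri (by simp) (by simp) hMseg
  have hMP : M ≠ P := fun hh => hPQ.ne (by rw [← hℓM, hh])
  have hMT : M ≠ T := fun hh => hQT.ne (by rw [← hℓM, hh])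
  set q : ℝ → E3 := fun t => (1 - t) • M + t • Q with hq
  have hℓq : ∀ t, ℓ (q t) = ℓ Q := fun t => by
    simp only [hq, map_add, map_smul, smul_eq_mul, hℓM]; ring
  have hqtri : ∀ t ∈ Icc (0 : ℝ) 1, convexHull ℝ {P, q t, T} ⊆ convexHull ℝ {P, Q, T} := by
    intro t ht
    refine convexHull_min ?_ (convex_convexHull _ _)
    rintro x (rfl | rfl | rfl)
    · exact subset_convexHull _ _ (by simp)
    · exact (convex_convexHull ℝ _) hMtri (subset_convexHull _ _ (by simp)) (by linarith [ht.2])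
        ht.1 (by ring)
    · exact subset_convexHull _ _ (by simp)
  have hpoly : ∀ t ∈ Icc (0 : ℝ) 1, PolySys (insert s(P, q t) (insert s(q t, T) R)) := fun t ht =>
    poly_insert_of_tri (ℓ := ℓ) h (by rw [hℓq]; exact hPQ) (by rw [hℓq]; exact hQT)
      fun e he x hx hx' => htri e he x hx (hqtri t ht hx')
  have hnotR : ∀ t ∈ Icc (0 : ℝ) 1, ∀ e ∈ R, q t ∉ e := by
    intro t ht e he hh
    rcases htri e he _ (mem_eseg_of_mem hh) (hqtri t ht (subset_convexHull _ _ (by simp))) with h1 | h1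
    · have := hℓq t; rw [h1] at this; linarith
    · have := hℓq t; rw [h1] at this; linarith
  have hq0 : q 0 = M := by simp [hq]
  have hq1 : q 1 = Q := by simp [hq]
  have hMR : ∀ e ∈ R, M ∉ e := by
    have := hnotR 0 (by simp); rwa [hq0] at this
  have hfix : ∀ t, ∀ e ∈ R, Sym2.map (Function.update id M (q t)) e = e := by
    intro t e he
    calc _ = e.map id := Sym2.map_congr fun v hv =>
          Function.update_of_ne (by rintro rfl; exact hMR e he hv) _ _
      _ = e := by simp
  have himg : ∀ t, (insert s(P, M) (insert s(M, T) R)).image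
      (Sym2.map (Function.update id M (q t))) = insert s(P, q t) (insert s(q t, T) R) := by
    intro t
    rw [Finset.image_insert, Finset.image_insert, Finset.image_congr (g := id) (hfix t),
      Finset.image_id]
    simp [Function.update_of_ne hMP.symm, Function.update_of_ne hMT.symm]
  have hmot := PolySys.ambientIsotopic_of_motion (E := insert s(P, M) (insert s(M, T) R))
    (fun t => Function.update id M (q t)) ?_ ?_ ?_ ?_
  · beta_reduce at hmot
    rw [himg 1, hq1] at hmot
    -- At time zero the moving vertex merely subdivides the edge.
    have hb : body (insert s(P, M) (insert s(M, T) R)) = body (insert s(P, T) R) := by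
      rw [body_insert, body_insert, body_insert, ← union_assoc]
      congr 1
      exact eseg_union P T hμ0 hμ1
    rwa [hb] at hmot
  · intro v
    by_cases hv : v = M
    · subst hv; simp only [Function.update_self, hq]; fun_prop
    · simp only [Function.update_of_ne hv]; fun_prop
  · intro e _ v _
    have : Function.update id M M = id := Function.update_eq_self M id
    simp only [hq0, this, id]
  · intro t ht; rw [himg]; exact hpoly t ht
  · intro t ht v hv w hw hvw
    have key : ∀ v, (∃ e ∈ insert s(P, M) (insert s(M, T) R), v ∈ e) → v ≠ M → v ≠ q t := by
      rintro v ⟨e, he, hve⟩ hvM rfl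
      simp only [Finset.mem_insert] at he
      rcases he with rfl | rfl | he
      · rcases Sym2.mem_iff.1 hve with h1 | h1
        · have := hℓq t; rw [h1] at this; linarith
        · exact hvM h1
      · rcases Sym2.mem_iff.1 hve with h1 | h1
        · exact hvM h1
        · have := hℓq t; rw [h1] at this; linarith
      · exact hnotR t ht e he hve
    by_cases h1 : v = M <;> by_cases h2 : w = M
    · rw [h1, h2]
    · simp only [h1, Function.update_self, Function.update_of_ne h2, id] at hvw
      exact absurd hvw.symm (key w hw h2)
    · simp only [h2, Function.update_self, Function.update_of_ne h1, id] at hvw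
      exact absurd hvw (key v hv h1)
    · simpa only [Function.update_of_ne h1, Function.update_of_ne h2, id] using hvw

/-- Only embeddedness of the simplified system has to be shown, as the isotopy is the inverse of the
one in `delta_add`. -/
theorem delta_remove (h : PolySys (insert s(P, Q) (insert s(Q, T) R))) (hPQ : ℓ P < ℓ Q)
    (hQT : ℓ Q < ℓ T)
    (htri : ∀ e ∈ R, ∀ x ∈ eseg e, x ∈ convexHull ℝ {P, Q, T} → x = P ∨ x = T) :
    PolySys (insert s(P, T) R) ∧
      AmbientIsotopic (body (insert s(P, Q) (insert s(Q, T) R))) (body (insert s(P, T) R)) := by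
  suffices PolySys (insert s(P, T) R) from ⟨this, (delta_add this hPQ hQT htri).2.symm⟩
  have hQP : Q ≠ P := fun hh => hPQ.ne (by rw [hh])
  have hQT' : Q ≠ T := fun hh => hQT.ne (by rw [hh])
  have hPT' : P ≠ T := fun hh => (hPQ.trans hQT).ne (by rw [hh])
  have hQ : ∀ e ∈ R, Q ∉ e := by
    intro e he hQe
    rcases htri e he Q (mem_eseg_of_mem hQe) (subset_convexHull _ _ (by simp)) with hh | hh
    · exact hQP hh
    · exact hQT' hh
  have hne : s(P, Q) ≠ s(Q, T) := by
    intro hh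
    have : P ∈ s(Q, T) := hh ▸ (by simp)
    rcases Sym2.mem_iff.1 this with hh | hh
    · exact hQP hh.symm
    · exact hPT' hh
  have hPT : s(P, T) ∉ R := by
    intro hh
    have hm : ((1 - 1 / 2 : ℝ)) • P + (1 / 2 : ℝ) • T ∈ eseg s(P, T) :=
      mem_eseg_mk.2 ⟨1 / 2, by norm_num, by norm_num, rfl⟩
    have h3 := htri _ hh _ hm (eseg_subset_tri (by simp) (by simp) hm)
    have h4 : ∀ y, (1 - 1 / 2 : ℝ) • P + (1 / 2 : ℝ) • T = y → ℓ y = (ℓ P + ℓ T) / 2 := by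
      rintro y rfl; simp only [map_add, map_smul, smul_eq_mul]; ring
    rcases h3 with h3 | h3 <;> have := h4 _ h3 <;> linarith
  have e1 : insert s(P, Q) (insert s(Q, T) R) = {s(P, Q), s(Q, T)} ∪ R := by ext; simp
  have e2 : insert s(P, T) R = {s(P, T)} ∪ R := by ext; simp
  rw [e2]
  have h' := h
  rw [e1] at h'
  refine h'.surgery ?_ ?_ (by simp) ?_ ?_ ?_ ?_
  · rw [Finset.disjoint_left]
    intro e he heR
    rcases Finset.mem_insert.1 he with rfl | he
    · exact hQ _ heR (by simp)
    · rw [Finset.mem_singleton.1 he] at heR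
      exact hQ _ heR (by simp)
  · simpa using hPT
  · simp [hPT']
  · intro e he e' he' hee
    rw [Finset.mem_singleton] at he he'
    exact absurd (he.trans he'.symm) hee
  · intro e he e' he' x hx hx'
    rw [Finset.mem_singleton] at he
    subst he
    rcases htri e' he' x hx' (eseg_subset_tri (by simp) (by simp) hx) with rfl | rfl
    · refine ⟨by simp, (h.meet (e := e') (e' := s(x, Q)) (by simp [he']) (by simp) ?_ hx'
        (mem_eseg_of_mem (by simp))).1⟩
      rintro rfl; exact hQ _ he' (by simp)
    · refine ⟨by simp, (h.meet (e := e') (e' := s(Q, x)) (by simp [he']) (by simp) ?_ hx'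
        (mem_eseg_of_mem (by simp))).1⟩
      rintro rfl; exact hQ _ he' (by simp)
  · intro v
    rw [deg_insert (by simpa using hne), deg_singleton, deg_singleton, mult_mk, mult_mk, mult_mk]
    by_cases hv : v = Q
    · subst hv
      right; right
      simp [hQP, hQT']
    · left; simp [hv]

end triangle

/-- Subdividing an edge. -/
theorem PolySys.subdivide {R : Finset (Sym2 E3)} {P T : E3} (h : PolySys (insert s(P, T) R))
    (hPT : s(P, T) ∉ R) {μ : ℝ} (h0 : 0 < μ) (h1 : μ < 1) :
    PolySys (insert s(P, (1 - μ) • P + μ • T) (insert s((1 - μ) • P + μ • T, T) R)) ∧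
      body (insert s(P, (1 - μ) • P + μ • T) (insert s((1 - μ) • P + μ • T, T) R)) =
        body (insert s(P, T) R) := by
  have hne : P ≠ T := fun hh => h.nd (Finset.mem_insert_self _ _) (by simp [hh])
  have hMseg : (1 - μ) • P + μ • T ∈ eseg s(P, T) := mem_eseg_mk.2 ⟨μ, h0.le, h1.le, rfl⟩
  have hpos : 0 < inner ℝ (T - P) (T - P) := real_inner_self_pos.2 (sub_ne_zero.2 hne.symm)
  constructor
  · have e1 : inner ℝ (T - P) ((1 - μ) • P + μ • T) =
        inner ℝ (T - P) P + μ * inner ℝ (T - P) (T - P) := by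
      simp only [inner_add_right, inner_smul_right, inner_sub_right]; ring
    have e2 : inner ℝ (T - P) T = inner ℝ (T - P) P + inner ℝ (T - P) (T - P) := by
      simp only [inner_sub_right]; ring
    -- The increasing form is the inner product with `T - P`, and the degenerate triangle is the
    -- edge itself.
    refine poly_insert_of_tri (ℓ := (innerSL ℝ (T - P)).toLinearMap) h ?_ ?_ ?_
    · simp only [ContinuousLinearMap.coe_coe, innerSL_apply_apply]
      rw [e1]; nlinarith
    · simp only [ContinuousLinearMap.coe_coe, innerSL_apply_apply]
      rw [e1, e2]; nlinarith
    · intro e he x hx hx'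
      have hx'' : x ∈ eseg s(P, T) := by
        refine convexHull_min ?_ (convex_eseg _) hx'
        rintro y (rfl | rfl | rfl)
        · exact mem_eseg_of_mem (by simp)
        · exact hMseg
        · exact mem_eseg_of_mem (by simp)
      exact Sym2.mem_iff.1 (h.meet (e := s(P, T)) (e' := e) (by simp) (by simp [he])
        (fun hh => hPT (hh ▸ he)) hx'' hx).1
  · rw [body_insert, body_insert, body_insert, ← union_assoc]
    congr 1
    exact eseg_union P T h0 h1

end

end

section
open Set Topology Filter
open scoped Classical
noncomputable section
attribute [local instance] sym2DecEq

/-! ### Skein-closed classes of links -/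

/-- Four polygonal links that differ only in the standard ball, where they are the four standard
pictures. -/
structure IsStandardQuadruple (Lp Ln Li Lz : Set E3) : Prop where
  poly : IsPolygonalLink Lp ∧ IsPolygonalLink Ln ∧ IsPolygonalLink Li ∧ IsPolygonalLink Lz
  ball : Lp ∩ skeinBall = tanglePos ∧ Ln ∩ skeinBall = tangleNeg ∧
    Li ∩ skeinBall = tangleInfty ∧ Lz ∩ skeinBall = tangleZero
  out : Ln \ skeinBall = Lp \ skeinBall ∧ Li \ skeinBall = Lp \ skeinBall ∧
    Lz \ skeinBall = Lp \ skeinBall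

/-- A class of links that is closed under ambient isotopy, contains the unknot and is compatible
with the skein relation. -/
structure SkeinClosed (Z : Set E3 → Prop) : Prop where
  iso : ∀ {L L' : Set E3}, AmbientIsotopic L L' → Z L → Z L'
  unknot : Z unknot.1
  pos_iff_neg : ∀ {Lp Ln Li Lz : Set E3}, IsStandardQuadruple Lp Ln Li Lz → Z Li → Z Lz →
    (Z Lp ↔ Z Ln)
  zero : ∀ {Lp Ln Li Lz : Set E3}, IsStandardQuadruple Lp Ln Li Lz → Z Lp → Z Ln → Z Li → Z Lz

theorem isLink_of_isPolygonalLink {L : Set E3} (h : IsPolygonalLink L) : IsLink L :=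
  ⟨L, h, AmbientIsotopic.refl L⟩

/-- The difference `f - f'` satisfies the same linear relation. If it vanishes on all but one link
of a quadruple, it vanishes on the last, provided the coefficient of that link is a unit.
Quantifying over proofs of `IsLink L` turns the equality into a predicate on all sets, which is
vacuous on sets that are not links. -/
theorem skeinClosed_eq {R : Type*} [CommRing R] (a b c d : R)
    (ha : IsUnit a) (hb : IsUnit b) (hd : IsUnit d)
    (f f' : Link → R) (hf : IsLinkInvariant f) (hf' : IsLinkInvariant f')
    (hskein : SatisfiesSkein a b c d f) (hskein' : SatisfiesSkein a b c d f')
    (hunknot : f unknot = f' unknot) :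
    SkeinClosed fun L => ∀ h : IsLink L, f ⟨L, h⟩ = f' ⟨L, h⟩ := by
  have quad : ∀ {Lp Ln Li Lz : Set E3} (h : IsStandardQuadruple Lp Ln Li Lz),
      IsSkeinQuadruple ⟨Lp, isLink_of_isPolygonalLink h.poly.1⟩
        ⟨Ln, isLink_of_isPolygonalLink h.poly.2.1⟩ ⟨Li, isLink_of_isPolygonalLink h.poly.2.2.1⟩
        ⟨Lz, isLink_of_isPolygonalLink h.poly.2.2.2⟩ := by
    intro Lp Ln Li Lz h
    refine ⟨Homeomorph.refl E3, IsFinalMapOfIsotopy.refl, ?_⟩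
    have hid : ∀ S : Set E3, Homeomorph.refl E3 '' S = S := fun S => by simp
    simp only [hid]
    exact ⟨h.poly, h.ball, h.out⟩
  refine ⟨?_, fun _ => hunknot, ?_, ?_⟩
  · intro L L' hL hZ h'
    have h : IsLink L := by
      obtain ⟨P, hP, hLP⟩ := h'
      exact ⟨P, hP, hL.trans hLP⟩
    rw [← hf ⟨L, h⟩ ⟨L', h'⟩ hL, ← hf' ⟨L, h⟩ ⟨L', h'⟩ hL, hZ h]
  · intro Lp Ln Li Lz h hi hz
    have e := hskein _ _ _ _ (quad h)
    have e' := hskein' _ _ _ _ (quad h)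
    rw [hi, hz] at e
    constructor
    · intro hp hl
      rw [hp] at e
      refine hb.mul_left_cancel ?_
      linear_combination e - e'
    · intro hn hl
      rw [hn] at e
      refine ha.mul_left_cancel ?_
      linear_combination e - e'
  · intro Lp Ln Li Lz h hp hn hi hl
    have e := hskein _ _ _ _ (quad h)
    have e' := hskein' _ _ _ _ (quad h)
    rw [hp, hn, hi] at e
    refine hd.mul_left_cancel ?_
    linear_combination e - e'

/-! ### Coordinates -/

/-- A coordinate function as a linear map. -/
def coord (i : Fin 3) : E3 →ₗ[ℝ] ℝ := (EuclideanSpace.proj i : E3 →L[ℝ] ℝ).toLinearMap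

theorem coord_apply (i : Fin 3) (x : E3) : coord i x = x i := rfl

theorem lt_of_mem_eseg {ℓ : E3 →ₗ[ℝ] ℝ} {h : ℝ} {e : Sym2 E3} (he : ∀ v ∈ e, h < ℓ v) {x : E3}
    (hx : x ∈ eseg e) : h < ℓ x :=
  eseg_subset (s := {x | h < ℓ x}) (convex_halfSpace_gt ℓ.isLinear h) he hx

theorem le_of_mem_eseg {ℓ : E3 →ₗ[ℝ] ℝ} {h : ℝ} {e : Sym2 E3} (he : ∀ v ∈ e, ℓ v ≤ h) {x : E3}
    (hx : x ∈ eseg e) : ℓ x ≤ h :=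
  eseg_subset (s := {x | ℓ x ≤ h}) (convex_halfSpace_le ℓ.isLinear h) he hx

/-! ### Triangles above the rest of a link -/

/-- The edges of a triangle. -/
def tri (P Q T : E3) : Finset (Sym2 E3) := {s(P, Q), s(Q, T), s(T, P)}

theorem tri_rotate (P Q T : E3) : tri P Q T = tri Q T P := by
  ext e; simp only [tri, Finset.mem_insert, Finset.mem_singleton]; tauto

theorem tri_swap (P Q T : E3) : tri P Q T = tri Q P T := by
  ext e
  simp only [tri, Finset.mem_insert, Finset.mem_singleton]
  rw [Sym2.eq_swap (a := Q) (b := P), Sym2.eq_swap (a := P) (b := T), Sym2.eq_swap (a := T) (b := Q)]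
  tauto

/-- Three points that are not collinear. -/
def NonCol (P Q T : E3) : Prop := ∀ s t : ℝ, s • (Q - P) + t • (T - P) = 0 → s = 0 ∧ t = 0

theorem NonCol.ne {P Q T : E3} (h : NonCol P Q T) : P ≠ Q ∧ Q ≠ T ∧ P ≠ T := by
  refine ⟨?_, ?_, ?_⟩
  · rintro rfl; have := (h 1 0 (by simp)).1; norm_num at this
  · rintro rfl; have := (h 1 (-1) (by module)).1; norm_num at this
  · rintro rfl; have := (h 0 1 (by simp)).2; norm_num at this

theorem deg_tri {P Q T : E3} (h : NonCol P Q T) (v : E3) : deg (tri P Q T) v =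
    2 * ((if v = P then 1 else 0) + (if v = Q then 1 else 0) + (if v = T then 1 else 0)) := by
  obtain ⟨h1, h2, h3⟩ := h.ne
  rw [tri, deg_insert (by simp [h1, h2, h3]), deg_insert (by simp [h2, h3.symm, h1.symm]),
    deg_singleton, mult_mk, mult_mk, mult_mk]
  by_cases hP : v = P <;> by_cases hQ : v = Q <;> by_cases hT : v = T <;>
    simp only [hP, hQ, hT, if_true, if_false] <;> simp_all

theorem tri_above {P Q T : E3} {h : ℝ} (hP : h < P 2) (hQ : h < Q 2) (hT : h < T 2) :
    ∀ e ∈ tri P Q T, ∀ x ∈ eseg e, h < x 2 := by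
  intro e he x hx
  refine lt_of_mem_eseg (ℓ := coord 2) (fun v hv => ?_) hx
  simp only [tri, Finset.mem_insert, Finset.mem_singleton] at he
  rcases he with rfl | rfl | rfl <;> rcases Sym2.mem_iff.1 hv with rfl | rfl <;> assumption

/-- The height `h` separates both triangles from the rest, so no condition on their relative
position is needed. -/
theorem PolySys.tri_union {R : Finset (Sym2 E3)} {P Q T P' Q' T' : E3} {h : ℝ}
    (hpoly : PolySys (tri P Q T ∪ R)) (hn : NonCol P Q T) (hn' : NonCol P' Q' T')
    (hR : ∀ e ∈ R, ∀ x ∈ eseg e, x 2 ≤ h) (hP : h < P 2) (hQ : h < Q 2) (hT : h < T 2)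
    (hP' : h < P' 2) (hQ' : h < Q' 2) (hT' : h < T' 2) : PolySys (tri P' Q' T' ∪ R) := by
  have hdisj : ∀ {P Q T : E3}, h < P 2 → h < Q 2 → h < T 2 → Disjoint (tri P Q T) R := by
    intro P Q T hP hQ hT
    rw [Finset.disjoint_left]
    intro e he he'
    obtain ⟨x, hx⟩ := eseg_nonempty e
    have := tri_above hP hQ hT e he x hx
    have := hR e he' x hx
    linarith
  have hc : ∀ e, e ∈ tri P' Q' T' ↔ e ∈ ({s(P', Q'), s(Q', T'), s(T', P')} : Set (Sym2 E3)) := by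
    intro e; simp [tri]
  have hcl := isClosedPolygonSystem_triangle P' Q' T' hn'
  refine hpoly.surgery (hdisj hP hQ hT) (hdisj hP' hQ' hT') (by simp [tri]) ?_ ?_ ?_ ?_
  · intro e he; exact hcl.not_isDiag e ((hc e).1 he)
  · intro e he e' he' hne x hx hx'
    exact hcl.inter_subset e ((hc e).1 he) e' ((hc e').1 he') hne ⟨hx, hx'⟩
  · intro e he e' he' x hx hx'
    have := tri_above hP' hQ' hT' e he x hx
    have := hR e' he' x hx'
    linarith
  · intro v
    have hR0 : h < v 2 → _root_.deg R v = 0 := fun hv => deg_eq_zero.2 fun e he hve => by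
      have := hR e he v (mem_eseg_of_mem hve); linarith
    rw [deg_tri hn, deg_tri hn']
    obtain ⟨h1, h2, h3⟩ := hn.ne
    obtain ⟨h1', h2', h3'⟩ := hn'.ne
    by_cases hv : v = P' ∨ v = Q' ∨ v = T'
    · right; left
      rcases hv with rfl | rfl | rfl
      · exact ⟨by simp [h1', h3'], hR0 hP'⟩
      · exact ⟨by simp [h1'.symm, h2'], hR0 hQ'⟩
      · exact ⟨by simp [h3'.symm, h2'.symm], hR0 hT'⟩
    · have hz : 2 * ((if v = P' then 1 else 0) + (if v = Q' then 1 else 0) +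
          (if v = T' then 1 else 0)) = 0 := by
        push Not at hv; simp [hv.1, hv.2.1, hv.2.2]
      by_cases hw : v = P ∨ v = Q ∨ v = T
      · right; right
        refine ⟨hz, ?_⟩
        rcases hw with rfl | rfl | rfl
        · simp [h1, h3]
        · simp [h1.symm, h2]
        · simp [h3.symm, h2.symm]
      · left; push Not at hw; simp only [hz, hw.1, hw.2.1, hw.2.2, if_false]

/-- A triangle that moves, without degenerating, above the rest of a link. -/
theorem tri_motion {R : Finset (Sym2 E3)} {P Q T : ℝ → E3} {h : ℝ} (cP : Continuous P)
    (cQ : Continuous Q) (cT : Continuous T) (hpoly : PolySys (tri (P 0) (Q 0) (T 0) ∪ R))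
    (hn : ∀ t ∈ Icc (0 : ℝ) 1, NonCol (P t) (Q t) (T t))
    (hR : ∀ e ∈ R, ∀ x ∈ eseg e, x 2 ≤ h)
    (hab : ∀ t ∈ Icc (0 : ℝ) 1, h < P t 2 ∧ h < Q t 2 ∧ h < T t 2) :
    PolySys (tri (P 1) (Q 1) (T 1) ∪ R) ∧
      AmbientIsotopic (body (tri (P 0) (Q 0) (T 0) ∪ R)) (body (tri (P 1) (Q 1) (T 1) ∪ R)) := by
  have m0 : (0 : ℝ) ∈ Icc (0 : ℝ) 1 := by simp
  have hp : ∀ t ∈ Icc (0 : ℝ) 1, PolySys (tri (P t) (Q t) (T t) ∪ R) := fun t ht =>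
    hpoly.tri_union (hn 0 m0) (hn t ht) hR (hab 0 m0).1 (hab 0 m0).2.1 (hab 0 m0).2.2
      (hab t ht).1 (hab t ht).2.1 (hab t ht).2.2
  obtain ⟨d1, d2, d3⟩ := (hn 0 m0).ne
  -- The motion carries the three vertices of the triangle and fixes all others, which lie at height
  -- at most `h`.
  let φ : ℝ → E3 → E3 := fun t v => if v = P 0 then P t else if v = Q 0 then Q t else
    if v = T 0 then T t else v
  have φP : ∀ t, φ t (P 0) = P t := fun t => if_pos rfl
  have φQ : ∀ t, φ t (Q 0) = Q t := fun t => by simp [φ, d1.symm]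
  have φT : ∀ t, φ t (T 0) = T t := fun t => by simp [φ, d3.symm, d2.symm]
  have φR : ∀ t v, v 2 ≤ h → φ t v = v := by
    intro t v hv
    have h1 : v ≠ P 0 := by rintro rfl; linarith [(hab 0 m0).1]
    have h2 : v ≠ Q 0 := by rintro rfl; linarith [(hab 0 m0).2.1]
    have h3 : v ≠ T 0 := by rintro rfl; linarith [(hab 0 m0).2.2]
    simp [φ, h1, h2, h3]
  have himg : ∀ t, (tri (P 0) (Q 0) (T 0) ∪ R).image (Sym2.map (φ t)) =
      tri (P t) (Q t) (T t) ∪ R := by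
    intro t
    rw [Finset.image_union]
    congr 1
    · simp [tri, Finset.image_insert, φP, φQ, φT]
    · rw [Finset.image_congr (g := id), Finset.image_id]
      intro e he
      calc _ = e.map id := Sym2.map_congr fun v hv => φR t v (hR e he v (mem_eseg_of_mem hv))
        _ = e := by simp
  refine ⟨hp 1 (by simp), ?_⟩
  rw [← himg 1]
  refine PolySys.ambientIsotopic_of_motion φ ?_ ?_ ?_ ?_
  · intro v
    simp only [φ]
    split_ifs <;> first | assumption | exact continuous_const
  · intro e he v hv
    simp only [φ]
    split_ifs with h1 h2 h3
    · exact h1.symm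
    · exact h2.symm
    · exact h3.symm
    · rfl
  · intro t ht; rw [himg]; exact hp t ht
  · intro t ht
    have hv : ∀ v, (∃ e ∈ tri (P 0) (Q 0) (T 0) ∪ R, v ∈ e) →
        v = P 0 ∨ v = Q 0 ∨ v = T 0 ∨ v 2 ≤ h := by
      rintro v ⟨e, he, hve⟩
      rcases Finset.mem_union.1 he with he | he
      · simp only [tri, Finset.mem_insert, Finset.mem_singleton] at he
        rcases he with rfl | rfl | rfl <;> rcases Sym2.mem_iff.1 hve with rfl | rfl <;> simp
      · exact Or.inr (Or.inr (Or.inr (hR e he v (mem_eseg_of_mem hve))))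
    obtain ⟨n1, n2, n3⟩ := (hn t ht).ne
    obtain ⟨a1, a2, a3⟩ := hab t ht
    have aux : ∀ {x y : E3}, h < x 2 → y 2 ≤ h → x ≠ y := by
      rintro x y hx hy rfl; linarith
    intro v hv1 w hw1 hvw
    rcases hv v hv1 with rfl | rfl | rfl | hv2 <;> rcases hv w hw1 with rfl | rfl | rfl | hw2 <;>
      first
      | rfl
      | (simp only [φP, φQ, φT] at hvw
         first
         | exact absurd hvw n1 | exact absurd hvw.symm n1 | exact absurd hvw n2
         | exact absurd hvw.symm n2 | exact absurd hvw n3 | exact absurd hvw.symm n3)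
      | (simp only [φP, φQ, φT, φR t _ hv2] at hvw
         first
         | exact absurd hvw.symm (aux a1 hv2)
         | exact absurd hvw.symm (aux a2 hv2) | exact absurd hvw.symm (aux a3 hv2))
      | (simp only [φP, φQ, φT, φR t _ hw2] at hvw
         first
         | exact absurd hvw (aux a1 hw2)
         | exact absurd hvw (aux a2 hw2) | exact absurd hvw (aux a3 hw2))
      | simpa only [φR t _ hv2, φR t _ hw2] using hvw

/-- The orientation of the projection of a triangle to the first and third coordinates. -/
def xzDet (P Q T : E3) : ℝ := (Q 0 - P 0) * (T 2 - P 2) - (T 0 - P 0) * (Q 2 - P 2)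

theorem nonCol_of_xzDet {P Q T : E3} (h : xzDet P Q T ≠ 0) : NonCol P Q T := by
  intro s t hst
  have h0 : s * (Q 0 - P 0) + t * (T 0 - P 0) = 0 := by
    simpa [coord_apply] using congrArg (coord 0) hst
  have h2 : s * (Q 2 - P 2) + t * (T 2 - P 2) = 0 := by
    simpa [coord_apply] using congrArg (coord 2) hst
  rw [xzDet] at h
  refine ⟨(mul_eq_zero.1 ?_).resolve_right h, (mul_eq_zero.1 ?_).resolve_right h⟩
  · linear_combination (T 2 - P 2) * h0 - (T 0 - P 0) * h2
  · linear_combination (Q 0 - P 0) * h2 - (Q 2 - P 2) * h0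

/-- Two nondegenerate triangles above the rest of a link may be moved into one another. -/
theorem tri_connect {R : Finset (Sym2 E3)} {P Q T P' Q' T' : E3} {h : ℝ}
    (hpoly : PolySys (tri P Q T ∪ R)) (hD : xzDet P Q T ≠ 0) (hD' : xzDet P' Q' T' ≠ 0)
    (hR : ∀ e ∈ R, ∀ x ∈ eseg e, x 2 ≤ h) (hP : h < P 2) (hQ : h < Q 2) (hT : h < T 2)
    (hP' : h < P' 2) (hQ' : h < Q' 2) (hT' : h < T' 2) :
    PolySys (tri P' Q' T' ∪ R) ∧
      AmbientIsotopic (body (tri P Q T ∪ R)) (body (tri P' Q' T' ∪ R)) := by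
  -- Exchanging two vertices leaves the triangle as a set of edges alone and changes the sign of the
  -- determinant, so both determinants may be taken positive.
  wlog hpos : 0 < xzDet P Q T generalizing P Q T
  · rw [tri_swap P Q T] at hpoly ⊢
    have hs : xzDet Q P T = - xzDet P Q T := by simp only [xzDet]; ring
    exact this hpoly (by rw [hs]; simpa using hD) hQ hP hT
      (by rw [hs]; exact neg_pos.2 (lt_of_le_of_ne (not_lt.1 hpos) hD))
  wlog hpos' : 0 < xzDet P' Q' T' generalizing P' Q' T'
  · rw [tri_swap P' Q' T']
    have hs : xzDet Q' P' T' = - xzDet P' Q' T' := by simp only [xzDet]; ring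
    exact this (by rw [hs]; simpa using hD') hQ' hP' hT'
      (by rw [hs]; exact neg_pos.2 (lt_of_le_of_ne (not_lt.1 hpos') hD'))
  -- `B` is the mixed term of the quadratic form `xzDet`. Its values at the three cyclic
  -- relabellings of the target triangle add up to zero, so for one of them it is nonnegative.
  let B : E3 → E3 → E3 → ℝ := fun A B C => xzDet (P + A) (Q + B) (T + C) - xzDet P Q T - xzDet A B C
  wlog hB : 0 ≤ B P' Q' T' generalizing P' Q' T'
  · have hrot : ∀ A B C, xzDet B C A = xzDet A B C := fun A B C => by simp only [xzDet]; ring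
    have hsum : B P' Q' T' + B Q' T' P' + B T' P' Q' = 0 := by
      simp only [B, xzDet, PiLp.add_apply]; ring
    by_cases h2 : 0 ≤ B Q' T' P'
    · rw [tri_rotate P' Q' T']
      exact this (by rwa [hrot]) hQ' hT' hP' (by rwa [hrot]) h2
    · rw [← tri_rotate T' P' Q']
      exact this (by rwa [← hrot]) hT' hP' hQ' (by rwa [← hrot]) (by linarith)
  have key := tri_motion (R := R) (P := fun t => (1 - t) • P + t • P')
    (Q := fun t => (1 - t) • Q + t • Q') (T := fun t => (1 - t) • T + t • T') (h := h)
    (by fun_prop) (by fun_prop) (by fun_prop) (by simpa using hpoly) ?_ hR ?_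
  · simpa using key
  · intro t ht
    apply nonCol_of_xzDet
    -- Along the straight motion the determinant is a combination of the two positive determinants
    -- and the nonnegative mixed term, so the triangle never degenerates.
    have e1 : xzDet ((1 - t) • P + t • P') ((1 - t) • Q + t • Q') ((1 - t) • T + t • T') =
        (1 - t) ^ 2 * xzDet P Q T + t * (1 - t) * B P' Q' T' + t ^ 2 * xzDet P' Q' T' := by
      simp only [B, xzDet, PiLp.add_apply, PiLp.smul_apply, smul_eq_mul]; ring
    rw [e1]
    have h1 : 0 ≤ 1 - t := by linarith [ht.2]
    have h2 : 0 ≤ t * (1 - t) * B P' Q' T' := mul_nonneg (mul_nonneg ht.1 h1) hB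
    rcases ht.1.eq_or_lt with h0 | h0
    · subst h0; simp; exact hpos.ne'
    · have : 0 < t ^ 2 * xzDet P' Q' T' := by positivity
      have : 0 ≤ (1 - t) ^ 2 * xzDet P Q T := by positivity
      linarith
  · intro t ht
    have aux : ∀ X Y : E3, h < X 2 → h < Y 2 → h < ((1 - t) • X + t • Y) 2 := by
      intro X Y hX hY
      simp only [PiLp.add_apply, PiLp.smul_apply, smul_eq_mul]
      nlinarith [ht.1, ht.2, mul_nonneg ht.1 (sub_nonneg.2 hY.le),
        mul_nonneg (sub_nonneg.2 ht.2) (sub_nonneg.2 hX.le)]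
    exact ⟨aux _ _ hP hP', aux _ _ hQ hQ', aux _ _ hT hT'⟩

end

end

section
open Set Topology Filter
open scoped Classical
noncomputable section
attribute [local instance] sym2DecEq

/-! ### Points on a line -/

section line
variable {E F : Type*} [AddCommGroup E] [Module ℝ E] [AddCommGroup F] [Module ℝ F]

/-- The point with parameter `t` on the line from `P` to `T`. -/
def ln (P T : E) (t : ℝ) : E := (1 - t) • P + t • T

theorem ln_zero (P T : E) : ln P T 0 = P := by simp [ln]

theorem ln_one (P T : E) : ln P T 1 = T := by simp [ln]

theorem ln_injective {P T : E} (h : P ≠ T) : Function.Injective (ln P T) := by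
  intro s t hst
  have h1 : (s - t) • (T - P) = 0 := by
    have : (s - t) • (T - P) = ln P T s - ln P T t := by simp only [ln]; module
    rw [this, hst, sub_self]
  rcases smul_eq_zero.1 h1 with h2 | h2
  · linarith
  · exact absurd (sub_eq_zero.1 h2).symm h

theorem ln_ln (P T : E) (μ ν t : ℝ) : ln (ln P T μ) (ln P T ν) t = ln P T ((1 - t) * μ + t * ν) := by
  simp only [ln]; module

theorem map_ln (f : E →ₗ[ℝ] F) (P T : E) (t : ℝ) : f (ln P T t) = ln (f P) (f T) t := by
  simp [ln]

theorem mem_eseg_iff {P T x : E} : x ∈ eseg s(P, T) ↔ ∃ t, 0 ≤ t ∧ t ≤ 1 ∧ x = ln P T t :=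
  mem_eseg_mk

theorem mem_eseg_ln {P T x : E} {μ ν : ℝ} (h : μ < ν) :
    x ∈ eseg s(ln P T μ, ln P T ν) ↔ ∃ t, μ ≤ t ∧ t ≤ ν ∧ x = ln P T t := by
  rw [mem_eseg_iff]
  constructor
  · rintro ⟨t, h0, h1, rfl⟩
    exact ⟨(1 - t) * μ + t * ν, by nlinarith, by nlinarith, ln_ln _ _ _ _ _⟩
  · rintro ⟨t, h0, h1, rfl⟩
    have h2 : 0 < ν - μ := by linarith
    refine ⟨(t - μ) / (ν - μ), div_nonneg (by linarith) h2.le, ?_, ?_⟩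
    · rw [div_le_one h2]; linarith
    · rw [ln_ln]; congr 1; field_simp; ring

theorem eseg_ln_subset {P T : E} {μ ν : ℝ} (h0 : 0 ≤ μ) (h : μ < ν) (h1 : ν ≤ 1) :
    eseg s(ln P T μ, ln P T ν) ⊆ eseg s(P, T) := by
  intro x hx
  obtain ⟨t, ht0, ht1, rfl⟩ := (mem_eseg_ln h).1 hx
  exact mem_eseg_iff.2 ⟨t, by linarith, by linarith, rfl⟩

end line

/-! ### Planar diagrams and their lifts -/

/-- The projection to the plane. -/
def proj : E3 →ₗ[ℝ] ℝ × ℝ := (coord 0).prod (coord 1)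

theorem proj_apply (x : E3) : proj x = (x 0, x 1) := rfl

/-- The point of height `z q` over the point `q` of the plane. -/
def lift (z : ℝ × ℝ → ℝ) (q : ℝ × ℝ) : E3 := !₂[q.1, q.2, z q]

theorem proj_lift (z : ℝ × ℝ → ℝ) (q : ℝ × ℝ) : proj (lift z q) = q := by
  simp [proj_apply, lift]

theorem lift_two (z : ℝ × ℝ → ℝ) (q : ℝ × ℝ) : lift z q 2 = z q := by
  simp [lift]

theorem lift_injective (z : ℝ × ℝ → ℝ) : Function.Injective (lift z) :=
  Function.LeftInverse.injective (proj_lift z)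

theorem E3.ext_proj {x y : E3} (h : proj x = proj y) (h2 : x 2 = y 2) : x = y := by
  simp only [proj_apply, Prod.mk.injEq] at h
  ext i
  fin_cases i
  · exact h.1
  · exact h.2
  · exact h2

theorem lift_congr {z z' : ℝ × ℝ → ℝ} {q : ℝ × ℝ} (h : z q = z' q) : lift z q = lift z' q := by
  simp [lift, h]

/-- The edges of the lift of a planar diagram with heights `z`. -/
def sys (z : ℝ × ℝ → ℝ) (P : Finset (Sym2 (ℝ × ℝ))) : Finset (Sym2 E3) :=
  P.image (Sym2.map (lift z))

theorem eseg_map_proj (e : Sym2 E3) : eseg (e.map proj) = proj '' eseg e :=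
  eseg_map proj.toAffineMap e

theorem map_proj_map_lift (z : ℝ × ℝ → ℝ) (e : Sym2 (ℝ × ℝ)) : (e.map (lift z)).map proj = e := by
  rw [Sym2.map_map]
  calc _ = e.map id := Sym2.map_congr fun v _ => proj_lift z v
    _ = e := by simp

theorem proj_mem_eseg {z : ℝ × ℝ → ℝ} {e : Sym2 (ℝ × ℝ)} {x : E3}
    (hx : x ∈ eseg (e.map (lift z))) : proj x ∈ eseg e := by
  rw [← map_proj_map_lift z e, eseg_map_proj]
  exact ⟨x, hx, rfl⟩

/-- The edge `e` runs over the edge `e'`. -/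
def Over (z : ℝ × ℝ → ℝ) (e e' : Sym2 (ℝ × ℝ)) : Prop :=
  ∀ x ∈ eseg (e.map (lift z)), ∀ y ∈ eseg (e'.map (lift z)), proj x = proj y → y 2 < x 2

/-- Two edges that meet only in common vertices. -/
def Flat {E : Type*} [AddCommGroup E] [Module ℝ E] (e e' : Sym2 E) : Prop :=
  ∀ q ∈ eseg e, q ∈ eseg e' → q ∈ e ∧ q ∈ e'

theorem Flat.symm {E : Type*} [AddCommGroup E] [Module ℝ E] {e e' : Sym2 E} (h : Flat e e') :
    Flat e' e := fun q hq hq' => (h q hq' hq).symm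

theorem lift_ln {z : ℝ × ℝ → ℝ} {a b : ℝ × ℝ} {x : E3} (hab : a ≠ b) {t : ℝ}
    (hx : x ∈ eseg (Sym2.map (lift z) s(a, b))) (ht : proj x = ln a b t) :
    x = ln (lift z a) (lift z b) t := by
  rw [Sym2.map_mk, mem_eseg_iff] at hx
  obtain ⟨s, -, -, rfl⟩ := hx
  rw [map_ln, proj_lift, proj_lift] at ht
  rw [ln_injective hab ht]

theorem lift_of_proj_mem {z : ℝ × ℝ → ℝ} {e : Sym2 (ℝ × ℝ)} (he : ¬ e.IsDiag) {x : E3}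
    (hx : x ∈ eseg (e.map (lift z))) (hv : proj x ∈ e) : lift z (proj x) = x := by
  obtain ⟨w, hw⟩ := Sym2.mem_iff_exists.1 hv
  rw [hw] at hx he
  have := lift_ln (z := z) (by simpa using he) hx (t := 0) (by rw [ln_zero])
  rw [ln_zero] at this
  exact this.symm

/-- A common point of two lifted edges lies over a common point of their projections. There the
edges have a common vertex in the flat case and different heights otherwise. -/
theorem emb_lift {P : Finset (Sym2 (ℝ × ℝ))} {z : ℝ × ℝ → ℝ} (hnd : ∀ e ∈ P, ¬ e.IsDiag)
    (h : ∀ e ∈ P, ∀ e' ∈ P, e ≠ e' → Flat e e' ∨ Over z e e' ∨ Over z e' e) : Emb P (lift z) := by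
  constructor
  · intro e he hd
    apply hnd e he
    rw [← map_proj_map_lift z e]
    exact hd.map
  · intro e he e' he' hne x hx hx'
    rcases h e he e' he' hne with h1 | h1 | h1
    · have h2 := h1 (proj x) (proj_mem_eseg hx) (proj_mem_eseg hx')
      exact ⟨proj x, h2.1, h2.2, lift_of_proj_mem (hnd e he) hx h2.1⟩
    · exact absurd (h1 x hx x hx' rfl) (lt_irrefl _)
    · exact absurd (h1 x hx' x hx rfl) (lt_irrefl _)

theorem lift_interp (z z' : ℝ × ℝ → ℝ) (t : ℝ) (q : ℝ × ℝ) :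
    lift (fun q => (1 - t) * z q + t * z' q) q = ln (lift z q) (lift z' q) t := by
  apply E3.ext_proj
  · rw [proj_lift, map_ln, proj_lift, proj_lift]; simp [ln]; module
  · rw [lift_two]; simp [ln, lift]

/-- Over a fixed point of the plane the heights of both edges are interpolated linearly, so the
inequality between them is preserved. -/
theorem Over.interp {z z' : ℝ × ℝ → ℝ} {e e' : Sym2 (ℝ × ℝ)} (h : Over z e e') (h' : Over z' e e')
    {t : ℝ} (ht : t ∈ Icc (0 : ℝ) 1) : Over (fun q => (1 - t) * z q + t * z' q) e e' := by
  have aux : ∀ e : Sym2 (ℝ × ℝ), ∀ x ∈ eseg (e.map (lift fun q => (1 - t) * z q + t * z' q)),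
      ∃ y ∈ eseg (e.map (lift z)), ∃ y' ∈ eseg (e.map (lift z')), proj y = proj x ∧
        proj y' = proj x ∧ x 2 = (1 - t) * y 2 + t * y' 2 := by
    intro e x hx
    induction e with | _ a b =>
    simp only [Sym2.map_mk, mem_eseg_iff] at hx ⊢
    obtain ⟨s, h0, h1, rfl⟩ := hx
    refine ⟨_, ⟨s, h0, h1, rfl⟩, _, ⟨s, h0, h1, rfl⟩, ?_, ?_, ?_⟩
    · simp only [map_ln, proj_lift]
    · simp only [map_ln, proj_lift]
    · simp only [ln, PiLp.add_apply, PiLp.smul_apply, lift_two, smul_eq_mul]; ring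
  intro x hx y hy hxy
  obtain ⟨x1, hx1, x2, hx2, p1, p2, hx3⟩ := aux e x hx
  obtain ⟨y1, hy1, y2, hy2, q1, q2, hy3⟩ := aux e' y hy
  have h1 := h x1 hx1 y1 hy1 (by rw [p1, q1, hxy])
  have h2 := h' x2 hx2 y2 hy2 (by rw [p2, q2, hxy])
  rw [hx3, hy3]
  rcases ht.1.eq_or_lt with h0 | h0
  · subst h0; linarith
  · have := mul_lt_mul_of_pos_left h2 h0
    have := mul_le_mul_of_nonneg_left h1.le (sub_nonneg.2 ht.2)
    linarith

/-- Changing the heights of a diagram without changing any crossing is an ambient isotopy. -/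
theorem height_motion {P : Finset (Sym2 (ℝ × ℝ))} {z z' : ℝ × ℝ → ℝ} (hnd : ∀ e ∈ P, ¬ e.IsDiag)
    (h : ∀ e ∈ P, ∀ e' ∈ P, e ≠ e' → Flat e e' ∨ (Over z e e' ∧ Over z' e e') ∨
      (Over z e' e ∧ Over z' e' e)) :
    AmbientIsotopic (body (sys z P)) (body (sys z' P)) := by
  have := ambientIsotopic_of_motion P
    (fun t => lift fun q => (1 - t) * z q + t * z' q) ?_ ?_
  · simpa [sys, body_image] using this
  · intro v
    simp only [lift_interp, ln]
    fun_prop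
  · intro t ht
    refine emb_lift hnd fun e he e' he' hne => ?_
    rcases h e he e' he' hne with h1 | h1 | h1
    · exact Or.inl h1
    · exact Or.inr (Or.inl (h1.1.interp h1.2 ht))
    · exact Or.inr (Or.inr (h1.1.interp h1.2 ht))

theorem Over.mono {z z' : ℝ × ℝ → ℝ} {e e' f f' : Sym2 (ℝ × ℝ)} (h : Over z e e')
    (h1 : eseg (f.map (lift z')) ⊆ eseg (e.map (lift z)))
    (h2 : f'.map (lift z') = e'.map (lift z)) : Over z' f f' := by
  intro x hx y hy hxy
  rw [h2] at hy
  exact h x (h1 hx) y hy hxy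

theorem Over.mono' {z z' : ℝ × ℝ → ℝ} {e e' f f' : Sym2 (ℝ × ℝ)} (h : Over z e e')
    (h1 : f.map (lift z') = e.map (lift z))
    (h2 : eseg (f'.map (lift z')) ⊆ eseg (e'.map (lift z))) : Over z' f f' := by
  intro x hx y hy hxy
  rw [h1] at hx
  exact h x hx y (h2 hy) hxy

theorem deg_split {V : Type*} {R : Finset (Sym2 V)} {A B w : V} (hAB : s(A, B) ∉ R)
    (hd : ∀ v, deg (insert s(A, B) R) v = 0 ∨ deg (insert s(A, B) R) v = 2) (hw : ∀ e ∈ R, w ∉ e)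
    (hA : w ≠ A) (hB : w ≠ B) (hne : A ≠ B) (v : V) :
    deg (insert s(A, w) (insert s(w, B) R)) v = 0 ∨
      deg (insert s(A, w) (insert s(w, B) R)) v = 2 := by
  have h1 : s(w, B) ∉ R := fun hh => hw _ hh (by simp)
  have h2 : s(A, w) ∉ insert s(w, B) R := by
    simp only [Finset.mem_insert, not_or]
    refine ⟨?_, fun hh => hw _ hh (by simp)⟩
    intro hh
    have : A ∈ s(w, B) := hh ▸ (by simp)
    rcases Sym2.mem_iff.1 this with h | h
    · exact hA h.symm
    · exact hne h
  have h3 := hd v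
  rw [deg_insert hAB, mult_mk] at h3
  rw [deg_insert h2, deg_insert h1, mult_mk, mult_mk]
  by_cases hv : v = w
  · subst hv
    have : deg R v = 0 := deg_eq_zero.2 hw
    right; simp [hA, hB, this]
  · simp only [hv, if_false]
    omega

end

end

section
open Set Topology Filter
open scoped Classical
noncomputable section
attribute [local instance] sym2DecEq

/-! ### Raising a strand at a crossing -/

/-- The position of two edges relative to each other is the same for the heights `z` and `z'`. -/
def SameSide (z z' : ℝ × ℝ → ℝ) (e e' : Sym2 (ℝ × ℝ)) : Prop :=
  Flat e e' ∨ (Over z e e' ∧ Over z' e e') ∨ (Over z e' e ∧ Over z' e' e)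

theorem SameSide.symm {z z' : ℝ × ℝ → ℝ} {e e' : Sym2 (ℝ × ℝ)} (h : SameSide z z' e e') :
    SameSide z z' e' e := by
  rcases h with h | h | h
  · exact Or.inl h.symm
  · exact Or.inr (Or.inr h)
  · exact Or.inr (Or.inl h)

theorem SameSide.right {z z' : ℝ × ℝ → ℝ} {e e' : Sym2 (ℝ × ℝ)} (h : SameSide z z' e e') :
    Flat e e' ∨ Over z' e e' ∨ Over z' e' e := by
  rcases h with h | h | h
  · exact Or.inl h
  · exact Or.inr (Or.inl h.2)
  · exact Or.inr (Or.inr h.2)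

theorem Over.congr {z z' : ℝ × ℝ → ℝ} {e e' : Sym2 (ℝ × ℝ)} (h : Over z e e')
    (h1 : e.map (lift z') = e.map (lift z)) (h2 : e'.map (lift z') = e'.map (lift z)) :
    Over z' e e' := by
  rw [Over, h1, h2]
  exact h

theorem flat_ln {E : Type*} [AddCommGroup E] [Module ℝ E] {A B : E} (hAB : A ≠ B)
    {μ ν μ' ν' : ℝ} (h1 : μ < ν) (h2 : ν ≤ μ') (h3 : μ' < ν') :
    Flat s(ln A B μ, ln A B ν) s(ln A B μ', ln A B ν') := by
  intro q hq hq'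
  obtain ⟨t, ht1, ht2, rfl⟩ := (mem_eseg_ln h1).1 hq
  obtain ⟨t', ht1', ht2', htt⟩ := (mem_eseg_ln h3).1 hq'
  obtain rfl := ln_injective hAB htt
  have e1 : t = ν := by linarith
  have e2 : t = μ' := by linarith
  exact ⟨by rw [e1]; simp, by rw [e2]; simp⟩

theorem eseg_split {E : Type*} [AddCommGroup E] [Module ℝ E] (P T : E) {μ₁ μ₂ μ₃ : ℝ}
    (h0 : 0 < μ₁) (h1 : μ₁ < μ₂) (h2 : μ₂ < μ₃) (h3 : μ₃ < 1) (Y : Set E) :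
    eseg s(ln P T μ₂, ln P T μ₃) ∪ (eseg s(ln P T μ₃, T) ∪ (eseg s(ln P T μ₁, ln P T μ₂) ∪
      (eseg s(P, ln P T μ₁) ∪ Y))) = eseg s(P, T) ∪ Y := by
  have e1 : eseg s(ln P T μ₃, T) = eseg s(ln P T μ₃, ln P T 1) := by rw [ln_one]
  have e0 : eseg s(P, ln P T μ₁) = eseg s(ln P T 0, ln P T μ₁) := by rw [ln_zero]
  ext x
  simp only [e0, e1, mem_union, mem_eseg_ln h1, mem_eseg_ln h2, mem_eseg_ln h3, mem_eseg_ln h0,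
    mem_eseg_iff (P := P) (T := T)]
  constructor
  · rintro (⟨t, _, _, rfl⟩ | ⟨t, _, _, rfl⟩ | ⟨t, _, _, rfl⟩ | ⟨t, _, _, rfl⟩ | h)
    · exact Or.inl ⟨t, by linarith, by linarith, rfl⟩
    · exact Or.inl ⟨t, by linarith, by linarith, rfl⟩
    · exact Or.inl ⟨t, by linarith, by linarith, rfl⟩
    · exact Or.inl ⟨t, by linarith, by linarith, rfl⟩
    · exact Or.inr h
  · rintro (⟨t, ht0, ht1, rfl⟩ | h)
    · rcases le_total t μ₁ with ha | ha
      · exact Or.inr (Or.inr (Or.inr (Or.inl ⟨t, ht0, ha, rfl⟩)))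
      rcases le_total t μ₂ with hb | hb
      · exact Or.inr (Or.inr (Or.inl ⟨t, ha, hb, rfl⟩))
      rcases le_total t μ₃ with hc | hc
      · exact Or.inl ⟨t, hb, hc, rfl⟩
      · exact Or.inr (Or.inl ⟨t, hc, ht1, rfl⟩)
    · exact Or.inr (Or.inr (Or.inr (Or.inr h)))

/-- The vertical unit vector. -/
def ez : E3 := !₂[0, 0, 1]

/-- Heights for a diagram in which the edge `A B` is subdivided at three points, the middle one of
which is raised by `η`. -/
def tentHeight (z : ℝ × ℝ → ℝ) (A B : ℝ × ℝ) (μ₁ μ₂ μ₃ η : ℝ) (q : ℝ × ℝ) : ℝ :=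
  if q = ln A B μ₁ then ln (z A) (z B) μ₁ else if q = ln A B μ₂ then ln (z A) (z B) μ₂ + η else
    if q = ln A B μ₃ then ln (z A) (z B) μ₃ else z q

theorem lift_ln_eq {z z' : ℝ × ℝ → ℝ} {A B : ℝ × ℝ} {μ η : ℝ}
    (h : z' (ln A B μ) = ln (z A) (z B) μ + η) :
    lift z' (ln A B μ) = ln (lift z A) (lift z B) μ + η • ez := by
  apply E3.ext_proj
  · rw [proj_lift, map_add, map_ln, proj_lift, proj_lift]
    have : proj (η • ez) = 0 := by simp [proj_apply, ez]
    rw [this, add_zero]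
  · rw [lift_two, h]; simp [ln, lift, ez]

section tent
variable {R : Finset (Sym2 (ℝ × ℝ))} {A B C D : ℝ × ℝ} {zp z0 : ℝ × ℝ → ℝ} {σ ρ s η : ℝ}

-- For the heights `z0` the edges `A B` and `C D` touch at the crossing, where the parameters are
-- `σ` and `ρ`. A crossing with `A B` on top is isotopic to the singular position `z0` with a short
-- piece of `A B` around the crossing raised to a tent of height `η`. Exchanging the roles of the
-- edges describes the opposite crossing over the same heights `z0`, so that the two crossings
-- differ only near one point.
set_option maxHeartbeats 600000 in
theorem tent_isotopy (hAB : s(A, B) ∉ R) (hCD : s(C, D) ∈ R)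
    (hdeg : ∀ v, deg (insert s(A, B) R) v = 0 ∨ deg (insert s(A, B) R) v = 2)
    (hnd : ∀ e ∈ insert s(A, B) R, ¬ e.IsDiag)
    (hvert : ∀ e ∈ R, ∀ t, 0 < t → t < 1 → ln A B t ∉ e)
    (hs : 0 < s) (hsσ : s < σ) (hσ : σ + s < 1) (hX : ln A B σ = ln C D ρ)
    (hmeet : ∀ q ∈ eseg s(A, B), q ∈ eseg s(C, D) → q = ln A B σ)
    (hfree : ∀ e ∈ R, e ≠ s(C, D) → ∀ t, σ - s ≤ t → t ≤ σ + s → ln A B t ∉ eseg e)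
    (hρ0 : 0 ≤ ρ) (hρ1 : ρ ≤ 1)
    (hover : Over zp s(A, B) s(C, D)) (h0 : ln (z0 A) (z0 B) σ = ln (z0 C) (z0 D) ρ) (hη : 0 < η)
    (hAe : ∀ e ∈ R, e ≠ s(C, D) → SameSide zp z0 s(A, B) e)
    (hRR : ∀ e ∈ R, ∀ e' ∈ R, e ≠ e' → SameSide zp z0 e e') :
    PolySys (insert s(ln (lift z0 A) (lift z0 B) σ + η • ez, ln (lift z0 A) (lift z0 B) (σ + s))
        (insert s(ln (lift z0 A) (lift z0 B) (σ + s), lift z0 B)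
        (insert s(ln (lift z0 A) (lift z0 B) (σ - s), ln (lift z0 A) (lift z0 B) σ + η • ez)
        (insert s(lift z0 A, ln (lift z0 A) (lift z0 B) (σ - s)) (sys z0 R))))) ∧
      AmbientIsotopic (body (sys zp (insert s(A, B) R)))
        (body (insert s(ln (lift z0 A) (lift z0 B) σ + η • ez, ln (lift z0 A) (lift z0 B) (σ + s))
        (insert s(ln (lift z0 A) (lift z0 B) (σ + s), lift z0 B)
        (insert s(ln (lift z0 A) (lift z0 B) (σ - s), ln (lift z0 A) (lift z0 B) σ + η • ez)
        (insert s(lift z0 A, ln (lift z0 A) (lift z0 B) (σ - s)) (sys z0 R)))))) := by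
  have hne : A ≠ B := by simpa using hnd _ (Finset.mem_insert_self _ _)
  have hCDne : C ≠ D := by simpa using hnd _ (Finset.mem_insert_of_mem hCD)
  have inj := ln_injective hne
  set a := ln A B (σ - s) with ha
  set X := ln A B σ with hXdef
  set b := ln A B (σ + s) with hb
  have lnA : A = ln A B 0 := (ln_zero A B).symm
  have lnB : B = ln A B 1 := (ln_one A B).symm
  have aX : a ≠ X := fun h => by have := inj h; linarith
  have ab : a ≠ b := fun h => by have := inj h; linarith
  have Xb : X ≠ b := fun h => by have := inj h; linarith
  have Aa : a ≠ A := fun h => by rw [lnA] at h; have := inj h; linarith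
  have AX : X ≠ A := fun h => by rw [lnA] at h; have := inj h; linarith
  have Ab : b ≠ A := fun h => by rw [lnA] at h; have := inj h; linarith
  have Ba : a ≠ B := fun h => by
    have := inj (show ln A B (σ - s) = ln A B 1 by rw [ln_one]; exact h); linarith
  have BX : X ≠ B := fun h => by
    have := inj (show ln A B σ = ln A B 1 by rw [ln_one]; exact h); linarith
  have Bb : b ≠ B := fun h => by
    have := inj (show ln A B (σ + s) = ln A B 1 by rw [ln_one]; exact h); linarith
  have Ra : ∀ e ∈ R, a ∉ e := fun e he => hvert e he _ (by linarith) (by linarith)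
  have RX : ∀ e ∈ R, X ∉ e := fun e he => hvert e he _ (by linarith) (by linarith)
  have Rb : ∀ e ∈ R, b ∉ e := fun e he => hvert e he _ (by linarith) (by linarith)
  set P1 : Finset (Sym2 (ℝ × ℝ)) :=
    insert s(X, b) (insert s(b, B) (insert s(a, X) (insert s(A, a) R))) with hP1
  -- heights at the vertices
  let H : (ℝ × ℝ → ℝ) → ℝ → ℝ × ℝ → ℝ := fun z η => tentHeight z A B (σ - s) σ (σ + s) η
  have Ha : ∀ z η, lift (H z η) a = ln (lift z A) (lift z B) (σ - s) := by
    intro z η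
    have := lift_ln_eq (z := z) (z' := H z η) (A := A) (B := B) (μ := σ - s) (η := 0)
      (by simp [H, tentHeight])
    simpa using this
  have HX : ∀ z η, lift (H z η) X = ln (lift z A) (lift z B) σ + η • ez := by
    intro z η
    refine lift_ln_eq (z := z) (z' := H z η) (A := A) (B := B) (μ := σ) (η := η) ?_
    change (if X = a then _ else if X = X then _ else _) = _
    rw [if_neg aX.symm, if_pos rfl]
  have Hb : ∀ z η, lift (H z η) b = ln (lift z A) (lift z B) (σ + s) := by
    intro z η
    have := lift_ln_eq (z := z) (z' := H z η) (A := A) (B := B) (μ := σ + s) (η := 0) (by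
      change (if b = a then _ else if b = X then _ else if b = b then _ else _) = _
      rw [if_neg ab.symm, if_neg Xb.symm, if_pos rfl, add_zero])
    simpa using this
  have Hv : ∀ z η v, v ≠ a → v ≠ X → v ≠ b → lift (H z η) v = lift z v := by
    intro z η v h1 h2 h3
    apply lift_congr
    change (if v = a then _ else if v = X then _ else if v = b then _ else _) = _
    rw [if_neg h1, if_neg h2, if_neg h3]
  have HA : ∀ z η, lift (H z η) A = lift z A := fun z η => Hv z η A Aa.symm AX.symm Ab.symm
  have HB : ∀ z η, lift (H z η) B = lift z B := fun z η => Hv z η B Ba.symm BX.symm Bb.symm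
  have HR : ∀ z η, ∀ e ∈ R, e.map (lift (H z η)) = e.map (lift z) := by
    intro z η e he
    refine Sym2.map_congr fun v hv => Hv z η v ?_ ?_ ?_
    · rintro rfl; exact Ra e he hv
    · rintro rfl; exact RX e he hv
    · rintro rfl; exact Rb e he hv
  have hsys : ∀ z η, sys (H z η) P1 =
      insert s(ln (lift z A) (lift z B) σ + η • ez, ln (lift z A) (lift z B) (σ + s))
        (insert s(ln (lift z A) (lift z B) (σ + s), lift z B)
        (insert s(ln (lift z A) (lift z B) (σ - s), ln (lift z A) (lift z B) σ + η • ez)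
        (insert s(lift z A, ln (lift z A) (lift z B) (σ - s)) (sys z R)))) := by
    intro z η
    rw [sys, hP1, Finset.image_insert, Finset.image_insert, Finset.image_insert,
      Finset.image_insert, Finset.image_congr (fun e he => HR z η e he)]
    simp only [Sym2.map_mk, Ha, HX, Hb, HA, HB]
    rfl
  -- outer pieces
  have outer : ∀ μ ν, 0 ≤ μ → μ < ν → ν ≤ 1 → (ν < σ ∨ σ < μ) →
      (∀ z η, Sym2.map (lift (H z η)) s(ln A B μ, ln A B ν) =
        s(ln (lift z A) (lift z B) μ, ln (lift z A) (lift z B) ν)) →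
      ∀ e ∈ R, SameSide (H zp 0) (H z0 η) s(ln A B μ, ln A B ν) e := by
    intro μ ν h1 h2 h3 h4 hm e he
    have hnX : ∀ q ∈ eseg s(ln A B μ, ln A B ν), q ≠ X := by
      intro q hq
      obtain ⟨t, ht1, ht2, rfl⟩ := (mem_eseg_ln h2).1 hq
      intro h
      have := inj h
      rcases h4 with h4 | h4 <;> linarith
    have hsub : ∀ z η, eseg (Sym2.map (lift (H z η)) s(ln A B μ, ln A B ν)) ⊆
        eseg (Sym2.map (lift z) s(A, B)) := by
      intro z η
      rw [hm]
      exact eseg_ln_subset h1 h2 h3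
    by_cases heC : e = s(C, D)
    · subst heC
      left
      intro q hq hq'
      exact absurd (hmeet q (eseg_ln_subset h1 h2 h3 hq) hq') (hnX q hq)
    · rcases hAe e he heC with h | h | h
      · left
        intro q hq hq'
        have h5 := h q (eseg_ln_subset h1 h2 h3 hq) hq'
        refine ⟨?_, h5.2⟩
        obtain ⟨t, ht1, ht2, rfl⟩ := (mem_eseg_ln h2).1 hq
        -- The points `A` and `B` can lie in a piece with parameters in `[0, 1]` only as its ends.
        rcases Sym2.mem_iff.1 h5.1 with h6 | h6
        · have h7 := inj (h6.trans (ln_zero A B).symm)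
          have : t = μ := by linarith
          rw [this]; simp
        · have h7 := inj (h6.trans (ln_one A B).symm)
          have : t = ν := by linarith
          rw [this]; simp
      · right; left
        exact ⟨h.1.mono (hsub _ _) (HR _ _ e he), h.2.mono (hsub _ _) (HR _ _ e he)⟩
      · right; right
        exact ⟨h.1.mono' (HR _ _ e he) (hsub _ _), h.2.mono' (HR _ _ e he) (hsub _ _)⟩
  -- inner pieces
  have overX : ∀ z η, ln (lift z C) (lift z D) ρ 2 < (ln (lift z A) (lift z B) σ + η • ez) 2 →
      ∀ w, w ≠ X → (∀ q ∈ eseg s(X, w), ∃ t, σ - s ≤ t ∧ t ≤ σ + s ∧ q = ln A B t) →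
      Over (H z η) s(X, w) s(C, D) := by
    intro z η hlt w hw hq x hx y hy hxy
    have h1 := proj_mem_eseg hx
    have h2 := proj_mem_eseg hy
    obtain ⟨t, ht1, ht2, hpt⟩ := hq _ h1
    -- The crossing is the only point that the piece and `C D` have in common in the plane, so a
    -- single comparison of heights decides.
    have h3 : proj x = X := hmeet _ (mem_eseg_iff.2 ⟨t, by linarith, by linarith, hpt⟩) (hxy ▸ h2)
    have h4 := lift_of_proj_mem (by simpa using hw.symm) hx (by rw [h3]; simp)
    rw [h3, HX] at h4
    rw [HR _ _ _ hCD] at hy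
    have h5 := lift_ln hCDne hy (t := ρ) (by rw [← hxy, h3, hX])
    rw [← h4, h5]
    exact hlt
  have hzp : ln (lift zp C) (lift zp D) ρ 2 <
      (ln (lift zp A) (lift zp B) σ + (0 : ℝ) • ez) 2 := by
    rw [zero_smul, add_zero]
    refine hover _ (mem_eseg_iff.2 ⟨σ, by linarith, by linarith, rfl⟩) _
      (mem_eseg_iff.2 ⟨ρ, hρ0, hρ1, rfl⟩) ?_
    simp only [map_ln, proj_lift]
    exact hX
  have hz0 : ln (lift z0 C) (lift z0 D) ρ 2 <
      (ln (lift z0 A) (lift z0 B) σ + η • ez) 2 := by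
    simp only [ln, smul_eq_mul] at h0
    simp [ln, lift, ez]
    linarith
  have inner : ∀ w, w ≠ X → (∀ q ∈ eseg s(X, w), ∃ t, σ - s ≤ t ∧ t ≤ σ + s ∧ q = ln A B t) →
      ∀ e ∈ R, SameSide (H zp 0) (H z0 η) s(X, w) e := by
    intro w hw hq e he
    by_cases heC : e = s(C, D)
    · subst heC
      right; left
      exact ⟨overX _ _ hzp w hw hq, overX _ _ hz0 w hw hq⟩
    · left
      intro q hq1 hq2
      obtain ⟨t, ht1, ht2, rfl⟩ := hq q hq1
      exact absurd hq2 (hfree e he heC t ht1 ht2)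
  have hnew : ∀ e ∈ ({s(X, b), s(b, B), s(a, X), s(A, a)} : Finset (Sym2 (ℝ × ℝ))),
      (¬ e.IsDiag) ∧ ∀ e' ∈ R, SameSide (H zp 0) (H z0 η) e e' := by
    intro e he
    simp only [Finset.mem_insert, Finset.mem_singleton] at he
    rcases he with rfl | rfl | rfl | rfl
    · refine ⟨by simpa using Xb, inner b Xb.symm ?_⟩
      intro q hq
      obtain ⟨t, h1, h2, rfl⟩ := (mem_eseg_ln (by linarith)).1 hq
      exact ⟨t, by linarith, h2, rfl⟩
    · refine ⟨by simpa using Bb, ?_⟩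
      have := outer (σ + s) 1 (by linarith) hσ le_rfl (Or.inr (by linarith)) (by
        intro z η
        rw [ln_one, ln_one, Sym2.map_mk, ← hb, Hb, HB])
      rwa [ln_one] at this
    · refine ⟨by simpa using aX, ?_⟩
      rw [Sym2.eq_swap]
      refine inner a aX ?_
      intro q hq
      rw [Sym2.eq_swap] at hq
      obtain ⟨t, h1, h2, rfl⟩ := (mem_eseg_ln (by linarith)).1 hq
      exact ⟨t, h1, by linarith, rfl⟩
    · refine ⟨by simpa using Aa.symm, ?_⟩
      have := outer 0 (σ - s) le_rfl (by linarith) (by linarith) (Or.inl (by linarith)) (by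
        intro z η
        rw [ln_zero, ln_zero, Sym2.map_mk, ← ha, Ha, HA])
      rwa [ln_zero] at this
  have hflat : ∀ e ∈ ({s(X, b), s(b, B), s(a, X), s(A, a)} : Finset (Sym2 (ℝ × ℝ))),
      ∀ e' ∈ ({s(X, b), s(b, B), s(a, X), s(A, a)} : Finset (Sym2 (ℝ × ℝ))), e ≠ e' →
      Flat e e' := by
    have f1 : Flat s(A, a) s(a, X) := by
      have := flat_ln hne (μ := 0) (ν := σ - s) (μ' := σ - s) (ν' := σ) (by linarith) le_rfl
        (by linarith)
      rwa [ln_zero] at this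
    have f2 : Flat s(A, a) s(X, b) := by
      have := flat_ln hne (μ := 0) (ν := σ - s) (μ' := σ) (ν' := σ + s) (by linarith) (by linarith)
        (by linarith)
      rwa [ln_zero] at this
    have f3 : Flat s(A, a) s(b, B) := by
      have := flat_ln hne (μ := 0) (ν := σ - s) (μ' := σ + s) (ν' := 1) (by linarith) (by linarith)
        (by linarith)
      rwa [ln_zero, ln_one] at this
    have f4 : Flat s(a, X) s(X, b) := flat_ln hne (by linarith) le_rfl (by linarith)
    have f5 : Flat s(a, X) s(b, B) := by
      have := flat_ln hne (μ := σ - s) (ν := σ) (μ' := σ + s) (ν' := 1) (by linarith) (by linarith)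
        (by linarith)
      rwa [ln_one] at this
    have f6 : Flat s(X, b) s(b, B) := by
      have := flat_ln hne (μ := σ) (ν := σ + s) (μ' := σ + s) (ν' := 1) (by linarith) (by linarith)
        (by linarith)
      rwa [ln_one] at this
    intro e he e' he' hee
    simp only [Finset.mem_insert, Finset.mem_singleton] at he he'
    rcases he with rfl | rfl | rfl | rfl <;> rcases he' with rfl | rfl | rfl | rfl <;>
      first
      | exact absurd rfl hee
      | assumption
      | (apply Flat.symm; assumption)
  have hmem : ∀ e ∈ P1, e ∈ ({s(X, b), s(b, B), s(a, X), s(A, a)} : Finset (Sym2 (ℝ × ℝ))) ∨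
      e ∈ R := by
    intro e he
    simp only [hP1, Finset.mem_insert, Finset.mem_singleton] at he ⊢
    tauto
  have hnd1 : ∀ e ∈ P1, ¬ e.IsDiag := by
    intro e he
    rcases hmem e he with he | he
    · exact (hnew e he).1
    · exact hnd e (Finset.mem_insert_of_mem he)
  have hside : ∀ e ∈ P1, ∀ e' ∈ P1, e ≠ e' → SameSide (H zp 0) (H z0 η) e e' := by
    intro e he e' he' hee
    rcases hmem e he with he | he <;> rcases hmem e' he' with he' | he'
    · exact Or.inl (hflat e he e' he' hee)
    · exact (hnew e he).2 e' he'
    · exact ((hnew e' he').2 e he).symm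
    · rcases hRR e he e' he' hee with h | h | h
      · exact Or.inl h
      · exact Or.inr (Or.inl ⟨h.1.congr (HR _ _ e he) (HR _ _ e' he'),
          h.2.congr (HR _ _ e he) (HR _ _ e' he')⟩)
      · exact Or.inr (Or.inr ⟨h.1.congr (HR _ _ e' he') (HR _ _ e he),
          h.2.congr (HR _ _ e' he') (HR _ _ e he)⟩)
  have hdeg1 : ∀ v, deg P1 v = 0 ∨ deg P1 v = 2 := by
    have d1 := deg_split (w := a) hAB hdeg Ra Aa Ba hne
    rw [Finset.insert_comm] at d1
    have d2 := deg_split (w := X) (A := a) (B := B) (R := insert s(A, a) R) ?_ d1 ?_ aX.symm BX Ba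
    · rw [Finset.insert_comm] at d2
      refine deg_split (w := b) (A := X) (B := B) ?_ d2 ?_ Xb.symm Bb BX
      · simp only [Finset.mem_insert, not_or]
        refine ⟨?_, ?_, fun h => RX _ h (by simp)⟩
        · simp [aX.symm, Ba.symm]
        · simp [AX, aX.symm]
      · intro e he
        simp only [Finset.mem_insert] at he
        rcases he with rfl | rfl | he
        · simp [ab.symm, Xb.symm]
        · simp [Ab, ab.symm]
        · exact Rb e he
    · simp only [Finset.mem_insert, not_or]
      exact ⟨by simp [Aa, hne.symm], fun h => Ra _ h (by simp)⟩
    · intro e he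
      rcases Finset.mem_insert.1 he with rfl | he
      · simp [AX, aX.symm]
      · exact RX e he
  rw [← hsys]
  constructor
  · exact (emb_lift hnd1 fun e he e' he' hee => (hside e he e' he' hee).right).poly_image
      ⟨_, Finset.mem_insert_self _ _⟩ hdeg1
  · have hm := height_motion hnd1 hside
    -- With `η = 0` the three new vertices lie on the lifted edge, so the link itself is unchanged.
    have hbody : body (sys (H zp 0) P1) = body (sys zp (insert s(A, B) R)) := by
      rw [hsys, zero_smul, add_zero, body_insert, body_insert, body_insert, body_insert,
        eseg_split _ _ (by linarith) (by linarith) (by linarith) (by linarith)]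
      rw [sys, sys, Finset.image_insert, body_insert]
      rfl
    rwa [hbody] at hm

end tent
end

end

section
open Set Topology Filter
open scoped Classical
noncomputable section
attribute [local instance] sym2DecEq

/-! ### Monotone paths with four edges -/

/-- The edges of a path with five vertices. -/
def path5 {V : Type*} (P₀ P₁ P₂ P₃ P₄ : V) : Finset (Sym2 V) :=
  {s(P₂, P₃), s(P₃, P₄), s(P₁, P₂), s(P₀, P₁)}

theorem mem_path5 {V : Type*} {P₀ P₁ P₂ P₃ P₄ : V} {e : Sym2 V} : e ∈ path5 P₀ P₁ P₂ P₃ P₄ ↔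
    e = s(P₂, P₃) ∨ e = s(P₃, P₄) ∨ e = s(P₁, P₂) ∨ e = s(P₀, P₁) := by
  simp [path5]

theorem insert_eq_path5_union {V : Type*} {P₀ P₁ P₂ P₃ P₄ : V} {R : Finset (Sym2 V)} :
    insert s(P₂, P₃) (insert s(P₃, P₄) (insert s(P₁, P₂) (insert s(P₀, P₁) R))) =
      path5 P₀ P₁ P₂ P₃ P₄ ∪ R := by
  ext e
  simp only [Finset.mem_insert, Finset.mem_union, mem_path5]
  tauto

theorem linear_le_of_mem_segment {ℓ : E3 →ₗ[ℝ] ℝ} {P Q x : E3} (h : ℓ P < ℓ Q)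
    (hx : x ∈ eseg s(P, Q)) : ℓ P ≤ ℓ x ∧ ℓ x ≤ ℓ Q := by
  obtain ⟨h1, h2⟩ := linear_lt_of_mem_segment h hx
  constructor
  · rcases h1 with rfl | h1
    · exact le_rfl
    · exact h1.le
  · rcases h2 with rfl | h2
    · exact le_rfl
    · exact h2.le

section path5
variable {P₀ P₁ P₂ P₃ P₄ : E3} {ℓ : E3 →ₗ[ℝ] ℝ}

/-- The inner vertices are written as loops because `mult` counts a loop twice. In this form the two
ends behave as for a single edge from `P₀` to `P₄`, which makes replaced paths easy to compare. -/
theorem deg_path5 (h0 : ℓ P₀ < ℓ P₁) (h1 : ℓ P₁ < ℓ P₂) (h2 : ℓ P₂ < ℓ P₃) (h3 : ℓ P₃ < ℓ P₄)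
    (v : E3) : deg (path5 P₀ P₁ P₂ P₃ P₄) v =
      mult s(P₀, P₄) v + (mult s(P₁, P₁) v + (mult s(P₂, P₂) v + mult s(P₃, P₃) v)) := by
  have ne : ∀ {x y : E3}, ℓ x < ℓ y → x ≠ y := by rintro x y h rfl; exact lt_irrefl _ h
  have n02 := ne (h0.trans h1)
  have n03 := ne (h0.trans (h1.trans h2))
  have n13 := ne (h1.trans h2)
  have n14 := ne (h1.trans (h2.trans h3))
  have n24 := ne (h2.trans h3)
  rw [path5, deg_insert, deg_insert, deg_insert, deg_singleton]
  · simp only [mult_mk]; omega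
  · simp [n02.symm, (ne h0).symm]
  · simp [n13.symm, (ne h2).symm, n03.symm]
  · simp [n24, n13.symm, n03.symm, n02.symm, (ne h2), (ne h1).symm]

theorem path5_nd (h0 : ℓ P₀ < ℓ P₁) (h1 : ℓ P₁ < ℓ P₂) (h2 : ℓ P₂ < ℓ P₃) (h3 : ℓ P₃ < ℓ P₄)
    {e : Sym2 E3} (he : e ∈ path5 P₀ P₁ P₂ P₃ P₄) : ¬ e.IsDiag := by
  have ne : ∀ {x y : E3}, ℓ x < ℓ y → x ≠ y := by rintro x y h rfl; exact lt_irrefl _ h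
  rcases mem_path5.1 he with rfl | rfl | rfl | rfl
  · simpa using ne h2
  · simpa using ne h3
  · simpa using ne h1
  · simpa using ne h0

theorem flat_of_linear {P Q Q' T : E3} (h0 : ℓ P < ℓ Q) (h1 : ℓ Q ≤ ℓ Q') (h2 : ℓ Q' < ℓ T)
    (hQ : Q = Q' ∨ ℓ Q < ℓ Q') : Flat s(P, Q) s(Q', T) := by
  intro x hx hx'
  have a1 := linear_lt_of_mem_segment h0 hx
  have a2 := linear_lt_of_mem_segment h2 hx'
  rcases a1.2 with rfl | b1
  · rcases a2.1 with rfl | b2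
    · simp
    · linarith
  · rcases a2.1 with rfl | b2 <;> linarith

theorem path5_flat (h0 : ℓ P₀ < ℓ P₁) (h1 : ℓ P₁ < ℓ P₂) (h2 : ℓ P₂ < ℓ P₃) (h3 : ℓ P₃ < ℓ P₄)
    {e e' : Sym2 E3} (he : e ∈ path5 P₀ P₁ P₂ P₃ P₄) (he' : e' ∈ path5 P₀ P₁ P₂ P₃ P₄)
    (hne : e ≠ e') : Flat e e' := by
  have f01 : Flat s(P₀, P₁) s(P₁, P₂) := flat_of_linear h0 le_rfl h1 (Or.inl rfl)
  have f02 : Flat s(P₀, P₁) s(P₂, P₃) := flat_of_linear h0 h1.le h2 (Or.inr h1)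
  have f03 : Flat s(P₀, P₁) s(P₃, P₄) :=
    flat_of_linear h0 (h1.trans h2).le h3 (Or.inr (h1.trans h2))
  have f12 : Flat s(P₁, P₂) s(P₂, P₃) := flat_of_linear h1 le_rfl h2 (Or.inl rfl)
  have f13 : Flat s(P₁, P₂) s(P₃, P₄) := flat_of_linear h1 h2.le h3 (Or.inr h2)
  have f23 : Flat s(P₂, P₃) s(P₃, P₄) := flat_of_linear h2 le_rfl h3 (Or.inl rfl)
  rcases mem_path5.1 he with rfl | rfl | rfl | rfl <;>
    rcases mem_path5.1 he' with rfl | rfl | rfl | rfl <;>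
    first
    | exact absurd rfl hne
    | assumption
    | (apply Flat.symm; assumption)

/-- Two vertex-disjoint edges of a monotone path have disjoint shadows. -/
theorem path5_disjoint (h0 : ℓ P₀ < ℓ P₁) (h1 : ℓ P₁ < ℓ P₂) (h2 : ℓ P₂ < ℓ P₃) (h3 : ℓ P₃ < ℓ P₄)
    {e e' : Sym2 E3} (he : e ∈ path5 P₀ P₁ P₂ P₃ P₄) (he' : e' ∈ path5 P₀ P₁ P₂ P₃ P₄)
    (hd : ∀ v ∈ e, v ∉ e') {x y : E3} (hx : x ∈ eseg e) (hy : y ∈ eseg e') : ℓ x ≠ ℓ y := by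
  intro hxy
  rcases mem_path5.1 he with rfl | rfl | rfl | rfl <;>
    rcases mem_path5.1 he' with rfl | rfl | rfl | rfl <;>
    first
    | (simp at hd; done)
    | exact hd _ (Sym2.mem_mk_left _ _) (Sym2.mem_mk_right _ _)
    | exact hd _ (Sym2.mem_mk_right _ _) (Sym2.mem_mk_left _ _)
    | (have a1 := linear_le_of_mem_segment (by assumption) hx
       have a2 := linear_le_of_mem_segment (by assumption) hy
       linarith)

end path5

theorem lt_of_mem_path5 {P₀ P₁ P₂ P₃ P₄ : E3} {ℓ : E3 →ₗ[ℝ] ℝ} {c : ℝ} (h0 : c < ℓ P₀)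
    (h1 : c < ℓ P₁) (h2 : c < ℓ P₂) (h3 : c < ℓ P₃) (h4 : c < ℓ P₄) :
    ∀ e ∈ path5 P₀ P₁ P₂ P₃ P₄, ∀ x ∈ eseg e, c < ℓ x := by
  intro e he x hx
  refine lt_of_mem_eseg (fun v hv => ?_) hx
  rcases mem_path5.1 he with rfl | rfl | rfl | rfl <;> rcases Sym2.mem_iff.1 hv with rfl | rfl <;>
    assumption

/-! ### Crossing numbers -/

/-- Two edges of a labelled planar graph without common vertex that meet. -/
def Crosses {V : Type*} (q : V → ℝ × ℝ) (e e' : Sym2 V) : Prop :=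
  (∀ v ∈ e, v ∉ e') ∧ ∃ x ∈ eseg (e.map q), x ∈ eseg (e'.map q)

/-- The number of ordered pairs of crossing edges. -/
def cnum {V : Type*} (E : Finset (Sym2 V)) (q : V → ℝ × ℝ) : ℕ :=
  ((E ×ˢ E).filter fun p => Crosses q p.1 p.2).card

theorem Crosses.symm {V : Type*} {q : V → ℝ × ℝ} {e e' : Sym2 V} (h : Crosses q e e') :
    Crosses q e' e :=
  ⟨fun v hv hv' => h.1 v hv' hv, by obtain ⟨x, h1, h2⟩ := h.2; exact ⟨x, h2, h1⟩⟩

theorem crosses_proj {e e' : Sym2 E3} : Crosses proj e e' ↔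
    (∀ v ∈ e, v ∉ e') ∧ ∃ x ∈ eseg e, ∃ y ∈ eseg e', proj x = proj y := by
  rw [Crosses, eseg_map_proj, eseg_map_proj]
  refine and_congr_right fun _ => ⟨?_, ?_⟩
  · rintro ⟨_, ⟨x, hx, rfl⟩, y, hy, h⟩; exact ⟨x, hx, y, hy, h.symm⟩
  · rintro ⟨x, hx, y, hy, h⟩; exact ⟨_, ⟨x, hx, rfl⟩, y, hy, h.symm⟩

/-- Injectivity of `f` is required only for pairs that cross. It may therefore send several pieces
of an edge to that edge, as long as each other edge crosses at most one of them. -/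
theorem cnum_le_of_injOn {V W : Type*} {E : Finset (Sym2 V)} {F : Finset (Sym2 W)}
    {q : V → ℝ × ℝ} {r : W → ℝ × ℝ} (f : Sym2 V → Sym2 W)
    (hf : ∀ e ∈ E, ∀ e' ∈ E, Crosses q e e' → f e ∈ F ∧ f e' ∈ F ∧ Crosses r (f e) (f e'))
    (hi : ∀ e₁ ∈ E, ∀ e₁' ∈ E, ∀ e₂ ∈ E, ∀ e₂' ∈ E, Crosses q e₁ e₁' → Crosses q e₂ e₂' →
      f e₁ = f e₂ → f e₁' = f e₂' → e₁ = e₂ ∧ e₁' = e₂') : cnum E q ≤ cnum F r := by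
  refine Finset.card_le_card_of_injOn (fun p => (f p.1, f p.2)) ?_ ?_
  · rintro ⟨e, e'⟩ h
    simp only [Finset.coe_filter, Finset.mem_product, mem_ofPred_eq] at h ⊢
    obtain ⟨h1, h2, h3⟩ := hf e h.1.1 e' h.1.2 h.2
    exact ⟨⟨h1, h2⟩, h3⟩
  · rintro ⟨e₁, e₁'⟩ h₁ ⟨e₂, e₂'⟩ h₂ h
    simp only [Finset.coe_filter, Finset.mem_product, mem_ofPred_eq] at h₁ h₂
    simp only [Prod.mk.injEq] at h ⊢
    exact hi _ h₁.1.1 _ h₁.1.2 _ h₂.1.1 _ h₂.1.2 h₁.2 h₂.2 h.1 h.2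

/-- The crossing pair `e₀`, `e₀'` is not hit by the injection, which makes the inequality strict. -/
theorem cnum_lt_of_injOn {V W : Type*} {E : Finset (Sym2 V)} {F : Finset (Sym2 W)}
    {q : V → ℝ × ℝ} {r : W → ℝ × ℝ} (f : Sym2 V → Sym2 W)
    (hf : ∀ e ∈ E, ∀ e' ∈ E, Crosses q e e' → f e ∈ F ∧ f e' ∈ F ∧ Crosses r (f e) (f e'))
    (hi : ∀ e₁ ∈ E, ∀ e₁' ∈ E, ∀ e₂ ∈ E, ∀ e₂' ∈ E, Crosses q e₁ e₁' → Crosses q e₂ e₂' →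
      f e₁ = f e₂ → f e₁' = f e₂' → e₁ = e₂ ∧ e₁' = e₂') {e₀ e₀' : Sym2 W} (h0 : e₀ ∈ F)
    (h0' : e₀' ∈ F) (hc : Crosses r e₀ e₀')
    (hnot : ∀ e ∈ E, ∀ e' ∈ E, Crosses q e e' → ¬ (f e = e₀ ∧ f e' = e₀')) :
    cnum E q < cnum F r := by
  have hsub : ((E ×ˢ E).filter fun p => Crosses q p.1 p.2).image (fun p => (f p.1, f p.2)) ⊂
      (F ×ˢ F).filter fun p => Crosses r p.1 p.2 := by
    rw [Finset.ssubset_iff_of_subset]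
    · refine ⟨(e₀, e₀'), ?_, ?_⟩
      · simp only [Finset.mem_filter, Finset.mem_product]; exact ⟨⟨h0, h0'⟩, hc⟩
      · simp only [Finset.mem_image, Finset.mem_filter, Finset.mem_product, Prod.mk.injEq]
        rintro ⟨⟨e, e'⟩, ⟨⟨he, he'⟩, h⟩, h2⟩
        exact hnot e he e' he' h h2
    · intro x hx
      simp only [Finset.mem_image, Finset.mem_filter, Finset.mem_product] at hx ⊢
      obtain ⟨⟨e, e'⟩, ⟨⟨he, he'⟩, h⟩, rfl⟩ := hx
      obtain ⟨h1, h2, h3⟩ := hf e he e' he' h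
      exact ⟨⟨h1, h2⟩, h3⟩
  have hcard := Finset.card_lt_card hsub
  rw [Finset.card_image_of_injOn] at hcard
  · exact hcard
  · rintro ⟨e₁, e₁'⟩ h₁ ⟨e₂, e₂'⟩ h₂ h
    simp only [Finset.coe_filter, Finset.mem_product, mem_ofPred_eq] at h₁ h₂
    simp only [Prod.mk.injEq] at h ⊢
    exact hi _ h₁.1.1 _ h₁.1.2 _ h₂.1.1 _ h₂.1.2 h₁.2 h₂.2 h.1 h.2

theorem cnum_mono {V : Type*} {E F : Finset (Sym2 V)} (h : E ⊆ F) (q : V → ℝ × ℝ) :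
    cnum E q ≤ cnum F q :=
  cnum_le_of_injOn id (fun _ he _ he' hc => ⟨h he, h he', hc⟩)
    fun _ _ _ _ _ _ _ _ _ _ h1 h2 => ⟨h1, h2⟩

/-- A map that preserves the parametrization of lines. -/
def LnMap {E F : Type*} [AddCommGroup E] [Module ℝ E] [AddCommGroup F] [Module ℝ F]
    (f : E → F) : Prop := ∀ P T t, f (ln P T t) = ln (f P) (f T) t

theorem LnMap.eseg_map {E F : Type*} [AddCommGroup E] [Module ℝ E] [AddCommGroup F] [Module ℝ F]
    {f : E → F} (hf : LnMap f) (e : Sym2 E) : eseg (e.map f) = f '' eseg e := by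
  induction e with | _ a b =>
  ext x
  simp only [Sym2.map_mk, mem_eseg_iff, mem_image]
  constructor
  · rintro ⟨t, h0, h1, rfl⟩; exact ⟨_, ⟨t, h0, h1, rfl⟩, hf _ _ _⟩
  · rintro ⟨_, ⟨t, h0, h1, rfl⟩, rfl⟩; exact ⟨t, h0, h1, hf _ _ _⟩

/-- `Φ` carries the new projection to the old one, so every crossing upstairs yields a crossing of
the original edges. Invertibility of `Φ` is not needed for this inequality. -/
theorem cnum_image_le {V W : Type*} {E : Finset (Sym2 V)} {q : V → ℝ × ℝ} {r : W → ℝ × ℝ}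
    {g : V → W} (hg : Function.Injective g) {Φ : ℝ × ℝ → ℝ × ℝ} (hΦ : LnMap Φ)
    (h : ∀ v, Φ (r (g v)) = q v) : cnum (E.image (Sym2.map g)) r ≤ cnum E q := by
  have hinj := Sym2.map.injective hg
  rcases E.eq_empty_or_nonempty with rfl | hE
  · simp [cnum]
  have : Nonempty (Sym2 V) := ⟨hE.choose⟩
  have hinv := Function.leftInverse_invFun hinj
  refine cnum_le_of_injOn (Function.invFun (Sym2.map g)) ?_ ?_
  · intro _ h1 _ h1' hc
    obtain ⟨e, he, rfl⟩ := Finset.mem_image.1 h1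
    obtain ⟨e', he', rfl⟩ := Finset.mem_image.1 h1'
    rw [hinv, hinv]
    refine ⟨he, he', ?_, ?_⟩
    · intro v hv hv'
      exact hc.1 (g v) (Sym2.mem_map.2 ⟨v, hv, rfl⟩) (Sym2.mem_map.2 ⟨v, hv', rfl⟩)
    · have key : ∀ e : Sym2 V, eseg (e.map q) = Φ '' eseg ((e.map g).map r) := by
        intro e
        rw [← hΦ.eseg_map, Sym2.map_map, Sym2.map_map]
        congr 1
        exact Sym2.map_congr fun v _ => (h v).symm
      obtain ⟨x, h1, h2⟩ := hc.2
      exact ⟨Φ x, by rw [key]; exact ⟨x, h1, rfl⟩, by rw [key]; exact ⟨x, h2, rfl⟩⟩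
  · intro e₁ h1 e₁' h1' e₂ h2 e₂' h2' _ _ h3 h4
    obtain ⟨e, he, rfl⟩ := Finset.mem_image.1 h1
    obtain ⟨e', he', rfl⟩ := Finset.mem_image.1 h1'
    obtain ⟨f, hf, rfl⟩ := Finset.mem_image.1 h2
    obtain ⟨f', hf', rfl⟩ := Finset.mem_image.1 h2'
    rw [hinv, hinv] at h3 h4
    rw [h3, h4]; exact ⟨rfl, rfl⟩

theorem PolySys.image_ln {S : Finset (Sym2 E3)} (h : PolySys S) {T : E3 → E3} (hT : LnMap T)
    (hi : Function.Injective T) :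
    PolySys (S.image (Sym2.map T)) ∧ body (S.image (Sym2.map T)) = T '' body S := by
  constructor
  · refine Emb.poly_image ⟨?_, ?_⟩ h.ne h.deg
    · intro e he hd
      have := h.nd he
      induction e with | _ a b =>
      simp only [Sym2.map_mk, Sym2.mk_isDiag_iff] at hd this
      exact this (hi hd)
    · intro e he e' he' hne x hx hx'
      rw [hT.eseg_map] at hx hx'
      obtain ⟨y, hy, rfl⟩ := hx
      obtain ⟨y', hy', hyy⟩ := hx'
      obtain rfl := hi hyy
      exact ⟨y', (h.meet he he' hne hy hy').1, (h.meet he he' hne hy hy').2, rfl⟩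
  · rw [body_image, carrier, body, image_iUnion₂]
    exact iUnion₂_congr fun e _ => hT.eseg_map e

end

end

section
open Set Topology Filter
open scoped Classical
noncomputable section
attribute [local instance] sym2DecEq

/-! ### The four standard pictures -/

theorem mem_skeinBall {x : E3} : x ∈ skeinBall ↔ x 0 ^ 2 + x 1 ^ 2 + x 2 ^ 2 ≤ 2 := by
  rw [skeinBall, mem_closedBall_zero_iff, EuclideanSpace.norm_eq, Real.sqrt_le_sqrt_iff (by norm_num)]
  simp [Fin.sum_univ_three]

theorem segment_subset_skeinBall {a b c a' b' c' : ℝ} (h : a ^ 2 + b ^ 2 + c ^ 2 ≤ 2)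
    (h' : a' ^ 2 + b' ^ 2 + c' ^ 2 ≤ 2) : segment ℝ (!₂[a, b, c] : E3) !₂[a', b', c'] ⊆ skeinBall :=
  (convex_closedBall _ _).segment_subset (mem_skeinBall.2 (by simpa using h))
    (mem_skeinBall.2 (by simpa using h'))

/-- The four end points of the standard pictures. -/
def corners : Set E3 := {!₂[-1, -1, 0], !₂[1, 1, 0], !₂[-1, 1, 0], !₂[1, -1, 0]}

theorem tangle_bounds : (tanglePos ⊆ skeinBall ∧ tangleNeg ⊆ skeinBall ∧ tangleInfty ⊆ skeinBall ∧
    tangleZero ⊆ skeinBall) ∧ corners ⊆ tanglePos ∧ corners ⊆ tangleNeg ∧ corners ⊆ tangleInfty ∧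
      corners ⊆ tangleZero := by
  refine ⟨⟨?_, ?_, ?_, ?_⟩, ?_, ?_, ?_, ?_⟩
  · rw [tanglePos]
    refine union_subset (union_subset ?_ ?_) ?_ <;> apply segment_subset_skeinBall <;> norm_num
  · rw [tangleNeg]
    refine union_subset (union_subset ?_ ?_) ?_ <;> apply segment_subset_skeinBall <;> norm_num
  · rw [tangleInfty]
    refine union_subset (union_subset ?_ ?_) (union_subset ?_ ?_) <;>
      apply segment_subset_skeinBall <;> norm_num
  · rw [tangleZero]
    refine union_subset (union_subset ?_ ?_) (union_subset ?_ ?_) <;>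
      apply segment_subset_skeinBall <;> norm_num
  · rintro x (rfl | rfl | rfl | rfl)
    · exact .inl (.inl (left_mem_segment _ _ _))
    · exact .inl (.inr (right_mem_segment _ _ _))
    · exact .inr (right_mem_segment _ _ _)
    · exact .inr (left_mem_segment _ _ _)
  · rintro x (rfl | rfl | rfl | rfl)
    · exact .inr (left_mem_segment _ _ _)
    · exact .inr (right_mem_segment _ _ _)
    · exact .inl (.inr (right_mem_segment _ _ _))
    · exact .inl (.inl (left_mem_segment _ _ _))
  · rintro x (rfl | rfl | rfl | rfl)
    · exact .inl (.inl (left_mem_segment _ _ _))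
    · exact .inr (.inr (right_mem_segment _ _ _))
    · exact .inl (.inr (right_mem_segment _ _ _))
    · exact .inr (.inl (left_mem_segment _ _ _))
  · rintro x (rfl | rfl | rfl | rfl)
    · exact .inl (.inl (left_mem_segment _ _ _))
    · exact .inr (.inr (right_mem_segment _ _ _))
    · exact .inr (.inl (left_mem_segment _ _ _))
    · exact .inl (.inr (right_mem_segment _ _ _))

/-- The outer part `O` touches the ball at most in the four corners, and these belong to each of the
four pictures. Gluing `O` to a picture therefore changes nothing inside the ball. -/
theorem isStandardQuadruple_of_union {O : Set E3} (hO : O ∩ skeinBall ⊆ corners)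
    (hp : IsPolygonalLink (tanglePos ∪ O)) (hn : IsPolygonalLink (tangleNeg ∪ O))
    (hi : IsPolygonalLink (tangleInfty ∪ O)) (hz : IsPolygonalLink (tangleZero ∪ O)) :
    IsStandardQuadruple (tanglePos ∪ O) (tangleNeg ∪ O) (tangleInfty ∪ O) (tangleZero ∪ O) := by
  obtain ⟨⟨bp, bn, bi, bz⟩, cp, cn, ci, cz⟩ := tangle_bounds
  have ball : ∀ {T : Set E3}, T ⊆ skeinBall → corners ⊆ T → (T ∪ O) ∩ skeinBall = T := by
    intro T h1 h2
    rw [union_inter_distrib_right, inter_eq_left.2 h1, union_eq_left.2 (hO.trans h2)]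
  have out : ∀ {T : Set E3}, T ⊆ skeinBall → (T ∪ O) \ skeinBall = O \ skeinBall := by
    intro T h1
    rw [union_sdiff_distrib, sdiff_eq_empty.2 h1, empty_union]
  exact ⟨⟨hp, hn, hi, hz⟩, ⟨ball bp cp, ball bn cn, ball bi ci, ball bz cz⟩,
    (out bn).trans (out bp).symm, (out bi).trans (out bp).symm, (out bz).trans (out bp).symm⟩

/-! ### Pairs of separated strands -/

/-- Two paths that are increasing for one linear form and are separated by another one. -/
structure Strands (ℓ μ : E3 →ₗ[ℝ] ℝ) (P₀ P₁ P₂ P₃ P₄ Q₀ Q₁ Q₂ Q₃ Q₄ : E3) : Prop where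
  p0 : ℓ P₀ < ℓ P₁
  p1 : ℓ P₁ < ℓ P₂
  p2 : ℓ P₂ < ℓ P₃
  p3 : ℓ P₃ < ℓ P₄
  q0 : ℓ Q₀ < ℓ Q₁
  q1 : ℓ Q₁ < ℓ Q₂
  q2 : ℓ Q₂ < ℓ Q₃
  q3 : ℓ Q₃ < ℓ Q₄
  neg : 0 < (-μ) P₀ ∧ 0 < (-μ) P₁ ∧ 0 < (-μ) P₂ ∧ 0 < (-μ) P₃ ∧ 0 < (-μ) P₄
  pos : 0 < μ Q₀ ∧ 0 < μ Q₁ ∧ 0 < μ Q₂ ∧ 0 < μ Q₃ ∧ 0 < μ Q₄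

namespace Strands
variable {ℓ μ : E3 →ₗ[ℝ] ℝ} {P₀ P₁ P₂ P₃ P₄ Q₀ Q₁ Q₂ Q₃ Q₄ : E3}

theorem separated (h : Strands ℓ μ P₀ P₁ P₂ P₃ P₄ Q₀ Q₁ Q₂ Q₃ Q₄) {e e' : Sym2 E3}
    (he : e ∈ path5 P₀ P₁ P₂ P₃ P₄) (he' : e' ∈ path5 Q₀ Q₁ Q₂ Q₃ Q₄) {x y : E3} (hx : x ∈ eseg e)
    (hy : y ∈ eseg e') : μ x < μ y := by
  obtain ⟨a0, a1, a2, a3, a4⟩ := h.neg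
  obtain ⟨b0, b1, b2, b3, b4⟩ := h.pos
  have h1 := lt_of_mem_path5 a0 a1 a2 a3 a4 e he x hx
  have h2 := lt_of_mem_path5 b0 b1 b2 b3 b4 e' he' y hy
  rw [LinearMap.neg_apply] at h1
  linarith

theorem nd (h : Strands ℓ μ P₀ P₁ P₂ P₃ P₄ Q₀ Q₁ Q₂ Q₃ Q₄) {e : Sym2 E3}
    (he : e ∈ path5 P₀ P₁ P₂ P₃ P₄ ∪ path5 Q₀ Q₁ Q₂ Q₃ Q₄) : ¬ e.IsDiag := by
  rcases Finset.mem_union.1 he with he | he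
  · exact path5_nd h.p0 h.p1 h.p2 h.p3 he
  · exact path5_nd h.q0 h.q1 h.q2 h.q3 he

theorem flat (h : Strands ℓ μ P₀ P₁ P₂ P₃ P₄ Q₀ Q₁ Q₂ Q₃ Q₄) {e e' : Sym2 E3}
    (he : e ∈ path5 P₀ P₁ P₂ P₃ P₄ ∪ path5 Q₀ Q₁ Q₂ Q₃ Q₄)
    (he' : e' ∈ path5 P₀ P₁ P₂ P₃ P₄ ∪ path5 Q₀ Q₁ Q₂ Q₃ Q₄) (hne : e ≠ e') : Flat e e' := by
  rcases Finset.mem_union.1 he with he | he <;> rcases Finset.mem_union.1 he' with he' | he'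
  · exact path5_flat h.p0 h.p1 h.p2 h.p3 he he' hne
  · intro x hx hx'
    exact absurd (h.separated he he' hx hx') (lt_irrefl _)
  · intro x hx hx'
    exact absurd (h.separated he' he hx' hx) (lt_irrefl _)
  · exact path5_flat h.q0 h.q1 h.q2 h.q3 he he' hne

theorem not_crosses (h : Strands ℓ μ P₀ P₁ P₂ P₃ P₄ Q₀ Q₁ Q₂ Q₃ Q₄)
    (hℓ : ∀ x y : E3, proj x = proj y → ℓ x = ℓ y) (hμ : ∀ x y : E3, proj x = proj y → μ x = μ y)
    {e e' : Sym2 E3}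
    (he : e ∈ path5 P₀ P₁ P₂ P₃ P₄ ∪ path5 Q₀ Q₁ Q₂ Q₃ Q₄)
    (he' : e' ∈ path5 P₀ P₁ P₂ P₃ P₄ ∪ path5 Q₀ Q₁ Q₂ Q₃ Q₄) : ¬ Crosses proj e e' := by
  rw [crosses_proj]
  rintro ⟨hd, x, hx, y, hy, hxy⟩
  rcases Finset.mem_union.1 he with he | he <;> rcases Finset.mem_union.1 he' with he' | he'
  · exact path5_disjoint h.p0 h.p1 h.p2 h.p3 he he' hd hx hy (hℓ _ _ hxy)
  · exact (h.separated he he' hx hy).ne (hμ _ _ hxy)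
  · exact (h.separated he' he hy hx).ne' (hμ _ _ hxy)
  · exact path5_disjoint h.q0 h.q1 h.q2 h.q3 he he' hd hx hy (hℓ _ _ hxy)

theorem deg_eq (h : Strands ℓ μ P₀ P₁ P₂ P₃ P₄ Q₀ Q₁ Q₂ Q₃ Q₄) (v : E3) :
    deg (path5 P₀ P₁ P₂ P₃ P₄ ∪ path5 Q₀ Q₁ Q₂ Q₃ Q₄) v =
      (mult s(P₀, P₄) v + (mult s(P₁, P₁) v + (mult s(P₂, P₂) v + mult s(P₃, P₃) v))) +
      (mult s(Q₀, Q₄) v + (mult s(Q₁, Q₁) v + (mult s(Q₂, Q₂) v + mult s(Q₃, Q₃) v))) := by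
  rw [deg_union, deg_path5 h.p0 h.p1 h.p2 h.p3, deg_path5 h.q0 h.q1 h.q2 h.q3]
  rw [Finset.disjoint_left]
  intro e he he'
  obtain ⟨x, hx⟩ := eseg_nonempty e
  exact absurd (h.separated he he' hx hx) (lt_irrefl _)

end Strands

/-- A new edge stays apart from `R` for one of two reasons: it lies over the disc that `R` avoids,
or it already occurs together with `R` in a polygon system `T`. The second case covers the outer
arms of a smoothing, which are inherited from one of the two crossings. -/
theorem PolySys.smooth {A N R : Finset (Sym2 E3)} (h : PolySys (A ∪ R)) (hAR : Disjoint A R)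
    (hne : N.Nonempty) (nd : ∀ e ∈ N, ¬ e.IsDiag)
    (hN : ∀ e ∈ N, ∀ e' ∈ N, e ≠ e' → Flat e e')
    (hR : ∀ e ∈ R, ∀ x ∈ eseg e, 2 < x 0 ^ 2 + x 1 ^ 2)
    (hNR : ∀ e ∈ N, (∀ x ∈ eseg e, x 0 ^ 2 + x 1 ^ 2 ≤ 2) ∨
      (e ∉ R ∧ ∃ T, PolySys T ∧ R ⊆ T ∧ e ∈ T))
    (hd : ∀ v, _root_.deg N v = _root_.deg A v ∨ (_root_.deg N v = 2 ∧ _root_.deg R v = 0) ∨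
      (_root_.deg N v = 0 ∧ _root_.deg A v = 2)) : PolySys (N ∪ R) := by
  refine h.surgery hAR ?_ hne nd ?_ ?_ hd
  · rw [Finset.disjoint_left]
    intro e he he'
    rcases hNR e he with h1 | ⟨h1, -⟩
    · obtain ⟨x, hx⟩ := eseg_nonempty e
      linarith [h1 x hx, hR e he' x hx]
    · exact h1 he'
  · intro e he e' he' hne x hx hx'
    have := hN e he e' he' hne x hx hx'
    exact this
  · intro e he e' he' x hx hx'
    rcases hNR e he with h1 | ⟨h1, T, hT, hRT, heT⟩
    · linarith [h1 x hx, hR e' he' x hx']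
    · exact hT.meet heT (hRT he') (by rintro rfl; exact h1 he') hx hx'

/-- The only new edges that cross `R` are the arms `Ry`, and `f` sends an arm to the strand `k` or
`k'` that contains it. Two arms of one strand have disjoint projections and an edge of `R` meets a
strand at most once in projection, so crossing pairs are mapped injectively. The crossing of `k`
with `k'` is lost. -/
theorem cnum_smooth {N R Ry : Finset (Sym2 E3)} {k k' : Sym2 E3} (hk : k ∉ R) (hk' : k' ∉ R)
    (hcross : Crosses proj k k') (f : Sym2 E3 → Sym2 E3) (hfR : ∀ e ∈ R, f e = e)
    (hN : ∀ e ∈ N, e ∉ Ry → ∀ e' ∈ R, ¬ Crosses proj e e')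
    (hRy : ∀ e ∈ Ry, (f e = k ∨ f e = k') ∧ eseg e ⊆ eseg (f e) ∧
      ∀ v ∈ f e, v ∈ e ∨ ∀ x ∈ eseg e, proj x ≠ proj v)
    (hNN : ∀ e ∈ N, ∀ e' ∈ N, ¬ Crosses proj e e')
    (hone : ∀ j, j = k ∨ j = k' → ∀ e ∈ R, ∀ x ∈ eseg j, ∀ x' ∈ eseg j, ∀ y ∈ eseg e, ∀ y' ∈ eseg e,
      proj x = proj y → proj x' = proj y' → proj x = proj x')
    (hdisj : ∀ e ∈ Ry, ∀ e' ∈ Ry, e ≠ e' → f e = f e' → ∀ x ∈ eseg e, ∀ y ∈ eseg e',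
      proj x ≠ proj y) :
    cnum (N ∪ R) proj < cnum (insert k (insert k' R)) proj := by
  have hRm : ∀ e ∈ R, e ∈ insert k (insert k' R) := fun e he =>
    Finset.mem_insert_of_mem (Finset.mem_insert_of_mem he)
  have hkm : ∀ j, j = k ∨ j = k' → j ∈ insert k (insert k' R) := by
    rintro j (rfl | rfl) <;> simp
  have hkR : ∀ j, j = k ∨ j = k' → j ∉ R := by
    rintro j (rfl | rfl)
    exacts [hk, hk']
  have key : ∀ e ∈ N, ∀ e' ∈ R, Crosses proj e e' → e ∈ Ry ∧ Crosses proj (f e) e' := by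
    intro e he e' he' hc
    have hr : e ∈ Ry := by
      by_contra hr
      exact hN e he hr e' he' hc
    refine ⟨hr, ?_⟩
    obtain ⟨h1, h2, h3⟩ := hRy e hr
    rw [crosses_proj] at hc ⊢
    obtain ⟨hd, x, hx, y, hy, hxy⟩ := hc
    refine ⟨fun v hv hv' => ?_, x, h2 hx, y, hy, hxy⟩
    -- If `e'` shares an end of the strand, that end belongs to the arm, against the assumption that
    -- the arm and `e'` have no common vertex, or else `e'` meets the strand over two different
    -- points.
    rcases h3 v hv with h4 | h4
    · exact hd v h4 hv'
    · exact h4 x hx (hone _ h1 e' he' x (h2 hx) v (mem_eseg_of_mem hv) y hy v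
        (mem_eseg_of_mem hv') hxy rfl)
  have key2 : ∀ e₁ ∈ N, ∀ e₂ ∈ N, ∀ e' ∈ R, Crosses proj e₁ e' → Crosses proj e₂ e' →
      f e₁ = f e₂ → e₁ = e₂ := by
    intro e₁ h1 e₂ h2 e' he' c1 c2 hf
    obtain ⟨r1, -⟩ := key e₁ h1 e' he' c1
    obtain ⟨r2, -⟩ := key e₂ h2 e' he' c2
    by_contra hne
    obtain ⟨-, x, hx, y, hy, hxy⟩ := crosses_proj.1 c1
    obtain ⟨-, x', hx', y', hy', hxy'⟩ := crosses_proj.1 c2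
    refine hdisj _ r1 _ r2 hne hf x hx x' hx' ?_
    refine hone _ (hRy _ r1).1 e' he' x ((hRy _ r1).2.1 hx) x' ?_ y hy y' hy' hxy hxy'
    rw [hf]; exact (hRy _ r2).2.1 hx'
  have cls : ∀ e ∈ N ∪ R, ∀ e' ∈ N ∪ R, Crosses proj e e' →
      (e ∈ R ∧ e' ∈ R) ∨ (e ∈ N ∧ e' ∈ R) ∨ (e ∈ R ∧ e' ∈ N) := by
    intro e he e' he' hc
    rcases Finset.mem_union.1 he with h1 | h1 <;> rcases Finset.mem_union.1 he' with h2 | h2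
    · exact absurd hc (hNN _ h1 _ h2)
    · exact .inr (.inl ⟨h1, h2⟩)
    · exact .inr (.inr ⟨h1, h2⟩)
    · exact .inl ⟨h1, h2⟩
  have nR : ∀ e ∈ N, ∀ e' ∈ R, Crosses proj e e' → f e ∉ R := fun e he e' he' hc =>
    hkR _ (hRy e (key e he e' he' hc).1).1
  refine cnum_lt_of_injOn f ?_ ?_ (hkm k (.inl rfl)) (hkm k' (.inr rfl)) hcross ?_
  · intro e he e' he' hc
    rcases cls e he e' he' hc with ⟨h1, h2⟩ | ⟨h1, h2⟩ | ⟨h1, h2⟩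
    · rw [hfR e h1, hfR e' h2]; exact ⟨hRm e h1, hRm e' h2, hc⟩
    · obtain ⟨r, c⟩ := key e h1 e' h2 hc
      rw [hfR e' h2]; exact ⟨hkm _ (hRy e r).1, hRm e' h2, c⟩
    · obtain ⟨r, c⟩ := key e' h2 e h1 hc.symm
      rw [hfR e h1]; exact ⟨hRm e h1, hkm _ (hRy e' r).1, c.symm⟩
  · intro e₁ m1 e₁' m1' e₂ m2 e₂' m2' c1 c2 hf hf'
    rcases cls _ m1 _ m1' c1 with ⟨h1, h2⟩ | ⟨h1, h2⟩ | ⟨h1, h2⟩ <;>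
      rcases cls _ m2 _ m2' c2 with ⟨h3, h4⟩ | ⟨h3, h4⟩ | ⟨h3, h4⟩
    · rw [hfR _ h1, hfR _ h3] at hf
      rw [hfR _ h2, hfR _ h4] at hf'
      exact ⟨hf, hf'⟩
    · exact absurd (by rw [← hf, hfR _ h1]; exact h1) (nR _ h3 _ h4 c2)
    · exact absurd (by rw [← hf', hfR _ h2]; exact h2) (nR _ h4 _ h3 c2.symm)
    · exact absurd (by rw [hf, hfR _ h3]; exact h3) (nR _ h1 _ h2 c1)
    · rw [hfR _ h2, hfR _ h4] at hf'
      subst hf'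
      exact ⟨key2 _ h1 _ h3 _ h2 c1 c2 hf, rfl⟩
    · exact absurd (by rw [hf, hfR _ h3]; exact h3) (nR _ h1 _ h2 c1)
    · exact absurd (by rw [hf', hfR _ h4]; exact h4) (nR _ h2 _ h1 c1.symm)
    · exact absurd (by rw [hf', hfR _ h4]; exact h4) (nR _ h2 _ h1 c1.symm)
    · rw [hfR _ h1, hfR _ h3] at hf
      subst hf
      exact ⟨rfl, key2 _ h2 _ h4 _ h1 c1.symm c2.symm hf'⟩
  · rintro e he e' he' hc ⟨h1, h2⟩
    rcases cls e he e' he' hc with ⟨h3, h4⟩ | ⟨h3, h4⟩ | ⟨h3, h4⟩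
    · rw [hfR e h3] at h1; exact hk (h1 ▸ h3)
    · rw [hfR e' h4] at h2; exact hk' (h2 ▸ h4)
    · rw [hfR e h3] at h1; exact hk (h1 ▸ h3)

end

end

section
open Set Topology Filter
open scoped Classical
noncomputable section
attribute [local instance] sym2DecEq

/-! ### Smoothing a crossing in standard position -/

theorem coord_vec {a b c : ℝ} : coord 0 !₂[a, b, c] = a ∧ coord 1 !₂[a, b, c] = b ∧
    coord 2 !₂[a, b, c] = c := by
  simp [coord_apply]

theorem coord_zero_of_proj {x y : E3} (h : proj x = proj y) : coord 0 x = coord 0 y :=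
  congrArg Prod.fst h

theorem coord_one_of_proj {x y : E3} (h : proj x = proj y) : coord 1 x = coord 1 y :=
  congrArg Prod.snd h

/-- The first end of the first strand of a crossing in standard position. -/
def armSW (a : ℝ) : E3 := !₂[-a, -a, 0]
/-- The second end of the first strand of a crossing in standard position. -/
def armNE (a : ℝ) : E3 := !₂[a, a, 0]
/-- The first end of the second strand of a crossing in standard position. -/
def armNW (a : ℝ) : E3 := !₂[-a, a, 0]
/-- The second end of the second strand of a crossing in standard position. -/
def armSE (a : ℝ) : E3 := !₂[a, -a, 0]

/-- The strand over the first diagonal that passes through the point `(0, 0, 1)`. -/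
def overPath (α β : ℝ) : Finset (Sym2 E3) :=
  path5 (armSW α) (armSW 1) !₂[0, 0, 1] (armNE 1) (armNE β)

/-- The strand over the second diagonal that passes through the point `(0, 0, 1)`. -/
def overPath' (γ δ : ℝ) : Finset (Sym2 E3) :=
  path5 (armNW γ) (armNW 1) !₂[0, 0, 1] (armSE 1) (armSE δ)

/-- The two strands of the vertical smoothing. -/
def inftyPaths (α β γ δ : ℝ) : Finset (Sym2 E3) :=
  path5 (armSW α) (armSW 1) !₂[-1 / 2, 0, 0] (armNW 1) (armNW γ) ∪
    path5 (armSE δ) (armSE 1) !₂[1 / 2, 0, 0] (armNE 1) (armNE β)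

/-- The two strands of the horizontal smoothing. -/
def zeroPaths (α β γ δ : ℝ) : Finset (Sym2 E3) :=
  path5 (armSW α) (armSW 1) !₂[0, -1 / 2, 0] (armSE 1) (armSE δ) ∪
    path5 (armNW γ) (armNW 1) !₂[0, 1 / 2, 0] (armNE 1) (armNE β)

/-- The four outer edges of the standard pictures. -/
def arms (α β γ δ : ℝ) : Finset (Sym2 E3) :=
  {s(armSW α, armSW 1), s(armNE 1, armNE β), s(armNW 1, armNW γ), s(armSE δ, armSE 1)}

theorem body_singleton (e : Sym2 E3) : body {e} = eseg e := by
  simp [body]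

section standard
variable {α β γ δ : ℝ} {R : Finset (Sym2 E3)}

theorem mem_arms {e : Sym2 E3} : e ∈ arms α β γ δ ↔ e = s(armSW α, armSW 1) ∨
    e = s(armNE 1, armNE β) ∨ e = s(armNW 1, armNW γ) ∨ e = s(armSE δ, armSE 1) := by
  simp [arms]

theorem strands_infty (hα : 1 < α) (hβ : 1 < β) (hγ : 1 < γ) (hδ : 1 < δ) :
    Strands (coord 1) (coord 0) (armSW α) (armSW 1) !₂[-1 / 2, 0, 0] (armNW 1) (armNW γ)
      (armSE δ) (armSE 1) !₂[1 / 2, 0, 0] (armNE 1) (armNE β) := by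
  constructor <;> simp only [armSW, armNE, armNW, armSE, LinearMap.neg_apply, coord_vec] <;>
    (repeat' constructor) <;> linarith

theorem strands_zero (hα : 1 < α) (hβ : 1 < β) (hγ : 1 < γ) (hδ : 1 < δ) :
    Strands (coord 0) (coord 1) (armSW α) (armSW 1) !₂[0, -1 / 2, 0] (armSE 1) (armSE δ)
      (armNW γ) (armNW 1) !₂[0, 1 / 2, 0] (armNE 1) (armNE β) := by
  constructor <;> simp only [armSW, armNE, armNW, armSE, LinearMap.neg_apply, coord_vec] <;>
    (repeat' constructor) <;> linarith

/-- The disc that contains the inner edges. -/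
def disc : Set E3 := {x | x 0 ^ 2 + x 1 ^ 2 ≤ 2}

theorem convex_disc : Convex ℝ disc := by
  have h : ConvexOn ℝ univ fun x : E3 => x 0 ^ 2 + x 1 ^ 2 := by
    have hs : ConvexOn ℝ univ fun x : ℝ => x ^ 2 := even_two.convexOn_pow
    exact (hs.comp_linearMap (coord 0)).add (hs.comp_linearMap (coord 1))
  simpa [disc] using h.convex_le 2

theorem eseg_subset_disc {p q : E3} (hp : p 0 ^ 2 + p 1 ^ 2 ≤ 2) (hq : q 0 ^ 2 + q 1 ^ 2 ≤ 2) :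
    ∀ x ∈ eseg s(p, q), x 0 ^ 2 + x 1 ^ 2 ≤ 2 :=
  eseg_subset convex_disc (by
    intro x hx
    rcases Sym2.mem_iff.1 hx with rfl | rfl <;> assumption)

theorem infty_cases {e : Sym2 E3} (he : e ∈ inftyPaths α β γ δ) :
    e ∈ arms α β γ δ ∨ ∀ x ∈ eseg e, x 0 ^ 2 + x 1 ^ 2 ≤ 2 := by
  rw [mem_arms]
  rcases Finset.mem_union.1 he with he | he <;> rcases mem_path5.1 he with rfl | rfl | rfl | rfl <;>
    first
    | (left; simp; done)
    | (right; apply eseg_subset_disc <;> simp [armSW, armNE, armNW, armSE] <;> norm_num)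

theorem zero_cases {e : Sym2 E3} (he : e ∈ zeroPaths α β γ δ) :
    e ∈ arms α β γ δ ∨ ∀ x ∈ eseg e, x 0 ^ 2 + x 1 ^ 2 ≤ 2 := by
  rw [mem_arms]
  rcases Finset.mem_union.1 he with he | he <;> rcases mem_path5.1 he with rfl | rfl | rfl | rfl <;>
    first
    | (left; simp [Sym2.eq_swap]; done)
    | (right; apply eseg_subset_disc <;> simp [armSW, armNE, armNW, armSE] <;> norm_num)

theorem deg_overPath (hα : 1 < α) (hβ : 1 < β) (v : E3) : deg (overPath α β) v =
    mult s(armSW α, armNE β) v + (mult s(armSW 1, armSW 1) v +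
      (mult s(!₂[0, 0, 1], !₂[0, 0, 1]) v + mult s(armNE 1, armNE 1) v)) := by
  refine deg_path5 (ℓ := coord 0) ?_ ?_ ?_ ?_ v <;> simp only [armSW, armNE, coord_vec] <;> linarith

theorem diag_not_mem_overPath (hγ : 1 < γ) : s(armNW γ, armSE δ) ∉ overPath α β := by
  rw [overPath, mem_path5]
  simp [armSW, armNE, armNW, armSE]
  refine ⟨⟨?_, ?_⟩, ?_, ?_⟩ <;> intros <;> linarith

/-- These are the alternatives required by `PolySys.surgery`: the tip `(0, 0, 1)` disappears, the
vertices over the disc get degree two and are not used by `R`, and all other vertices keep their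
degree. -/
theorem deg_infty (hα : 1 < α) (hβ : 1 < β) (hγ : 1 < γ) (hδ : 1 < δ)
    (hR : ∀ e ∈ R, ∀ x ∈ eseg e, 2 < x 0 ^ 2 + x 1 ^ 2) (v : E3) :
    deg (inftyPaths α β γ δ) v = deg (insert s(armNW γ, armSE δ) (overPath α β)) v ∨
      (deg (inftyPaths α β γ δ) v = 2 ∧ deg R v = 0) ∨
      (deg (inftyPaths α β γ δ) v = 0 ∧
        deg (insert s(armNW γ, armSE δ) (overPath α β)) v = 2) := by
  rw [inftyPaths, (strands_infty hα hβ hγ hδ).deg_eq, deg_insert (diag_not_mem_overPath hγ),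
    deg_overPath hα hβ]
  have hR0 : v 0 ^ 2 + v 1 ^ 2 ≤ 2 → deg R v = 0 := by
    intro h
    rw [deg_eq_zero]
    intro e he hv
    linarith [hR e he v (mem_eseg_of_mem hv)]
  have a : (1 : ℝ) ≠ α ∧ (1 : ℝ) ≠ β ∧ (1 : ℝ) ≠ γ ∧ (1 : ℝ) ≠ δ := ⟨hα.ne, hβ.ne, hγ.ne, hδ.ne⟩
  have b : (1 : ℝ) ≠ -α ∧ (-1 : ℝ) ≠ β ∧ (1 : ℝ) ≠ -γ ∧ (-1 : ℝ) ≠ δ := by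
    refine ⟨?_, ?_, ?_, ?_⟩ <;> linarith
  have c : α ≠ 0 ∧ (0 : ℝ) ≠ β ∧ (0 : ℝ) ≠ γ ∧ δ ≠ 0 := by
    refine ⟨?_, ?_, ?_, ?_⟩ <;> linarith
  by_cases h1 : v = !₂[0, 0, 1]
  · right; right
    subst h1
    simp [mult_mk, armSW, armNE, armNW, armSE]
  by_cases h2 : v = armSW 1 ∨ v = armNE 1 ∨ v = armNW 1 ∨ v = armSE 1 ∨ v = !₂[-1 / 2, 0, 0] ∨
      v = !₂[1 / 2, 0, 0]
  · right; left
    rcases h2 with rfl | rfl | rfl | rfl | rfl | rfl <;> refine ⟨?_, hR0 ?_⟩ <;>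
    simp [mult_mk, armSW, armNE, armNW, armSE, a, b, c]
    all_goals norm_num
  · left
    push Not at h2
    simp only [mult_mk, h1, h2, if_false]
    omega

theorem deg_zero (hα : 1 < α) (hβ : 1 < β) (hγ : 1 < γ) (hδ : 1 < δ)
    (hR : ∀ e ∈ R, ∀ x ∈ eseg e, 2 < x 0 ^ 2 + x 1 ^ 2) (v : E3) :
    deg (zeroPaths α β γ δ) v = deg (insert s(armNW γ, armSE δ) (overPath α β)) v ∨
      (deg (zeroPaths α β γ δ) v = 2 ∧ deg R v = 0) ∨
      (deg (zeroPaths α β γ δ) v = 0 ∧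
        deg (insert s(armNW γ, armSE δ) (overPath α β)) v = 2) := by
  rw [zeroPaths, (strands_zero hα hβ hγ hδ).deg_eq, deg_insert (diag_not_mem_overPath hγ),
    deg_overPath hα hβ]
  have hR0 : v 0 ^ 2 + v 1 ^ 2 ≤ 2 → deg R v = 0 := by
    intro h
    rw [deg_eq_zero]
    intro e he hv
    linarith [hR e he v (mem_eseg_of_mem hv)]
  have a : (1 : ℝ) ≠ α ∧ (1 : ℝ) ≠ β ∧ (1 : ℝ) ≠ γ ∧ (1 : ℝ) ≠ δ := ⟨hα.ne, hβ.ne, hγ.ne, hδ.ne⟩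
  have b : (1 : ℝ) ≠ -α ∧ (-1 : ℝ) ≠ β ∧ (-1 : ℝ) ≠ γ ∧ (1 : ℝ) ≠ -δ := by
    refine ⟨?_, ?_, ?_, ?_⟩ <;> linarith
  have c : (0 : ℝ) ≠ α ∧ (0 : ℝ) ≠ β ∧ γ ≠ 0 ∧ (0 : ℝ) ≠ δ ∧ α ≠ 0 ∧ β ≠ 0 ∧ δ ≠ 0 := by
    refine ⟨?_, ?_, ?_, ?_, ?_, ?_, ?_⟩ <;> linarith
  by_cases h1 : v = !₂[0, 0, 1]
  · right; right
    subst h1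
    simp [mult_mk, armSW, armNE, armNW, armSE]
  by_cases h2 : v = armSW 1 ∨ v = armNE 1 ∨ v = armNW 1 ∨ v = armSE 1 ∨ v = !₂[0, -1 / 2, 0] ∨
      v = !₂[0, 1 / 2, 0]
  · right; left
    rcases h2 with rfl | rfl | rfl | rfl | rfl | rfl <;> refine ⟨?_, hR0 ?_⟩ <;>
    simp [mult_mk, armSW, armNE, armNW, armSE, a, b, c]
    all_goals norm_num
  · left
    push Not at h2
    simp only [mult_mk, h1, h2, if_false]
    omega

/-! ### Arms and strands, parametrised along the two diagonals -/

theorem mem_eseg_smul {a b : ℝ} (hab : a ≤ b) {u x : E3} :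
    x ∈ eseg s(a • u, b • u) ↔ ∃ t, a ≤ t ∧ t ≤ b ∧ x = t • u := by
  have h := eseg_map ((LinearMap.toSpanSingleton ℝ E3 u).toAffineMap) s(a, b)
  simp only [Sym2.map_mk, LinearMap.coe_toAffineMap, LinearMap.toSpanSingleton_apply] at h
  rw [h, eseg_mk, segment_eq_Icc hab]
  constructor
  · rintro ⟨t, ⟨h1, h2⟩, rfl⟩; exact ⟨t, h1, h2, rfl⟩
  · rintro ⟨t, h1, h2, rfl⟩; exact ⟨t, ⟨h1, h2⟩, rfl⟩

/-- The direction of the first diagonal. -/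
def diagNE : E3 := !₂[1, 1, 0]
/-- The direction of the second diagonal. -/
def diagSE : E3 := !₂[1, -1, 0]

theorem arm_eq (a : ℝ) : armSW a = (-a) • diagNE ∧ armNE a = a • diagNE ∧
    armNW a = (-a) • diagSE ∧ armSE a = a • diagSE := by
  refine ⟨?_, ?_, ?_, ?_⟩ <;> ext i <;> fin_cases i <;>
    simp [armSW, armNE, armNW, armSE, diagNE, diagSE]

theorem proj_smul_diag {s t : ℝ} : (proj (s • diagNE) = proj (t • diagNE) → s = t) ∧
    (proj (s • diagSE) = proj (t • diagSE) → s = t) := by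
  constructor <;> intro h <;> simpa [proj_apply, diagNE, diagSE] using congrArg Prod.fst h

theorem mem_armSW (hα : 1 < α) {x : E3} :
    x ∈ eseg s(armSW α, armSW 1) ↔ ∃ t, -α ≤ t ∧ t ≤ -1 ∧ x = t • diagNE := by
  rw [(arm_eq α).1, (arm_eq 1).1, mem_eseg_smul (by linarith)]

theorem mem_armNE (hβ : 1 < β) {x : E3} :
    x ∈ eseg s(armNE 1, armNE β) ↔ ∃ t, 1 ≤ t ∧ t ≤ β ∧ x = t • diagNE := by
  rw [(arm_eq β).2.1, (arm_eq 1).2.1, mem_eseg_smul (by linarith)]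

theorem mem_armNW (hγ : 1 < γ) {x : E3} :
    x ∈ eseg s(armNW 1, armNW γ) ↔ ∃ t, -γ ≤ t ∧ t ≤ -1 ∧ x = t • diagSE := by
  rw [Sym2.eq_swap, (arm_eq γ).2.2.1, (arm_eq 1).2.2.1, mem_eseg_smul (by linarith)]

theorem mem_armSE (hδ : 1 < δ) {x : E3} :
    x ∈ eseg s(armSE δ, armSE 1) ↔ ∃ t, 1 ≤ t ∧ t ≤ δ ∧ x = t • diagSE := by
  rw [Sym2.eq_swap, (arm_eq δ).2.2.2, (arm_eq 1).2.2.2, mem_eseg_smul (by linarith)]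

theorem mem_diagNE (hα : 1 ≤ α) (hβ : 1 ≤ β) {x : E3} :
    x ∈ eseg s(armSW α, armNE β) ↔ ∃ t, -α ≤ t ∧ t ≤ β ∧ x = t • diagNE := by
  rw [(arm_eq α).1, (arm_eq β).2.1, mem_eseg_smul (by linarith)]

theorem mem_diagSE (hγ : 1 ≤ γ) (hδ : 1 ≤ δ) {x : E3} :
    x ∈ eseg s(armNW γ, armSE δ) ↔ ∃ t, -γ ≤ t ∧ t ≤ δ ∧ x = t • diagSE := by
  rw [(arm_eq γ).2.2.1, (arm_eq δ).2.2.2, mem_eseg_smul (by linarith)]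

theorem eseg_diagNE (hα : 1 < α) (hβ : 1 < β) : eseg s(armSW α, armNE β) =
    eseg s(armSW 1, armNE 1) ∪ (eseg s(armSW α, armSW 1) ∪ eseg s(armNE 1, armNE β)) := by
  ext x
  rw [mem_diagNE hα.le hβ.le, mem_union, mem_union, mem_diagNE le_rfl le_rfl, mem_armSW hα,
    mem_armNE hβ]
  constructor
  · rintro ⟨t, h1, h2, rfl⟩
    rcases le_total t (-1) with h3 | h3
    · exact .inr (.inl ⟨t, h1, h3, rfl⟩)
    · rcases le_total t 1 with h4 | h4
      · exact .inl ⟨t, h3, h4, rfl⟩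
      · exact .inr (.inr ⟨t, h4, h2, rfl⟩)
  · rintro (⟨t, h1, h2, rfl⟩ | ⟨t, h1, h2, rfl⟩ | ⟨t, h1, h2, rfl⟩) <;>
      exact ⟨t, by linarith, by linarith, rfl⟩

theorem eseg_diagSE (hγ : 1 < γ) (hδ : 1 < δ) : eseg s(armNW γ, armSE δ) =
    eseg s(armNW 1, armSE 1) ∪ (eseg s(armNW 1, armNW γ) ∪ eseg s(armSE δ, armSE 1)) := by
  ext x
  rw [mem_diagSE hγ.le hδ.le, mem_union, mem_union, mem_diagSE le_rfl le_rfl, mem_armNW hγ,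
    mem_armSE hδ]
  constructor
  · rintro ⟨t, h1, h2, rfl⟩
    rcases le_total t (-1) with h3 | h3
    · exact .inr (.inl ⟨t, h1, h3, rfl⟩)
    · rcases le_total t 1 with h4 | h4
      · exact .inl ⟨t, h3, h4, rfl⟩
      · exact .inr (.inr ⟨t, h4, h2, rfl⟩)
  · rintro (⟨t, h1, h2, rfl⟩ | ⟨t, h1, h2, rfl⟩ | ⟨t, h1, h2, rfl⟩) <;>
      exact ⟨t, by linarith, by linarith, rfl⟩

theorem body_pos (hγ : 1 < γ) (hδ : 1 < δ) :
    body (overPath α β ∪ insert s(armNW γ, armSE δ) R) =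
      tanglePos ∪ (body (arms α β γ δ) ∪ body R) := by
  rw [body_union, body_insert, overPath, path5, arms, eseg_diagSE hγ hδ]
  simp only [body_insert, body_singleton]
  simp only [tanglePos, armSW, armSE, armNE, armNW, eseg_mk,
    segment_symm ℝ (!₂[(-1 : ℝ), 1, 0] : E3) !₂[1, -1, 0]]
  ext x; simp only [mem_union]; tauto

theorem body_neg (hα : 1 < α) (hβ : 1 < β) :
    body (overPath' γ δ ∪ insert s(armSW α, armNE β) R) =
      tangleNeg ∪ (body (arms α β γ δ) ∪ body R) := by
  rw [body_union, body_insert, overPath', path5, arms, eseg_diagNE hα hβ]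
  simp only [body_insert, body_singleton, Sym2.eq_swap (a := armNW γ),
    Sym2.eq_swap (a := armSE δ)]
  simp only [tangleNeg, armSW, armSE, armNE, armNW, eseg_mk,
    segment_symm ℝ (!₂[(-1 : ℝ), 1, 0] : E3) !₂[0, 0, 1],
    segment_symm ℝ (!₂[0, 0, 1] : E3) !₂[(1 : ℝ), -1, 0]]
  ext x; simp only [mem_union]; tauto

theorem body_infty :
    body (inftyPaths α β γ δ ∪ R) = tangleInfty ∪ (body (arms α β γ δ) ∪ body R) := by
  rw [body_union, inftyPaths, body_union, path5, path5, arms]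
  simp only [body_insert, body_singleton]
  simp only [tangleInfty, armSW, armSE, armNE, armNW, eseg_mk]
  ext x; simp only [mem_union]; tauto

theorem body_zero :
    body (zeroPaths α β γ δ ∪ R) = tangleZero ∪ (body (arms α β γ δ) ∪ body R) := by
  rw [body_union, zeroPaths, body_union, path5, path5, arms]
  simp only [body_insert, body_singleton, Sym2.eq_swap (a := armNW γ),
    Sym2.eq_swap (a := armSE δ)]
  simp only [tangleZero, armSW, armSE, armNE, armNW, eseg_mk,
    segment_symm ℝ (!₂[(1 : ℝ), -1, 0] : E3)]
  ext x; simp only [mem_union]; tauto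

/-- At parameter `t` on a diagonal the squared norm is `2 * t ^ 2`, so an arm, where `|t| ≥ 1`,
meets the ball only at its inner end. -/
theorem arms_outside (hα : 1 < α) (hβ : 1 < β) (hγ : 1 < γ) (hδ : 1 < δ)
    (hR : ∀ e ∈ R, ∀ x ∈ eseg e, 2 < x 0 ^ 2 + x 1 ^ 2) :
    (body (arms α β γ δ) ∪ body R) ∩ skeinBall ⊆ corners := by
  have sq : ∀ t : ℝ, 1 ≤ t → t ^ 2 + t ^ 2 ≤ 2 → t = 1 := by intro t h1 h2; nlinarith
  rintro x ⟨hx, hb⟩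
  rw [mem_skeinBall] at hb
  rcases hx with hx | hx
  · obtain ⟨e, he, hx⟩ := mem_iUnion₂.1 hx
    rcases mem_arms.1 he with rfl | rfl | rfl | rfl
    · obtain ⟨t, -, h2, rfl⟩ := (mem_armSW hα).1 hx
      have := sq (-t) (by linarith) (by simpa [diagNE] using hb)
      obtain rfl : t = -1 := by linarith
      rw [← (arm_eq 1).1]; simp [corners, armSW]
    · obtain ⟨t, h1, -, rfl⟩ := (mem_armNE hβ).1 hx
      obtain rfl := sq t h1 (by simpa [diagNE] using hb)
      rw [← (arm_eq 1).2.1]; simp [corners, armNE]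
    · obtain ⟨t, -, h2, rfl⟩ := (mem_armNW hγ).1 hx
      have := sq (-t) (by linarith) (by simpa [diagSE] using hb)
      obtain rfl : t = -1 := by linarith
      rw [← (arm_eq 1).2.2.1]; simp [corners, armNW]
    · obtain ⟨t, h1, -, rfl⟩ := (mem_armSE hδ).1 hx
      obtain rfl := sq t h1 (by simpa [diagSE] using hb)
      rw [← (arm_eq 1).2.2.2]; simp [corners, armSE]
  · obtain ⟨e, he, hx⟩ := mem_iUnion₂.1 hx
    nlinarith [hR e he x hx, sq_nonneg (x 2)]

theorem eq_arm_of_norm {e : Sym2 E3} (he : e ∈ arms α β γ δ) :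
    ∃ v ∈ e, v 0 ^ 2 + v 1 ^ 2 ≤ 2 := by
  rcases mem_arms.1 he with rfl | rfl | rfl | rfl
  · exact ⟨armSW 1, by simp, by norm_num [armSW]⟩
  · exact ⟨armNE 1, by simp, by norm_num [armNE]⟩
  · exact ⟨armNW 1, by simp, by norm_num [armNW]⟩
  · exact ⟨armSE 1, by simp, by norm_num [armSE]⟩

/-- The strand of the crossing that contains an arm. -/
def armStrand (α β γ δ : ℝ) (e : Sym2 E3) : Sym2 E3 :=
  if e = s(armSW α, armSW 1) ∨ e = s(armNE 1, armNE β) then s(armSW α, armNE β)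
  else s(armNW γ, armSE δ)

theorem armStrand_eq (hα : 1 < α) :
    armStrand α β γ δ s(armSW α, armSW 1) = s(armSW α, armNE β) ∧
    armStrand α β γ δ s(armNE 1, armNE β) = s(armSW α, armNE β) ∧
    armStrand α β γ δ s(armNW 1, armNW γ) = s(armNW γ, armSE δ) ∧
    armStrand α β γ δ s(armSE δ, armSE 1) = s(armNW γ, armSE δ) := by
  refine ⟨by simp [armStrand], by simp [armStrand], ?_, ?_⟩
  · rw [armStrand, if_neg]
    simp [armSW, armNE, armNW]
    norm_num
    constructor <;> intros <;> linarith
  · rw [armStrand, if_neg]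
    simp [armSW, armNE, armSE]
    norm_num
    constructor <;> intros <;> linarith

theorem diag_crosses (hα : 1 < α) (hβ : 1 < β) (hγ : 1 < γ) (hδ : 1 < δ) :
    Crosses proj s(armSW α, armNE β) s(armNW γ, armSE δ) := by
  rw [crosses_proj]
  refine ⟨?_, 0, ?_, 0, ?_, rfl⟩
  · simp [armSW, armNE, armNW, armSE]
    refine ⟨⟨?_, ?_⟩, ?_, ?_⟩ <;> intros <;> linarith
  · exact (mem_diagNE hα.le hβ.le).2 ⟨0, by linarith, by linarith, by simp⟩
  · exact (mem_diagSE hγ.le hδ.le).2 ⟨0, by linarith, by linarith, by simp⟩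

/-- These are the properties of the arms on which the crossing count in `cnum_smooth` relies. -/
theorem arm_spec (hα : 1 < α) (hβ : 1 < β) (hγ : 1 < γ) (hδ : 1 < δ) {e : Sym2 E3}
    (he : e ∈ arms α β γ δ) :
    (armStrand α β γ δ e = s(armSW α, armNE β) ∨ armStrand α β γ δ e = s(armNW γ, armSE δ)) ∧
      eseg e ⊆ eseg (armStrand α β γ δ e) ∧
      ∀ v ∈ armStrand α β γ δ e, v ∈ e ∨ ∀ x ∈ eseg e, proj x ≠ proj v := by
  obtain ⟨f1, f2, f3, f4⟩ := armStrand_eq (α := α) (β := β) (γ := γ) (δ := δ) hα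
  rcases mem_arms.1 he with rfl | rfl | rfl | rfl
  · rw [f1]
    refine ⟨.inl rfl, ?_, ?_⟩
    · intro x hx
      obtain ⟨t, h1, h2, rfl⟩ := (mem_armSW hα).1 hx
      exact (mem_diagNE hα.le hβ.le).2 ⟨t, by linarith, by linarith, rfl⟩
    · intro v hv
      rcases Sym2.mem_iff.1 hv with rfl | rfl
      · left; simp
      · right; intro x hx h
        obtain ⟨t, h1, h2, rfl⟩ := (mem_armSW hα).1 hx
        rw [(arm_eq β).2.1] at h
        linarith [proj_smul_diag.1 h]
  · rw [f2]
    refine ⟨.inl rfl, ?_, ?_⟩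
    · intro x hx
      obtain ⟨t, h1, h2, rfl⟩ := (mem_armNE hβ).1 hx
      exact (mem_diagNE hα.le hβ.le).2 ⟨t, by linarith, by linarith, rfl⟩
    · intro v hv
      rcases Sym2.mem_iff.1 hv with rfl | rfl
      · right; intro x hx h
        obtain ⟨t, h1, h2, rfl⟩ := (mem_armNE hβ).1 hx
        rw [(arm_eq α).1] at h
        linarith [proj_smul_diag.1 h]
      · left; simp
  · rw [f3]
    refine ⟨.inr rfl, ?_, ?_⟩
    · intro x hx
      obtain ⟨t, h1, h2, rfl⟩ := (mem_armNW hγ).1 hx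
      exact (mem_diagSE hγ.le hδ.le).2 ⟨t, by linarith, by linarith, rfl⟩
    · intro v hv
      rcases Sym2.mem_iff.1 hv with rfl | rfl
      · left; simp
      · right; intro x hx h
        obtain ⟨t, h1, h2, rfl⟩ := (mem_armNW hγ).1 hx
        rw [(arm_eq δ).2.2.2] at h
        linarith [proj_smul_diag.2 h]
  · rw [f4]
    refine ⟨.inr rfl, ?_, ?_⟩
    · intro x hx
      obtain ⟨t, h1, h2, rfl⟩ := (mem_armSE hδ).1 hx
      exact (mem_diagSE hγ.le hδ.le).2 ⟨t, by linarith, by linarith, rfl⟩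
    · intro v hv
      rcases Sym2.mem_iff.1 hv with rfl | rfl
      · right; intro x hx h
        obtain ⟨t, h1, h2, rfl⟩ := (mem_armSE hδ).1 hx
        rw [(arm_eq γ).2.2.1] at h
        linarith [proj_smul_diag.2 h]
      · left; simp

theorem arms_disjoint (hα : 1 < α) (hβ : 1 < β) (hγ : 1 < γ) (hδ : 1 < δ) {e e' : Sym2 E3}
    (he : e ∈ arms α β γ δ) (he' : e' ∈ arms α β γ δ) (hne : e ≠ e')
    (hf : armStrand α β γ δ e = armStrand α β γ δ e') {x y : E3} (hx : x ∈ eseg e)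
    (hy : y ∈ eseg e') : proj x ≠ proj y := by
  obtain ⟨f1, f2, f3, f4⟩ := armStrand_eq (α := α) (β := β) (γ := γ) (δ := δ) hα
  have hk : s(armSW α, armNE β) ≠ s(armNW γ, armSE δ) := by
    intro h
    have h1 := (diag_crosses hα hβ hγ hδ).1 (armSW α) (by simp)
    rw [← h] at h1
    simp at h1
  intro h
  rcases mem_arms.1 he with rfl | rfl | rfl | rfl <;>
    rcases mem_arms.1 he' with rfl | rfl | rfl | rfl <;>
    simp only [f1, f2, f3, f4] at hf <;>
    first
    | exact hne rfl
    | exact hk hf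
    | exact hk hf.symm
    | skip
  · obtain ⟨t, h1, h2, rfl⟩ := (mem_armSW hα).1 hx
    obtain ⟨t', h1', h2', rfl⟩ := (mem_armNE hβ).1 hy
    linarith [proj_smul_diag.1 h]
  · obtain ⟨t, h1, h2, rfl⟩ := (mem_armNE hβ).1 hx
    obtain ⟨t', h1', h2', rfl⟩ := (mem_armSW hα).1 hy
    linarith [proj_smul_diag.1 h]
  · obtain ⟨t, h1, h2, rfl⟩ := (mem_armNW hγ).1 hx
    obtain ⟨t', h1', h2', rfl⟩ := (mem_armSE hδ).1 hy
    linarith [proj_smul_diag.2 h]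
  · obtain ⟨t, h1, h2, rfl⟩ := (mem_armSE hδ).1 hx
    obtain ⟨t', h1', h2', rfl⟩ := (mem_armNW hγ).1 hy
    linarith [proj_smul_diag.2 h]

/-- The smoothings of a crossing in standard position form a skein quadruple with the two crossings,
and they have fewer crossings. -/
theorem exists_standardQuadruple (hα : 1 < α) (hβ : 1 < β) (hγ : 1 < γ) (hδ : 1 < δ)
    (hR : ∀ e ∈ R, ∀ x ∈ eseg e, 2 < x 0 ^ 2 + x 1 ^ 2)
    (hp : PolySys (overPath α β ∪ insert s(armNW γ, armSE δ) R))
    (hn : PolySys (overPath' γ δ ∪ insert s(armSW α, armNE β) R))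
    (hone : ∀ j, j = s(armSW α, armNE β) ∨ j = s(armNW γ, armSE δ) → ∀ e ∈ R, ∀ x ∈ eseg j,
      ∀ x' ∈ eseg j, ∀ y ∈ eseg e, ∀ y' ∈ eseg e,
      proj x = proj y → proj x' = proj y' → proj x = proj x') :
    ∃ Si Sz, PolySys Si ∧ PolySys Sz ∧
      IsStandardQuadruple (body (overPath α β ∪ insert s(armNW γ, armSE δ) R))
        (body (overPath' γ δ ∪ insert s(armSW α, armNE β) R)) (body Si) (body Sz) ∧
      cnum Si proj < cnum (insert s(armSW α, armNE β) (insert s(armNW γ, armSE δ) R)) proj ∧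
      cnum Sz proj < cnum (insert s(armSW α, armNE β) (insert s(armNW γ, armSE δ) R)) proj := by
  have far : ∀ e ∈ R, ∀ v ∈ eseg e, ¬ v 0 ^ 2 + v 1 ^ 2 ≤ 2 := fun e he v hv =>
    not_le.2 (hR e he v hv)
  have hkR : s(armSW α, armNE β) ∉ R := fun h => far _ h 0
    ((mem_diagNE hα.le hβ.le).2 ⟨0, by linarith, by linarith, by simp⟩) (by simp)
  have hkR' : s(armNW γ, armSE δ) ∉ R := fun h => far _ h 0
    ((mem_diagSE hγ.le hδ.le).2 ⟨0, by linarith, by linarith, by simp⟩) (by simp)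
  have harmR : ∀ e ∈ arms α β γ δ, e ∉ R := by
    intro e he he'
    obtain ⟨v, hv, h⟩ := eq_arm_of_norm he
    exact far e he' v (mem_eseg_of_mem hv) h
  have hAR : Disjoint (insert s(armNW γ, armSE δ) (overPath α β)) R := by
    rw [Finset.disjoint_left]
    intro e he
    rcases Finset.mem_insert.1 he with rfl | he
    · exact hkR'
    · rcases mem_path5.1 he with rfl | rfl | rfl | rfl
      · exact fun h => far _ h !₂[0, 0, 1] (mem_eseg_of_mem (by simp)) (by norm_num)
      · exact harmR _ (by simp [mem_arms])
      · exact fun h => far _ h !₂[0, 0, 1] (mem_eseg_of_mem (by simp)) (by norm_num)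
      · exact harmR _ (by simp [mem_arms])
  have hp' : PolySys (insert s(armNW γ, armSE δ) (overPath α β) ∪ R) := by
    rwa [Finset.insert_union, ← Finset.union_insert]
  have harmT : ∀ e ∈ arms α β γ δ, e ∉ R ∧ ∃ T, PolySys T ∧ R ⊆ T ∧ e ∈ T := by
    intro e he
    -- The arms on the first diagonal are edges of the first crossing, where that strand passes
    -- through the tip. The arms on the second diagonal are edges of the second crossing.
    refine ⟨harmR e he, ?_⟩
    have sub : ∀ (N : Finset (Sym2 E3)) (k : Sym2 E3), R ⊆ N ∪ insert k R := fun N k e he =>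
      Finset.mem_union_right _ (Finset.mem_insert_of_mem he)
    rcases mem_arms.1 he with rfl | rfl | rfl | rfl
    · exact ⟨_, hp, sub _ _, Finset.mem_union_left _ (mem_path5.2 (by simp))⟩
    · exact ⟨_, hp, sub _ _, Finset.mem_union_left _ (mem_path5.2 (by simp))⟩
    · exact ⟨_, hn, sub _ _, Finset.mem_union_left _ (mem_path5.2 (by simp))⟩
    · exact ⟨_, hn, sub _ _, Finset.mem_union_left _ (mem_path5.2 (by simp))⟩
  have hsi := strands_infty hα hβ hγ hδ
  have hsz := strands_zero hα hβ hγ hδ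
  have hi : PolySys (inftyPaths α β γ δ ∪ R) :=
    hp'.smooth hAR ⟨_, Finset.mem_union_left _ (Finset.mem_insert_self _ _)⟩ (fun e => hsi.nd)
      (fun e he e' he' => hsi.flat he he') hR (fun e he => (infty_cases he).symm.imp id (harmT e))
      (deg_infty hα hβ hγ hδ hR)
  have hz : PolySys (zeroPaths α β γ δ ∪ R) :=
    hp'.smooth hAR ⟨_, Finset.mem_union_left _ (Finset.mem_insert_self _ _)⟩ (fun e => hsz.nd)
      (fun e he e' he' => hsz.flat he he') hR (fun e he => (zero_cases he).symm.imp id (harmT e))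
      (deg_zero hα hβ hγ hδ hR)
  -- Inner edges of a smoothing project into the disc, edges of `R` project outside it.
  have hin : ∀ e : Sym2 E3, (∀ x ∈ eseg e, x 0 ^ 2 + x 1 ^ 2 ≤ 2) → ∀ e' ∈ R,
      ¬ Crosses proj e e' := by
    intro e he e' he' hc
    obtain ⟨-, x, hx, y, hy, hxy⟩ := crosses_proj.1 hc
    have h0 : x 0 = y 0 := coord_zero_of_proj hxy
    have h1 : x 1 = y 1 := coord_one_of_proj hxy
    have := he x hx
    rw [h0, h1] at this
    exact far e' he' y hy this
  -- The case distinction makes the map the identity on `R`, as `cnum_smooth` demands. The arms are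
  -- not in `R`.
  have hf : ∀ e ∈ arms α β γ δ, (if e ∈ R then e else armStrand α β γ δ e) =
    armStrand α β γ δ e := fun e he => if_neg (harmR e he)
  have hspec : ∀ e ∈ arms α β γ δ,
      ((if e ∈ R then e else armStrand α β γ δ e) = s(armSW α, armNE β) ∨
        (if e ∈ R then e else armStrand α β γ δ e) = s(armNW γ, armSE δ)) ∧
      eseg e ⊆ eseg (if e ∈ R then e else armStrand α β γ δ e) ∧
      ∀ v ∈ (if e ∈ R then e else armStrand α β γ δ e), v ∈ e ∨
        ∀ x ∈ eseg e, proj x ≠ proj v := by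
    intro e he
    rw [hf e he]
    exact arm_spec hα hβ hγ hδ he
  have hdisj : ∀ e ∈ arms α β γ δ, ∀ e' ∈ arms α β γ δ, e ≠ e' →
      (if e ∈ R then e else armStrand α β γ δ e) = (if e' ∈ R then e' else armStrand α β γ δ e') →
      ∀ x ∈ eseg e, ∀ y ∈ eseg e', proj x ≠ proj y := by
    intro e he e' he' hne h x hx y hy
    rw [hf e he, hf e' he'] at h
    exact arms_disjoint hα hβ hγ hδ he he' hne h hx hy
  refine ⟨_, _, hi, hz, ?_, ?_, ?_⟩
  · have lp := hp.isPolygonalLink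
    have ln := hn.isPolygonalLink
    have li := hi.isPolygonalLink
    have lz := hz.isPolygonalLink
    rw [body_pos hγ hδ] at lp ⊢
    rw [body_neg hα hβ] at ln ⊢
    rw [body_infty] at li ⊢
    rw [body_zero] at lz ⊢
    exact isStandardQuadruple_of_union (arms_outside hα hβ hγ hδ hR) lp ln li lz
  · exact cnum_smooth hkR hkR' (diag_crosses hα hβ hγ hδ)
      (fun e => if e ∈ R then e else armStrand α β γ δ e) (fun e he => if_pos he)
      (fun e he he' => hin e ((infty_cases he).resolve_left he')) hspec
      (fun e he e' he' => hsi.not_crosses (fun _ _ => coord_one_of_proj)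
        (fun _ _ => coord_zero_of_proj) he he') hone hdisj
  · exact cnum_smooth hkR hkR' (diag_crosses hα hβ hγ hδ)
      (fun e => if e ∈ R then e else armStrand α β γ δ e) (fun e he => if_pos he)
      (fun e he he' => hin e ((zero_cases he).resolve_left he')) hspec
      (fun e he e' he' => hsz.not_crosses (fun _ _ => coord_zero_of_proj)
        (fun _ _ => coord_one_of_proj) he he') hone hdisj

end standard
end

end

section
open Set Topology Filter
open scoped Classical
noncomputable section
attribute [local instance] sym2DecEq

/-! ### Affine changes of coordinates -/

/-- The linear map with given values at the basis vectors. -/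
def frameMap (F₀ F₁ F₂ : E3) : E3 →ₗ[ℝ] E3 :=
  (coord 0).smulRight F₀ + (coord 1).smulRight F₁ + (coord 2).smulRight F₂

theorem frameMap_apply (F₀ F₁ F₂ x : E3) :
    frameMap F₀ F₁ F₂ x = x 0 • F₀ + x 1 • F₁ + x 2 • F₂ := rfl

theorem frameMap_injective {F₀ F₁ F₂ : E3} (h0 : F₂ 0 = 0) (h1 : F₂ 1 = 0) (h2 : F₂ 2 ≠ 0)
    (hd : F₀ 0 * F₁ 1 - F₁ 0 * F₀ 1 ≠ 0) : Function.Injective (frameMap F₀ F₁ F₂) := by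
  rw [injective_iff_map_eq_zero]
  intro x hx
  rw [frameMap_apply] at hx
  have e0 := congrArg (fun v : E3 => v 0) hx
  have e1 := congrArg (fun v : E3 => v 1) hx
  have e2 := congrArg (fun v : E3 => v 2) hx
  simp only [PiLp.add_apply, PiLp.smul_apply, smul_eq_mul, PiLp.zero_apply, h0, h1, mul_zero,
    add_zero] at e0 e1 e2
  have x0 : x 0 = 0 := by
    refine (mul_eq_zero.1 (?_ : (F₀ 0 * F₁ 1 - F₁ 0 * F₀ 1) * x 0 = 0)).resolve_left hd
    linear_combination F₁ 1 * e0 - F₁ 0 * e1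
  have x1 : x 1 = 0 := by
    refine (mul_eq_zero.1 (?_ : (F₀ 0 * F₁ 1 - F₁ 0 * F₀ 1) * x 1 = 0)).resolve_left hd
    linear_combination F₀ 0 * e1 - F₀ 1 * e0
  rw [x0, x1] at e2
  have x2 : x 2 = 0 := by
    refine (mul_eq_zero.1 (?_ : x 2 * F₂ 2 = 0)).resolve_right h2
    linarith
  ext i
  fin_cases i
  exacts [x0, x1, x2]

/-- The affine homeomorphism with a given injective linear part. -/
def affineHomeo (X : E3) (f : E3 →ₗ[ℝ] E3) (hf : Function.Injective f) : E3 ≃ₜ E3 :=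
  (LinearEquiv.ofInjectiveEndo f hf).toContinuousLinearEquiv.toHomeomorph.trans
    (Homeomorph.addLeft X)

theorem affineHomeo_apply (X : E3) (f : E3 →ₗ[ℝ] E3) (hf : Function.Injective f) (x : E3) :
    affineHomeo X f hf x = X + f x := rfl

/-- An affine map whose linear part is block triangular, with a positive determinant and a
non-negative trace of the upper block and a positive lower entry, is isotopic to the identity. -/
theorem exists_isotopy_affine (X F₀ F₁ : E3) {s : ℝ} (hs : 0 < s)
    (hd : 0 < F₀ 0 * F₁ 1 - F₁ 0 * F₀ 1) (ht : 0 ≤ F₀ 0 + F₁ 1) :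
    ∃ Ψ : E3 ≃ₜ E3, IsFinalMapOfIsotopy Ψ ∧
      ∀ x, Ψ x = X + (x 0 • F₀ + x 1 • F₁ + x 2 • (s • ez)) := by
  -- On the straight path from the identity the upper block has determinant `(1 - t) ^ 2 + t * (1 -
  -- t) * trace + t ^ 2 * det`, which is positive. This is where the sign of the trace enters.
  have inj : ∀ t : unitInterval, Function.Injective
      (frameMap ((1 - t : ℝ) • !₂[1, 0, 0] + (t : ℝ) • F₀) ((1 - t : ℝ) • !₂[0, 1, 0] + (t : ℝ) • F₁)
        ((1 - t : ℝ) • ez + (t : ℝ) • s • ez)) := by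
    rintro ⟨t, t0, t1⟩
    refine frameMap_injective (by simp [ez]) (by simp [ez]) ?_ ?_
    · simp only [ez, PiLp.add_apply, PiLp.smul_apply, smul_eq_mul]
      simp
      rcases t0.eq_or_lt with rfl | t0
      · simp
      · have := mul_pos t0 hs
        nlinarith
    · simp
      rcases t0.eq_or_lt with rfl | t0'
      · simp
      · have h1 := mul_pos (mul_pos t0' t0') hd
        have h2 := mul_nonneg (mul_nonneg t0 (sub_nonneg.2 t1)) ht
        nlinarith [sq_nonneg (1 - t)]
  have base : ∀ x : E3, x 0 • (!₂[1, 0, 0] : E3) + x 1 • (!₂[0, 1, 0] : E3) + x 2 • ez = x := by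
    intro x; ext i; fin_cases i <;> simp [ez]
  have val : ∀ (t : unitInterval) (x : E3),
      affineHomeo ((t : ℝ) • X) _ (inj t) x =
        (1 - t : ℝ) • x + (t : ℝ) • (X + (x 0 • F₀ + x 1 • F₁ + x 2 • (s • ez))) := by
    intro t x
    rw [affineHomeo_apply, frameMap_apply]
    have h : (1 - t : ℝ) • x = (1 - t : ℝ) • (x 0 • (!₂[1, 0, 0] : E3) +
      x 1 • (!₂[0, 1, 0] : E3) + x 2 • ez) := by rw [base x]
    rw [h]
    module
  refine ⟨affineHomeo _ _ (inj 1), ⟨fun t => affineHomeo ((t : ℝ) • X) _ (inj t), ?_, ?_, rfl⟩, ?_⟩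
  · simp only [val]
    fun_prop
  · ext1 x
    rw [val]
    simp
  · intro x
    rw [val]
    simp

theorem SkeinClosed.iff {Z : Set E3 → Prop} (hZ : SkeinClosed Z) {L L' : Set E3}
    (h : AmbientIsotopic L L') : Z L ↔ Z L' := ⟨hZ.iso h, hZ.iso h.symm⟩

theorem path5_image {V W : Type*} (f : V → W) (P₀ P₁ P₂ P₃ P₄ : V) :
    (path5 P₀ P₁ P₂ P₃ P₄).image (Sym2.map f) = path5 (f P₀) (f P₁) (f P₂) (f P₃) (f P₄) := by
  simp [path5, Finset.image_insert]

theorem LnMap.symm {Ψ : E3 ≃ₜ E3} (h : LnMap Ψ) : LnMap Ψ.symm := by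
  intro P T t
  apply Ψ.injective
  rw [h, Ψ.apply_symm_apply, Ψ.apply_symm_apply, Ψ.apply_symm_apply]

theorem PolySys.image_homeo {S : Finset (Sym2 E3)} (h : PolySys S) {Ψ : E3 ≃ₜ E3}
    (hΨ : IsFinalMapOfIsotopy Ψ) (hl : LnMap Ψ) : PolySys (S.image (Sym2.map Ψ)) ∧
      AmbientIsotopic (body S) (body (S.image (Sym2.map Ψ))) := by
  obtain ⟨h1, h2⟩ := h.image_ln hl Ψ.injective
  exact ⟨h1, Ψ, hΨ, h2.symm⟩

/-! ### Generic planar diagrams -/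

/-- A closed planar polygonal diagram whose only singularities are transverse double points. -/
structure Gen (P : Finset (Sym2 (ℝ × ℝ))) : Prop where
  nd : ∀ e ∈ P, ¬ e.IsDiag
  sing : ∀ e ∈ P, ∀ e' ∈ P, e ≠ e' → ∀ q ∈ eseg e, q ∈ eseg e' → ∀ q' ∈ eseg e, q' ∈ eseg e' →
    q = q'
  vert : ∀ e ∈ P, ∀ v ∈ e, ∀ e' ∈ P, v ∈ eseg e' → v ∈ e'
  triple : ∀ e ∈ P, ∀ e' ∈ P, ∀ e'' ∈ P, e ≠ e' → e ≠ e'' → e' ≠ e'' → ∀ q ∈ eseg e, q ∈ eseg e' →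
    q ∈ eseg e'' → q ∈ e
  deg : ∀ v, deg P v = 0 ∨ deg P v = 2

theorem exists_radius {X : ℝ × ℝ} {R : Finset (Sym2 (ℝ × ℝ))} (h : ∀ e ∈ R, X ∉ eseg e) :
    ∃ r : ℝ, 0 < r ∧ ∀ e ∈ R, ∀ q ∈ eseg e, r ≤ dist q X := by
  obtain ⟨r, h0, h1⟩ := exists_pos_le_dist_of_disjoint (s := ⋃ e ∈ R, eseg e) (t := {X})
    (R.finite_toSet.isCompact_biUnion fun e _ => isCompact_eseg e) isCompact_singleton
    (by rw [disjoint_singleton_right]; simpa using h)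
  exact ⟨r, h0, fun e he q hq => h1 q (mem_biUnion he hq) X rfl⟩

section crossing
variable {R : Finset (Sym2 (ℝ × ℝ))} {A B C D : ℝ × ℝ} {zp zn z0 : ℝ × ℝ → ℝ} {σ ρ : ℝ}
  {Z : Set E3 → Prop}

/-- The tent over the first of two crossing strands. -/
theorem Gen.tent {s : ℝ} {r : ℝ} (hP : Gen (insert s(A, B) (insert s(C, D) R)))
    (hAB : s(A, B) ∉ insert s(C, D) R)
    (hs : 0 < s) (hsσ : s < σ) (hσ : σ + s < 1) (hρ : 0 ≤ ρ ∧ ρ ≤ 1) (hX : ln A B σ = ln C D ρ)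
    (hr : ∀ e ∈ R, ∀ q ∈ eseg e, r ≤ dist q (ln A B σ)) (hsr : s * ‖B - A‖ < r)
    (hover : Over zp s(A, B) s(C, D)) (h0 : ln (z0 A) (z0 B) σ = ln (z0 C) (z0 D) ρ)
    (hside : ∀ e ∈ insert s(A, B) (insert s(C, D) R), ∀ e' ∈ insert s(A, B) (insert s(C, D) R),
      e ≠ e' → ¬ (e = s(A, B) ∧ e' = s(C, D)) → ¬ (e = s(C, D) ∧ e' = s(A, B)) →
      SameSide zp z0 e e') :
    PolySys (path5 (lift z0 A) (ln (lift z0 A) (lift z0 B) (σ - s))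
        (ln (lift z0 A) (lift z0 B) σ + s • ez) (ln (lift z0 A) (lift z0 B) (σ + s)) (lift z0 B) ∪
        insert s(lift z0 C, lift z0 D) (sys z0 R)) ∧
      AmbientIsotopic (body (sys zp (insert s(A, B) (insert s(C, D) R))))
        (body (path5 (lift z0 A) (ln (lift z0 A) (lift z0 B) (σ - s))
        (ln (lift z0 A) (lift z0 B) σ + s • ez) (ln (lift z0 A) (lift z0 B) (σ + s)) (lift z0 B) ∪
        insert s(lift z0 C, lift z0 D) (sys z0 R))) := by
  have hne : A ≠ B := by simpa using hP.nd _ (Finset.mem_insert_self _ _)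
  have hCDm : s(C, D) ∈ insert s(C, D) R := Finset.mem_insert_self _ _
  have hABm : s(A, B) ∈ insert s(A, B) (insert s(C, D) R) := Finset.mem_insert_self _ _
  have hm : ∀ e ∈ insert s(C, D) R, e ∈ insert s(A, B) (insert s(C, D) R) := fun e he =>
    Finset.mem_insert_of_mem he
  have hneq : ∀ e ∈ insert s(C, D) R, s(A, B) ≠ e := by rintro e he rfl; exact hAB he
  have hσm : ln A B σ ∈ eseg s(A, B) := mem_eseg_iff.2 ⟨σ, by linarith, by linarith, rfl⟩
  have h := tent_isotopy (z0 := z0) (zp := zp) (η := s) hAB hCDm hP.deg hP.nd ?_ hs hsσ hσ hX ?_ ?_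
    hρ.1 hρ.2 hover h0 hs ?_ ?_
  · simpa only [insert_eq_path5_union, sys, Finset.image_insert, Sym2.map_mk] using h
  · intro e he t t0 t1 hmem
    have := hP.vert e (hm e he) _ hmem _ hABm (mem_eseg_iff.2 ⟨t, t0.le, t1.le, rfl⟩)
    rcases Sym2.mem_iff.1 this with h1 | h1
    · have := ln_injective hne (h1.trans (ln_zero A B).symm)
      exact t0.ne' this
    · have := ln_injective hne (h1.trans (ln_one A B).symm)
      exact t1.ne this
  · intro q hq hq'
    exact hP.sing _ hABm _ (hm _ hCDm) (hneq _ hCDm) q hq hq' _ hσm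
      (mem_eseg_iff.2 ⟨ρ, hρ.1, hρ.2, hX⟩)
  -- A point of `A B` whose parameter differs from `σ` by at most `s` is within `s * ‖B - A‖ < r` of
  -- the crossing, hence on no edge of `R`.
  · intro e he hne t t0 t1 hmem
    have he' : e ∈ R := (Finset.mem_insert.1 he).resolve_left hne
    have h1 := hr e he' _ hmem
    have h2 : ln A B t - ln A B σ = (t - σ) • (B - A) := by simp only [ln]; module
    rw [dist_eq_norm, h2, norm_smul, Real.norm_eq_abs] at h1
    have h3 : |t - σ| ≤ s := abs_le.2 ⟨by linarith, by linarith⟩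
    nlinarith [norm_nonneg (B - A)]
  · intro e he hne
    exact hside _ hABm _ (hm e he) (hneq e he) (fun h => hne h.2) (fun h => hneq _ hCDm h.1)
  · intro e he e' he' hne
    exact hside _ (hm e he) _ (hm e' he') hne (fun h => hneq e he h.1.symm)
      (fun h => hneq e' he' h.2.symm)

/-- The map preserves the vertical direction and therefore induces an affine map of the plane. -/
theorem planar_of_proj {Ψ : E3 → E3} {X F₀ F₁ : E3} {s : ℝ}
    (hΨ : ∀ x, Ψ x = X + (x 0 • F₀ + x 1 • F₁ + x 2 • (s • ez))) (x : E3) :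
    proj (Ψ x) = proj X + ((proj x).1 • proj F₀ + (proj x).2 • proj F₁) := by
  have h : proj ez = 0 := by simp [proj_apply, ez]
  rw [hΨ]
  simp only [map_add, map_smul, h, smul_zero, add_zero]
  rfl

set_option maxHeartbeats 1000000 in
/-- Changing a generic crossing in a skein-closed class, when the strands are labelled in such a way
that the standard crossing is reached by an isotopy. -/
theorem Gen.crossing_of_oriented (hZ : SkeinClosed Z)
    (hP : Gen (insert s(A, B) (insert s(C, D) R)))
    (hAB : s(A, B) ∉ insert s(C, D) R) (hCD : s(C, D) ∉ R) (hσ : 0 < σ ∧ σ < 1) (hρ : 0 < ρ ∧ ρ < 1)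
    (hX : ln A B σ = ln C D ρ) (hover : Over zp s(A, B) s(C, D)) (hover' : Over zn s(C, D) s(A, B))
    (h0 : ln (z0 A) (z0 B) σ = ln (z0 C) (z0 D) ρ)
    (hside : ∀ e ∈ insert s(A, B) (insert s(C, D) R), ∀ e' ∈ insert s(A, B) (insert s(C, D) R),
      e ≠ e' → ¬ (e = s(A, B) ∧ e' = s(C, D)) → ¬ (e = s(C, D) ∧ e' = s(A, B)) →
      SameSide zp z0 e e' ∧ SameSide zn z0 e e')
    (hdet : 0 < (B - A).1 * (C - D).2 - (B - A).2 * (C - D).1)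
    (htr : 0 ≤ ((B - A).1 - (C - D).1) + ((B - A).2 + (C - D).2))
    (hlt : ∀ S, PolySys S → cnum S proj < cnum (insert s(A, B) (insert s(C, D) R)) id →
      Z (body S)) :
    Z (body (sys zp (insert s(A, B) (insert s(C, D) R)))) ↔
      Z (body (sys zn (insert s(A, B) (insert s(C, D) R)))) := by
  set P := insert s(A, B) (insert s(C, D) R) with hPdef
  have hcomm : insert s(C, D) (insert s(A, B) R) = P := Finset.insert_comm _ _ _
  have hne : A ≠ B := by simpa using hP.nd _ (Finset.mem_insert_self _ _)
  have hneq : s(A, B) ≠ s(C, D) := fun h => hAB (h ▸ Finset.mem_insert_self _ _)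
  have hABR : s(A, B) ∉ R := fun h => hAB (Finset.mem_insert_of_mem h)
  have hCD' : s(C, D) ∉ insert s(A, B) R := by
    rw [Finset.mem_insert]; rintro (h | h)
    exacts [hneq h.symm, hCD h]
  have mAB : s(A, B) ∈ P := Finset.mem_insert_self _ _
  have mCD : s(C, D) ∈ P := Finset.mem_insert_of_mem (Finset.mem_insert_self _ _)
  have mR : ∀ e ∈ R, e ∈ P := fun e he => Finset.mem_insert_of_mem (Finset.mem_insert_of_mem he)
  have XAB : ln A B σ ∈ eseg s(A, B) := mem_eseg_iff.2 ⟨σ, hσ.1.le, hσ.2.le, rfl⟩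
  have XCD : ln A B σ ∈ eseg s(C, D) := mem_eseg_iff.2 ⟨ρ, hρ.1.le, hρ.2.le, hX⟩
  have hXR : ∀ e ∈ R, ln A B σ ∉ eseg e := by
    intro e he hXe
    have := hP.triple _ mAB _ mCD _ (mR e he) hneq (by rintro rfl; exact hABR he)
      (by rintro rfl; exact hCD he) _ XAB XCD hXe
    rcases Sym2.mem_iff.1 this with h1 | h1
    · exact hσ.1.ne' (ln_injective hne (h1.trans (ln_zero A B).symm))
    · exact hσ.2.ne (ln_injective hne (h1.trans (ln_one A B).symm))
  obtain ⟨r, r0, hr⟩ := exists_radius hXR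
  -- The first four bounds keep the cut points inside the two edges. The last keeps the image of the
  -- cylinder over the disc of radius `√2` within planar distance `r` of the crossing, away from all
  -- other edges.
  obtain ⟨s, s0, sσ, sσ', sρ, sρ', sr⟩ : ∃ s : ℝ, 0 < s ∧ s < σ ∧ s < 1 - σ ∧ s < ρ ∧ s < 1 - ρ ∧
      s * (4 * (‖B - A‖ + ‖C - D‖ + 1)) < r := by
    have hK : 0 < 4 * (‖B - A‖ + ‖C - D‖ + 1) := by positivity
    have h1 := hσ.1
    have h2 := sub_pos.2 hσ.2
    have h3 := hρ.1
    have h4 := sub_pos.2 hρ.2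
    have h5 := div_pos r0 hK
    obtain ⟨s, s0, hs⟩ := exists_between (lt_min (lt_min (lt_min h1 h2) (lt_min h3 h4)) h5)
    simp only [lt_min_iff] at hs
    exact ⟨s, s0, hs.1.1.1, hs.1.1.2, hs.1.2.1, hs.1.2.2, (lt_div_iff₀ hK).1 hs.2⟩
  -- The two crossings become the two ways of raising one strand over the other from the common
  -- singular heights `z0`.
  have t1 := Gen.tent (z0 := z0) (zp := zp) hP hAB s0 sσ (by linarith) ⟨hρ.1.le, hρ.2.le⟩ hX hr
    (by nlinarith [norm_nonneg (B - A), norm_nonneg (C - D)]) hover h0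
    (fun e he e' he' h1 h2 h3 => (hside e he e' he' h1 h2 h3).1)
  have t2 := Gen.tent (z0 := z0) (zp := zn) (hcomm ▸ hP) hCD' s0 sρ (by linarith)
    ⟨hσ.1.le, hσ.2.le⟩ hX.symm (by rwa [← hX])
    (by rw [norm_sub_rev]; nlinarith [norm_nonneg (B - A), norm_nonneg (C - D)]) hover' h0.symm
    (fun e he e' he' h1 h2 h3 => (hside e (hcomm ▸ he) e' (hcomm ▸ he') h1
      (fun h => h3 h) (fun h => h2 h)).2)
  rw [hcomm] at t2
  set A0 := lift z0 A with hA0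
  set B0 := lift z0 B with hB0
  set C0 := lift z0 C with hC0
  set D0 := lift z0 D with hD0
  have hX0 : ln A0 B0 σ = ln C0 D0 ρ := by
    refine E3.ext_proj ?_ ?_
    · rw [map_ln, map_ln, hA0, hB0, hC0, hD0, proj_lift, proj_lift, proj_lift, proj_lift, hX]
    · have := map_ln (coord 2) A0 B0 σ
      have h' := map_ln (coord 2) C0 D0 ρ
      simp only [coord_apply, hA0, hB0, hC0, hD0, lift_two] at this h'
      rw [hA0, hB0, hC0, hD0, this, h', h0]
  -- `Ψ` sends the diagonal direction `(1, 1, 0)` to `s • (B0 - A0)`, the direction `(1, -1, 0)` to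
  -- `s • (D0 - C0)` and the tip `(0, 0, 1)` to the top of the tent. So `A`, `B`, `C`, `D` become
  -- the ends SW, NE, NW, SE, and the two hypotheses on the labelling are those on determinant and
  -- trace.
  obtain ⟨Ψ, iΨ, hΨ⟩ := exists_isotopy_affine (ln A0 B0 σ) ((s / 2) • ((B0 - A0) - (C0 - D0)))
    ((s / 2) • ((B0 - A0) + (C0 - D0))) s0 (by
      simp only [hA0, hB0, hC0, hD0, lift, PiLp.smul_apply, PiLp.sub_apply, PiLp.add_apply]
      simp
      simp only [Prod.fst_sub, Prod.snd_sub] at hdet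
      nlinarith [mul_pos (mul_pos s0 s0) hdet]) (by
      simp only [hA0, hB0, hC0, hD0, lift, PiLp.smul_apply, PiLp.sub_apply, PiLp.add_apply]
      simp
      simp only [Prod.fst_sub, Prod.snd_sub] at htr
      nlinarith [mul_nonneg s0.le htr])
  have lΨ : LnMap Ψ := by
    intro U T t
    have hc : ∀ i, (ln U T t) i = (1 - t) * U i + t * T i := fun i => by simp [ln]
    rw [hΨ, hΨ, hΨ, hc, hc, hc]
    simp only [ln]
    module
  have vSW : ∀ a, Ψ (armSW a) = ln A0 B0 (σ - a * s) := by
    intro a; rw [hΨ]; simp [armSW]; simp only [ln]; module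
  have vNE : ∀ a, Ψ (armNE a) = ln A0 B0 (σ + a * s) := by
    intro a; rw [hΨ]; simp [armNE]; simp only [ln]; module
  have vNW : ∀ a, Ψ (armNW a) = ln C0 D0 (ρ - a * s) := by
    intro a; rw [hΨ, hX0]; simp [armNW]; simp only [ln]; module
  have vSE : ∀ a, Ψ (armSE a) = ln C0 D0 (ρ + a * s) := by
    intro a; rw [hΨ, hX0]; simp [armSE]; simp only [ln]; module
  have vT : Ψ !₂[0, 0, 1] = ln A0 B0 σ + s • ez := by
    rw [hΨ]; simp
  have eA : Ψ.symm A0 = armSW (σ / s) := by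
    rw [Homeomorph.symm_apply_eq, vSW, div_mul_cancel₀ _ s0.ne', sub_self, ln_zero]
  have eB : Ψ.symm B0 = armNE ((1 - σ) / s) := by
    rw [Homeomorph.symm_apply_eq, vNE, div_mul_cancel₀ _ s0.ne', add_sub_cancel, ln_one]
  have eC : Ψ.symm C0 = armNW (ρ / s) := by
    rw [Homeomorph.symm_apply_eq, vNW, div_mul_cancel₀ _ s0.ne', sub_self, ln_zero]
  have eD : Ψ.symm D0 = armSE ((1 - ρ) / s) := by
    rw [Homeomorph.symm_apply_eq, vSE, div_mul_cancel₀ _ s0.ne', add_sub_cancel, ln_one]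
  have e1 : Ψ.symm (ln A0 B0 (σ - s)) = armSW 1 := by
    rw [Homeomorph.symm_apply_eq, vSW, one_mul]
  have e2 : Ψ.symm (ln A0 B0 (σ + s)) = armNE 1 := by
    rw [Homeomorph.symm_apply_eq, vNE, one_mul]
  have e3 : Ψ.symm (ln C0 D0 (ρ - s)) = armNW 1 := by
    rw [Homeomorph.symm_apply_eq, vNW, one_mul]
  have e4 : Ψ.symm (ln C0 D0 (ρ + s)) = armSE 1 := by
    rw [Homeomorph.symm_apply_eq, vSE, one_mul]
  have e5 : Ψ.symm (ln A0 B0 σ + s • ez) = !₂[0, 0, 1] := by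
    rw [Homeomorph.symm_apply_eq, vT]
  set R' := (sys z0 R).image (Sym2.map Ψ.symm) with hR'
  have q1 := t1.1.image_homeo iΨ.symm lΨ.symm
  rw [← hX0] at t2
  have q2 := t2.1.image_homeo iΨ.symm lΨ.symm
  simp only [Finset.image_union, path5_image, Finset.image_insert, Sym2.map_mk, eA, eB, eC, eD, e1,
    e2, e3, e4, e5, ← hR'] at q1 q2
  rw [hZ.iff (t1.2.trans q1.2), hZ.iff (t2.2.trans q2.2)]
  set f₀ := proj ((s / 2) • ((B0 - A0) - (C0 - D0))) with hf₀
  set f₁ := proj ((s / 2) • ((B0 - A0) + (C0 - D0))) with hf₁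
  have hpX : proj (ln A0 B0 σ) = ln A B σ := by
    rw [map_ln, hA0, hB0, proj_lift, proj_lift]
  have hpl : ∀ x, proj (Ψ x) = ln A B σ + ((proj x).1 • f₀ + (proj x).2 • f₁) := by
    intro x; rw [planar_of_proj hΨ, hpX]
  have hshift : ∀ (x : E3) (c : ℝ), Ψ (x + (c / s) • ez) = Ψ x + c • ez := by
    intro x c
    rw [hΨ, hΨ]
    have e0 : (x + (c / s) • ez) 0 = x 0 := by simp [ez]
    have e1 : (x + (c / s) • ez) 1 = x 1 := by simp [ez]
    have e2 : (x + (c / s) • ez) 2 = x 2 + c / s := by simp [ez]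
    have e3 : c • ez = (c / s) • s • ez := by rw [smul_smul, div_mul_cancel₀ _ s0.ne']
    rw [e0, e1, e2, e3]
    module
  -- Two points of a vertical line differ by a multiple of `ez`, and so do their preimages under
  -- `Ψ`.
  have hinj : ∀ x x', proj (Ψ x) = proj (Ψ x') → proj x = proj x' := by
    intro x x' h
    have h1 : Ψ x' = Ψ (x + (((Ψ x') 2 - (Ψ x) 2) / s) • ez) := by
      rw [hshift]
      refine E3.ext_proj ?_ ?_
      · have : proj ez = 0 := by simp [proj_apply, ez]
        rw [map_add, map_smul, this, smul_zero, add_zero, h]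
      · simp [ez]
    rw [Ψ.injective h1]
    have : proj ez = 0 := by simp [proj_apply, ez]
    rw [map_add, map_smul, this, smul_zero, add_zero]
  have hmem : ∀ k : Sym2 (ℝ × ℝ), ∀ x ∈ eseg ((k.map (lift z0)).map Ψ.symm),
      proj (Ψ x) ∈ eseg k := by
    intro k x hx
    rw [lΨ.symm.eseg_map] at hx
    obtain ⟨y, hy, rfl⟩ := hx
    rw [Ψ.apply_symm_apply]
    exact proj_mem_eseg hy
  have kAB : s(armSW (σ / s), armNE ((1 - σ) / s)) = (s(A, B).map (lift z0)).map Ψ.symm := by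
    simp only [Sym2.map_mk, ← hA0, ← hB0, eA, eB]
  have kCD : s(armNW (ρ / s), armSE ((1 - ρ) / s)) = (s(C, D).map (lift z0)).map Ψ.symm := by
    simp only [Sym2.map_mk, ← hC0, ← hD0, eC, eD]
  have hR2 : ∀ e ∈ R', ∃ k ∈ R, e = (k.map (lift z0)).map Ψ.symm := by
    intro e he
    obtain ⟨_, h1, rfl⟩ := Finset.mem_image.1 he
    obtain ⟨k, hk, rfl⟩ := Finset.mem_image.1 h1
    exact ⟨k, hk, rfl⟩
  have hfar : ∀ e ∈ R', ∀ x ∈ eseg e, 2 < x 0 ^ 2 + x 1 ^ 2 := by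
    intro e he x hx
    obtain ⟨k, hk, rfl⟩ := hR2 e he
    -- A point over the disc has its first two coordinates bounded by `2`, and the choice of `s`
    -- then puts its image too close to the crossing.
    by_contra! h2
    have h3 := hr k hk _ (hmem k x hx)
    rw [hpl, dist_eq_norm, add_sub_cancel_left] at h3
    have b0 : |(proj x).1| ≤ 2 := by
      change |x 0| ≤ 2
      exact abs_le_of_sq_le_sq (by nlinarith [sq_nonneg (x 1)]) (by norm_num)
    have b1 : |(proj x).2| ≤ 2 := by
      change |x 1| ≤ 2
      exact abs_le_of_sq_le_sq (by nlinarith [sq_nonneg (x 0)]) (by norm_num)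
    have c0 : ‖f₀‖ ≤ s / 2 * (‖B - A‖ + ‖C - D‖) := by
      rw [hf₀, map_smul, norm_smul, Real.norm_of_nonneg (by positivity)]
      simp only [map_sub, hA0, hB0, hC0, hD0, proj_lift]
      gcongr
      exact norm_sub_le _ _
    have c1 : ‖f₁‖ ≤ s / 2 * (‖B - A‖ + ‖C - D‖) := by
      rw [hf₁, map_smul, norm_smul, Real.norm_of_nonneg (by positivity)]
      simp only [map_sub, map_add, hA0, hB0, hC0, hD0, proj_lift]
      gcongr
      exact norm_add_le _ _
    have h4 := norm_add_le ((proj x).1 • f₀) ((proj x).2 • f₁)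
    rw [norm_smul, norm_smul, Real.norm_eq_abs, Real.norm_eq_abs] at h4
    have h5 : |(proj x).1| * ‖f₀‖ ≤ 2 * (s / 2 * (‖B - A‖ + ‖C - D‖)) := by gcongr
    have h6 : |(proj x).2| * ‖f₁‖ ≤ 2 * (s / 2 * (‖B - A‖ + ‖C - D‖)) := by gcongr
    nlinarith [mul_nonneg s0.le (norm_nonneg (B - A)), mul_nonneg s0.le (norm_nonneg (C - D))]
  have hone : ∀ j, j = s(armSW (σ / s), armNE ((1 - σ) / s)) ∨
      j = s(armNW (ρ / s), armSE ((1 - ρ) / s)) → ∀ e ∈ R', ∀ x ∈ eseg j, ∀ x' ∈ eseg j,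
      ∀ y ∈ eseg e, ∀ y' ∈ eseg e, proj x = proj y → proj x' = proj y' → proj x = proj x' := by
    intro j hj e he
    obtain ⟨m, hm, rfl⟩ := hR2 e he
    have hk : ∃ k ∈ P, k ≠ m ∧ j = (k.map (lift z0)).map Ψ.symm := by
      rcases hj with rfl | rfl
      · exact ⟨_, mAB, by rintro rfl; exact hABR hm, kAB⟩
      · exact ⟨_, mCD, by rintro rfl; exact hCD hm, kCD⟩
    obtain ⟨k, hk, hkm, rfl⟩ := hk
    intro x hx x' hx' y hy y' hy' h1 h2
    have g1 : proj (Ψ x) = proj (Ψ y) := by rw [hpl, hpl, h1]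
    have g2 : proj (Ψ x') = proj (Ψ y') := by rw [hpl, hpl, h2]
    refine hinj _ _ (hP.sing k hk m (mR m hm) hkm _ (hmem k x hx) ?_ _ (hmem k x' hx') ?_)
    · rw [g1]; exact hmem m y hy
    · rw [g2]; exact hmem m y' hy'
  obtain ⟨Si, Sz, hi, hz, hq, hci, hcz⟩ := exists_standardQuadruple ((one_lt_div s0).2 sσ)
    ((one_lt_div s0).2 sσ') ((one_lt_div s0).2 sρ) ((one_lt_div s0).2 sρ') hfar q1.1 q2.1 hone
  -- The affine change of coordinates creates no crossings, so both smoothings have fewer crossings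
  -- than the original diagram and belong to the class by `hlt`.
  have hcn : cnum (insert s(armSW (σ / s), armNE ((1 - σ) / s))
      (insert s(armNW (ρ / s), armSE ((1 - ρ) / s)) R')) proj ≤ cnum P id := by
    have himg : insert s(armSW (σ / s), armNE ((1 - σ) / s))
        (insert s(armNW (ρ / s), armSE ((1 - ρ) / s)) R') =
        P.image (Sym2.map fun v => Ψ.symm (lift z0 v)) := by
      rw [hPdef, Finset.image_insert, Finset.image_insert, kAB, kCD, hR', sys, Finset.image_image]
      simp only [Sym2.map_map]
      congr 3
      ext e : 1
      rw [Function.comp_apply, Sym2.map_map]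
      rfl
    rw [himg]
    refine cnum_image_le (Φ := fun p => ln A B σ + (p.1 • f₀ + p.2 • f₁))
      (fun a b h => lift_injective z0 (Ψ.symm.injective h)) ?_ ?_
    · intro U T t
      simp only [ln, Prod.fst_add, Prod.snd_add, Prod.smul_fst, Prod.smul_snd, smul_eq_mul]
      module
    · intro v
      rw [← hpl, Ψ.apply_symm_apply, proj_lift]; rfl
  exact hZ.pos_iff_neg hq (hlt _ hi (hci.trans_le hcn)) (hlt _ hz (hcz.trans_le hcn))

end crossing
end

end

section
open Set Topology Filter
open scoped Classical
noncomputable section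
attribute [local instance] sym2DecEq

/-! ### Crossing changes -/

theorem ln_swap {E : Type*} [AddCommGroup E] [Module ℝ E] (P T : E) (t : ℝ) :
    ln T P (1 - t) = ln P T t := by
  simp only [ln]; module

theorem exists_smul_eq_of_det {u v : ℝ × ℝ} (hv : v ≠ 0) (h : u.1 * v.2 - u.2 * v.1 = 0) :
    ∃ k : ℝ, u = k • v := by
  by_cases h1 : v.1 = 0
  · have h2 : v.2 ≠ 0 := fun h2 => hv (Prod.ext h1 h2)
    refine ⟨u.2 / v.2, Prod.ext ?_ ?_⟩
    · simp only [Prod.smul_fst, smul_eq_mul, h1, mul_zero]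
      rw [h1, mul_zero, sub_zero] at h
      exact (mul_eq_zero.1 h).resolve_right h2
    · simp only [Prod.smul_snd, smul_eq_mul]; field_simp
  · refine ⟨u.1 / v.1, Prod.ext ?_ ?_⟩
    · simp only [Prod.smul_fst, smul_eq_mul]; field_simp
    · simp only [Prod.smul_snd, smul_eq_mul]; field_simp; linarith

/-- Two crossing segments with a single common point are transverse. -/
theorem det_ne_zero_of_single {A B C D : ℝ × ℝ} (hAB : A ≠ B) (hCD : C ≠ D) {σ ρ : ℝ}
    (hσ : 0 < σ ∧ σ < 1) (hρ : 0 < ρ ∧ ρ < 1) (hX : ln A B σ = ln C D ρ)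
    (h : ∀ q ∈ eseg s(A, B), q ∈ eseg s(C, D) → q = ln A B σ) :
    (B - A).1 * (D - C).2 - (B - A).2 * (D - C).1 ≠ 0 := by
  intro hd
  obtain ⟨k, hk⟩ := exists_smul_eq_of_det (sub_ne_zero.2 hCD.symm) hd
  have hm : 0 < min ρ (1 - ρ) := lt_min hρ.1 (sub_pos.2 hρ.2)
  -- If the segments were parallel, moving by a small `ε` along one of them would stay on the other
  -- and give a second common point. The bounds keep both parameters in the unit interval.
  obtain ⟨ε, ε0, hε⟩ := exists_between (lt_min (sub_pos.2 hσ.2)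
    (div_pos hm (by positivity : 0 < |k| + 1)))
  rw [lt_min_iff, lt_div_iff₀ (by positivity)] at hε
  have hb : |ε * k| ≤ min ρ (1 - ρ) := by
    rw [abs_mul, abs_of_pos ε0]; nlinarith
  have h1 := abs_le.1 (hb.trans (min_le_left _ _))
  have h2 := abs_le.1 (hb.trans (min_le_right _ _))
  have e1 : ln A B (σ + ε) = ln C D (ρ + ε * k) := by
    have a1 : ln A B (σ + ε) = ln A B σ + ε • (B - A) := by simp only [ln]; module
    have a2 : ln C D (ρ + ε * k) = ln C D ρ + ε • k • (D - C) := by simp only [ln]; module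
    rw [a1, a2, hX, hk]
  have := h (ln A B (σ + ε)) (mem_eseg_iff.2 ⟨_, by linarith [hσ.1], by linarith [hε.1], rfl⟩)
    (mem_eseg_iff.2 ⟨_, by linarith, by linarith, e1⟩)
  linarith [ln_injective hAB this]

/-- The ends of the edges can be labelled as `Gen.crossing_of_oriented` requires: exchanging `C` and
`D` changes the sign of the determinant, and reversing both edges changes the sign of the trace and
keeps the determinant. -/
theorem Gen.crossing {P : Finset (Sym2 (ℝ × ℝ))} {zp zn z0 : ℝ × ℝ → ℝ} {Z : Set E3 → Prop}
    (hZ : SkeinClosed Z) (hP : Gen P) {e₁ e₂ : Sym2 (ℝ × ℝ)} (h₁ : e₁ ∈ P) (h₂ : e₂ ∈ P)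
    (hne : e₁ ≠ e₂) (hflat : ¬ Flat e₁ e₂) (hover : Over zp e₁ e₂) (hover' : Over zn e₂ e₁)
    (hmeet : ∃ x ∈ eseg (e₁.map (lift z0)), x ∈ eseg (e₂.map (lift z0)))
    (hside : ∀ e ∈ P, ∀ e' ∈ P, e ≠ e' → ¬ (e = e₁ ∧ e' = e₂) → ¬ (e = e₂ ∧ e' = e₁) →
      SameSide zp z0 e e' ∧ SameSide zn z0 e e')
    (hlt : ∀ S, PolySys S → cnum S proj < cnum P id → Z (body S)) :
    Z (body (sys zp P)) ↔ Z (body (sys zn P)) := by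
  have main : ∀ A B C D : ℝ × ℝ, ∀ σ ρ : ℝ, e₁ = s(A, B) → e₂ = s(C, D) → 0 < σ ∧ σ < 1 →
      0 < ρ ∧ ρ < 1 → ln A B σ = ln C D ρ → ln (z0 A) (z0 B) σ = ln (z0 C) (z0 D) ρ →
      0 < (B - A).1 * (C - D).2 - (B - A).2 * (C - D).1 →
      0 ≤ ((B - A).1 - (C - D).1) + ((B - A).2 + (C - D).2) →
      (Z (body (sys zp P)) ↔ Z (body (sys zn P))) := by
    rintro A B C D σ ρ rfl rfl hσ hρ hX h0 hd ht
    have hm : s(C, D) ∈ P.erase s(A, B) := Finset.mem_erase.2 ⟨hne.symm, h₂⟩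
    have hPe : insert s(A, B) (insert s(C, D) ((P.erase s(A, B)).erase s(C, D))) = P := by
      rw [Finset.insert_erase hm, Finset.insert_erase h₁]
    have hAB : s(A, B) ∉ insert s(C, D) ((P.erase s(A, B)).erase s(C, D)) := by
      rw [Finset.insert_erase hm]; exact Finset.notMem_erase _ _
    have := Gen.crossing_of_oriented (zp := zp) (zn := zn) (z0 := z0) hZ (hPe.symm ▸ hP) hAB
      (Finset.notMem_erase _ _) hσ hρ hX hover hover' h0 (by rw [hPe]; exact hside) hd ht
      (by rw [hPe]; exact hlt)
    rwa [hPe] at this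
  have main2 : ∀ A B C D : ℝ × ℝ, ∀ σ ρ : ℝ, e₁ = s(A, B) → e₂ = s(C, D) → 0 < σ ∧ σ < 1 →
      0 < ρ ∧ ρ < 1 → ln A B σ = ln C D ρ → ln (z0 A) (z0 B) σ = ln (z0 C) (z0 D) ρ →
      0 < (B - A).1 * (C - D).2 - (B - A).2 * (C - D).1 →
      (Z (body (sys zp P)) ↔ Z (body (sys zn P))) := by
    intro A B C D σ ρ h1 h2 hσ hρ hX h0 hd
    rcases le_total 0 (((B - A).1 - (C - D).1) + ((B - A).2 + (C - D).2)) with ht | ht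
    · exact main A B C D σ ρ h1 h2 hσ hρ hX h0 hd ht
    · refine main B A D C (1 - σ) (1 - ρ) (h1.trans Sym2.eq_swap) (h2.trans Sym2.eq_swap)
        ⟨by linarith [hσ.2], by linarith [hσ.1]⟩ ⟨by linarith [hρ.2], by linarith [hρ.1]⟩
        (by rw [ln_swap, ln_swap, hX]) (by rw [ln_swap, ln_swap, h0]) ?_ ?_ <;>
      simp only [Prod.fst_sub, Prod.snd_sub] at hd ht ⊢ <;> nlinarith
  obtain ⟨x, hx1, hx2⟩ := hmeet
  have hq1 := proj_mem_eseg hx1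
  have hq2 := proj_mem_eseg hx2
  have hv1 : proj x ∉ e₁ := by
    intro h
    refine hflat fun q hq hq' => ?_
    obtain rfl := hP.sing _ h₁ _ h₂ hne _ hq1 hq2 q hq hq'
    exact ⟨h, hP.vert _ h₁ _ h _ h₂ hq2⟩
  have hv2 : proj x ∉ e₂ := fun h => hv1 (hP.vert _ h₂ _ h _ h₁ hq1)
  have hn1 := hP.nd _ h₁
  have hn2 := hP.nd _ h₂
  induction e₁ with | _ A B =>
  induction e₂ with | _ C D =>
  rw [Sym2.mk_isDiag_iff] at hn1 hn2
  rw [Sym2.map_mk] at hx1 hx2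
  obtain ⟨σ, σ0, σ1, rfl⟩ := mem_eseg_iff.1 hx1
  obtain ⟨ρ, ρ0, ρ1, hx⟩ := mem_eseg_iff.1 hx2
  have hX : ln A B σ = ln C D ρ := by
    have := congrArg proj hx
    simpa only [map_ln, proj_lift] using this
  have h0 : ln (z0 A) (z0 B) σ = ln (z0 C) (z0 D) ρ := by
    have := congrArg (coord 2) hx
    simpa only [map_ln, coord_apply, lift_two] using this
  rw [map_ln, proj_lift, proj_lift] at hv1 hv2 hq1 hq2
  have hσ : 0 < σ ∧ σ < 1 := by
    constructor
    · refine lt_of_le_of_ne σ0 ?_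
      rintro rfl; exact hv1 (by simp [ln_zero])
    · refine lt_of_le_of_ne σ1 ?_
      rintro rfl; exact hv1 (by simp [ln_one])
  have hρ : 0 < ρ ∧ ρ < 1 := by
    rw [hX] at hv2
    constructor
    · refine lt_of_le_of_ne ρ0 ?_
      rintro rfl; exact hv2 (by simp [ln_zero])
    · refine lt_of_le_of_ne ρ1 ?_
      rintro rfl; exact hv2 (by simp [ln_one])
  have hdet := det_ne_zero_of_single hn1 hn2 hσ hρ hX fun q hq hq' =>
    hP.sing _ h₁ _ h₂ hne q hq hq' _ hq1 hq2
  rcases lt_or_gt_of_ne hdet with hd | hd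
  · refine main2 A B C D σ ρ rfl rfl hσ hρ hX h0 ?_
    simp only [Prod.fst_sub, Prod.snd_sub] at hd ⊢; nlinarith
  · exact main2 A B D C σ (1 - ρ) rfl Sym2.eq_swap hσ ⟨by linarith [hρ.2], by linarith [hρ.1]⟩
      (by rw [ln_swap, hX]) (by rw [ln_swap, h0]) hd

end

end

section
open Set Topology Filter
open scoped Classical
noncomputable section
attribute [local instance] sym2DecEq

/-! ### Changing the heights of a generic diagram -/

/-- Any two edges that meet outside their end points are at different heights there. -/
def Good (z : ℝ × ℝ → ℝ) (P : Finset (Sym2 (ℝ × ℝ))) : Prop :=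
  ∀ e ∈ P, ∀ e' ∈ P, e ≠ e' → Flat e e' ∨ Over z e e' ∨ Over z e' e

/-- A linear form that measures the difference in height of two edges at their crossing. -/
structure IsGap (e e' : Sym2 (ℝ × ℝ)) (Δ : (ℝ × ℝ → ℝ) →ₗ[ℝ] ℝ) : Prop where
  pos : ∀ z, 0 < Δ z ↔ Over z e e'
  neg : ∀ z, Δ z < 0 ↔ Over z e' e
  zero : ∀ z, Δ z = 0 → ∃ x ∈ eseg (e.map (lift z)), x ∈ eseg (e'.map (lift z))
  single : ∀ v, (v ∈ e ↔ 0 < Δ (Pi.single v 1)) ∧ (v ∈ e' ↔ Δ (Pi.single v 1) < 0)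

/-- The edges cross at a single point with fixed parameters `σ` and `ρ`, so the difference in height
there is a linear form in the heights of the four ends. Its coefficients are positive at the ends of
`e` and negative at those of `e'`, so the form remembers the ordered pair. -/
theorem Gen.exists_isGap {P : Finset (Sym2 (ℝ × ℝ))} (hP : Gen P) {e e' : Sym2 (ℝ × ℝ)} (he : e ∈ P)
    (he' : e' ∈ P) (hne : e ≠ e') (hf : ¬ Flat e e') : ∃ Δ, IsGap e e' Δ := by
  have hdisj : ∀ v ∈ e, v ∉ e' := by
    intro v hv hv'
    refine hf fun q hq hq' => ?_
    obtain rfl := hP.sing _ he _ he' hne _ (mem_eseg_of_mem hv) (mem_eseg_of_mem hv') q hq hq'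
    exact ⟨hv, hv'⟩
  obtain ⟨q, hq, hq', hqf⟩ : ∃ q ∈ eseg e, q ∈ eseg e' ∧ ¬ (q ∈ e ∧ q ∈ e') := by
    by_contra! h
    exact hf fun q hq hq' => h q hq hq'
  have hv1 : q ∉ e := fun h => hqf ⟨h, hP.vert _ he _ h _ he' hq'⟩
  have hv2 : q ∉ e' := fun h => hqf ⟨hP.vert _ he' _ h _ he hq, h⟩
  have hn1 := hP.nd _ he
  have hn2 := hP.nd _ he'
  have single := fun p hp hp' => hP.sing _ he _ he' hne p hp hp' q hq hq'
  clear he he' hne hqf hf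
  induction e with | _ A B =>
  induction e' with | _ C D =>
  replace hn1 : A ≠ B := by simpa using hn1
  replace hn2 : C ≠ D := by simpa using hn2
  obtain ⟨σ, σ0, σ1, rfl⟩ := mem_eseg_iff.1 hq
  obtain ⟨ρ, ρ0, ρ1, hX⟩ := mem_eseg_iff.1 hq'
  have hσ0 : 0 < σ := lt_of_le_of_ne σ0 (by rintro rfl; exact hv1 (by simp [ln_zero]))
  have hσ1 : σ < 1 := lt_of_le_of_ne σ1 (by rintro rfl; exact hv1 (by simp [ln_one]))
  have hρ0 : 0 < ρ := lt_of_le_of_ne ρ0 (by rintro rfl; exact hv2 (by simp [hX, ln_zero]))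
  have hρ1 : ρ < 1 := lt_of_le_of_ne ρ1 (by rintro rfl; exact hv2 (by simp [hX, ln_one]))
  refine ⟨((1 - σ) • LinearMap.proj A + σ • LinearMap.proj B) -
    ((1 - ρ) • LinearMap.proj C + ρ • LinearMap.proj D), ?_⟩
  set Δ : (ℝ × ℝ → ℝ) →ₗ[ℝ] ℝ := ((1 - σ) • LinearMap.proj A + σ • LinearMap.proj B) -
    ((1 - ρ) • LinearMap.proj C + ρ • LinearMap.proj D) with hΔ
  have hval : ∀ z, Δ z = ((1 - σ) * z A + σ * z B) - ((1 - ρ) * z C + ρ * z D) := fun z => rfl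
  have h2 : ∀ (z : ℝ × ℝ → ℝ) (U T : ℝ × ℝ) (t : ℝ),
      (ln (lift z U) (lift z T) t) 2 = (1 - t) * z U + t * z T := by
    intro z U T t; simp [ln, lift]
  have memAB : ∀ z : ℝ × ℝ → ℝ,
      ln (lift z A) (lift z B) σ ∈ eseg (Sym2.map (lift z) s(A, B)) := fun z =>
    mem_eseg_iff.2 ⟨σ, σ0, σ1, rfl⟩
  have memCD : ∀ z : ℝ × ℝ → ℝ,
      ln (lift z C) (lift z D) ρ ∈ eseg (Sym2.map (lift z) s(C, D)) := fun z =>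
    mem_eseg_iff.2 ⟨ρ, ρ0, ρ1, rfl⟩
  have pp : ∀ z : ℝ × ℝ → ℝ,
      proj (ln (lift z A) (lift z B) σ) = proj (ln (lift z C) (lift z D) ρ) := fun z => by
    simp only [map_ln, proj_lift, hX]
  have uniq : ∀ (z : ℝ × ℝ → ℝ) (x y : E3), x ∈ eseg (Sym2.map (lift z) s(A, B)) →
      y ∈ eseg (Sym2.map (lift z) s(C, D)) → proj x = proj y →
      x = ln (lift z A) (lift z B) σ ∧ y = ln (lift z C) (lift z D) ρ := by
    intro z x y hx hy hxy
    have := single (proj x) (proj_mem_eseg hx) (hxy ▸ proj_mem_eseg hy)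
    exact ⟨lift_ln hn1 hx this, lift_ln hn2 hy (by rw [← hxy, this, hX])⟩
  refine ⟨?_, ?_, ?_, ?_⟩
  · intro z
    constructor
    · intro h x hx y hy hxy
      obtain ⟨rfl, rfl⟩ := uniq z x y hx hy hxy
      rw [h2, h2]; rw [hval] at h; linarith
    · intro h
      have := h _ (memAB z) _ (memCD z) (pp z)
      rw [h2, h2] at this; rw [hval]; linarith
  · intro z
    constructor
    · intro h y hy x hx hxy
      obtain ⟨rfl, rfl⟩ := uniq z x y hx hy hxy.symm
      rw [h2, h2]; rw [hval] at h; linarith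
    · intro h
      have := h _ (memCD z) _ (memAB z) (pp z).symm
      rw [h2, h2] at this; rw [hval]; linarith
  · intro z h
    refine ⟨_, memAB z, ?_⟩
    have : ln (lift z A) (lift z B) σ = ln (lift z C) (lift z D) ρ := by
      refine E3.ext_proj (pp z) ?_
      rw [h2, h2]; rw [hval] at h; linarith
    rw [this]; exact memCD z
  · intro v
    have hAC : A ≠ C ∧ A ≠ D := by simpa using hdisj A (by simp)
    have hBC : B ≠ C ∧ B ≠ D := by simpa using hdisj B (by simp)
    rw [hval]
    simp only [Sym2.mem_iff, Pi.single_apply]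
    rcases eq_or_ne v A with rfl | hA
    · simp [hn1.symm, hAC.1.symm, hAC.2.symm, hAC.1, hAC.2]; constructor <;> linarith
    rcases eq_or_ne v B with rfl | hB
    · simp [hn1, hBC.1.symm, hBC.2.symm, hBC.1, hBC.2]; constructor <;> linarith
    rcases eq_or_ne v C with rfl | hC
    · simp [hn2.symm, hA.symm, hB.symm, hA, hB]; constructor <;> linarith
    rcases eq_or_ne v D with rfl | hD
    · simp [hn2, hA.symm, hB.symm, hA, hB]; constructor <;> linarith
    simp [hA, hA.symm, hB, hB.symm, hC, hC.symm, hD, hD.symm]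

theorem IsGap.swap {e e' : Sym2 (ℝ × ℝ)} {Δ Δ' : (ℝ × ℝ → ℝ) →ₗ[ℝ] ℝ} (h : IsGap e e' Δ)
    (h' : IsGap e' e Δ') (z : ℝ × ℝ → ℝ) : Δ z < 0 ↔ 0 < Δ' z := by
  rw [h.neg, h'.pos]

/-- The gaps of different pairs of edges are not proportional. -/
theorem IsGap.independent {e e' f f' : Sym2 (ℝ × ℝ)} {Δ Δ' : (ℝ × ℝ → ℝ) →ₗ[ℝ] ℝ}
    (h : IsGap e e' Δ) (h' : IsGap f f' Δ') {α β : ℝ} (hα : 0 < α) (hβ : 0 < β)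
    (hs : α • Δ = β • Δ') : e = f ∧ e' = f' := by
  have hv : ∀ z, α * Δ z = β * Δ' z := fun z => by
    simpa using congrArg (fun l : (ℝ × ℝ → ℝ) →ₗ[ℝ] ℝ => l z) hs
  have h1 : ∀ z, 0 < Δ z ↔ 0 < Δ' z := fun z => by
    rw [← mul_pos_iff_of_pos_left hα, hv, mul_pos_iff_of_pos_left hβ]
  have h2 : ∀ z, Δ z < 0 ↔ Δ' z < 0 := fun z => by
    rw [← neg_pos, ← mul_pos_iff_of_pos_left hα, mul_neg, hv, ← mul_neg,
      mul_pos_iff_of_pos_left hβ, neg_pos]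
  constructor <;> refine Sym2.ext fun v => ?_
  · rw [(h.single v).1, (h'.single v).1, h1]
  · rw [(h.single v).2, (h'.single v).2, h2]

/-- The heights on the way from `z` to `z'`. -/
def between (z z' : ℝ × ℝ → ℝ) (t : ℝ) : ℝ × ℝ → ℝ := (1 - t) • z + t • z'

theorem map_between (Δ : (ℝ × ℝ → ℝ) →ₗ[ℝ] ℝ) (z z' : ℝ × ℝ → ℝ) (t : ℝ) :
    Δ (between z z' t) = (1 - t) * Δ z + t * Δ z' := by
  simp [between]

/-- A choice of gaps for all pairs of edges. -/
def gap (e e' : Sym2 (ℝ × ℝ)) : (ℝ × ℝ → ℝ) →ₗ[ℝ] ℝ :=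
  if h : ∃ Δ, IsGap e e' Δ then h.choose else 0

section heights
variable {P : Finset (Sym2 (ℝ × ℝ))} {Z : Set E3 → Prop} {z z' : ℝ × ℝ → ℝ}

theorem Gen.isGap (hP : Gen P) {e e' : Sym2 (ℝ × ℝ)} (he : e ∈ P)
    (he' : e' ∈ P) (hne : e ≠ e') (hf : ¬ Flat e e') : IsGap e e' (gap e e') := by
  have h := hP.exists_isGap he he' hne hf
  rw [gap, dif_pos h]
  exact h.choose_spec

theorem Good.gap_ne (h : Good z P) (hP : Gen P) {e e' : Sym2 (ℝ × ℝ)} (he : e ∈ P)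
    (he' : e' ∈ P) (hne : e ≠ e') (hf : ¬ Flat e e') : 0 < gap e e' z ∨ gap e e' z < 0 := by
  have hg := hP.isGap he he' hne hf
  rcases (h e he e' he' hne).resolve_left hf with h1 | h1
  · exact .inl ((hg.pos z).2 h1)
  · exact .inr ((hg.neg z).2 h1)

/-- The ordered pairs of edges whose order changes. -/
def changes (P : Finset (Sym2 (ℝ × ℝ))) (z z' : ℝ × ℝ → ℝ) :
    Finset (Sym2 (ℝ × ℝ) × Sym2 (ℝ × ℝ)) :=
  (P ×ˢ P).filter fun p => p.1 ≠ p.2 ∧ ¬ Flat p.1 p.2 ∧ 0 < gap p.1 p.2 z ∧ gap p.1 p.2 z' < 0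

theorem mem_changes {p : Sym2 (ℝ × ℝ) × Sym2 (ℝ × ℝ)} : p ∈ changes P z z' ↔ (p.1 ∈ P ∧ p.2 ∈ P) ∧
    p.1 ≠ p.2 ∧ ¬ Flat p.1 p.2 ∧ 0 < gap p.1 p.2 z ∧ gap p.1 p.2 z' < 0 := by
  simp [changes]

/-- The pairs whose order changes do so at different times. -/
def Distinct (P : Finset (Sym2 (ℝ × ℝ))) (z z' : ℝ × ℝ → ℝ) : Prop :=
  ∀ p ∈ changes P z z', ∀ q ∈ changes P z z', p ≠ q →
    gap p.1 p.2 z * gap q.1 q.2 z' ≠ gap q.1 q.2 z * gap p.1 p.2 z'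

theorem changes_symm {e e' : Sym2 (ℝ × ℝ)} (hP : Gen P) (he : e ∈ P) (he' : e' ∈ P) (hne : e ≠ e')
    (hf : ¬ Flat e e') : (e', e) ∈ changes P z z' ↔ gap e e' z < 0 ∧ 0 < gap e e' z' := by
  have h1 := hP.isGap he he' hne hf
  have h2 := hP.isGap he' he hne.symm (fun h => hf h.symm)
  rw [mem_changes, ← h1.swap h2, ← h2.swap h1]
  exact ⟨fun h => h.2.2.2, fun h => ⟨⟨he', he⟩, hne.symm, fun h => hf h.symm, h⟩⟩

theorem Gen.sameSide (hP : Gen P) {e e' : Sym2 (ℝ × ℝ)} (he : e ∈ P) (he' : e' ∈ P) (hne : e ≠ e')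
    (h : ¬ Flat e e' → (0 < gap e e' z ∧ 0 < gap e e' z') ∨ (gap e e' z < 0 ∧ gap e e' z' < 0)) :
    SameSide z z' e e' := by
  by_cases hf : Flat e e'
  · exact .inl hf
  have hg := hP.isGap he he' hne hf
  rcases h hf with ⟨h1, h2⟩ | ⟨h1, h2⟩
  · exact .inr (.inl ⟨(hg.pos _).1 h1, (hg.pos _).1 h2⟩)
  · exact .inr (.inr ⟨(hg.neg _).1 h1, (hg.neg _).1 h2⟩)

/-- On the straight way from `z` to `z'` every gap is affine in time and the gaps that change sign
do so one at a time. Passing the first sign change is a single crossing change, with the heights at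
that instant as the singular ones in `Gen.crossing`, and one change fewer remains. -/
theorem Gen.height_change_of_distinct (hZ : SkeinClosed Z) (hP : Gen P)
    (hlt : ∀ S, PolySys S → cnum S proj < cnum P id → Z (body S)) (hz' : Good z' P) :
    ∀ (n : ℕ) (z : ℝ × ℝ → ℝ), (changes P z z').card = n → Good z P → Distinct P z z' →
      (Z (body (sys z P)) ↔ Z (body (sys z' P))) := by
  intro n
  induction n with
  | zero =>
    intro z hn hz _
    have hempty : changes P z z' = ∅ := Finset.card_eq_zero.1 hn
    refine hZ.iff (height_motion hP.nd fun e he e' he' hne => ?_)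
    refine hP.sameSide he he' hne fun hf => ?_
    rcases hz.gap_ne hP he he' hne hf with h1 | h1 <;>
      rcases hz'.gap_ne hP he he' hne hf with h2 | h2
    · exact .inl ⟨h1, h2⟩
    · have : (e, e') ∈ changes P z z' := mem_changes.2 ⟨⟨he, he'⟩, hne, hf, h1, h2⟩
      simp [hempty] at this
    · have := (changes_symm hP he he' hne hf).2 ⟨h1, h2⟩
      simp [hempty] at this
    · exact .inr ⟨h1, h2⟩
  | succ n ih =>
    intro z hn hz hd
    -- The time at which the gap of the pair vanishes on the way from `z` to `z'`.
    set root : Sym2 (ℝ × ℝ) × Sym2 (ℝ × ℝ) → ℝ := fun p =>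
      gap p.1 p.2 z / (gap p.1 p.2 z - gap p.1 p.2 z') with hroot
    have hchange : ∀ p ∈ changes P z z', 0 < gap p.1 p.2 z - gap p.1 p.2 z' ∧ 0 < root p ∧
        root p < 1 := by
      intro p hp
      obtain ⟨-, -, -, h1, h2⟩ := mem_changes.1 hp
      have h3 : 0 < gap p.1 p.2 z - gap p.1 p.2 z' := by linarith
      exact ⟨h3, div_pos h1 h3, (div_lt_one h3).2 (by linarith)⟩
    obtain ⟨p, hp, hmin⟩ := Finset.exists_min_image (changes P z z') root
      (Finset.card_pos.1 (by omega))
    obtain ⟨hp0, hp1, hp2⟩ := hchange p hp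
    have hmin' : ∀ q ∈ changes P z z', q ≠ p → root p < root q := by
      intro q hq hqp
      refine lt_of_le_of_ne (hmin q hq) fun h => ?_
      rw [hroot] at h
      simp only at h
      rw [div_eq_div_iff hp0.ne' (hchange q hq).1.ne'] at h
      exact hd p hp q hq hqp.symm (by linarith)
    -- The move stops shortly after the first sign change and before the next one.
    obtain ⟨t, ht0, ht1, htq⟩ : ∃ t, root p < t ∧ t < 1 ∧
        ∀ q ∈ changes P z z', q ≠ p → t < root q := by
      have ev : ∀ᶠ t in 𝓝[>] (root p), ∀ q ∈ changes P z z', q ≠ p → t < root q := by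
        refine (Finset.eventually_all _).2 fun q hq => ?_
        by_cases hqp : q = p
        · exact .of_forall fun t h => absurd hqp h
        · filter_upwards [nhdsWithin_le_nhds (gt_mem_nhds (hmin' q hq hqp))] with t h _ using h
      have ev2 : ∀ᶠ t in 𝓝[>] (root p), t < 1 := nhdsWithin_le_nhds (gt_mem_nhds hp2)
      have ev3 : ∀ᶠ t in 𝓝[>] (root p), root p < t := self_mem_nhdsWithin
      obtain ⟨t, h1, h2, h3⟩ := (ev.and (ev2.and ev3)).exists
      exact ⟨t, h3, h2, h1⟩
    have hpos : ∀ τ, 0 ≤ τ → τ ≤ t → ∀ e ∈ P, ∀ e' ∈ P, e ≠ e' → ¬ Flat e e' → (e, e') ≠ p →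
        0 < gap e e' z → 0 < gap e e' (between z z' τ) := by
      intro τ h0 hτ e he e' he' hne hf hep h1
      rw [map_between]
      rcases hz'.gap_ne hP he he' hne hf with h2 | h2
      · have := mul_pos (show 0 < 1 - τ by linarith) h1
        have := mul_nonneg h0 h2.le
        linarith
      · have hm : (e, e') ∈ changes P z z' := mem_changes.2 ⟨⟨he, he'⟩, hne, hf, h1, h2⟩
        have h3 := lt_of_le_of_lt hτ (htq _ hm hep)
        rw [hroot] at h3
        simp only at h3
        rw [lt_div_iff₀ (by linarith)] at h3
        linarith
    have hneg : ∀ τ, 0 ≤ τ → τ ≤ t → ∀ e ∈ P, ∀ e' ∈ P, e ≠ e' → ¬ Flat e e' → (e', e) ≠ p →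
        gap e e' z < 0 → gap e e' (between z z' τ) < 0 := by
      intro τ h0 hτ e he e' he' hne hf hep h1
      have g1 := hP.isGap he he' hne hf
      have g2 := hP.isGap he' he hne.symm (fun h => hf h.symm)
      rw [g1.swap g2] at h1 ⊢
      exact hpos τ h0 hτ e' he' e he hne.symm (fun h => hf h.symm) hep h1
    obtain ⟨⟨m1, m2⟩, pne, pf, pz, pz'⟩ := mem_changes.1 hp
    have pg := hP.isGap m1 m2 pne pf
    have pt : gap p.1 p.2 (between z z' t) < 0 := by
      rw [map_between]
      have := ht0
      rw [hroot] at this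
      simp only at this
      rw [div_lt_iff₀ hp0] at this
      linarith
    have p0 : gap p.1 p.2 (between z z' (root p)) = 0 := by
      rw [map_between, hroot]
      simp only
      field_simp
      ring
    have side : ∀ e ∈ P, ∀ e' ∈ P, e ≠ e' → ¬ (e = p.1 ∧ e' = p.2) → ¬ (e = p.2 ∧ e' = p.1) →
        SameSide z (between z z' (root p)) e e' ∧
          SameSide (between z z' t) (between z z' (root p)) e e' := by
      intro e he e' he' hne h1 h2
      have h1' : (e, e') ≠ p := by rintro rfl; exact h1 ⟨rfl, rfl⟩
      have h2' : (e', e) ≠ p := by rintro rfl; exact h2 ⟨rfl, rfl⟩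
      constructor <;> refine hP.sameSide he he' hne fun hf => ?_
      · rcases hz.gap_ne hP he he' hne hf with h | h
        · exact .inl ⟨h, hpos _ hp1.le ht0.le _ he _ he' hne hf h1' h⟩
        · exact .inr ⟨h, hneg _ hp1.le ht0.le _ he _ he' hne hf h2' h⟩
      · rcases hz.gap_ne hP he he' hne hf with h | h
        · exact .inl ⟨hpos _ (hp1.trans ht0).le le_rfl _ he _ he' hne hf h1' h,
            hpos _ hp1.le ht0.le _ he _ he' hne hf h1' h⟩
        · exact .inr ⟨hneg _ (hp1.trans ht0).le le_rfl _ he _ he' hne hf h2' h,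
            hneg _ hp1.le ht0.le _ he _ he' hne hf h2' h⟩
    have step := Gen.crossing (zp := z) (zn := between z z' t) (z0 := between z z' (root p)) hZ hP
      m1 m2 pne pf ((pg.pos _).1 pz) ((pg.neg _).1 pt) (pg.zero _ p0) side hlt
    rw [step]
    have hp12 : (p.2, p.1) ∉ changes P (between z z' t) z' := by
      intro h
      rw [changes_symm hP m1 m2 pne pf] at h
      linarith [h.2]
    have hsub : ∀ q ∈ changes P (between z z' t) z', q ∈ changes P z z' ∧ q ≠ p := by
      intro q hq
      obtain ⟨⟨n1, n2⟩, qne, qf, qz, qz'⟩ := mem_changes.1 hq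
      have hqp : q ≠ p := by
        rintro rfl
        exact lt_asymm qz pt
      refine ⟨mem_changes.2 ⟨⟨n1, n2⟩, qne, qf, ?_, qz'⟩, hqp⟩
      rcases hz.gap_ne hP n1 n2 qne qf with h | h
      · exact h
      · have := hneg t (hp1.trans ht0).le le_rfl _ n1 _ n2 qne qf
          (by rintro rfl; exact hp12 hq) h
        exact absurd this (lt_asymm qz)
    refine ih _ ?_ ?_ ?_
    · have heq : changes P (between z z' t) z' = (changes P z z').erase p := by
        ext q
        rw [Finset.mem_erase]
        refine ⟨fun hq => (hsub q hq).symm, fun ⟨hqp, hq⟩ => ?_⟩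
        obtain ⟨⟨n1, n2⟩, qne, qf, qz, qz'⟩ := mem_changes.1 hq
        exact mem_changes.2 ⟨⟨n1, n2⟩, qne, qf,
          hpos t (hp1.trans ht0).le le_rfl _ n1 _ n2 qne qf hqp qz, qz'⟩
      rw [heq, Finset.card_erase_of_mem hp, hn]; rfl
    · intro e he e' he' hne
      by_cases hf : Flat e e'
      · exact .inl hf
      right
      by_cases h1 : (e, e') = p
      · subst h1; exact .inr ((pg.neg _).1 pt)
      by_cases h2 : (e', e) = p
      · subst h2; exact .inl ((pg.neg _).1 pt)
      have g := hP.isGap he he' hne hf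
      rcases hz.gap_ne hP he he' hne hf with h | h
      · exact .inl ((g.pos _).1 (hpos _ (hp1.trans ht0).le le_rfl _ he _ he' hne hf h1 h))
      · exact .inr ((g.neg _).1 (hneg _ (hp1.trans ht0).le le_rfl _ he _ he' hne hf h2 h))
    · intro q hq q' hq' hne h
      -- Starting at time `t` instead of zero multiplies the difference of the two cross products by
      -- `1 - t`, so coincidences of times are unaffected.
      refine hd q (hsub q hq).1 q' (hsub q' hq').1 hne ?_
      rw [map_between, map_between] at h
      have h1 : (1 - t) ≠ 0 := by linarith
      refine mul_left_cancel₀ h1 ?_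
      linarith

/-! ### Making the crossing changes happen at different times -/

theorem eventually_add_mul_ne (a : ℝ) {b : ℝ} (hb : b ≠ 0) : ∀ᶠ s in 𝓝[>] (0 : ℝ), a + s * b ≠ 0 := by
  have h : ∀ᶠ s in 𝓝[>] (0 : ℝ), s ≠ -a / b := by
    by_cases hab : -a / b = 0
    · have : ∀ᶠ s in 𝓝[>] (0 : ℝ), 0 < s := self_mem_nhdsWithin
      filter_upwards [this] with s hs
      rw [hab]; exact hs.ne'
    · exact nhdsWithin_le_nhds (isOpen_ne.mem_nhds (Ne.symm hab))
  filter_upwards [h] with s hs h0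
  exact hs (by rw [eq_div_iff hb]; linarith)

theorem eventually_add_mul_pos {a : ℝ} (b : ℝ) (ha : 0 < a) :
    ∀ᶠ s in 𝓝[>] (0 : ℝ), 0 < a + s * b := by
  have hc : Continuous fun s : ℝ => a + s * b := by fun_prop
  exact nhdsWithin_le_nhds (hc.continuousAt.eventually_mem
    (isOpen_Ioi.mem_nhds (by simpa using ha)))

/-- Two pairs change at the same time exactly when a certain linear form in the initial heights
vanishes. These finitely many forms are nonzero, since gaps of different pairs are not proportional,
so a small move in a suitable direction avoids all coincidences without changing a crossing. -/
theorem Gen.exists_distinct (hP : Gen P) (hz : Good z P) (z' : ℝ × ℝ → ℝ) :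
    ∃ w, Good w P ∧ Distinct P w z' ∧ ∀ e ∈ P, ∀ e' ∈ P, e ≠ e' → SameSide z w e e' := by
  set I := {i : (Sym2 (ℝ × ℝ) × Sym2 (ℝ × ℝ)) × (Sym2 (ℝ × ℝ) × Sym2 (ℝ × ℝ)) //
    i.1 ∈ changes P z z' ∧ i.2 ∈ changes P z z' ∧ i.1 ≠ i.2} with hI
  have : Finite I := by
    refine Finite.of_injective (β := ↥(changes P z z') × ↥(changes P z z'))
      (fun i => (⟨i.1.1, i.2.1⟩, ⟨i.1.2, i.2.2.1⟩)) fun i j h => ?_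
    simp only [Prod.mk.injEq, Subtype.mk.injEq] at h
    exact Subtype.ext (Prod.ext h.1 h.2)
  set L : I → Module.Dual ℝ (ℝ × ℝ → ℝ) := fun i =>
    gap i.1.2.1 i.1.2.2 z' • gap i.1.1.1 i.1.1.2 - gap i.1.1.1 i.1.1.2 z' • gap i.1.2.1 i.1.2.2
    with hL
  have hLne : ∀ i, ∃ y, L i y ≠ 0 := by
    intro i
    by_contra! h
    obtain ⟨⟨⟨p1, p2⟩, ⟨q1, q2⟩⟩, hp, hq, hne⟩ := i
    obtain ⟨pm, pne, pf, pz, pz'⟩ := mem_changes.1 hp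
    obtain ⟨qm, qne, qf, qz, qz'⟩ := mem_changes.1 hq
    simp only at pm pne pf pz pz' qm qne qf qz qz'
    have hind := (hP.isGap pm.1 pm.2 pne pf).independent (hP.isGap qm.1 qm.2 qne qf)
      (neg_pos.2 qz') (neg_pos.2 pz') (by
        refine LinearMap.ext fun y => ?_
        have := h y
        simp only [hL, LinearMap.sub_apply, LinearMap.smul_apply, smul_eq_mul] at this ⊢
        linarith)
    exact hne (Prod.ext hind.1 hind.2)
  -- Finitely many nonzero linear forms over an infinite field have a common vector on which none of
  -- them vanishes.
  obtain ⟨y, hy⟩ := Module.Dual.exists_forall_ne_zero_of_forall_exists L hLne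
  have hv : ∀ (Δ : (ℝ × ℝ → ℝ) →ₗ[ℝ] ℝ) (s : ℝ), Δ (z + s • y) = Δ z + s * Δ y := by
    intro Δ s; simp
  have ev1 : ∀ᶠ s in 𝓝[>] (0 : ℝ), ∀ i, L i (z + s • y) ≠ 0 := by
    refine eventually_all.2 fun i => ?_
    simp only [hv]
    exact eventually_add_mul_ne _ (hy i)
  have ev2 : ∀ᶠ s in 𝓝[>] (0 : ℝ), ∀ e ∈ P, ∀ e' ∈ P, (0 < gap e e' z → 0 < gap e e' (z + s • y)) ∧
      (gap e e' z < 0 → gap e e' (z + s • y) < 0) := by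
    refine (Finset.eventually_all _).2 fun e _ => (Finset.eventually_all _).2 fun e' _ => ?_
    refine Eventually.and ?_ ?_
    · by_cases h : 0 < gap e e' z
      · filter_upwards [eventually_add_mul_pos (gap e e' y) h] with s hs _
        rw [hv]; exact hs
      · exact .of_forall fun s h' => absurd h' h
    · by_cases h : gap e e' z < 0
      · filter_upwards [eventually_add_mul_pos (-gap e e' y) (neg_pos.2 h)] with s hs _
        rw [hv]; linarith
      · exact .of_forall fun s h' => absurd h' h
  obtain ⟨s, h1, h2⟩ := (ev1.and ev2).exists
  have side : ∀ e ∈ P, ∀ e' ∈ P, e ≠ e' → SameSide z (z + s • y) e e' := by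
    intro e he e' he' hne
    refine hP.sameSide he he' hne fun hf => ?_
    rcases hz.gap_ne hP he he' hne hf with h | h
    · exact .inl ⟨h, (h2 e he e' he').1 h⟩
    · exact .inr ⟨h, (h2 e he e' he').2 h⟩
  -- The small move creates no new changes, so the forms considered before suffice.
  have hch : ∀ p ∈ changes P (z + s • y) z', p ∈ changes P z z' := by
    intro p hp
    obtain ⟨pm, pne, pf, pz, pz'⟩ := mem_changes.1 hp
    refine mem_changes.2 ⟨pm, pne, pf, ?_, pz'⟩
    rcases hz.gap_ne hP pm.1 pm.2 pne pf with h | h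
    · exact h
    · exact absurd pz (lt_asymm ((h2 _ pm.1 _ pm.2).2 h))
  refine ⟨z + s • y, fun e he e' he' hne => (side e he e' he' hne).right, ?_, side⟩
  intro p hp q hq hne h
  refine h1 ⟨(p, q), hch p hp, hch q hq, hne⟩ ?_
  simp only [hL, LinearMap.sub_apply, LinearMap.smul_apply, smul_eq_mul]
  linarith

/-- In a skein-closed class that contains all links with fewer crossings, the heights of a generic
diagram do not matter. -/
theorem Gen.height_change (hZ : SkeinClosed Z) (hP : Gen P) (hz : Good z P) (hz' : Good z' P)
    (hlt : ∀ S, PolySys S → cnum S proj < cnum P id → Z (body S)) :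
    Z (body (sys z P)) ↔ Z (body (sys z' P)) := by
  obtain ⟨w, hw, hd, hs⟩ := hP.exists_distinct hz z'
  rw [hZ.iff (height_motion hP.nd hs)]
  exact hP.height_change_of_distinct hZ hlt hz' _ w rfl hw hd

end heights
end

end

section
open Set Topology Filter
open scoped Classical
noncomputable section
attribute [local instance] sym2DecEq

/-! ### The cycle through a vertex -/

section cycle
variable {V : Type*} {P : Finset (Sym2 V)}

theorem exists_other (hnd : ∀ e ∈ P, ¬ e.IsDiag) (hdeg : ∀ v, deg P v = 0 ∨ deg P v = 2) {e : Sym2 V}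
    (he : e ∈ P) {v : V} (hv : v ∈ e) : ∃ e' ∈ P, e' ≠ e ∧ v ∈ e' ∧
      ∀ f ∈ P, v ∈ f → f = e ∨ f = e' := by
  have h2 : deg P v = 2 := (hdeg v).resolve_left fun h => deg_eq_zero.1 h e he hv
  rw [deg_eq_card hnd, ncard_eq_two] at h2
  obtain ⟨a, b, hab, h⟩ := h2
  have hmem : ∀ f, f ∈ P ∧ v ∈ f ↔ f = a ∨ f = b := fun f => by
    have := Set.ext_iff.1 h f
    simpa using this
  rcases (hmem e).1 ⟨he, hv⟩ with rfl | rfl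
  · obtain ⟨hb, hvb⟩ := (hmem b).2 (.inr rfl)
    exact ⟨b, hb, hab.symm, hvb, fun f hf hvf => (hmem f).1 ⟨hf, hvf⟩⟩
  · obtain ⟨ha, hva⟩ := (hmem a).2 (.inl rfl)
    exact ⟨a, ha, hab, hva, fun f hf hvf => ((hmem f).1 ⟨hf, hvf⟩).symm⟩

/-- The edges of a path. -/
def pathEdges (w : ℕ → V) (k : ℕ) : Finset (Sym2 V) :=
  (Finset.range k).image fun i => s(w i, w (i + 1))

theorem mem_pathEdges {w : ℕ → V} {k : ℕ} {e : Sym2 V} :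
    e ∈ pathEdges w k ↔ ∃ i < k, e = s(w i, w (i + 1)) := by
  simp [pathEdges, eq_comm]

theorem pathEdges_succ (w : ℕ → V) (k : ℕ) :
    pathEdges w (k + 1) = insert s(w k, w (k + 1)) (pathEdges w k) := by
  rw [pathEdges, Finset.range_add_one, Finset.image_insert]; rfl

/-- A cycle that is a component of the graph. -/
structure IsCycle (P : Finset (Sym2 V)) (w : ℕ → V) (k : ℕ) : Prop where
  two : 2 ≤ k
  inj : ∀ i ≤ k, ∀ j ≤ k, w i = w j → i = j
  edge : ∀ i < k, s(w i, w (i + 1)) ∈ P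
  close : s(w k, w 0) ∈ P
  full : ∀ e ∈ P, ∀ i ≤ k, w i ∈ e → e ∈ insert s(w k, w 0) (pathEdges w k)

/-- A longest simple path from `u` has a second edge at its far end. This edge leads back to the
path by maximality, and only to `u`, since at every inner vertex of the path both edges are already
used. -/
theorem exists_isCycle (hnd : ∀ e ∈ P, ¬ e.IsDiag) (hdeg : ∀ v, deg P v = 0 ∨ deg P v = 2) {u : V}
    (hu : ∃ e ∈ P, u ∈ e) : ∃ w k, IsCycle P w k ∧ w 0 = u := by
  set Path : ℕ → Prop := fun k => ∃ w : ℕ → V, w 0 = u ∧ (∀ i ≤ k, ∀ j ≤ k, w i = w j → i = j) ∧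
    ∀ i < k, s(w i, w (i + 1)) ∈ P with hPath
  have hbound : ∀ k, Path k → k ≤ P.card := by
    rintro k ⟨w, -, hinj, hedge⟩
    have h1 : (pathEdges w k).card = k := by
      rw [pathEdges, Finset.card_image_of_injOn, Finset.card_range]
      intro i hi j hj hij
      simp only [Finset.coe_range, mem_Iio] at hi hj
      rcases Sym2.eq_iff.1 hij with ⟨h, -⟩ | ⟨h, h'⟩
      · exact hinj i hi.le j hj.le h
      · have := hinj i hi.le (j + 1) hj h
        have := hinj (i + 1) hi j hj.le h'
        omega
    rw [← h1]
    refine Finset.card_le_card fun e he => ?_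
    obtain ⟨i, hi, rfl⟩ := mem_pathEdges.1 he
    exact hedge i hi
  have h1 : Path 1 := by
    obtain ⟨e, he, hue⟩ := hu
    obtain ⟨v, rfl⟩ := Sym2.mem_iff_exists.1 hue
    have huv : u ≠ v := by simpa using hnd _ he
    refine ⟨fun i => if i = 0 then u else v, rfl, ?_, ?_⟩
    · intro i hi j hj h
      interval_cases i <;> interval_cases j <;> simp_all
    · intro i hi
      obtain rfl : i = 0 := by omega
      simpa using he
  obtain ⟨k, hk, hmax⟩ : ∃ k, Path k ∧ ∀ j, Path j → j ≤ k := by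
    have hne : {k | Path k}.Nonempty := ⟨1, h1⟩
    have hbd : BddAbove {k | Path k} := ⟨P.card, fun k hk => hbound k hk⟩
    exact ⟨sSup {k | Path k}, Nat.sSup_mem hne hbd, fun j hj => le_csSup hbd hj⟩
  have hk1 := hmax 1 h1
  obtain ⟨w, h0, hinj, hedge⟩ := hk
  obtain ⟨l, rfl⟩ : ∃ l, k = l + 1 := ⟨k - 1, by omega⟩
  obtain ⟨e', he', hne, hv, hall⟩ := exists_other hnd hdeg (hedge l (by omega))
    (Sym2.mem_mk_right (w l) (w (l + 1)))
  obtain ⟨x, rfl⟩ := Sym2.mem_iff_exists.1 hv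
  have hxw : ∃ j ≤ l + 1, x = w j := by
    -- Otherwise the path could be extended by `x`.
    by_contra! hx
    refine absurd (hmax (l + 2) ⟨fun i => if i ≤ l + 1 then w i else x, by simp [h0], ?_, ?_⟩)
      (by omega)
    · intro i hi j hj h
      by_cases hi' : i ≤ l + 1 <;> by_cases hj' : j ≤ l + 1
      · simp only [hi', hj', if_true] at h
        exact hinj i hi' j hj' h
      · simp only [hi', hj', if_true, if_false] at h
        exact absurd h.symm (hx i hi')
      · simp only [hi', hj', if_true, if_false] at h
        exact absurd h (hx j hj')
      · omega
    · intro i hi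
      by_cases hil : i = l + 1
      · subst hil; simpa using he'
      · have a1 : i ≤ l + 1 := by omega
        have a2 : i + 1 ≤ l + 1 := by omega
        simp only [a1, a2, if_true]
        exact hedge i (by omega)
  obtain ⟨j, hj, rfl⟩ := hxw
  have hjl : j ≠ l + 1 := by
    rintro rfl
    exact hnd _ he' (by simp)
  have hjl' : j ≠ l := by
    rintro rfl
    exact hne Sym2.eq_swap
  obtain rfl : j = 0 := by
    by_contra hj0
    obtain ⟨i, rfl⟩ : ∃ i, j = i + 1 := ⟨j - 1, by omega⟩
    obtain ⟨f, -, -, -, hf⟩ := exists_other hnd hdeg (hedge i (by omega))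
      (Sym2.mem_mk_right (w i) (w (i + 1)))
    have e1 := hf _ (hedge (i + 1) (by omega)) (by simp)
    have e2 := hf _ he' (by simp)
    have n1 : s(w (i + 1), w (i + 1 + 1)) ≠ s(w i, w (i + 1)) := by
      intro h
      rcases Sym2.eq_iff.1 h with ⟨h, -⟩ | ⟨-, h⟩
      · have := hinj _ (by omega) _ (by omega) h; omega
      · have := hinj _ (by omega) _ (by omega) h; omega
    have n2 : s(w (l + 1), w (i + 1)) ≠ s(w i, w (i + 1)) := by
      intro h
      rcases Sym2.eq_iff.1 h with ⟨h, -⟩ | ⟨h, -⟩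
      · have := hinj _ le_rfl _ (by omega) h; omega
      · have := hinj _ le_rfl _ (by omega) h; omega
    have e3 := (e1.resolve_left n1).trans (e2.resolve_left n2).symm
    rcases Sym2.eq_iff.1 e3 with ⟨h, -⟩ | ⟨-, h⟩
    · have := hinj _ (by omega) _ le_rfl h; omega
    · have := hinj _ (by omega) _ le_rfl h; omega
  refine ⟨w, l + 1, ⟨by omega, hinj, hedge, he', ?_⟩, h0⟩
  -- At each vertex the cycle already has two edges, which exhaust its degree, so the cycle is a
  -- whole component.
  intro e he i hi hwi
  have hpe : ∀ j < l + 1, s(w j, w (j + 1)) ∈ insert s(w (l + 1), w 0) (pathEdges w (l + 1)) :=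
    fun j hj => Finset.mem_insert_of_mem (mem_pathEdges.2 ⟨j, hj, rfl⟩)
  rcases Nat.eq_zero_or_pos i with rfl | hi0
  · obtain ⟨f, -, -, -, hf⟩ := exists_other hnd hdeg he' (Sym2.mem_mk_right (w (l + 1)) (w 0))
    rcases hf e he hwi with rfl | rfl
    · exact Finset.mem_insert_self _ _
    · rcases hf _ (hedge 0 (by omega)) (by simp) with h | h
      · rcases Sym2.eq_iff.1 h with ⟨h, -⟩ | ⟨-, h⟩
        · have := hinj _ (by omega) _ le_rfl h; omega
        · have := hinj _ (by omega) _ le_rfl h; omega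
      · rw [← h]; exact hpe 0 (by omega)
  · obtain ⟨m, rfl⟩ : ∃ m, i = m + 1 := ⟨i - 1, by omega⟩
    by_cases hml : m = l
    · subst hml
      rcases hall e he hwi with rfl | rfl
      · exact hpe _ (by omega)
      · exact Finset.mem_insert_self _ _
    · obtain ⟨f, -, -, -, hf⟩ := exists_other hnd hdeg (hedge m (by omega))
        (Sym2.mem_mk_right (w m) (w (m + 1)))
      rcases hf e he hwi with rfl | rfl
      · exact hpe m (by omega)
      · rcases hf _ (hedge (m + 1) (by omega)) (by simp) with h | h
        · rcases Sym2.eq_iff.1 h with ⟨h, -⟩ | ⟨-, h⟩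
          · have := hinj _ (by omega) _ (by omega) h; omega
          · have := hinj _ (by omega) _ (by omega) h; omega
        · rw [← h]; exact hpe (m + 1) (by omega)

end cycle
end

end

section
open Set Topology Filter
open scoped Classical
noncomputable section
attribute [local instance] sym2DecEq

/-! ### Contracting an unknotted component -/

/-- On the triangle `ℓ` takes its minimum only at the vertex `P`. -/
theorem eq_of_mem_tri {ℓ : E3 →ₗ[ℝ] ℝ} {P Q T x : E3} (hx : x ∈ convexHull ℝ {P, Q, T})
    (hQ : ℓ P < ℓ Q) (hT : ℓ P < ℓ T) (hle : ℓ x ≤ ℓ P) : x = P := by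
  rw [convexHull_insert (by simp), convexHull_pair, ← eseg_mk] at hx
  obtain ⟨P', hP', y, hy, hx'⟩ := mem_convexJoin.1 hx
  obtain rfl : P' = P := hP'
  have hy' : ℓ P' < ℓ y := lt_of_mem_eseg (fun v hv => by
    rcases Sym2.mem_iff.1 hv with rfl | rfl <;> assumption) hy
  rw [← eseg_mk] at hx'
  exact (linear_lt_of_mem_segment hy' hx').1.resolve_right (not_lt.2 hle)

theorem ge_of_mem_eseg {ℓ : E3 →ₗ[ℝ] ℝ} {h : ℝ} {e : Sym2 E3} (he : ∀ v ∈ e, h ≤ ℓ v) {x : E3}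
    (hx : x ∈ eseg e) : h ≤ ℓ x := by
  have := le_of_mem_eseg (ℓ := -ℓ) (h := -h) (fun v hv => by simpa using he v hv) hx
  simpa using this

/-- A polygon that is monotone except for its last edge, and lies over the rest of a link, can be
contracted to a triangle. -/
theorem contract_path {W : ℕ → E3} {k : ℕ} {S : Finset (Sym2 E3)} {ℓ μ : E3 →ₗ[ℝ] ℝ}
    (hℓ : ∀ i j, i < j → j ≤ k → ℓ (W i) < ℓ (W j)) (hμ0 : μ (W 0) = μ (W k))
    (hμ : ∀ i, 1 ≤ i → i < k → μ (W i) < μ (W k)) (hS : ∀ e ∈ S, ∀ x ∈ eseg e, ℓ x < ℓ (W 0))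
    {j : ℕ} (h1 : 1 ≤ j) (hjk : j < k)
    (h : PolySys (insert s(W j, W k) (insert s(W k, W 0) (pathEdges W j ∪ S)))) :
    PolySys (tri (W 0) (W 1) (W k) ∪ S) ∧
      AmbientIsotopic (body (insert s(W j, W k) (insert s(W k, W 0) (pathEdges W j ∪ S))))
        (body (tri (W 0) (W 1) (W k) ∪ S)) := by
  induction j, h1 using Nat.le_induction with
  | base =>
    have : insert s(W 1, W k) (insert s(W k, W 0) (pathEdges W 1 ∪ S)) =
        tri (W 0) (W 1) (W k) ∪ S := by
      ext e
      simp only [pathEdges, tri, Finset.mem_insert, Finset.mem_union, Finset.mem_singleton,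
        Finset.range_one, Finset.image_singleton]
      tauto
    rw [this] at h ⊢
    exact ⟨h, AmbientIsotopic.refl _⟩
  | succ i hi ih =>
    have hset : insert s(W (i + 1), W k) (insert s(W k, W 0) (pathEdges W (i + 1) ∪ S)) =
        insert s(W i, W (i + 1)) (insert s(W (i + 1), W k)
          (insert s(W k, W 0) (pathEdges W i ∪ S))) := by
      rw [pathEdges_succ]
      ext e
      simp only [Finset.mem_insert, Finset.mem_union]
      tauto
    rw [hset] at h ⊢
    have hiQ := hℓ i (i + 1) (by omega) (by omega)
    have hQk := hℓ (i + 1) k (by omega) le_rfl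
    -- The vertex `W (i + 1)` is cut off by the triangle with corners `W i`, `W (i + 1)` and `W k`.
    obtain ⟨g1, g2⟩ := delta_remove h hiQ hQk (by
      intro e he x hx hxt
      rcases Finset.mem_insert.1 he with rfl | he
      · right
        -- The closing edge lies on the level of `μ` through `W k`, whereas the triangle reaches
        -- this level only in `W k`.
        refine eq_of_mem_tri (ℓ := -μ) (P := W k) (Q := W i) (T := W (i + 1)) ?_ ?_ ?_ ?_
        · convert hxt using 2
          ext y; simp only [mem_insert_iff, mem_singleton_iff]; tauto
        · simpa using hμ i hi (by omega)
        · simpa using hμ (i + 1) (by omega) (by omega)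
        · simp only [LinearMap.neg_apply, neg_le_neg_iff]
          refine ge_of_mem_eseg (fun v hv => ?_) hx
          rcases Sym2.mem_iff.1 hv with rfl | rfl
          · exact le_rfl
          · exact hμ0.ge
      · left
        -- The earlier edges of the path and the other components lie at or below the level of `ℓ`
        -- through `W i`, the lowest corner of the triangle.
        refine eq_of_mem_tri hxt hiQ (hiQ.trans hQk) ?_
        rcases Finset.mem_union.1 he with he | he
        · obtain ⟨m, hm, rfl⟩ := mem_pathEdges.1 he
          refine le_of_mem_eseg (fun v hv => ?_) hx
          rcases Sym2.mem_iff.1 hv with rfl | rfl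
          · exact (hℓ _ _ hm (by omega)).le
          · rcases (Nat.succ_le_of_lt hm).eq_or_lt with h | h
            · rw [← h]
            · exact (hℓ _ _ h (by omega)).le
        · have h3 : ℓ (W 0) < ℓ (W i) := hℓ 0 i (by omega) (by omega)
          exact ((hS e he x hx).trans h3).le)
    obtain ⟨g3, g4⟩ := ih (by omega) g1
    exact ⟨g3, g2.trans g4⟩

/-! ### Raising a component -/

theorem Gen.flat_of_mem {P : Finset (Sym2 (ℝ × ℝ))} (hP : Gen P) {e e' : Sym2 (ℝ × ℝ)} (he : e ∈ P)
    (he' : e' ∈ P) (hne : e ≠ e') {v : ℝ × ℝ} (hv : v ∈ e) (hv' : v ∈ e') : Flat e e' := by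
  intro q hq hq'
  obtain rfl := hP.sing _ he _ he' hne _ (mem_eseg_of_mem hv) (mem_eseg_of_mem hv') q hq hq'
  exact ⟨hv, hv'⟩

theorem Good.polySys {P : Finset (Sym2 (ℝ × ℝ))} {z : ℝ × ℝ → ℝ} (h : Good z P)
    (hnd : ∀ e ∈ P, ¬ e.IsDiag) (hdeg : ∀ v, deg P v = 0 ∨ deg P v = 2) (hne : P.Nonempty) :
    PolySys (sys z P) := (emb_lift hnd h).poly_image hne hdeg

/-- The relative height of the `i`-th vertex of a raised component. -/
def climb (k : ℕ) (N : ℝ) (i : ℕ) : ℝ := if i = k then N else i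

/-- The heights after a component has been raised. -/
def raised (z : ℝ × ℝ → ℝ) (w : ℕ → ℝ × ℝ) (k : ℕ) (H N : ℝ) (v : ℝ × ℝ) : ℝ :=
  if h : ∃ i, i ≤ k ∧ w i = v then H + climb k N (Nat.find h) else z v

section raise
variable {P : Finset (Sym2 (ℝ × ℝ))} {z : ℝ × ℝ → ℝ} {w : ℕ → ℝ × ℝ} {k : ℕ} {H N : ℝ}

theorem raised_apply (hw : IsCycle P w k) {i : ℕ} (hi : i ≤ k) :
    raised z w k H N (w i) = H + climb k N i := by
  have h : ∃ j, j ≤ k ∧ w j = w i := ⟨i, hi, rfl⟩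
  rw [raised, dif_pos h, hw.inj _ (Nat.find_spec h).1 i hi (Nat.find_spec h).2]

theorem raised_of_ne {v : ℝ × ℝ} (h : ∀ i ≤ k, w i ≠ v) : raised z w k H N v = z v := by
  rw [raised, dif_neg]
  rintro ⟨i, hi, h'⟩
  exact h i hi h'

theorem climb_lt (hN : k < N) {i j : ℕ} (hij : i < j) (hj : j ≤ k) : climb k N i < climb k N j := by
  rw [climb, climb, if_neg (by omega)]
  split_ifs with h
  · exact lt_of_le_of_lt (by exact_mod_cast (by omega : i ≤ k)) hN
  · exact_mod_cast hij

/-- The rest of the diagram after a component has been removed. -/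
def restOf (P : Finset (Sym2 (ℝ × ℝ))) (w : ℕ → ℝ × ℝ) (k : ℕ) : Finset (Sym2 (ℝ × ℝ)) :=
  P \ insert s(w k, w 0) (pathEdges w k)

theorem IsCycle.subset (hw : IsCycle P w k) : insert s(w k, w 0) (pathEdges w k) ⊆ P := by
  intro e he
  rcases Finset.mem_insert.1 he with rfl | he
  · exact hw.close
  · obtain ⟨i, hi, rfl⟩ := mem_pathEdges.1 he
    exact hw.edge i hi

theorem restOf_ne (hw : IsCycle P w k) {e : Sym2 (ℝ × ℝ)} (he : e ∈ restOf P w k) {v : ℝ × ℝ}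
    (hv : v ∈ e) : ∀ i ≤ k, w i ≠ v := by
  rintro i hi rfl
  obtain ⟨h1, h2⟩ := Finset.mem_sdiff.1 he
  exact h2 (hw.full e h1 i hi hv)

theorem map_raised (hw : IsCycle P w k) {e : Sym2 (ℝ × ℝ)} (he : e ∈ restOf P w k) :
    e.map (lift (raised z w k H N)) = e.map (lift z) :=
  Sym2.map_congr fun _ hv => lift_congr (raised_of_ne (restOf_ne hw he hv))

theorem deg_restOf (hw : IsCycle P w k) (hdeg : ∀ v, deg P v = 0 ∨ deg P v = 2) (v : ℝ × ℝ) :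
    deg (restOf P w k) v = 0 ∨ deg (restOf P w k) v = 2 := by
  by_cases h : ∃ i ≤ k, w i = v
  · obtain ⟨i, hi, rfl⟩ := h
    left
    rw [deg_eq_zero]
    intro e he hv
    exact restOf_ne hw he hv i hi rfl
  · push Not at h
    have h1 : P = insert s(w k, w 0) (pathEdges w k) ∪ restOf P w k := by
      rw [restOf, Finset.union_sdiff_of_subset hw.subset]
    have h2 : deg (insert s(w k, w 0) (pathEdges w k)) v = 0 := by
      rw [deg_eq_zero]
      intro e he hv
      rcases Finset.mem_insert.1 he with rfl | he
      · rcases Sym2.mem_iff.1 hv with h3 | h3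
        · exact h k le_rfl h3.symm
        · exact h 0 (by omega) h3.symm
      · obtain ⟨i, hi, rfl⟩ := mem_pathEdges.1 he
        rcases Sym2.mem_iff.1 hv with h3 | h3
        · exact h i (by omega) h3.symm
        · exact h (i + 1) (by omega) h3.symm
    have h3 := hdeg v
    rw [h1, deg_union (by rw [restOf]; exact Finset.disjoint_sdiff), h2, zero_add] at h3
    exact h3

/-- The linear form that is constant on the last edge of a raised component. -/
def tilt (w : ℕ → ℝ × ℝ) (k : ℕ) (N : ℝ) : E3 →ₗ[ℝ] ℝ :=
  coord 0 + (((w 0).1 - (w k).1) / N) • coord 2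

theorem tilt_raised (hw : IsCycle P w k) {i : ℕ} (hi : i ≤ k) :
    tilt w k N (lift (raised z w k H N) (w i)) =
      (w i).1 + ((w 0).1 - (w k).1) / N * (H + climb k N i) := by
  rw [← raised_apply (z := z) hw hi]; rfl

theorem tilt_zero (hw : IsCycle P w k) (hN : k < N) :
    tilt w k N (lift (raised z w k H N) (w 0)) = tilt w k N (lift (raised z w k H N) (w k)) := by
  have hN0 : N ≠ 0 := (lt_of_le_of_lt (Nat.cast_nonneg k) hN).ne'
  have hk := hw.two
  rw [tilt_raised hw (by omega), tilt_raised hw le_rfl, climb, climb, if_neg (by omega), if_pos rfl]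
  field_simp
  push_cast
  ring

/-- The vertex `w 0` lies to the right of the others, and by `hN'` the last vertex is raised so far
that the tilt cannot compensate the distance in the first coordinate. -/
theorem tilt_lt (hw : IsCycle P w k) (hN : k < N)
    (hN' : ∀ i, 1 ≤ i → i < k → ((w 0).1 - (w k).1) * i < N * ((w 0).1 - (w i).1)) {i : ℕ}
    (h1 : 1 ≤ i) (hik : i < k) :
    tilt w k N (lift (raised z w k H N) (w i)) < tilt w k N (lift (raised z w k H N) (w k)) := by
  have hN0 : 0 < N := lt_of_le_of_lt (Nat.cast_nonneg k) hN
  rw [← tilt_zero hw hN, tilt_raised hw hik.le, tilt_raised hw (by omega), climb, climb,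
    if_neg (by omega), if_neg (by omega)]
  have h := hN' i h1 hik
  have e1 : ((w 0).1 - (w k).1) / N * (H + i) = ((w 0).1 - (w k).1) / N * H +
    ((w 0).1 - (w k).1) * i / N := by ring
  have e2 : ((w 0).1 - (w k).1) * i / N < (w 0).1 - (w i).1 := by
    rw [div_lt_iff₀ hN0]; linarith
  rw [e1]
  push_cast
  linarith

/-- The raised component lies over everything else. Along its path heights increase, so of two edges
without common vertex the later runs over the earlier. The closing edge runs over the inner path
edges because it has the larger value of `tilt`, and over a common point of the plane a larger tilt
means a larger height. -/
theorem good_raised (hP : Gen P) (hz : Good z P) (hw : IsCycle P w k) (hN : k < N)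
    (hN' : ∀ i, 1 ≤ i → i < k → ((w 0).1 - (w k).1) * i < N * ((w 0).1 - (w i).1))
    (hH : ∀ e ∈ P, ∀ v ∈ e, z v < H) (hmax : (w k).1 < (w 0).1) : Good (raised z w k H N) P := by
  have hN0 : 0 < N := lt_of_le_of_lt (Nat.cast_nonneg k) hN
  have hk := hw.two
  have hclimb0 : ∀ i, 0 ≤ climb k N i := by
    intro i; rw [climb]; split_ifs
    · exact hN0.le
    · exact Nat.cast_nonneg i
  set z' := raised z w k H N with hz'
  have h2 : ∀ i ≤ k, coord 2 (lift z' (w i)) = H + climb k N i := fun i hi =>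
    (lift_two z' (w i)).trans (raised_apply hw hi)
  have cls : ∀ e ∈ P, e ∈ restOf P w k ∨ e = s(w k, w 0) ∨ ∃ i < k, e = s(w i, w (i + 1)) := by
    intro e he
    by_cases h : e ∈ insert s(w k, w 0) (pathEdges w k)
    · rcases Finset.mem_insert.1 h with h | h
      · exact .inr (.inl h)
      · exact .inr (.inr (mem_pathEdges.1 h))
    · exact .inl (Finset.mem_sdiff.2 ⟨he, h⟩)
  have hlow : ∀ i < k, ∀ x ∈ eseg (s(w i, w (i + 1)).map (lift z')), H + climb k N i ≤ coord 2 x := by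
    intro i hi x hx
    refine ge_of_mem_eseg (fun v hv => ?_) hx
    rw [Sym2.map_mk] at hv
    rcases Sym2.mem_iff.1 hv with rfl | rfl
    · rw [h2 i hi.le]
    · rw [h2 (i + 1) hi]; linarith [climb_lt hN (Nat.lt_succ_self i) hi]
  have hhigh : ∀ i < k, ∀ x ∈ eseg (s(w i, w (i + 1)).map (lift z')),
      coord 2 x ≤ H + climb k N (i + 1) := by
    intro i hi x hx
    refine le_of_mem_eseg (fun v hv => ?_) hx
    rw [Sym2.map_mk] at hv
    rcases Sym2.mem_iff.1 hv with rfl | rfl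
    · rw [h2 i hi.le]; linarith [climb_lt hN (Nat.lt_succ_self i) hi]
    · rw [h2 (i + 1) hi]
  have hrest : ∀ e ∈ restOf P w k, ∀ x ∈ eseg (e.map (lift z')), coord 2 x < H := by
    intro e he x hx
    rw [map_raised hw he] at hx
    have := lt_of_mem_eseg (ℓ := -coord 2) (h := -H) (fun v hv => ?_) hx
    · simpa using this
    · obtain ⟨u, hu, rfl⟩ := Sym2.mem_map.1 hv
      have := hH e (Finset.mem_sdiff.1 he).1 u hu
      simp only [LinearMap.neg_apply, neg_lt_neg_iff, coord_apply, lift_two]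
      exact this
  have over_rest : ∀ e' ∈ restOf P w k, (Over z' s(w k, w 0) e') ∧
      ∀ i < k, Over z' s(w i, w (i + 1)) e' := by
    intro e' he'
    constructor
    · intro x hx y hy _
      refine lt_of_lt_of_le (hrest e' he' y hy) (ge_of_mem_eseg (ℓ := coord 2) (fun v hv => ?_) hx)
      rw [Sym2.map_mk] at hv
      rcases Sym2.mem_iff.1 hv with rfl | rfl
      · rw [h2 k le_rfl]; linarith [hclimb0 k]
      · rw [h2 0 (by omega)]; linarith [hclimb0 0]
    · intro i hi x hx y hy _
      have h3 := hrest e' he' y hy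
      have h4 := hlow i hi x hx
      rw [coord_apply] at h3 h4
      linarith [hclimb0 i]
  have over_path : ∀ i j, i + 1 < j → j < k → Over z' s(w j, w (j + 1)) s(w i, w (i + 1)) := by
    intro i j hij hj x hx y hy _
    have h3 := hhigh i (by omega) y hy
    have h4 := hlow j hj x hx
    rw [coord_apply] at h3 h4
    linarith [climb_lt hN hij hj.le]
  have over_close : ∀ i, 1 ≤ i → i + 1 < k → Over z' s(w k, w 0) s(w i, w (i + 1)) := by
    intro i h1 hi x hx y hy hxy
    have h3 : tilt w k N (lift z' (w k)) ≤ tilt w k N x := by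
      refine ge_of_mem_eseg (fun v hv => ?_) hx
      rw [Sym2.map_mk] at hv
      rcases Sym2.mem_iff.1 hv with rfl | rfl
      · exact le_rfl
      · exact (tilt_zero hw hN).ge
    have h4 : (-tilt w k N) (lift z' (w k)) < (-tilt w k N) y := by
      refine lt_of_mem_eseg (fun v hv => ?_) hy
      rw [Sym2.map_mk] at hv
      rw [LinearMap.neg_apply, LinearMap.neg_apply, neg_lt_neg_iff]
      rcases Sym2.mem_iff.1 hv with rfl | rfl
      · exact tilt_lt hw hN hN' h1 (by omega)
      · exact tilt_lt hw hN hN' (by omega) hi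
    rw [LinearMap.neg_apply, LinearMap.neg_apply, neg_lt_neg_iff] at h4
    -- The first coordinates agree at a crossing, so the comparison of tilts is a comparison of
    -- third coordinates with the positive factor `h6`.
    have h5 := h4.trans_le h3
    simp only [tilt, LinearMap.add_apply, LinearMap.smul_apply, smul_eq_mul,
      coord_zero_of_proj hxy] at h5
    have h6 : 0 < ((w 0).1 - (w k).1) / N := div_pos (by linarith) hN0
    exact lt_of_mul_lt_mul_left (by linarith : _ * coord 2 y < _ * coord 2 x) h6.le
  intro e he e' he' hne
  rcases cls e he with h | rfl | ⟨i, hi, rfl⟩ <;> rcases cls e' he' with h' | rfl | ⟨j, hj, rfl⟩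
  · refine (hz e he e' he' hne).imp id (Or.imp (fun h3 => h3.congr ?_ ?_) fun h3 => h3.congr ?_ ?_)
    all_goals exact map_raised hw ‹_›
  · exact .inr (.inr (over_rest e h).1)
  · exact .inr (.inr ((over_rest e h).2 j hj))
  · exact .inr (.inl (over_rest e' h').1)
  · exact absurd rfl hne
  · by_cases h0 : j = 0
    · subst h0; exact .inl (hP.flat_of_mem he he' hne (v := w 0) (by simp) (by simp))
    by_cases h1 : j + 1 = k
    · subst h1; exact .inl (hP.flat_of_mem he he' hne (v := w (j + 1)) (by simp) (by simp))
    exact .inr (.inl (over_close j (by omega) (by omega)))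
  · exact .inr (.inl ((over_rest e' h').2 i hi))
  · by_cases h0 : i = 0
    · subst h0; exact .inl (hP.flat_of_mem he he' hne (v := w 0) (by simp) (by simp))
    by_cases h1 : i + 1 = k
    · subst h1; exact .inl (hP.flat_of_mem he he' hne (v := w (i + 1)) (by simp) (by simp))
    exact .inr (.inr (over_close i (by omega) (by omega)))
  · rcases lt_trichotomy i j with h | rfl | h
    · by_cases h1 : i + 1 = j
      · subst h1; exact .inl (hP.flat_of_mem he he' hne (v := w (i + 1)) (by simp) (by simp))
      · exact .inr (.inr (over_path i j (by omega) hj))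
    · exact absurd rfl hne
    · by_cases h1 : j + 1 = i
      · subst h1; exact .inl (hP.flat_of_mem he he' hne (v := w (j + 1)) (by simp) (by simp))
      · exact .inr (.inl (over_path j i (by omega) hi))

/-- A generic diagram in a skein-closed class can be replaced by one in which a component is a
triangle that lies over all other components. -/
theorem Gen.exists_top_triangle {Z : Set E3 → Prop} (hZ : SkeinClosed Z) (hP : Gen P)
    (hz : Good z P) (hne : P.Nonempty)
    (hfst : ∀ e ∈ P, ∀ v ∈ e, ∀ e' ∈ P, ∀ v' ∈ e', v.1 = v'.1 → v = v')
    (hlt : ∀ S, PolySys S → cnum S proj < cnum P id → Z (body S)) :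
    ∃ R ⊂ P, (∀ v, _root_.deg R v = 0 ∨ _root_.deg R v = 2) ∧ ∃ (A B C : E3) (h : ℝ),
      PolySys (tri A B C ∪ sys z R) ∧ xzDet A B C ≠ 0 ∧ (∀ e ∈ sys z R, ∀ x ∈ eseg e, x 2 ≤ h) ∧
      h < A 2 ∧ h < B 2 ∧ h < C 2 ∧
      (Z (body (sys z P)) ↔ Z (body (tri A B C ∪ sys z R))) := by
  -- The component to be raised is the one through the rightmost vertex, from which it is traversed.
  -- By `hfst` this vertex lies strictly to the right of all others.
  obtain ⟨u, ⟨eu, heu, hueu⟩, humax⟩ : ∃ u, (∃ e ∈ P, u ∈ e) ∧ ∀ e ∈ P, ∀ v ∈ e, v.1 ≤ u.1 := by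
    set vs : Finset (ℝ × ℝ) := P.biUnion fun e => e.toFinset with hvs
    have hmem : ∀ v, v ∈ vs ↔ ∃ e ∈ P, v ∈ e := by simp [hvs]
    obtain ⟨e, he⟩ := hne
    obtain ⟨v, hv⟩ : ∃ v, v ∈ e := by
      induction e with | _ a b => exact ⟨a, by simp⟩
    obtain ⟨u, hu, hmax⟩ := Finset.exists_max_image vs Prod.fst ⟨v, (hmem v).2 ⟨e, he, hv⟩⟩
    exact ⟨u, (hmem u).1 hu, fun e he v hv => hmax v ((hmem v).2 ⟨e, he, hv⟩)⟩
  obtain ⟨w, k, hw, rfl⟩ := exists_isCycle hP.nd hP.deg ⟨eu, heu, hueu⟩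
  have hk := hw.two
  have hwx : ∀ i, 1 ≤ i → i ≤ k → (w i).1 < (w 0).1 := by
    intro i h1 hi
    have hmem : ∃ e ∈ P, w i ∈ e := by
      obtain ⟨j, rfl⟩ : ∃ j, i = j + 1 := ⟨i - 1, by omega⟩
      exact ⟨_, hw.edge j hi, by simp⟩
    obtain ⟨e, he, hv⟩ := hmem
    refine lt_of_le_of_ne (humax e he _ hv) fun h => ?_
    have := hw.inj i hi 0 (by omega) (hfst e he _ hv eu heu _ hueu h)
    omega
  obtain ⟨h, hh⟩ : ∃ h, ∀ e ∈ P, ∀ v ∈ e, z v ≤ h := by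
    have : ∀ᶠ h in (atTop : Filter ℝ), ∀ e ∈ P, ∀ v ∈ e, z v ≤ h := by
      refine (Finset.eventually_all _).2 fun e _ => ?_
      induction e with | _ a b =>
      filter_upwards [eventually_ge_atTop (z a), eventually_ge_atTop (z b)] with h h1 h2
      simp [h1, h2]
    exact this.exists
  -- The closing edge is made so steep that the whole path stays on one side of a tilted plane
  -- through it. Each of the finitely many conditions holds for large `N`.
  obtain ⟨N, hN, hN'⟩ : ∃ N : ℝ, k < N ∧ ∀ i ∈ Finset.range k, 1 ≤ i →
      ((w 0).1 - (w k).1) * i < N * ((w 0).1 - (w i).1) := by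
    have : ∀ᶠ N in (atTop : Filter ℝ), ∀ i ∈ Finset.range k, 1 ≤ i →
        ((w 0).1 - (w k).1) * i < N * ((w 0).1 - (w i).1) := by
      refine (Finset.eventually_all _).2 fun i hi => ?_
      by_cases h1 : 1 ≤ i
      · have hpos := sub_pos.2 (hwx i h1 (Finset.mem_range.1 hi).le)
        filter_upwards [eventually_gt_atTop (((w 0).1 - (w k).1) * i / ((w 0).1 - (w i).1))]
          with N hN _
        rwa [div_lt_iff₀ hpos] at hN
      · exact .of_forall fun N h => absurd h h1
    exact ((eventually_gt_atTop (k : ℝ)).and this).exists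
  replace hN' : ∀ i, 1 ≤ i → i < k → ((w 0).1 - (w k).1) * i < N * ((w 0).1 - (w i).1) :=
    fun i h1 hi => hN' i (Finset.mem_range.2 hi) h1
  have hN0 : 0 < N := lt_of_le_of_lt (Nat.cast_nonneg k) hN
  have hH : ∀ e ∈ P, ∀ v ∈ e, z v < h + 1 := fun e he v hv => by linarith [hh e he v hv]
  have hmax := hwx k (by omega) le_rfl
  have hz' := good_raised hP hz hw hN hN' hH hmax
  set z' := raised z w k (h + 1) N with hz'def
  have hstep := hP.height_change hZ hz hz' hlt
  have hsysR : sys z' (restOf P w k) = sys z (restOf P w k) :=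
    Finset.image_congr fun e he => map_raised hw he
  set W : ℕ → E3 := fun i => lift z' (w i) with hW
  have hPsplit : P = insert s(w k, w 0) (pathEdges w k) ∪ restOf P w k := by
    rw [restOf, Finset.union_sdiff_of_subset hw.subset]
  have hpe : (pathEdges w k).image (Sym2.map (lift z')) = pathEdges W k := by
    rw [pathEdges, Finset.image_image]; rfl
  have hsys : sys z' P = insert s(W (k - 1), W k)
      (insert s(W k, W 0) (pathEdges W (k - 1) ∪ sys z (restOf P w k))) := by
    conv_lhs => rw [hPsplit]
    rw [← hsysR]
    have hk1 : pathEdges W k = insert s(W (k - 1), W k) (pathEdges W (k - 1)) := by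
      obtain ⟨l, rfl⟩ : ∃ l, k = l + 1 := ⟨k - 1, by omega⟩
      exact pathEdges_succ W l
    rw [sys, Finset.image_union, Finset.image_insert, hpe, hk1, Sym2.map_mk]
    ext e
    simp only [Finset.mem_insert, Finset.mem_union, sys]
    tauto
  have h2 : ∀ i ≤ k, coord 2 (W i) = h + 1 + climb k N i := fun i hi =>
    (lift_two z' (w i)).trans (raised_apply hw hi)
  have hc0 : climb k N 0 = 0 := by rw [climb, if_neg (by omega)]; simp
  have hc1 : climb k N 1 = 1 := by rw [climb, if_neg (by omega)]; simp
  have hck : climb k N k = N := by rw [climb, if_pos rfl]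
  have hR : ∀ e ∈ sys z (restOf P w k), ∀ x ∈ eseg e, coord 2 x ≤ h := by
    intro e he x hx
    obtain ⟨f, hf, rfl⟩ := Finset.mem_image.1 he
    refine le_of_mem_eseg (fun v hv => ?_) hx
    obtain ⟨q, hq, rfl⟩ := Sym2.mem_map.1 hv
    rw [coord_apply, lift_two]
    exact hh f (Finset.mem_sdiff.1 hf).1 q hq
  have hpoly := hz'.polySys hP.nd hP.deg hne
  rw [hsys] at hpoly
  obtain ⟨g1, g2⟩ := contract_path (W := W) (k := k) (S := sys z (restOf P w k)) (ℓ := coord 2)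
    (μ := tilt w k N)
    (fun i j hij hj => by
      rw [h2 i (by omega), h2 j hj]; linarith [climb_lt hN hij hj])
    (tilt_zero hw hN) (fun i h1 hi => tilt_lt hw hN hN' h1 hi)
    (fun e he x hx => by
      rw [h2 0 (by omega), hc0]; linarith [hR e he x hx]) (j := k - 1) (by omega) (by omega) hpoly
  have e0 : W 0 2 = h + 1 := by
    have := h2 0 (by omega); rw [hc0, add_zero] at this; exact this
  have e1 : W 1 2 = h + 1 + 1 := by
    have := h2 1 (by omega); rw [hc1] at this; exact this
  have ek : W k 2 = h + 1 + N := by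
    have := h2 k le_rfl; rw [hck] at this; exact this
  refine ⟨restOf P w k, ?_, deg_restOf hw hP.deg, W 0, W 1, W k, h, g1, ?_, hR, ?_, ?_, ?_, ?_⟩
  · rw [restOf]
    exact Finset.sdiff_ssubset hw.subset ⟨_, Finset.mem_insert_self _ _⟩
  -- The determinant equals `(x₀ - xₖ) - N * (x₀ - x₁)` in terms of the first coordinates, and it is
  -- negative by the choice of `N` at the index one.
  · have x1 := hN' 1 le_rfl (by omega)
    rw [xzDet, e0, e1, ek]
    simp only [hW, lift]
    simp
    push_cast at x1
    intro h0
    nlinarith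
  · rw [e0]; linarith
  · rw [e1]; linarith
  · rw [ek]; linarith
  · rw [hstep, hsys]
    exact hZ.iff g2

end raise
end

end

section
open Set Topology Filter
open scoped Classical
noncomputable section
attribute [local instance] sym2DecEq

/-! ### Generic configurations -/

/-- A function that is analytic along lines. -/
def LineAnalytic {X : Type*} [AddCommGroup X] [Module ℝ X] (f : X → ℝ) : Prop :=
  ∀ p q : X, AnalyticOnNhd ℝ (fun t : ℝ => f (ln p q t)) univ

/-- By the identity theorem, zeros accumulating at one point of a line would make the function
vanish on the whole line. -/
theorem LineAnalytic.eventually_ne {X : Type*} [AddCommGroup X] [Module ℝ X] {f : X → ℝ}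
    (hf : LineAnalytic f) (p q : X) {t₁ : ℝ} (h : f (ln p q t₁) ≠ 0) (t₀ : ℝ) :
    ∀ᶠ t in 𝓝[≠] t₀, f (ln p q t) ≠ 0 := by
  by_contra hcon
  rw [not_eventually] at hcon
  refine h ((hf p q).eqOn_zero_of_preconnected_of_frequently_eq_zero isPreconnected_univ
    (mem_univ t₀) ?_ (mem_univ t₁))
  exact hcon.mono fun t ht => not_not.1 ht

/-- From a point where the earlier functions are nonzero, a small step towards a point where the
next one is nonzero keeps the former and gains the latter. -/
theorem exists_common_ne {X : Type*} [AddCommGroup X] [Module ℝ X] {ι : Type*} [Finite ι]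
    (f : ι → X → ℝ) (hf : ∀ i, LineAnalytic (f i)) (hne : ∀ i, ∃ c, f i c ≠ 0) :
    ∃ c, ∀ i, f i c ≠ 0 := by
  have : Fintype ι := Fintype.ofFinite ι
  suffices h : ∀ s : Finset ι, ∃ c, ∀ i ∈ s, f i c ≠ 0 by
    obtain ⟨c, hc⟩ := h Finset.univ
    exact ⟨c, fun i => hc i (Finset.mem_univ i)⟩
  intro s
  induction s using Finset.induction_on with
  | empty => exact ⟨0, by simp⟩
  | insert i s _ ih =>
    obtain ⟨c, hc⟩ := ih
    obtain ⟨r, hr⟩ := hne i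
    have h1 := (hf i).eventually_ne c r (t₁ := 1) (by rwa [ln_one]) 0
    have h2 : ∀ᶠ t in 𝓝[≠] (0 : ℝ), ∀ j ∈ s, f j (ln c r t) ≠ 0 :=
      (Finset.eventually_all _).2 fun j hj =>
        (hf j).eventually_ne c r (t₁ := 0) (by rw [ln_zero]; exact hc j hj) 0
    obtain ⟨t, h3, h4⟩ := (h1.and h2).exists
    refine ⟨ln c r t, fun j hj => ?_⟩
    rcases Finset.mem_insert.1 hj with rfl | hj
    · exact h3
    · exact h4 j hj

/-- The oriented area spanned by three points. -/
def area (a b q : ℝ × ℝ) : ℝ := (b.1 - a.1) * (q.2 - a.2) - (b.2 - a.2) * (q.1 - a.1)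

/-- The determinant of the equations of three lines. -/
def concurrency (x : Fin 6 → ℝ × ℝ) : ℝ :=
  Matrix.det !![(x 0).2 - (x 1).2, (x 1).1 - (x 0).1, (x 0).1 * (x 1).2 - (x 1).1 * (x 0).2;
    (x 2).2 - (x 3).2, (x 3).1 - (x 2).1, (x 2).1 * (x 3).2 - (x 3).1 * (x 2).2;
    (x 4).2 - (x 5).2, (x 5).1 - (x 4).1, (x 4).1 * (x 5).2 - (x 5).1 * (x 4).2]

/-- The homogeneous coordinates of a common point of the three lines lie in the kernel of the
matrix. The coefficients of the combination are the cofactors of its last column. -/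
theorem concurrency_eq_zero {x : Fin 6 → ℝ × ℝ} {q : ℝ × ℝ} (h0 : area (x 0) (x 1) q = 0)
    (h1 : area (x 2) (x 3) q = 0) (h2 : area (x 4) (x 5) q = 0) : concurrency x = 0 := by
  simp only [concurrency, Matrix.det_fin_three, Matrix.of_apply, Matrix.cons_val', Matrix.cons_val]
  simp only [area] at h0 h1 h2
  linear_combination
    (((x 2).2 - (x 3).2) * ((x 5).1 - (x 4).1) - ((x 3).1 - (x 2).1) * ((x 4).2 - (x 5).2)) * h0 +
    (((x 1).1 - (x 0).1) * ((x 4).2 - (x 5).2) - ((x 0).2 - (x 1).2) * ((x 5).1 - (x 4).1)) * h1 +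
    (((x 0).2 - (x 1).2) * ((x 3).1 - (x 2).1) - ((x 1).1 - (x 0).1) * ((x 2).2 - (x 3).2)) * h2

theorem area_ln (a b q q' : ℝ × ℝ) (t : ℝ) :
    area a b (ln q q' t) = (1 - t) * area a b q + t * area a b q' := by
  simp only [area, ln, Prod.fst_add, Prod.snd_add, Prod.smul_fst, Prod.smul_snd, smul_eq_mul]
  ring

theorem area_eq_zero {a b q : ℝ × ℝ} (h : q ∈ eseg s(a, b)) : area a b q = 0 := by
  obtain ⟨t, -, -, rfl⟩ := mem_eseg_iff.1 h
  rw [area_ln]; simp only [area]; ring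

/-- Planar positions of points in general position. -/
structure Generic {V : Type*} (vs : Finset V) (c : V → ℝ × ℝ) : Prop where
  fst : ∀ x : Fin 2 ↪ vs, (c (x 0)).1 - (c (x 1)).1 ≠ 0
  area : ∀ x : Fin 3 ↪ vs, area (c (x 0)) (c (x 1)) (c (x 2)) ≠ 0
  conc : ∀ x : Fin 6 ↪ vs, concurrency (fun i => c (x i)) ≠ 0

theorem analytic_coord {V : Type*} (p q : V → ℝ × ℝ) (v : V) :
    AnalyticOnNhd ℝ (fun t : ℝ => (ln p q t v).1) univ ∧
    AnalyticOnNhd ℝ (fun t : ℝ => (ln p q t v).2) univ := by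
  constructor
  · have : (fun t : ℝ => (ln p q t v).1) = fun t => (1 - t) * (p v).1 + t * (q v).1 := by
      ext t; simp [ln]
    rw [this]; intro t _; fun_prop
  · have : (fun t : ℝ => (ln p q t v).2) = fun t => (1 - t) * (p v).2 + t * (q v).2 := by
      ext t; simp [ln]
    rw [this]; intro t _; fun_prop

/-- Genericity is the simultaneous nonvanishing of finitely many functions that are polynomial along
lines. Each is nonzero for some configuration, so they have a common nonzero configuration `q`. On
the line from `p` to `q` the bad parameters cannot accumulate at zero. -/
theorem Generic.eventually {V : Type*} (vs : Finset V) (p : V → ℝ × ℝ) :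
    ∃ q : V → ℝ × ℝ, ∀ᶠ t in 𝓝[≠] (0 : ℝ), Generic vs (ln p q t) := by
  set f : (Fin 2 ↪ vs) ⊕ (Fin 3 ↪ vs) ⊕ (Fin 6 ↪ vs) → (V → ℝ × ℝ) → ℝ :=
    Sum.elim (fun x c => (c (x 0)).1 - (c (x 1)).1)
      (Sum.elim (fun x c => _root_.area (c (x 0)) (c (x 1)) (c (x 2)))
        fun x c => concurrency fun i => c (x i)) with hf
  have han : ∀ i, LineAnalytic (f i) := by
    have a1 := fun p q v => (analytic_coord (V := V) p q v).1
    have a2 := fun p q v => (analytic_coord (V := V) p q v).2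
    rintro (x | x | x) p q
    · exact (a1 p q _).sub (a1 p q _)
    · exact (((a1 p q _).sub (a1 p q _)).mul ((a2 p q _).sub (a2 p q _))).sub
        (((a2 p q _).sub (a2 p q _)).mul ((a1 p q _).sub (a1 p q _)))
    · simp only [hf, Sum.elim_inr, concurrency, Matrix.det_fin_three, Matrix.of_apply,
        Matrix.cons_val', Matrix.cons_val]
      intro t _
      have b1 := fun v => a1 p q v t (mem_univ t)
      have b2 := fun v => a2 p q v t (mem_univ t)
      fun_prop
  -- Distinct points may be given arbitrary positions, so a single example of a nonzero value is
  -- enough for each function.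
  have hext : ∀ {n : ℕ} (x : Fin n ↪ vs) (y : Fin n → ℝ × ℝ) (i : Fin n),
      Function.extend (fun i => (x i : V)) y 0 (x i) = y i := fun x y i =>
    (Subtype.val_injective.comp x.injective).extend_apply y 0 i
  have hne : ∀ i, ∃ c, f i c ≠ 0 := by
    rintro (x | x | x)
    · refine ⟨Function.extend (fun i => (x i : V)) ![(1, 0), (0, 0)] 0, ?_⟩
      simp only [hf, Sum.elim_inl, hext]
      simp
    · refine ⟨Function.extend (fun i => (x i : V)) ![(0, 0), (1, 0), (0, 1)] 0, ?_⟩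
      simp only [hf, Sum.elim_inl, Sum.elim_inr, hext]
      simp [_root_.area]
    -- The three lines are the two coordinate axes and the line through `(1, 0)` and `(0, 1)`, which
    -- have no common point.
    · refine ⟨Function.extend (fun i => (x i : V))
        ![(0, 0), (1, 0), (0, 0), (0, 1), (1, 0), (0, 1)] 0, ?_⟩
      simp only [hf, Sum.elim_inr, hext]
      simp [concurrency, Matrix.det_fin_three]
  obtain ⟨q, hq⟩ := exists_common_ne f han hne
  refine ⟨q, ?_⟩
  have h : ∀ᶠ t in 𝓝[≠] (0 : ℝ), ∀ i, f i (ln p q t) ≠ 0 :=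
    eventually_all.2 fun i => (han i).eventually_ne p q (t₁ := 1) (by rw [ln_one]; exact hq i) 0
  filter_upwards [h] with t ht
  exact ⟨fun x => ht (.inl x), fun x => ht (.inr (.inl x)), fun x => ht (.inr (.inr x))⟩

/-! ### Generic projections -/

/-- The vertices of a graph. -/
def verts {V : Type*} (S : Finset (Sym2 V)) : Finset V := S.biUnion fun e => e.toFinset

theorem mem_verts {V : Type*} {S : Finset (Sym2 V)} {v : V} : v ∈ verts S ↔ ∃ e ∈ S, v ∈ e := by
  simp [verts]

section generic
variable {V : Type*} {vs : Finset V} {c : V → ℝ × ℝ}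

theorem Generic.fst_inj (h : Generic vs c) {a b : V} (ha : a ∈ vs) (hb : b ∈ vs)
    (hab : (c a).1 = (c b).1) : a = b := by
  by_contra hne
  refine h.fst ⟨![⟨a, ha⟩, ⟨b, hb⟩], ?_⟩ (sub_eq_zero.2 hab)
  intro i j hij
  fin_cases i <;> fin_cases j <;> simp_all

theorem Generic.injOn (h : Generic vs c) : InjOn c vs := fun _ ha _ hb hab =>
  h.fst_inj ha hb (by rw [hab])

theorem Generic.area_ne (h : Generic vs c) {a b d : V} (ha : a ∈ vs) (hb : b ∈ vs) (hd : d ∈ vs)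
    (hab : a ≠ b) (had : a ≠ d) (hbd : b ≠ d) : _root_.area (c a) (c b) (c d) ≠ 0 := by
  refine h.area ⟨![⟨a, ha⟩, ⟨b, hb⟩, ⟨d, hd⟩], ?_⟩
  intro i j hij
  fin_cases i <;> fin_cases j <;> simp_all

theorem Generic.conc_ne (h : Generic vs c) {a b d e f g : V} (ha : a ∈ vs) (hb : b ∈ vs)
    (hd : d ∈ vs) (he : e ∈ vs) (hf : f ∈ vs) (hg : g ∈ vs) (hn : [a, b, d, e, f, g].Nodup) :
    concurrency ![c a, c b, c d, c e, c f, c g] ≠ 0 := by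
  have := h.conc ⟨![⟨a, ha⟩, ⟨b, hb⟩, ⟨d, hd⟩, ⟨e, he⟩, ⟨f, hf⟩, ⟨g, hg⟩], ?_⟩
  · convert this using 2
    ext i : 1
    fin_cases i <;> rfl
  · simp only [List.nodup_cons, List.mem_cons, not_or] at hn
    intro i j hij
    fin_cases i <;> fin_cases j <;> simp_all

/-- A vertex inside another edge, or two common points of two edges, would produce three collinear
vertices. Three edges through one point that is not an end of the first have six distinct ends,
because edges with a common vertex meet only there, and so would produce three concurrent lines. -/
theorem Generic.gen {S : Finset (Sym2 V)} (h : Generic (verts S) c) (hnd : ∀ e ∈ S, ¬ e.IsDiag)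
    (hdeg : ∀ v, deg S v = 0 ∨ deg S v = 2) : Gen (S.image (Sym2.map c)) := by
  have hv : ∀ e ∈ S, ∀ v ∈ e, v ∈ verts S := fun e he v hv => mem_verts.2 ⟨e, he, hv⟩
  have hinj : InjOn c {v | ∃ e ∈ S, v ∈ e} := fun a ha b hb =>
    h.injOn (mem_verts.2 ha) (mem_verts.2 hb)
  have nd : ∀ e ∈ S, ¬ (e.map c).IsDiag := by
    intro e he
    have h1 := hnd e he
    have h2 := hv e he
    induction e with | _ a b =>
    simp only [Sym2.map_mk, Sym2.mk_isDiag_iff] at h1 ⊢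
    exact fun h3 => h1 (h.injOn (h2 a (by simp)) (h2 b (by simp)) h3)
  have vert : ∀ v ∈ verts S, ∀ e ∈ S, c v ∈ eseg (e.map c) → v ∈ e := by
    intro v hvs e he hmem
    have h1 := hnd e he
    have h2 := hv e he
    induction e with | _ a b =>
    rw [Sym2.mk_isDiag_iff] at h1
    by_contra h3
    simp only [Sym2.mem_iff, not_or] at h3
    exact h.area_ne (h2 a (by simp)) (h2 b (by simp)) hvs h1 (Ne.symm h3.1) (Ne.symm h3.2)
      (area_eq_zero hmem)
  have sing : ∀ e ∈ S, ∀ e' ∈ S, e ≠ e' → ∀ q ∈ eseg (e.map c), q ∈ eseg (e'.map c) →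
      ∀ q' ∈ eseg (e.map c), q' ∈ eseg (e'.map c) → q = q' := by
    intro e he e' he' hne q hq hq2 q' hq' hq2'
    have h1 := hnd e he
    have h1' := hnd e' he'
    have h2 := hv e he
    have h2' := hv e' he'
    induction e with | _ a b =>
    rw [Sym2.mk_isDiag_iff] at h1
    obtain ⟨f, hf, hfab⟩ : ∃ f ∈ e', f ∉ s(a, b) := by
      by_contra! hcon
      refine hne ?_
      induction e' with | _ f g =>
      rw [Sym2.mk_isDiag_iff] at h1'
      have hf := hcon f (by simp)
      have hg := hcon g (by simp)
      simp only [Sym2.mem_iff] at hf hg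
      rcases hf with rfl | rfl <;> rcases hg with rfl | rfl
      · exact absurd rfl h1'
      · rfl
      · exact Sym2.eq_swap
      · exact absurd rfl h1'
    obtain ⟨g, rfl⟩ := Sym2.mem_iff_exists.1 hf
    simp only [Sym2.mem_iff, not_or] at hfab
    by_contra hqq
    rw [Sym2.map_mk] at hq hq2 hq' hq2'
    obtain ⟨s, -, -, rfl⟩ := mem_eseg_iff.1 hq2
    obtain ⟨s', -, -, rfl⟩ := mem_eseg_iff.1 hq2'
    have hss : s' - s ≠ 0 := fun h0 => hqq (by rw [sub_eq_zero.1 h0])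
    -- The end `f` of the second edge is an affine combination of the two common points, hence
    -- collinear with the ends of the first edge.
    have hF : ln (ln (c f) (c g) s) (ln (c f) (c g) s') (-s / (s' - s)) = c f := by
      rw [ln_ln]
      have : (1 - -s / (s' - s)) * s + -s / (s' - s) * s' = 0 := by field_simp; ring
      rw [this, ln_zero]
    have h3 := area_ln (c a) (c b) (ln (c f) (c g) s) (ln (c f) (c g) s') (-s / (s' - s))
    rw [hF, area_eq_zero hq, area_eq_zero hq', mul_zero, mul_zero, add_zero] at h3
    exact h.area_ne (h2 a (by simp)) (h2 b (by simp)) (h2' f (by simp)) h1 (Ne.symm hfab.1)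
      (Ne.symm hfab.2) h3
  have share : ∀ e ∈ S, ∀ e' ∈ S, e ≠ e' → ∀ q ∈ eseg (e.map c), q ∈ eseg (e'.map c) →
      ∀ x ∈ e, x ∈ e' → q = c x := fun e he e' he' hne q hq hq' x hx hx' =>
    sing e he e' he' hne q hq hq' _ (mem_eseg_of_mem (Sym2.mem_map.2 ⟨x, hx, rfl⟩))
      (mem_eseg_of_mem (Sym2.mem_map.2 ⟨x, hx', rfl⟩))
  refine ⟨?_, ?_, ?_, ?_, deg_image hinj hdeg⟩
  · intro _ m1
    obtain ⟨e, he, rfl⟩ := Finset.mem_image.1 m1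
    exact nd e he
  · intro _ m1 _ m2 hne
    obtain ⟨e, he, rfl⟩ := Finset.mem_image.1 m1
    obtain ⟨e', he', rfl⟩ := Finset.mem_image.1 m2
    exact sing e he e' he' (fun h => hne (by rw [h]))
  · intro _ m1 v hve _ m2 hvm
    obtain ⟨e, he, rfl⟩ := Finset.mem_image.1 m1
    obtain ⟨e', he', rfl⟩ := Finset.mem_image.1 m2
    obtain ⟨x, hx, rfl⟩ := Sym2.mem_map.1 hve
    exact Sym2.mem_map.2 ⟨x, vert x (hv e he x hx) e' he' hvm, rfl⟩
  · intro _ m1 _ m2 _ m3 h1 h2 h3 q hq hq' hq''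
    obtain ⟨e, he, rfl⟩ := Finset.mem_image.1 m1
    obtain ⟨e', he', rfl⟩ := Finset.mem_image.1 m2
    obtain ⟨e'', he'', rfl⟩ := Finset.mem_image.1 m3
    replace h1 : e ≠ e' := fun h => h1 (by rw [h])
    replace h2 : e ≠ e'' := fun h => h2 (by rw [h])
    replace h3 : e' ≠ e'' := fun h => h3 (by rw [h])
    by_contra hqe
    have d1 : ∀ x ∈ e, x ∉ e' := fun x hx hx' =>
      hqe (share e he e' he' h1 q hq hq' x hx hx' ▸ Sym2.mem_map.2 ⟨x, hx, rfl⟩)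
    have d2 : ∀ x ∈ e, x ∉ e'' := fun x hx hx' =>
      hqe (share e he e'' he'' h2 q hq hq'' x hx hx' ▸ Sym2.mem_map.2 ⟨x, hx, rfl⟩)
    have d3 : ∀ x ∈ e', x ∉ e'' := by
      intro x hx hx'
      have := share e' he' e'' he'' h3 q hq' hq'' x hx hx'
      subst this
      exact d1 x (vert x (hv e' he' x hx) e he hq) hx
    have n1 := hnd e he
    have n2 := hnd e' he'
    have n3 := hnd e'' he''
    have v1 := hv e he
    have v2 := hv e' he'
    have v3 := hv e'' he''
    induction e with | _ a b =>
    induction e' with | _ f g =>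
    induction e'' with | _ k l =>
    rw [Sym2.map_mk] at hq hq' hq''
    refine h.conc_ne (v1 a (by simp)) (v1 b (by simp)) (v2 f (by simp)) (v2 g (by simp))
      (v3 k (by simp)) (v3 l (by simp)) ?_ (concurrency_eq_zero (q := q) (area_eq_zero hq)
        (area_eq_zero hq') (area_eq_zero hq''))
    simp only [Sym2.mem_iff, forall_eq_or_imp, forall_eq, not_or, Sym2.mk_isDiag_iff] at *
    simp only [List.nodup_cons, List.mem_cons, not_or, List.not_mem_nil, not_false_eq_true,
      List.nodup_nil, and_true]
    tauto

end generic
end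

end

section
open Set Topology Filter
open scoped Classical
noncomputable section
attribute [local instance] sym2DecEq

/-! ### Perturbation of a link to a generic position -/

theorem eq_of_proj_eq {z : ℝ × ℝ → ℝ} {e : Sym2 (ℝ × ℝ)} (he : ¬ e.IsDiag) {x y : E3}
    (hx : x ∈ eseg (e.map (lift z))) (hy : y ∈ eseg (e.map (lift z))) (h : proj x = proj y) :
    x = y := by
  induction e with | _ a b =>
  rw [Sym2.mk_isDiag_iff] at he
  rw [Sym2.map_mk] at hx hy
  obtain ⟨s, -, -, rfl⟩ := mem_eseg_iff.1 hx
  obtain ⟨t, -, -, rfl⟩ := mem_eseg_iff.1 hy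
  rw [map_ln, map_ln, proj_lift, proj_lift] at h
  rw [ln_injective he h]

theorem proj_mem_of_mem_lift {z : ℝ × ℝ → ℝ} {e : Sym2 (ℝ × ℝ)} {x : E3}
    (hx : x ∈ eseg (e.map (lift z))) : proj x ∈ eseg e := by
  rw [← map_proj_map_lift z e, eseg_map_proj]
  exact mem_image_of_mem _ hx

theorem exists_mem_lift {z : ℝ × ℝ → ℝ} {e : Sym2 (ℝ × ℝ)} {q : ℝ × ℝ}
    (hq : q ∈ eseg e) : ∃ x ∈ eseg (e.map (lift z)), proj x = q := by
  rw [← map_proj_map_lift z e, eseg_map_proj] at hq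
  exact hq

/-- Two edges of a generic diagram have at most one point in common, so one comparison of heights
decides which runs over the other. Equal heights would be a meeting point of the lifted edges, which
is a common vertex. -/
theorem Gen.good {P : Finset (Sym2 (ℝ × ℝ))} {z : ℝ × ℝ → ℝ} (hP : Gen P)
    (h : PolySys (sys z P)) : Good z P := by
  intro e he e' he' hne
  by_contra! hcon
  obtain ⟨hf, hcon⟩ := hcon
  rw [Flat] at hf
  push Not at hf
  obtain ⟨q, hq, hq', hqq⟩ := hf
  obtain ⟨x, hx, hxq⟩ := exists_mem_lift (z := z) hq
  obtain ⟨y, hy, hyq⟩ := exists_mem_lift (z := z) hq'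
  have huniq : ∀ a ∈ eseg (e.map (lift z)), ∀ b ∈ eseg (e'.map (lift z)), proj a = proj b →
      a = x ∧ b = y := by
    intro a ha b hb hab
    have h1 := hP.sing e he e' he' hne _ (proj_mem_of_mem_lift ha)
      (hab ▸ proj_mem_of_mem_lift hb) q hq hq'
    exact ⟨eq_of_proj_eq (hP.nd e he) ha hx (h1.trans hxq.symm),
      eq_of_proj_eq (hP.nd e' he') hb hy (hab.symm.trans (h1.trans hyq.symm))⟩
  rcases lt_trichotomy (x 2) (y 2) with h1 | h1 | h1
  · refine hcon.2 fun a ha b hb hab => ?_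
    obtain ⟨rfl, rfl⟩ := huniq b hb a ha hab.symm
    exact h1
  · obtain rfl : x = y := E3.ext_proj (hxq.trans hyq.symm) h1
    obtain ⟨v, hv, hv', hvx⟩ := h.emb.meet _ (Finset.mem_image_of_mem _ he) _
      (Finset.mem_image_of_mem _ he') (fun h => hne (Sym2.map.injective (lift_injective z) h)) x
      (by rwa [Sym2.map_id]) (by rwa [Sym2.map_id])
    obtain ⟨w, hw, rfl⟩ := Sym2.mem_map.1 hv
    obtain ⟨w', hw', hww⟩ := Sym2.mem_map.1 hv'
    obtain rfl := lift_injective z hww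
    obtain rfl : w' = q := by rw [← hxq, ← hvx, id, proj_lift]
    exact hqq hw hw'
  · refine hcon.1 fun a ha b hb hab => ?_
    obtain ⟨rfl, rfl⟩ := huniq a ha b hb hab
    exact h1

/-- Nonvanishing of the difference of two points is an open condition and the pairs of edge
parameters form a compact square. -/
theorem eventually_disjoint_eseg {V : Type*} (p q : V → ℝ × ℝ) (e e' : Sym2 V)
    (h : Disjoint (eseg (e.map p)) (eseg (e'.map p))) :
    ∀ᶠ t in 𝓝 (0 : ℝ), Disjoint (eseg (e.map (ln p q t))) (eseg (e'.map (ln p q t))) := by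
  induction e with | _ a b =>
  induction e' with | _ a' b' =>
  have key : ∀ᶠ t in 𝓝 (0 : ℝ), ∀ s ∈ Icc (0 : ℝ) 1 ×ˢ Icc (0 : ℝ) 1,
      ln (ln p q t a) (ln p q t b) s.1 - ln (ln p q t a') (ln p q t b') s.2 ≠ 0 := by
    refine (isCompact_Icc.prod isCompact_Icc).eventually_forall_of_forall_eventually ?_
    rintro ⟨s, s'⟩ ⟨hs, hs'⟩
    have hc : Continuous fun y : ℝ × ℝ × ℝ => ln (ln p q y.1 a) (ln p q y.1 b) y.2.1 -
        ln (ln p q y.1 a') (ln p q y.1 b') y.2.2 := by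
      simp only [ln, Pi.add_apply, Pi.smul_apply]
      fun_prop
    refine hc.continuousAt.eventually_ne ?_
    simp only [ln_zero]
    intro h0
    refine disjoint_left.1 h (mem_eseg_iff.2 ⟨s, hs.1, hs.2, rfl⟩) ?_
    rw [sub_eq_zero.1 h0]
    exact mem_eseg_iff.2 ⟨s', hs'.1, hs'.2, rfl⟩
  filter_upwards [key] with t ht
  rw [disjoint_left]
  intro x hx hx'
  obtain ⟨s, h0, h1, rfl⟩ := mem_eseg_iff.1 hx
  obtain ⟨s', h0', h1', hs⟩ := mem_eseg_iff.1 hx'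
  exact ht (s, s') ⟨⟨h0, h1⟩, h0', h1'⟩ (sub_eq_zero.2 hs)

/-- The vertices are moved horizontally by a small amount in a generic direction. Edges with
disjoint projections keep disjoint projections, so no new crossing pair arises. -/
theorem PolySys.exists_generic {S : Finset (Sym2 E3)} (hS : PolySys S) :
    ∃ (P : Finset (Sym2 (ℝ × ℝ))) (z : ℝ × ℝ → ℝ), Gen P ∧ Good z P ∧ P.Nonempty ∧
      (∀ e ∈ P, ∀ v ∈ e, ∀ e' ∈ P, ∀ v' ∈ e', v.1 = v'.1 → v = v') ∧
      AmbientIsotopic (body S) (body (sys z P)) ∧ cnum P id ≤ cnum S proj ∧ P.card ≤ S.card := by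
  obtain ⟨q, hq⟩ := Generic.eventually (verts S) proj
  obtain ⟨δ, hδ, hst⟩ := hS.emb.exists_stable
  set c : ℝ → E3 → ℝ × ℝ := fun t => ln proj q t with hc
  set g : ℝ → E3 → E3 := fun t v => !₂[(c t v).1, (c t v).2, v 2] with hg
  have hg0 : ∀ v, g 0 v = v := by
    intro v
    simp only [hg, hc, ln_zero]
    ext i
    fin_cases i <;> simp [proj_apply]
  have hgc : ∀ v, Continuous fun t => g t v := by
    intro v
    simp only [hg, hc, ln, Pi.add_apply, Pi.smul_apply]
    refine (PiLp.continuous_toLp 2 _).comp ?_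
    refine continuous_pi fun i => ?_
    fin_cases i <;> simp <;> fun_prop
  have e1 := exists_pos_forall_norm_sub_lt S g hgc 0 hδ
  have e2 : ∀ᶠ t in 𝓝 (0 : ℝ), ∀ p ∈ S ×ˢ S, Disjoint (eseg (p.1.map proj)) (eseg (p.2.map proj)) →
      Disjoint (eseg (p.1.map (c t))) (eseg (p.2.map (c t))) := by
    refine (Finset.eventually_all _).2 fun p _ => ?_
    by_cases h : Disjoint (eseg (p.1.map proj)) (eseg (p.2.map proj))
    · filter_upwards [eventually_disjoint_eseg proj q p.1 p.2 h] with t ht _ using ht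
    · exact .of_forall fun t h' => absurd h' h
  obtain ⟨t, hgen, h1, h2⟩ := (hq.and (mem_nhdsWithin_of_mem_nhds (e1.and e2))).exists
  obtain ⟨hemb, hiso⟩ := hst (g t) fun e he v hv => by
    have := h1 e he v hv
    rwa [hg0] at this
  have hnd : ∀ e ∈ S, ¬ e.IsDiag := fun e he => hS.nd he
  have hinj := hgen.injOn
  have hP : Gen (S.image (Sym2.map (c t))) := hgen.gen hnd hS.deg
  -- The height over a vertex of the diagram is that of the unique vertex of the link projecting to
  -- it.
  set z : ℝ × ℝ → ℝ := fun x => Function.invFunOn (c t) (verts S) x 2 with hz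
  have hlift : ∀ v ∈ verts S, lift z (c t v) = g t v := by
    intro v hv
    have : Function.invFunOn (c t) (verts S) (c t v) = v :=
      hinj (Function.invFunOn_mem ⟨v, hv, rfl⟩) hv (Function.invFunOn_eq ⟨v, hv, rfl⟩)
    simp [lift, hz, hg, this]
  have hsys : sys z (S.image (Sym2.map (c t))) = S.image (Sym2.map (g t)) := by
    rw [sys, Finset.image_image]
    refine Finset.image_congr fun e he => ?_
    rw [Function.comp_apply, Sym2.map_map]
    exact Sym2.map_congr fun v hv => hlift v (mem_verts.2 ⟨e, he, hv⟩)
  refine ⟨_, z, hP, hP.good ?_, hS.ne.image _, ?_, ?_, ?_, Finset.card_image_le⟩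
  · rw [hsys]
    exact hemb.poly_image hS.ne hS.deg
  · intro _ m1 _ hv _ m2 _ hv' hvv
    obtain ⟨e, he, rfl⟩ := Finset.mem_image.1 m1
    obtain ⟨e', he', rfl⟩ := Finset.mem_image.1 m2
    obtain ⟨v, hve, rfl⟩ := Sym2.mem_map.1 hv
    obtain ⟨v', hve', rfl⟩ := Sym2.mem_map.1 hv'
    rw [hgen.fst_inj (mem_verts.2 ⟨e, he, hve⟩) (mem_verts.2 ⟨e', he', hve'⟩) hvv]
  · rw [hsys, body_image]
    rwa [← body_image S id, Sym2.map_id, Finset.image_id] at hiso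
  -- A crossing pair of the diagram is pulled back to a pair of edges of the original link, whose
  -- projections met already by `h2`.
  · have hpre : ∀ f ∈ S.image (Sym2.map (c t)), ∃ e ∈ S, e.map (c t) = f := fun f hf =>
      Finset.mem_image.1 hf
    choose! k hkS hk using hpre
    refine cnum_le_of_injOn k ?_ ?_
    · intro f hf f' hf' hcr
      refine ⟨hkS f hf, hkS f' hf', fun v hv hv' => ?_, ?_⟩
      · refine hcr.1 (c t v) ?_ ?_
        · rw [← hk f hf]; exact Sym2.mem_map.2 ⟨v, hv, rfl⟩
        · rw [← hk f' hf']; exact Sym2.mem_map.2 ⟨v, hv', rfl⟩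
      · obtain ⟨x, hx, hx'⟩ := hcr.2
        rw [Sym2.map_id, id] at hx hx'
        rw [← hk f hf] at hx
        rw [← hk f' hf'] at hx'
        have h3 := h2 (k f, k f') (Finset.mk_mem_product (hkS f hf) (hkS f' hf'))
        exact not_disjoint_iff.1 fun h4 => disjoint_left.1 (h3 h4) hx hx'
    · intro e₁ h1 e₁' h1' e₂ h2 e₂' h2' _ _ h3 h4
      exact ⟨by rw [← hk e₁ h1, h3, hk e₂ h2], by rw [← hk e₁' h1', h4, hk e₂' h2']⟩
end

end

section
open Set Topology Filter
open scoped Classical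
noncomputable section
attribute [local instance] sym2DecEq

/-! ### Polygonal arcs -/

/-- The edges of the polygonal arc through the given vertices. -/
def pathSet : List E3 → Finset (Sym2 E3)
  | [] => ∅
  | [_] => ∅
  | a :: b :: l => insert s(a, b) (pathSet (b :: l))

theorem pathSet_single (a : E3) : pathSet [a] = ∅ := rfl

theorem pathSet_cons (a b : E3) (l : List E3) :
    pathSet (a :: b :: l) = insert s(a, b) (pathSet (b :: l)) := rfl

theorem pathSet_append (l₁ l₂ : List E3) (P T : E3) : pathSet (l₁ ++ P :: T :: l₂) =
    insert s(P, T) (pathSet (l₁ ++ [P]) ∪ pathSet (T :: l₂)) := by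
  induction l₁ with
  | nil => simp [pathSet]
  | cons a l ih =>
    cases l with
    | nil =>
      simp only [List.nil_append, List.cons_append, pathSet_cons, pathSet_single] at ih ⊢
      ext e; simp only [Finset.mem_insert, Finset.mem_union, Finset.notMem_empty]; tauto
    | cons b l =>
      simp only [List.cons_append, pathSet_cons] at ih ⊢
      rw [ih]
      ext e; simp only [Finset.mem_insert, Finset.mem_union]; tauto

theorem path_add {l₁ l₂ : List E3} {P Q T : E3} {X : Finset (Sym2 E3)} (ℓ : E3 →ₗ[ℝ] ℝ)
    (h : PolySys (pathSet (l₁ ++ P :: T :: l₂) ∪ X)) (hPQ : ℓ P < ℓ Q) (hQT : ℓ Q < ℓ T)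
    (hL : ∀ e ∈ pathSet (l₁ ++ [P]) ∪ pathSet (T :: l₂), ∀ x ∈ eseg e,
      x ∈ convexHull ℝ {P, Q, T} → x = P ∨ x = T)
    (hX : ∀ e ∈ X, ∀ x ∈ eseg e, x ∈ convexHull ℝ {P, Q, T} → x = P ∨ x = T) :
    PolySys (pathSet (l₁ ++ P :: Q :: T :: l₂) ∪ X) ∧
      AmbientIsotopic (body (pathSet (l₁ ++ P :: T :: l₂) ∪ X))
        (body (pathSet (l₁ ++ P :: Q :: T :: l₂) ∪ X)) := by
  have e2 : pathSet (l₁ ++ P :: Q :: T :: l₂) ∪ X = insert s(P, Q) (insert s(Q, T)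
      (pathSet (l₁ ++ [P]) ∪ pathSet (T :: l₂) ∪ X)) := by
    rw [pathSet_append, pathSet_cons]
    ext e; simp only [Finset.mem_insert, Finset.mem_union]; tauto
  rw [e2]
  rw [pathSet_append, Finset.insert_union] at h ⊢
  refine delta_add h hPQ hQT fun e he => ?_
  rcases Finset.mem_union.1 he with he | he
  · exact hL e he
  · exact hX e he

theorem path_remove {l₁ l₂ : List E3} {P Q T : E3} {X : Finset (Sym2 E3)} (ℓ : E3 →ₗ[ℝ] ℝ)
    (h : PolySys (pathSet (l₁ ++ P :: Q :: T :: l₂) ∪ X)) (hPQ : ℓ P < ℓ Q) (hQT : ℓ Q < ℓ T)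
    (hL : ∀ e ∈ pathSet (l₁ ++ [P]) ∪ pathSet (T :: l₂), ∀ x ∈ eseg e,
      x ∈ convexHull ℝ {P, Q, T} → x = P ∨ x = T)
    (hX : ∀ e ∈ X, ∀ x ∈ eseg e, x ∈ convexHull ℝ {P, Q, T} → x = P ∨ x = T) :
    PolySys (pathSet (l₁ ++ P :: T :: l₂) ∪ X) ∧
      AmbientIsotopic (body (pathSet (l₁ ++ P :: Q :: T :: l₂) ∪ X))
        (body (pathSet (l₁ ++ P :: T :: l₂) ∪ X)) := by
  have e2 : pathSet (l₁ ++ P :: Q :: T :: l₂) ∪ X = insert s(P, Q) (insert s(Q, T)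
      (pathSet (l₁ ++ [P]) ∪ pathSet (T :: l₂) ∪ X)) := by
    rw [pathSet_append, pathSet_cons]
    ext e; simp only [Finset.mem_insert, Finset.mem_union]; tauto
  rw [e2] at h ⊢
  rw [pathSet_append, Finset.insert_union]
  refine delta_remove h hPQ hQT fun e he => ?_
  rcases Finset.mem_union.1 he with he | he
  · exact hL e he
  · exact hX e he

theorem mem_convexHull_triple {P Q T x : E3} (h : x ∈ convexHull ℝ {P, Q, T}) :
    ∃ α β γ : ℝ, 0 ≤ α ∧ 0 ≤ β ∧ 0 ≤ γ ∧ α + β + γ = 1 ∧ x = α • P + β • Q + γ • T := by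
  rw [convexHull_insert (by simp), mem_convexJoin] at h
  obtain ⟨_, rfl, y, hy, hx⟩ := h
  rw [convexHull_pair] at hy
  obtain ⟨b, c, hb, hc, hbc, rfl⟩ := hy
  obtain ⟨a, d, ha, hd, had, rfl⟩ := hx
  refine ⟨a, d * b, d * c, ha, mul_nonneg hd hb, mul_nonneg hd hc, ?_, ?_⟩
  · rw [add_assoc, ← mul_add, hbc, mul_one, had]
  · module

/-- The condition that the segment `a b` meets the triangle `P Q T` at most in `P` or `T`, in
coordinates. -/
theorem meet_of_coords {a b P Q T : E3}
    (H : ∀ s α β γ : ℝ, 0 ≤ s → s ≤ 1 → 0 ≤ α → 0 ≤ β → 0 ≤ γ → α + β + γ = 1 →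
      (1 - s) * a 0 + s * b 0 = α * P 0 + β * Q 0 + γ * T 0 →
      (1 - s) * a 1 + s * b 1 = α * P 1 + β * Q 1 + γ * T 1 →
      (1 - s) * a 2 + s * b 2 = α * P 2 + β * Q 2 + γ * T 2 →
      (β ≤ 0 ∧ γ ≤ 0) ∨ (α ≤ 0 ∧ β ≤ 0)) :
    ∀ x ∈ eseg s(a, b), x ∈ convexHull ℝ {P, Q, T} → x = P ∨ x = T := by
  intro x hx hx'
  obtain ⟨s, s0, s1, rfl⟩ := mem_eseg_iff.1 hx
  obtain ⟨α, β, γ, hα, hβ, hγ, hsum, hx⟩ := mem_convexHull_triple hx'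
  have hc : ∀ i, (1 - s) * a i + s * b i = α * P i + β * Q i + γ * T i := fun i => by
    simpa [ln] using congrArg (fun v : E3 => v i) hx
  rcases H s α β γ s0 s1 hα hβ hγ hsum (hc 0) (hc 1) (hc 2) with ⟨h1, h2⟩ | ⟨h1, h2⟩
  · obtain rfl := le_antisymm h1 hβ
    obtain rfl := le_antisymm h2 hγ
    obtain rfl : α = 1 := by linarith
    left; rw [hx]; simp
  · obtain rfl := le_antisymm h1 hα
    obtain rfl := le_antisymm h2 hβ
    obtain rfl : γ = 1 := by linarith
    right; rw [hx]; simp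

/-- All corners of the triangle lie at height at least `h`, with `Q` and one of `P`, `T` strictly
above it. So the triangle touches the level `h` at most in the remaining corner. -/
theorem meet_of_low {O : Finset (Sym2 E3)} {h : ℝ} (hO : ∀ e ∈ O, ∀ x ∈ eseg e, x 2 ≤ h)
    {P Q T : E3} (hQ : h < Q 2) (hP : h ≤ P 2) (hT : h ≤ T 2) (hPT : 2 * h < P 2 + T 2) :
    ∀ e ∈ O, ∀ x ∈ eseg e, x ∈ convexHull ℝ {P, Q, T} → x = P ∨ x = T := by
  intro e he x hx hx'
  have hlow := hO e he x hx
  obtain ⟨α, β, γ, hα, hβ, hγ, hsum, rfl⟩ := mem_convexHull_triple hx'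
  have hc : α * (P 2 - h) + β * (Q 2 - h) + γ * (T 2 - h) ≤ 0 := by
    simp only [PiLp.add_apply, PiLp.smul_apply, smul_eq_mul] at hlow
    linear_combination hlow - h * hsum
  have h1 := mul_nonneg hα (sub_nonneg.2 hP)
  have h2 := mul_nonneg hβ (sub_nonneg.2 hQ.le)
  have h3 := mul_nonneg hγ (sub_nonneg.2 hT)
  have hβ0 : β = 0 := (mul_eq_zero.1 (by linarith : β * (Q 2 - h) = 0)).resolve_right (by linarith)
  rcases mul_eq_zero.1 (by linarith : γ * (T 2 - h) = 0) with h4 | h4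
  · left
    obtain rfl : α = 1 := by linarith
    simp [hβ0, h4]
  · right
    have : α = 0 := (mul_eq_zero.1 (by linarith : α * (P 2 - h) = 0)).resolve_right (by linarith)
    obtain rfl : γ = 1 := by linarith
    simp [hβ0, this]

/-! ### Distant unions -/

theorem PolySys.union {S₁ S₂ : Finset (Sym2 E3)} (h₁ : PolySys S₁) (h₂ : PolySys S₂)
    (hd : ∀ e ∈ S₁, ∀ e' ∈ S₂, Disjoint (eseg e) (eseg e')) : PolySys (S₁ ∪ S₂) := by
  have hdis : Disjoint S₁ S₂ := by
    rw [Finset.disjoint_left]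
    intro e he he'
    obtain ⟨x, hx⟩ := eseg_nonempty e
    exact disjoint_left.1 (hd e he e he') hx hx
  refine ⟨h₁.ne.mono Finset.subset_union_left, ⟨fun e he => ?_, ?_⟩, fun v => ?_⟩
  · rcases Finset.mem_union.1 he with he | he
    · exact h₁.emb.nd e he
    · exact h₂.emb.nd e he
  · intro e he e' he' hne x hx hx'
    rcases Finset.mem_union.1 he with he | he <;> rcases Finset.mem_union.1 he' with he' | he'
    · exact h₁.emb.meet e he e' he' hne x hx hx'
    · rw [Sym2.map_id] at hx hx'
      exact (disjoint_left.1 (hd e he e' he') hx hx').elim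
    · rw [Sym2.map_id] at hx hx'
      exact (disjoint_left.1 (hd e' he' e he) hx' hx).elim
    · exact h₂.emb.meet e he e' he' hne x hx hx'
  · rw [deg_union hdis]
    by_cases h : ∃ e ∈ S₁, v ∈ e
    · obtain ⟨e, he, hv⟩ := h
      have : _root_.deg S₂ v = 0 := deg_eq_zero.2 fun e' he' hv' =>
        disjoint_left.1 (hd e he e' he') (mem_eseg_of_mem hv) (mem_eseg_of_mem hv')
      rw [this, add_zero]
      exact h₁.deg v
    · push Not at h
      rw [deg_eq_zero.2 h, zero_add]
      exact h₂.deg v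

theorem polySys_tri {A B C : E3} (h : NonCol A B C) : PolySys (tri A B C) := by
  have h1 := isClosedPolygonSystem_triangle A B C h
  have h2 := PolySys.of_isClosedPolygonSystem h1
  have : h1.finite.toFinset = tri A B C := by ext e; simp [tri]
  rwa [this] at h2

theorem PolySys.tri_union_of_low {R : Finset (Sym2 E3)} (hR : PolySys R) {A B C : E3} {h : ℝ}
    (hn : NonCol A B C) (hlow : ∀ e ∈ R, ∀ x ∈ eseg e, x 2 ≤ h) (hA : h < A 2) (hB : h < B 2)
    (hC : h < C 2) : PolySys (tri A B C ∪ R) :=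
  (polySys_tri hn).union hR fun e he e' he' => disjoint_left.2 fun x hx hx' =>
    absurd (tri_above hA hB hC e he x hx) (not_lt.2 (hlow e' he' x hx'))

/-! ### Moving a cap -/

/-- The slab between the heights `ℓ` and `h` contains nothing of `O` except possibly the two feet of
the cap, so the top of the cap may be placed anywhere above the feet in the slab. -/
theorem emb_cap {Y Q Q' Y' : E3} {O : Finset (Sym2 E3)} {h ℓ : ℝ}
    (hS : PolySys (pathSet [Y, Q, Y'] ∪ O)) (hY : Y 2 = ℓ) (hY' : Y' 2 = ℓ)
    (hO : ∀ e ∈ O, ∀ x ∈ eseg e, ℓ ≤ x 2 → x 2 ≤ h → x = Y ∨ x = Y')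
    (hQ : ℓ < Q 2) (hQh : Q 2 ≤ h) (hQ' : ℓ < Q' 2) (hQh' : Q' 2 ≤ h) :
    Emb (pathSet [Y, Q, Y'] ∪ O) (Function.update id Q Q') := by
  set p : E3 → E3 := Function.update id Q Q' with hp
  have hpQ : p Q = Q' := Function.update_self ..
  have hpv : ∀ v, v ≠ Q → p v = v := fun v hv => Function.update_of_ne hv ..
  have hYQ : Y ≠ Q := fun hh => by rw [hh] at hY; linarith
  have hYQ' : Y' ≠ Q := fun hh => by rw [hh] at hY'; linarith
  have hYq : Y ≠ Q' := fun hh => by rw [hh] at hY; linarith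
  have hYq' : Y' ≠ Q' := fun hh => by rw [hh] at hY'; linarith
  have hOQ : ∀ e ∈ O, Q ∉ e := by
    intro e he hmem
    rcases hO e he Q (mem_eseg_of_mem hmem) hQ.le hQh with hh | hh
    · exact hYQ hh.symm
    · exact hYQ' hh.symm
  have hOp : ∀ e ∈ O, e.map p = e := by
    intro e he
    suffices e.map p = e.map id by rwa [Sym2.map_id, id] at this
    exact Sym2.map_congr fun v hv => hpv v fun hh => hOQ e he (hh ▸ hv)
  have hmem : ∀ e, e ∈ pathSet [Y, Q, Y'] ∪ O ↔ (e = s(Y, Q) ∨ e = s(Y', Q)) ∨ e ∈ O := by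
    intro e
    simp only [pathSet, Finset.mem_union, Finset.mem_insert, Finset.notMem_empty, or_false]
    rw [Sym2.eq_swap (a := Q)]
  have hend : ∀ e, e = s(Y, Q) ∨ e = s(Y', Q) → ∃ y, (y = Y ∨ y = Y') ∧ e = s(y, Q) := by
    rintro e (rfl | rfl)
    · exact ⟨Y, .inl rfl, rfl⟩
    · exact ⟨Y', .inr rfl, rfl⟩
  have hy2 : ∀ y, y = Y ∨ y = Y' → y 2 = ℓ ∧ y ≠ Q ∧ y ≠ Q' := by
    rintro y (rfl | rfl)
    · exact ⟨hY, hYQ, hYq⟩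
    · exact ⟨hY', hYQ', hYq'⟩
  have hmap : ∀ y, y = Y ∨ y = Y' → (s(y, Q)).map p = s(y, Q') := fun y hy => by
    rw [Sym2.map_mk, hpQ, hpv y (hy2 y hy).2.1]
  have hcross : ∀ y, (y = Y ∨ y = Y') → s(y, Q) ∈ pathSet [Y, Q, Y'] ∪ O → ∀ e ∈ O,
      ∀ x ∈ eseg s(y, Q'), x ∈ eseg e → x = y ∧ y ∈ e := by
    intro y hy hyS e he x hx hx'
    obtain ⟨s, s0, s1, rfl⟩ := mem_eseg_iff.1 hx
    have h2 : ln y Q' s 2 = ℓ + s * (Q' 2 - ℓ) := by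
      simp only [ln, PiLp.add_apply, PiLp.smul_apply, smul_eq_mul, (hy2 y hy).1]; ring
    have h3 : 0 ≤ s * (Q' 2 - ℓ) := mul_nonneg s0 (by linarith)
    have h4 : s * (Q' 2 - ℓ) ≤ Q' 2 - ℓ := by nlinarith
    have h5 := hO e he _ hx' (by linarith) (by linarith)
    have h6 : ln y Q' s 2 = ℓ := by
      rcases h5 with h5 | h5 <;> rw [h5] <;> assumption
    have h7 : s = 0 := (mul_eq_zero.1 (by linarith : s * (Q' 2 - ℓ) = 0)).resolve_right
      (by linarith)
    rw [h7, ln_zero] at hx' ⊢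
    refine ⟨rfl, (hS.meet hyS (Finset.mem_union_right _ he) ?_ (mem_eseg_of_mem (by simp)) hx').2⟩
    rintro rfl
    exact hOQ _ he (by simp)
  constructor
  · intro e he
    rcases (hmem e).1 he with he | he
    · obtain ⟨y, hy, rfl⟩ := hend e he
      rw [hmap y hy]
      simpa using (hy2 y hy).2.2
    · rw [hOp e he]
      exact hS.nd (Finset.mem_union_right _ he)
  · intro e he e' he' hne x hx hx'
    rcases (hmem e).1 he with h1 | h1 <;> rcases (hmem e').1 he' with h1' | h1'
    · obtain ⟨y, hy, rfl⟩ := hend e h1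
      obtain ⟨y', hy', rfl⟩ := hend e' h1'
      rw [hmap y hy] at hx
      rw [hmap y' hy'] at hx'
      refine ⟨Q, by simp, by simp, ?_⟩
      obtain ⟨s, s0, s1, rfl⟩ := mem_eseg_iff.1 hx
      obtain ⟨t, t0, t1, ht⟩ := mem_eseg_iff.1 hx'
      -- Both feet have height `ℓ`, so the height of a point determines its parameter on either side
      -- of the cap. Points of the two sides at equal heights coincide only at the top.
      have hst : s = t := by
        have := congrArg (fun v : E3 => v 2) ht
        simp only [ln, PiLp.add_apply, PiLp.smul_apply, smul_eq_mul, (hy2 y hy).1,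
          (hy2 y' hy').1] at this
        have h3 : (s - t) * (Q' 2 - ℓ) = 0 := by linear_combination this
        exact sub_eq_zero.1 ((mul_eq_zero.1 h3).resolve_right (by linarith))
      subst hst
      have h3 : (1 - s) • (y - y') = 0 := by
        have : (1 - s) • (y - y') = ln y Q' s - ln y' Q' s := by simp only [ln]; module
        rw [this, ht, sub_self]
      rcases smul_eq_zero.1 h3 with h4 | h4
      · obtain rfl : s = 1 := by linarith
        rw [ln_one, hpQ]
      · exact absurd (by rw [sub_eq_zero.1 h4]) hne
    · obtain ⟨y, hy, rfl⟩ := hend e h1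
      rw [hmap y hy] at hx
      rw [hOp e' h1'] at hx'
      obtain ⟨rfl, h3⟩ := hcross y hy he e' h1' x hx hx'
      exact ⟨x, by simp, h3, hpv x (hy2 x hy).2.1⟩
    · obtain ⟨y, hy, rfl⟩ := hend e' h1'
      rw [hmap y hy] at hx'
      rw [hOp e h1] at hx
      obtain ⟨rfl, h3⟩ := hcross y hy he' e h1 x hx' hx
      exact ⟨x, h3, by simp, hpv x (hy2 x hy).2.1⟩
    · rw [hOp e h1] at hx
      rw [hOp e' h1'] at hx'
      obtain ⟨h3, h4⟩ := hS.meet (Finset.mem_union_right _ h1) (Finset.mem_union_right _ h1') hne hx hx'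
      exact ⟨x, h3, h4, hpv x fun hh => hOQ e h1 (hh ▸ h3)⟩

/-- The top of a cap may be moved freely. -/
theorem cap_move {Y Q Q' Y' : E3} {O : Finset (Sym2 E3)} {h ℓ : ℝ}
    (hS : PolySys (pathSet [Y, Q, Y'] ∪ O)) (hY : Y 2 = ℓ) (hY' : Y' 2 = ℓ)
    (hO : ∀ e ∈ O, ∀ x ∈ eseg e, ℓ ≤ x 2 → x 2 ≤ h → x = Y ∨ x = Y')
    (hQ : ℓ < Q 2) (hQh : Q 2 ≤ h) (hQ' : ℓ < Q' 2) (hQh' : Q' 2 ≤ h) :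
    PolySys (pathSet [Y, Q', Y'] ∪ O) ∧
      AmbientIsotopic (body (pathSet [Y, Q, Y'] ∪ O)) (body (pathSet [Y, Q', Y'] ∪ O)) := by
  have hemb : ∀ X : E3, ℓ < X 2 → X 2 ≤ h → Emb (pathSet [Y, Q, Y'] ∪ O) (Function.update id Q X) :=
    fun X h1 h2 => emb_cap hS hY hY' hO hQ hQh h1 h2
  have himg : ∀ X : E3, (pathSet [Y, Q, Y'] ∪ O).image (Sym2.map (Function.update id Q X)) =
      pathSet [Y, X, Y'] ∪ O := by
    intro X
    have hYQ : Y ≠ Q := fun hh => by rw [hh] at hY; linarith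
    have hYQ' : Y' ≠ Q := fun hh => by rw [hh] at hY'; linarith
    have hOp : O.image (Sym2.map (Function.update id Q X)) = O := by
      conv_rhs => rw [← Finset.image_id (s := O)]
      refine Finset.image_congr fun e he => ?_
      conv_rhs => rw [← Sym2.map_id]
      refine Sym2.map_congr fun v hv => Function.update_of_ne ?_ _ _
      rintro rfl
      rcases hO e he v (mem_eseg_of_mem hv) hQ.le hQh with hh | hh
      · exact hYQ hh.symm
      · exact hYQ' hh.symm
    rw [Finset.image_union, hOp]
    simp [pathSet, Finset.image_insert, hYQ, hYQ']
  have hm := ambientIsotopic_of_motion (pathSet [Y, Q, Y'] ∪ O)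
    (fun t => Function.update id Q (ln Q Q' t)) ?_ ?_
  · simp only [ln_zero, ln_one] at hm
    rw [← body_image, ← body_image, himg, himg] at hm
    refine ⟨?_, hm⟩
    rw [← himg]
    exact (hemb Q' hQ' hQh').poly_image hS.ne hS.deg
  · intro v
    by_cases hv : v = Q
    · subst hv
      simp only [Function.update_self, ln]
      fun_prop
    · simp only [Function.update_of_ne hv]
      exact continuous_const
  · rintro t ⟨t0, t1⟩
    have h2 : ln Q Q' t 2 = (1 - t) * Q 2 + t * Q' 2 := by simp [ln]
    refine hemb _ ?_ ?_ <;> rw [h2]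
    · exact convex_Ioi ℓ hQ hQ' (by linarith) t0 (by ring)
    · exact convex_Iic h hQh hQh' (by linarith) t0 (by ring)
end

end

section
open Set Topology Filter
open scoped Classical
noncomputable section
attribute [local instance] sym2DecEq

/-! ### A curl at the top of a link -/

/-- A point given by its coordinates. -/
def pt (x y z : ℝ) : E3 := !₂[x, y, z]

theorem pt_zero (x y z : ℝ) : pt x y z 0 = x := by simp [pt]
theorem pt_one (x y z : ℝ) : pt x y z 1 = y := by simp [pt]
theorem pt_two (x y z : ℝ) : pt x y z 2 = z := by simp [pt]

set_option linter.unusedSimpArgs false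

section arcs
variable {O : Finset (Sym2 E3)}

theorem path_add_low (hO : ∀ e ∈ O, ∀ x ∈ eseg e, x 2 ≤ -2) {l₁ l₂ : List E3} {P Q T : E3}
    (ℓ : E3 →ₗ[ℝ] ℝ) (h : PolySys (pathSet (l₁ ++ P :: T :: l₂) ∪ O)) 
    (hc : (ℓ P < ℓ Q ∧ ℓ Q < ℓ T) ∧ -2 < Q 2 ∧ -2 ≤ P 2 ∧ -2 ≤ T 2 ∧ 2 * -2 < P 2 + T 2)
    (hL : ∀ e ∈ pathSet (l₁ ++ [P]) ∪ pathSet (T :: l₂), ∀ x ∈ eseg e,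
      x ∈ convexHull ℝ {P, Q, T} → x = P ∨ x = T) :
    PolySys (pathSet (l₁ ++ P :: Q :: T :: l₂) ∪ O) ∧
      AmbientIsotopic (body (pathSet (l₁ ++ P :: T :: l₂) ∪ O))
        (body (pathSet (l₁ ++ P :: Q :: T :: l₂) ∪ O)) :=
  path_add ℓ h hc.1.1 hc.1.2 hL (meet_of_low hO hc.2.1 hc.2.2.1 hc.2.2.2.1 hc.2.2.2.2)

theorem path_add_loop (hO : ∀ e ∈ O, ∀ x ∈ eseg e, x 2 ≤ -2) {l₁ l₂ l₃ : List E3} {P Q T : E3}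
    (ℓ : E3 →ₗ[ℝ] ℝ) (h : PolySys (pathSet (l₁ ++ P :: T :: l₂) ∪ (O ∪ pathSet l₃)))
    (hc : (ℓ P < ℓ Q ∧ ℓ Q < ℓ T) ∧ -2 < Q 2 ∧ -2 ≤ P 2 ∧ -2 ≤ T 2 ∧ 2 * -2 < P 2 + T 2)
    (hL : ∀ e ∈ pathSet (l₁ ++ [P]) ∪ pathSet (T :: l₂) ∪ pathSet l₃, ∀ x ∈ eseg e,
      x ∈ convexHull ℝ {P, Q, T} → x = P ∨ x = T) :
    PolySys (pathSet (l₁ ++ P :: Q :: T :: l₂) ∪ (O ∪ pathSet l₃)) ∧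
      AmbientIsotopic (body (pathSet (l₁ ++ P :: T :: l₂) ∪ (O ∪ pathSet l₃)))
        (body (pathSet (l₁ ++ P :: Q :: T :: l₂) ∪ (O ∪ pathSet l₃))) := by
  refine path_add ℓ h hc.1.1 hc.1.2 (fun e he => hL e (Finset.mem_union_left _ he)) fun e he => ?_
  rcases Finset.mem_union.1 he with he | he
  · exact meet_of_low hO hc.2.1 hc.2.2.1 hc.2.2.2.1 hc.2.2.2.2 e he
  · exact hL e (Finset.mem_union_right _ he)

theorem path_remove_loop (hO : ∀ e ∈ O, ∀ x ∈ eseg e, x 2 ≤ -2) {l₁ l₂ l₃ : List E3} {P Q T : E3}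
    (ℓ : E3 →ₗ[ℝ] ℝ) (h : PolySys (pathSet (l₁ ++ P :: Q :: T :: l₂) ∪ (O ∪ pathSet l₃)))
    (hc : (ℓ P < ℓ Q ∧ ℓ Q < ℓ T) ∧ -2 < Q 2 ∧ -2 ≤ P 2 ∧ -2 ≤ T 2 ∧ 2 * -2 < P 2 + T 2)
    (hL : ∀ e ∈ pathSet (l₁ ++ [P]) ∪ pathSet (T :: l₂) ∪ pathSet l₃, ∀ x ∈ eseg e,
      x ∈ convexHull ℝ {P, Q, T} → x = P ∨ x = T) :
    PolySys (pathSet (l₁ ++ P :: T :: l₂) ∪ (O ∪ pathSet l₃)) ∧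
      AmbientIsotopic (body (pathSet (l₁ ++ P :: Q :: T :: l₂) ∪ (O ∪ pathSet l₃)))
        (body (pathSet (l₁ ++ P :: T :: l₂) ∪ (O ∪ pathSet l₃))) := by
  refine path_remove ℓ h hc.1.1 hc.1.2 (fun e he => hL e (Finset.mem_union_left _ he)) fun e he => ?_
  rcases Finset.mem_union.1 he with he | he
  · exact meet_of_low hO hc.2.1 hc.2.2.1 hc.2.2.2.1 hc.2.2.2.2 e he
  · exact hL e (Finset.mem_union_right _ he)

/-- The cap over the feet is turned into the arc that runs through the smoothing `∞` and closes
behind it at `(0, 3, 3)`. Each step inserts one vertex by a triangle move, with an explicit linear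
form increasing along the new sides. -/
theorem infty_arc (hO : ∀ e ∈ O, ∀ x ∈ eseg e, x 2 ≤ -2)
    (h : PolySys (pathSet [pt (-1) (-1) (-2), pt 0 3 3, pt 1 (-1) (-2)] ∪ O)) :
    PolySys (pathSet [pt (-1) (-1) (-2), pt (-1) (-1) 0, pt (-1 / 2) 0 0, pt (-1) 1 0, pt 0 3 3,
      pt 1 1 0, pt (1 / 2) 0 0, pt 1 (-1) 0, pt 1 (-1) (-2)] ∪ O) ∧
    AmbientIsotopic (body (pathSet [pt (-1) (-1) (-2), pt 0 3 3, pt 1 (-1) (-2)] ∪ O))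
      (body (pathSet [pt (-1) (-1) (-2), pt (-1) (-1) 0, pt (-1 / 2) 0 0, pt (-1) 1 0, pt 0 3 3,
        pt 1 1 0, pt (1 / 2) 0 0, pt 1 (-1) 0, pt 1 (-1) (-2)] ∪ O)) := by
  have h1 := path_add_low hO (l₁ := []) (l₂ := [pt 1 (-1) (-2)]) (P := pt (-1) (-1) (-2)) (Q :=
    pt (-1 / 2) 0 0) (T := pt 0 3 3) (coord 1) h
    (by simp only [LinearMap.add_apply, LinearMap.sub_apply, LinearMap.neg_apply,
      LinearMap.smul_apply, smul_eq_mul, coord_apply, pt_zero, pt_one, pt_two]; norm_num)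
    (by
      simp only [pathSet, List.nil_append, List.cons_append, Finset.forall_mem_union,
        Finset.forall_mem_insert, Finset.notMem_empty, IsEmpty.forall_iff, implies_true, and_true,
        true_and]
      -- There is one goal for each remaining edge of the arc. In barycentric coordinates the
      -- equations of a common point force it to be a corner of the triangle, by linear arithmetic.
      and_intros
      all_goals
        refine meet_of_coords fun s α β γ s0 s1 hα hβ hγ hs e0 e1 e2 => ?_
        simp only [pt_zero, pt_one, pt_two] at e0 e1 e2
        first
        | exact .inl ⟨by linarith, by linarith⟩
        | exact .inr ⟨by linarith, by linarith⟩)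
  have h2 := path_add_low hO (l₁ := [pt (-1) (-1) (-2), pt (-1 / 2) 0 0]) (l₂ := []) (P := pt 0 3
    3) (Q := pt (1 / 2) 0 0) (T := pt 1 (-1) (-2)) (-coord 1) h1.1
    (by simp only [LinearMap.add_apply, LinearMap.sub_apply, LinearMap.neg_apply,
      LinearMap.smul_apply, smul_eq_mul, coord_apply, pt_zero, pt_one, pt_two]; norm_num)
    (by
      simp only [pathSet, List.nil_append, List.cons_append, Finset.forall_mem_union,
        Finset.forall_mem_insert, Finset.notMem_empty, IsEmpty.forall_iff, implies_true, and_true,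
        true_and]
      and_intros
      all_goals
        refine meet_of_coords fun s α β γ s0 s1 hα hβ hγ hs e0 e1 e2 => ?_
        simp only [pt_zero, pt_one, pt_two] at e0 e1 e2
        first
        | exact .inl ⟨by linarith, by linarith⟩
        | exact .inr ⟨by linarith, by linarith⟩)
  have h3 := path_add_low hO (l₁ := []) (l₂ := [pt 0 3 3, pt (1 / 2) 0 0, pt 1 (-1) (-2)]) (P :=
    pt (-1) (-1) (-2)) (Q := pt (-1) (-1) 0) (T := pt (-1 / 2) 0 0) (coord 1 + coord 2) h2.1
    (by simp only [LinearMap.add_apply, LinearMap.sub_apply, LinearMap.neg_apply,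
      LinearMap.smul_apply, smul_eq_mul, coord_apply, pt_zero, pt_one, pt_two]; norm_num)
    (by
      simp only [pathSet, List.nil_append, List.cons_append, Finset.forall_mem_union,
        Finset.forall_mem_insert, Finset.notMem_empty, IsEmpty.forall_iff, implies_true, and_true,
        true_and]
      and_intros
      all_goals
        refine meet_of_coords fun s α β γ s0 s1 hα hβ hγ hs e0 e1 e2 => ?_
        simp only [pt_zero, pt_one, pt_two] at e0 e1 e2
        first
        | exact .inl ⟨by linarith, by linarith⟩
        | exact .inr ⟨by linarith, by linarith⟩)
  have h4 := path_add_low hO (l₁ := [pt (-1) (-1) (-2), pt (-1) (-1) 0]) (l₂ := [pt (1 / 2) 0 0,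
    pt 1 (-1) (-2)]) (P := pt (-1 / 2) 0 0) (Q := pt (-1) 1 0) (T := pt 0 3 3) (coord 1) h3.1
    (by simp only [LinearMap.add_apply, LinearMap.sub_apply, LinearMap.neg_apply,
      LinearMap.smul_apply, smul_eq_mul, coord_apply, pt_zero, pt_one, pt_two]; norm_num)
    (by
      simp only [pathSet, List.nil_append, List.cons_append, Finset.forall_mem_union,
        Finset.forall_mem_insert, Finset.notMem_empty, IsEmpty.forall_iff, implies_true, and_true,
        true_and]
      and_intros
      all_goals
        refine meet_of_coords fun s α β γ s0 s1 hα hβ hγ hs e0 e1 e2 => ?_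
        simp only [pt_zero, pt_one, pt_two] at e0 e1 e2
        first
        | exact .inl ⟨by linarith, by linarith⟩
        | exact .inr ⟨by linarith, by linarith⟩)
  have h5 := path_add_low hO (l₁ := [pt (-1) (-1) (-2), pt (-1) (-1) 0, pt (-1 / 2) 0 0, pt (-1)
    1 0]) (l₂ := [pt 1 (-1) (-2)]) (P := pt 0 3 3) (Q := pt 1 1 0) (T := pt (1 / 2) 0 0) (-coord
    1) h4.1
    (by simp only [LinearMap.add_apply, LinearMap.sub_apply, LinearMap.neg_apply,
      LinearMap.smul_apply, smul_eq_mul, coord_apply, pt_zero, pt_one, pt_two]; norm_num)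
    (by
      simp only [pathSet, List.nil_append, List.cons_append, Finset.forall_mem_union,
        Finset.forall_mem_insert, Finset.notMem_empty, IsEmpty.forall_iff, implies_true, and_true,
        true_and]
      and_intros
      all_goals
        refine meet_of_coords fun s α β γ s0 s1 hα hβ hγ hs e0 e1 e2 => ?_
        simp only [pt_zero, pt_one, pt_two] at e0 e1 e2
        first
        | exact .inl ⟨by linarith, by linarith⟩
        | exact .inr ⟨by linarith, by linarith⟩)
  have h6 := path_add_low hO (l₁ := [pt (-1) (-1) (-2), pt (-1) (-1) 0, pt (-1 / 2) 0 0, pt (-1)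
    1 0, pt 0 3 3, pt 1 1 0]) (l₂ := []) (P := pt (1 / 2) 0 0) (Q := pt 1 (-1) 0) (T := pt 1 (-1)
    (-2)) (-coord 1 - coord 2) h5.1
    (by simp only [LinearMap.add_apply, LinearMap.sub_apply, LinearMap.neg_apply,
      LinearMap.smul_apply, smul_eq_mul, coord_apply, pt_zero, pt_one, pt_two]; norm_num)
    (by
      simp only [pathSet, List.nil_append, List.cons_append, Finset.forall_mem_union,
        Finset.forall_mem_insert, Finset.notMem_empty, IsEmpty.forall_iff, implies_true, and_true,
        true_and]
      and_intros
      all_goals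
        refine meet_of_coords fun s α β γ s0 s1 hα hβ hγ hs e0 e1 e2 => ?_
        simp only [pt_zero, pt_one, pt_two] at e0 e1 e2
        first
        | exact .inl ⟨by linarith, by linarith⟩
        | exact .inr ⟨by linarith, by linarith⟩)
  exact ⟨h6.1, ((((h1.2.trans h2.2).trans h3.2).trans h4.2).trans h5.2).trans h6.2⟩

/-- With the loop closed at `(0, 3, 3)`, the positive crossing is a kink in the cap, and removing
the kink is a sequence of triangle moves. -/
theorem pos_arc (hO : ∀ e ∈ O, ∀ x ∈ eseg e, x 2 ≤ -2)
    (h : PolySys (pathSet [pt (-1) (-1) (-2), pt 1 1 0, pt 1 (-1) (-2)] ∪ O)) :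
    PolySys (pathSet [pt (-1) (-1) (-2), pt (-1) (-1) 0, pt 0 0 1, pt 1 1 0, pt 0 3 3, pt (-1) 1
      0, pt 1 (-1) 0, pt 1 (-1) (-2)] ∪ O) ∧
    AmbientIsotopic (body (pathSet [pt (-1) (-1) (-2), pt 1 1 0, pt 1 (-1) (-2)] ∪ O))
      (body (pathSet [pt (-1) (-1) (-2), pt (-1) (-1) 0, pt 0 0 1, pt 1 1 0, pt 0 3 3, pt (-1) 1
        0, pt 1 (-1) 0, pt 1 (-1) (-2)] ∪ O)) := by
  have h1 := path_add_low hO (l₁ := []) (l₂ := [pt 1 (-1) (-2)]) (P := pt (-1) (-1) (-2)) (Q :=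
    pt 0 0 1) (T := pt 1 1 0) (coord 0) h
    (by simp only [LinearMap.add_apply, LinearMap.sub_apply, LinearMap.neg_apply,
      LinearMap.smul_apply, smul_eq_mul, coord_apply, pt_zero, pt_one, pt_two]; norm_num)
    (by
      simp only [pathSet, List.nil_append, List.cons_append, Finset.forall_mem_union,
        Finset.forall_mem_insert, Finset.notMem_empty, IsEmpty.forall_iff, implies_true, and_true,
        true_and]
      and_intros
      all_goals
        refine meet_of_coords fun s α β γ s0 s1 hα hβ hγ hs e0 e1 e2 => ?_
        simp only [pt_zero, pt_one, pt_two] at e0 e1 e2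
        first
        | exact .inl ⟨by linarith, by linarith⟩
        | exact .inr ⟨by linarith, by linarith⟩)
  have h2 := path_add_low hO (l₁ := []) (l₂ := [pt 1 1 0, pt 1 (-1) (-2)]) (P := pt (-1) (-1)
    (-2)) (Q := pt (-1) (-1) 0) (T := pt 0 0 1) (coord 1 + coord 2) h1.1
    (by simp only [LinearMap.add_apply, LinearMap.sub_apply, LinearMap.neg_apply,
      LinearMap.smul_apply, smul_eq_mul, coord_apply, pt_zero, pt_one, pt_two]; norm_num)
    (by
      simp only [pathSet, List.nil_append, List.cons_append, Finset.forall_mem_union,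
        Finset.forall_mem_insert, Finset.notMem_empty, IsEmpty.forall_iff, implies_true, and_true,
        true_and]
      and_intros
      all_goals
        refine meet_of_coords fun s α β γ s0 s1 hα hβ hγ hs e0 e1 e2 => ?_
        simp only [pt_zero, pt_one, pt_two] at e0 e1 e2
        first
        | exact .inl ⟨by linarith, by linarith⟩
        | exact .inr ⟨by linarith, by linarith⟩)
  have h3 := path_add_low hO (l₁ := [pt (-1) (-1) (-2), pt (-1) (-1) 0, pt 0 0 1]) (l₂ := []) (P
    := pt 1 1 0) (Q := pt 1 (-1) 0) (T := pt 1 (-1) (-2)) (-coord 1 - coord 2) h2.1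
    (by simp only [LinearMap.add_apply, LinearMap.sub_apply, LinearMap.neg_apply,
      LinearMap.smul_apply, smul_eq_mul, coord_apply, pt_zero, pt_one, pt_two]; norm_num)
    (by
      simp only [pathSet, List.nil_append, List.cons_append, Finset.forall_mem_union,
        Finset.forall_mem_insert, Finset.notMem_empty, IsEmpty.forall_iff, implies_true, and_true,
        true_and]
      and_intros
      all_goals
        refine meet_of_coords fun s α β γ s0 s1 hα hβ hγ hs e0 e1 e2 => ?_
        simp only [pt_zero, pt_one, pt_two] at e0 e1 e2
        first
        | exact .inl ⟨by linarith, by linarith⟩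
        | exact .inr ⟨by linarith, by linarith⟩)
  have h4 := path_add_low hO (l₁ := [pt (-1) (-1) (-2), pt (-1) (-1) 0, pt 0 0 1]) (l₂ := [pt 1
    (-1) (-2)]) (P := pt 1 1 0) (Q := pt (-1) 1 0) (T := pt 1 (-1) 0) (-coord 0 - (2 : ℝ) • coord
    1) h3.1
    (by simp only [LinearMap.add_apply, LinearMap.sub_apply, LinearMap.neg_apply,
      LinearMap.smul_apply, smul_eq_mul, coord_apply, pt_zero, pt_one, pt_two]; norm_num)
    (by
      simp only [pathSet, List.nil_append, List.cons_append, Finset.forall_mem_union,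
        Finset.forall_mem_insert, Finset.notMem_empty, IsEmpty.forall_iff, implies_true, and_true,
        true_and]
      and_intros
      all_goals
        refine meet_of_coords fun s α β γ s0 s1 hα hβ hγ hs e0 e1 e2 => ?_
        simp only [pt_zero, pt_one, pt_two] at e0 e1 e2
        first
        | exact .inl ⟨by linarith, by linarith⟩
        | exact .inr ⟨by linarith, by linarith⟩)
  have h5 := path_add_low hO (l₁ := [pt (-1) (-1) (-2), pt (-1) (-1) 0, pt 0 0 1]) (l₂ := [pt 1
    (-1) 0, pt 1 (-1) (-2)]) (P := pt 1 1 0) (Q := pt 0 3 3) (T := pt (-1) 1 0) (-coord 0) h4.1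
    (by simp only [LinearMap.add_apply, LinearMap.sub_apply, LinearMap.neg_apply,
      LinearMap.smul_apply, smul_eq_mul, coord_apply, pt_zero, pt_one, pt_two]; norm_num)
    (by
      simp only [pathSet, List.nil_append, List.cons_append, Finset.forall_mem_union,
        Finset.forall_mem_insert, Finset.notMem_empty, IsEmpty.forall_iff, implies_true, and_true,
        true_and]
      and_intros
      all_goals
        refine meet_of_coords fun s α β γ s0 s1 hα hβ hγ hs e0 e1 e2 => ?_
        simp only [pt_zero, pt_one, pt_two] at e0 e1 e2
        first
        | exact .inl ⟨by linarith, by linarith⟩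
        | exact .inr ⟨by linarith, by linarith⟩)
  exact ⟨h5.1, (((h1.2.trans h2.2).trans h3.2).trans h4.2).trans h5.2⟩

/-- This is the kink with the opposite crossing. It starts from the same cap as `pos_arc`, now with
the second strand passing through the tip. -/
theorem neg_arc (hO : ∀ e ∈ O, ∀ x ∈ eseg e, x 2 ≤ -2)
    (h : PolySys (pathSet [pt (-1) (-1) (-2), pt 1 1 0, pt 1 (-1) (-2)] ∪ O)) :
    PolySys (pathSet [pt (-1) (-1) (-2), pt (-1) (-1) 0, pt 1 1 0, pt 0 3 3, pt (-1) 1 0, pt 0 0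
      1, pt 1 (-1) 0, pt 1 (-1) (-2)] ∪ O) ∧
    AmbientIsotopic (body (pathSet [pt (-1) (-1) (-2), pt 1 1 0, pt 1 (-1) (-2)] ∪ O))
      (body (pathSet [pt (-1) (-1) (-2), pt (-1) (-1) 0, pt 1 1 0, pt 0 3 3, pt (-1) 1 0, pt 0 0
        1, pt 1 (-1) 0, pt 1 (-1) (-2)] ∪ O)) := by
  have h1 := path_add_low hO (l₁ := []) (l₂ := [pt 1 (-1) (-2)]) (P := pt (-1) (-1) (-2)) (Q :=
    pt (-1) (-1) 0) (T := pt 1 1 0) (coord 0 + coord 1 + coord 2) h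
    (by simp only [LinearMap.add_apply, LinearMap.sub_apply, LinearMap.neg_apply,
      LinearMap.smul_apply, smul_eq_mul, coord_apply, pt_zero, pt_one, pt_two]; norm_num)
    (by
      simp only [pathSet, List.nil_append, List.cons_append, Finset.forall_mem_union,
        Finset.forall_mem_insert, Finset.notMem_empty, IsEmpty.forall_iff, implies_true, and_true,
        true_and]
      and_intros
      all_goals
        refine meet_of_coords fun s α β γ s0 s1 hα hβ hγ hs e0 e1 e2 => ?_
        simp only [pt_zero, pt_one, pt_two] at e0 e1 e2
        first
        | exact .inl ⟨by linarith, by linarith⟩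
        | exact .inr ⟨by linarith, by linarith⟩)
  have h2 := path_add_low hO (l₁ := [pt (-1) (-1) (-2), pt (-1) (-1) 0]) (l₂ := []) (P := pt 1 1
    0) (Q := pt 1 (-1) 0) (T := pt 1 (-1) (-2)) (-coord 1 - coord 2) h1.1
    (by simp only [LinearMap.add_apply, LinearMap.sub_apply, LinearMap.neg_apply,
      LinearMap.smul_apply, smul_eq_mul, coord_apply, pt_zero, pt_one, pt_two]; norm_num)
    (by
      simp only [pathSet, List.nil_append, List.cons_append, Finset.forall_mem_union,
        Finset.forall_mem_insert, Finset.notMem_empty, IsEmpty.forall_iff, implies_true, and_true,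
        true_and]
      and_intros
      all_goals
        refine meet_of_coords fun s α β γ s0 s1 hα hβ hγ hs e0 e1 e2 => ?_
        simp only [pt_zero, pt_one, pt_two] at e0 e1 e2
        first
        | exact .inl ⟨by linarith, by linarith⟩
        | exact .inr ⟨by linarith, by linarith⟩)
  have h3 := path_add_low hO (l₁ := [pt (-1) (-1) (-2), pt (-1) (-1) 0]) (l₂ := [pt 1 (-1) (-2)])
    (P := pt 1 1 0) (Q := pt 0 0 1) (T := pt 1 (-1) 0) (-coord 1) h2.1
    (by simp only [LinearMap.add_apply, LinearMap.sub_apply, LinearMap.neg_apply,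
      LinearMap.smul_apply, smul_eq_mul, coord_apply, pt_zero, pt_one, pt_two]; norm_num)
    (by
      simp only [pathSet, List.nil_append, List.cons_append, Finset.forall_mem_union,
        Finset.forall_mem_insert, Finset.notMem_empty, IsEmpty.forall_iff, implies_true, and_true,
        true_and]
      and_intros
      all_goals
        refine meet_of_coords fun s α β γ s0 s1 hα hβ hγ hs e0 e1 e2 => ?_
        simp only [pt_zero, pt_one, pt_two] at e0 e1 e2
        first
        | exact .inl ⟨by linarith, by linarith⟩
        | exact .inr ⟨by linarith, by linarith⟩)
  have h4 := path_add_low hO (l₁ := [pt (-1) (-1) (-2), pt (-1) (-1) 0]) (l₂ := [pt 1 (-1) 0, pt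
    1 (-1) (-2)]) (P := pt 1 1 0) (Q := pt (-1) 1 0) (T := pt 0 0 1) (-coord 0 - (2 : ℝ) • coord
    1) h3.1
    (by simp only [LinearMap.add_apply, LinearMap.sub_apply, LinearMap.neg_apply,
      LinearMap.smul_apply, smul_eq_mul, coord_apply, pt_zero, pt_one, pt_two]; norm_num)
    (by
      simp only [pathSet, List.nil_append, List.cons_append, Finset.forall_mem_union,
        Finset.forall_mem_insert, Finset.notMem_empty, IsEmpty.forall_iff, implies_true, and_true,
        true_and]
      and_intros
      all_goals
        refine meet_of_coords fun s α β γ s0 s1 hα hβ hγ hs e0 e1 e2 => ?_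
        simp only [pt_zero, pt_one, pt_two] at e0 e1 e2
        first
        | exact .inl ⟨by linarith, by linarith⟩
        | exact .inr ⟨by linarith, by linarith⟩)
  have h5 := path_add_low hO (l₁ := [pt (-1) (-1) (-2), pt (-1) (-1) 0]) (l₂ := [pt 0 0 1, pt 1
    (-1) 0, pt 1 (-1) (-2)]) (P := pt 1 1 0) (Q := pt 0 3 3) (T := pt (-1) 1 0) (-coord 0) h4.1
    (by simp only [LinearMap.add_apply, LinearMap.sub_apply, LinearMap.neg_apply,
      LinearMap.smul_apply, smul_eq_mul, coord_apply, pt_zero, pt_one, pt_two]; norm_num)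
    (by
      simp only [pathSet, List.nil_append, List.cons_append, Finset.forall_mem_union,
        Finset.forall_mem_insert, Finset.notMem_empty, IsEmpty.forall_iff, implies_true, and_true,
        true_and]
      and_intros
      all_goals
        refine meet_of_coords fun s α β γ s0 s1 hα hβ hγ hs e0 e1 e2 => ?_
        simp only [pt_zero, pt_one, pt_two] at e0 e1 e2
        first
        | exact .inl ⟨by linarith, by linarith⟩
        | exact .inr ⟨by linarith, by linarith⟩)
  exact ⟨h5.1, (((h1.2.trans h2.2).trans h3.2).trans h4.2).trans h5.2⟩

/-- In the smoothing `0` the cap becomes the lower arc and the loop closes up to a circle of its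
own. The cap starts low enough to stay clear of the triangle that becomes this circle. -/
theorem zero_arc (hO : ∀ e ∈ O, ∀ x ∈ eseg e, x 2 ≤ -2)
    (h : PolySys (pathSet [pt (-1) (-1) (-2), pt 0 (-1) (-1), pt 1 (-1) (-2)] ∪ (O ∪ pathSet [pt
      (-1) 1 0, pt 1 1 0, pt 0 3 3, pt (-1) 1 0]))) :
    PolySys (pathSet [pt (-1) 1 0, pt 0 (1 / 2) 0, pt 1 1 0, pt 0 3 3, pt (-1) 1 0] ∪ (O ∪
      pathSet [pt (-1) (-1) (-2), pt (-1) (-1) 0, pt 0 (-1 / 2) 0, pt 1 (-1) 0, pt 1 (-1) (-2)]))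
      ∧
    AmbientIsotopic (body (pathSet [pt (-1) (-1) (-2), pt 0 (-1) (-1), pt 1 (-1) (-2)] ∪ (O ∪
      pathSet [pt (-1) 1 0, pt 1 1 0, pt 0 3 3, pt (-1) 1 0])))
      (body (pathSet [pt (-1) 1 0, pt 0 (1 / 2) 0, pt 1 1 0, pt 0 3 3, pt (-1) 1 0] ∪ (O ∪
        pathSet [pt (-1) (-1) (-2), pt (-1) (-1) 0, pt 0 (-1 / 2) 0, pt 1 (-1) 0, pt 1 (-1)
        (-2)]))) := by
  have h1 := path_add_loop hO (l₁ := [pt (-1) (-1) (-2)]) (l₂ := []) (P := pt 0 (-1) (-1)) (Q :=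
    pt 0 (-1 / 2) 0) (T := pt 1 (-1) (-2)) ((4 : ℝ) • coord 0 + coord 1) h
    (by simp only [LinearMap.add_apply, LinearMap.sub_apply, LinearMap.neg_apply,
      LinearMap.smul_apply, smul_eq_mul, coord_apply, pt_zero, pt_one, pt_two]; norm_num)
    (by
      simp only [pathSet, List.nil_append, List.cons_append, Finset.forall_mem_union,
        Finset.forall_mem_insert, Finset.notMem_empty, IsEmpty.forall_iff, implies_true, and_true,
        true_and]
      and_intros
      all_goals
        refine meet_of_coords fun s α β γ s0 s1 hα hβ hγ hs e0 e1 e2 => ?_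
        simp only [pt_zero, pt_one, pt_two] at e0 e1 e2
        first
        | exact .inl ⟨by linarith, by linarith⟩
        | exact .inr ⟨by linarith, by linarith⟩)
  have h2 := path_remove_loop hO (l₁ := []) (l₂ := [pt 1 (-1) (-2)]) (P := pt (-1) (-1) (-2)) (Q
    := pt 0 (-1) (-1)) (T := pt 0 (-1 / 2) 0) (coord 2) h1.1
    (by simp only [LinearMap.add_apply, LinearMap.sub_apply, LinearMap.neg_apply,
      LinearMap.smul_apply, smul_eq_mul, coord_apply, pt_zero, pt_one, pt_two]; norm_num)
    (by
      simp only [pathSet, List.nil_append, List.cons_append, Finset.forall_mem_union,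
        Finset.forall_mem_insert, Finset.notMem_empty, IsEmpty.forall_iff, implies_true, and_true,
        true_and]
      and_intros
      all_goals
        refine meet_of_coords fun s α β γ s0 s1 hα hβ hγ hs e0 e1 e2 => ?_
        simp only [pt_zero, pt_one, pt_two] at e0 e1 e2
        first
        | exact .inl ⟨by linarith, by linarith⟩
        | exact .inr ⟨by linarith, by linarith⟩)
  have h3 := path_add_loop hO (l₁ := []) (l₂ := [pt 1 (-1) (-2)]) (P := pt (-1) (-1) (-2)) (Q :=
    pt (-1) (-1) 0) (T := pt 0 (-1 / 2) 0) (coord 1 + coord 2) h2.1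
    (by simp only [LinearMap.add_apply, LinearMap.sub_apply, LinearMap.neg_apply,
      LinearMap.smul_apply, smul_eq_mul, coord_apply, pt_zero, pt_one, pt_two]; norm_num)
    (by
      simp only [pathSet, List.nil_append, List.cons_append, Finset.forall_mem_union,
        Finset.forall_mem_insert, Finset.notMem_empty, IsEmpty.forall_iff, implies_true, and_true,
        true_and]
      and_intros
      all_goals
        refine meet_of_coords fun s α β γ s0 s1 hα hβ hγ hs e0 e1 e2 => ?_
        simp only [pt_zero, pt_one, pt_two] at e0 e1 e2
        first
        | exact .inl ⟨by linarith, by linarith⟩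
        | exact .inr ⟨by linarith, by linarith⟩)
  have h4 := path_add_loop hO (l₁ := [pt (-1) (-1) (-2), pt (-1) (-1) 0]) (l₂ := []) (P := pt 0
    (-1 / 2) 0) (Q := pt 1 (-1) 0) (T := pt 1 (-1) (-2)) (-coord 1 - coord 2) h3.1
    (by simp only [LinearMap.add_apply, LinearMap.sub_apply, LinearMap.neg_apply,
      LinearMap.smul_apply, smul_eq_mul, coord_apply, pt_zero, pt_one, pt_two]; norm_num)
    (by
      simp only [pathSet, List.nil_append, List.cons_append, Finset.forall_mem_union,
        Finset.forall_mem_insert, Finset.notMem_empty, IsEmpty.forall_iff, implies_true, and_true,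
        true_and]
      and_intros
      all_goals
        refine meet_of_coords fun s α β γ s0 s1 hα hβ hγ hs e0 e1 e2 => ?_
        simp only [pt_zero, pt_one, pt_two] at e0 e1 e2
        first
        | exact .inl ⟨by linarith, by linarith⟩
        | exact .inr ⟨by linarith, by linarith⟩)
  -- The last move takes place on the circle, so the roles of the arc and the circle are exchanged.
  have swap : ∀ A B : Finset (Sym2 E3), A ∪ (O ∪ B) = B ∪ (O ∪ A) := fun A B => by
    rw [Finset.union_left_comm, Finset.union_comm A B, Finset.union_left_comm]
  rw [swap] at h4
  have h5 := path_add_loop hO (l₁ := []) (l₂ := [pt 0 3 3, pt (-1) 1 0]) (P := pt (-1) 1 0) (Q :=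
    pt 0 (1 / 2) 0) (T := pt 1 1 0) (coord 0) h4.1
    (by simp only [LinearMap.add_apply, LinearMap.sub_apply, LinearMap.neg_apply,
      LinearMap.smul_apply, smul_eq_mul, coord_apply, pt_zero, pt_one, pt_two]; norm_num)
    (by
      simp only [pathSet, List.nil_append, List.cons_append, Finset.forall_mem_union,
        Finset.forall_mem_insert, Finset.notMem_empty, IsEmpty.forall_iff, implies_true, and_true,
        true_and]
      and_intros
      all_goals
        refine meet_of_coords fun s α β γ s0 s1 hα hβ hγ hs e0 e1 e2 => ?_
        simp only [pt_zero, pt_one, pt_two] at e0 e1 e2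
        first
        | exact .inl ⟨by linarith, by linarith⟩
        | exact .inr ⟨by linarith, by linarith⟩)
  exact ⟨h5.1, (((h1.2.trans h2.2).trans h3.2).trans h4.2).trans h5.2⟩

end arcs
end

end

/-! ### The skein quadruple of a curl -/

section
open Set Topology Filter
open scoped Classical
noncomputable section
attribute [local instance] sym2DecEq

/-- The part of the links of a curl that lies outside the ball. -/
def curlFrame (O : Finset (Sym2 E3)) : Set E3 :=
  segment ℝ (pt (-1) (-1) (-2)) (pt (-1) (-1) 0) ∪ segment ℝ (pt 1 (-1) (-2)) (pt 1 (-1) 0) ∪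
    (segment ℝ (pt (-1) 1 0) (pt 0 3 3) ∪ segment ℝ (pt 1 1 0) (pt 0 3 3)) ∪ body O

section frame
variable {O : Finset (Sym2 E3)}

/-- Each outer segment starts at a corner on the sphere in a direction that has nonnegative inner
product with the corner, so it leaves the ball at once. The remaining edges lie below the ball. -/
theorem curlFrame_inter (hO : ∀ e ∈ O, ∀ x ∈ eseg e, x 2 ≤ -2) :
    curlFrame O ∩ skeinBall ⊆ corners := by
  have key : ∀ a b c : ℝ, ∀ v : E3, a ^ 2 + b ^ 2 + c ^ 2 = 2 → 2 * a * (v 0 - a) +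
      2 * b * (v 1 - b) + 2 * c * (v 2 - c) ≥ 0 → ∀ x ∈ segment ℝ v (pt a b c),
      x ∈ skeinBall → v ≠ pt a b c → x = pt a b c := by
    intro a b c v hn hdot x hx hball hne
    rw [← eseg_mk, Sym2.eq_swap] at hx
    obtain ⟨s, s0, s1, rfl⟩ := mem_eseg_iff.1 hx
    rw [mem_skeinBall] at hball
    simp only [ln, PiLp.add_apply, PiLp.smul_apply, smul_eq_mul, pt_zero, pt_one, pt_two] at hball
    have h1 : s ^ 2 * ((v 0 - a) ^ 2 + (v 1 - b) ^ 2 + (v 2 - c) ^ 2) ≤ 0 := by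
      have := mul_nonneg s0 hdot
      nlinarith
    have h2 : 0 < (v 0 - a) ^ 2 + (v 1 - b) ^ 2 + (v 2 - c) ^ 2 := by
      by_contra hcon
      have e0 : v 0 - a = 0 := by
        apply pow_eq_zero_iff (two_ne_zero) |>.1; nlinarith [sq_nonneg (v 0 - a), sq_nonneg (v 1 - b), sq_nonneg (v 2 - c)]
      have e1 : v 1 - b = 0 := by
        apply pow_eq_zero_iff (two_ne_zero) |>.1; nlinarith [sq_nonneg (v 0 - a), sq_nonneg (v 1 - b), sq_nonneg (v 2 - c)]
      have e2 : v 2 - c = 0 := by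
        apply pow_eq_zero_iff (two_ne_zero) |>.1; nlinarith [sq_nonneg (v 0 - a), sq_nonneg (v 1 - b), sq_nonneg (v 2 - c)]
      refine hne (E3.ext_proj ?_ ?_)
      · simp only [proj_apply, pt_zero, pt_one, Prod.mk.injEq]
        exact ⟨by linarith, by linarith⟩
      · rw [pt_two]; linarith
    have h3 : s ^ 2 = 0 := le_antisymm (by by_contra hcon; push Not at hcon; nlinarith) (sq_nonneg s)
    have h4 : s = 0 := by simpa using h3
    rw [h4, ln_zero]
  have ne : ∀ {a b c a' b' c' : ℝ}, c ≠ c' → pt a b c ≠ pt a' b' c' := fun h hh =>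
    h (by simpa [pt_two] using congrArg (fun v : E3 => v 2) hh)
  rintro x ⟨hx, hball⟩
  rw [curlFrame, segment_symm ℝ (pt (-1) 1 0), segment_symm ℝ (pt 1 1 0)] at hx
  have hsw : ∀ P, P ∈ corners ↔ P = pt (-1) (-1) 0 ∨ P = pt 1 1 0 ∨ P = pt (-1) 1 0 ∨
      P = pt 1 (-1) 0 := fun P => by simp [corners, pt]
  rw [hsw]
  rcases hx with ((hx | hx) | hx | hx) | hx
  · exact .inl (key _ _ _ _ (by norm_num) (by simp only [pt_zero, pt_one, pt_two]; norm_num) x hx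
      hball (ne (by norm_num)))
  · exact .inr (.inr (.inr (key _ _ _ _ (by norm_num)
      (by simp only [pt_zero, pt_one, pt_two]; norm_num) x hx hball (ne (by norm_num)))))
  · exact .inr (.inr (.inl (key _ _ _ _ (by norm_num)
      (by simp only [pt_zero, pt_one, pt_two]; norm_num) x hx hball (ne (by norm_num)))))
  · exact .inr (.inl (key _ _ _ _ (by norm_num)
      (by simp only [pt_zero, pt_one, pt_two]; norm_num) x hx hball (ne (by norm_num))))
  · obtain ⟨e, he, hx⟩ := mem_iUnion₂.1 hx
    have h1 := hO e he x hx
    rw [mem_skeinBall] at hball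
    nlinarith [sq_nonneg (x 0), sq_nonneg (x 1)]

theorem body_empty : body ∅ = ∅ := by simp [body]

theorem body_infty_arc : body (pathSet [pt (-1) (-1) (-2), pt (-1) (-1) 0, pt (-1 / 2) 0 0,
    pt (-1) 1 0, pt 0 3 3, pt 1 1 0, pt (1 / 2) 0 0, pt 1 (-1) 0, pt 1 (-1) (-2)] ∪ O) =
    tangleInfty ∪ curlFrame O := by
  simp only [pathSet, body_union, body_insert, body_empty, eseg_mk, curlFrame]
  rw [segment_symm ℝ (pt 0 3 3), segment_symm ℝ (pt 1 1 0) (pt (1 / 2) 0 0),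
    segment_symm ℝ (pt (1 / 2) 0 0) (pt 1 (-1) 0), segment_symm ℝ (pt 1 (-1) 0) (pt 1 (-1) (-2))]
  simp only [pt, tangleInfty]
  ext x
  simp only [mem_union, mem_empty_iff_false]
  tauto

theorem body_pos_arc : body (pathSet [pt (-1) (-1) (-2), pt (-1) (-1) 0, pt 0 0 1, pt 1 1 0,
    pt 0 3 3, pt (-1) 1 0, pt 1 (-1) 0, pt 1 (-1) (-2)] ∪ O) = tanglePos ∪ curlFrame O := by
  simp only [pathSet, body_union, body_insert, body_empty, eseg_mk, curlFrame]
  rw [segment_symm ℝ (pt 0 3 3), segment_symm ℝ (pt (-1) 1 0) (pt 1 (-1) 0),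
    segment_symm ℝ (pt 1 (-1) 0) (pt 1 (-1) (-2))]
  simp only [pt, tanglePos]
  ext x
  simp only [mem_union, mem_empty_iff_false]
  tauto

theorem body_neg_arc : body (pathSet [pt (-1) (-1) (-2), pt (-1) (-1) 0, pt 1 1 0, pt 0 3 3,
    pt (-1) 1 0, pt 0 0 1, pt 1 (-1) 0, pt 1 (-1) (-2)] ∪ O) = tangleNeg ∪ curlFrame O := by
  simp only [pathSet, body_union, body_insert, body_empty, eseg_mk, curlFrame]
  rw [segment_symm ℝ (pt 0 3 3), segment_symm ℝ (pt (-1) 1 0) (pt 0 0 1),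
    segment_symm ℝ (pt 0 0 1) (pt 1 (-1) 0), segment_symm ℝ (pt 1 (-1) 0) (pt 1 (-1) (-2))]
  simp only [pt, tangleNeg]
  ext x
  simp only [mem_union, mem_empty_iff_false]
  tauto

theorem body_zero_arc : body (pathSet [pt (-1) 1 0, pt 0 (1 / 2) 0, pt 1 1 0, pt 0 3 3, pt (-1) 1 0] ∪
    (O ∪ pathSet [pt (-1) (-1) (-2), pt (-1) (-1) 0, pt 0 (-1 / 2) 0, pt 1 (-1) 0,
      pt 1 (-1) (-2)])) = tangleZero ∪ curlFrame O := by
  simp only [pathSet, body_union, body_insert, body_empty, eseg_mk, curlFrame]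
  rw [segment_symm ℝ (pt 0 3 3), segment_symm ℝ (pt 1 (-1) 0) (pt 1 (-1) (-2))]
  simp only [pt, tangleZero]
  ext x
  simp only [mem_union, mem_empty_iff_false]
  tauto

theorem tri_eq_pathSet (P Q T : E3) : tri P Q T = pathSet [P, Q, T, P] := by
  simp [tri, pathSet]

variable {Z : Set E3 → Prop}

/-- Both crossings and the smoothing `∞` of the curl are isotopic to the link with a cap, hence in
the class. The smoothing `0` is isotopic to this link with a triangle above it. -/
theorem SkeinClosed.curl_of_standard (hZ : SkeinClosed Z) {Q A B C : E3} {h : ℝ}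
    (hS : PolySys (pathSet [pt (-1) (-1) (-2), Q, pt 1 (-1) (-2)] ∪ O))
    (hO : ∀ e ∈ O, ∀ x ∈ eseg e, x 2 ≤ -2)
    (ht : ∀ e ∈ O, ∀ x ∈ eseg e, -2 ≤ x 2 → x = pt (-1) (-1) (-2) ∨ x = pt 1 (-1) (-2))
    (hQ : -2 < Q 2) (hZS : Z (body (pathSet [pt (-1) (-1) (-2), Q, pt 1 (-1) (-2)] ∪ O)))
    (hD : xzDet A B C ≠ 0) (hh : -1 ≤ h) (hQh : Q 2 ≤ h) (hA : h < A 2) (hB : h < B 2)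
    (hC : h < C 2) :
    Z (body (tri A B C ∪ (pathSet [pt (-1) (-1) (-2), Q, pt 1 (-1) (-2)] ∪ O))) := by
  have hlow : ∀ (X : E3) (k : ℝ), -2 ≤ k → X 2 ≤ k →
      ∀ e ∈ pathSet [pt (-1) (-1) (-2), X, pt 1 (-1) (-2)] ∪ O, ∀ x ∈ eseg e, x 2 ≤ k := by
    intro X k hk hX e he x hx
    simp only [pathSet, Finset.mem_union, Finset.mem_insert, Finset.notMem_empty, or_false] at he
    rcases he with (rfl | rfl) | he
    · refine le_of_mem_eseg (ℓ := coord 2) (fun v hv => ?_) hx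
      rcases Sym2.mem_iff.1 hv with rfl | rfl
      · rwa [coord_apply, pt_two]
      · exact hX
    · refine le_of_mem_eseg (ℓ := coord 2) (fun v hv => ?_) hx
      rcases Sym2.mem_iff.1 hv with rfl | rfl
      · exact hX
      · rwa [coord_apply, pt_two]
    · exact (hO e he x hx).trans hk
  have mv : ∀ X : E3, -2 < X 2 → PolySys (pathSet [pt (-1) (-1) (-2), X, pt 1 (-1) (-2)] ∪ O) ∧
      Z (body (pathSet [pt (-1) (-1) (-2), X, pt 1 (-1) (-2)] ∪ O)) := by
    intro X hX
    obtain ⟨h1, h2⟩ := cap_move (h := max (Q 2) (X 2)) hS (pt_two _ _ _) (pt_two _ _ _)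
      (fun e he x hx h0 _ => ht e he x hx h0) hQ (le_max_left _ _) hX (le_max_right _ _)
    exact ⟨h1, hZ.iso h2 hZS⟩
  -- The top of the cap is placed at a vertex of the arc that is to be built: at `(0, 3, 3)` for the
  -- smoothing, at the corner `(1, 1, 0)` for the crossings.
  obtain ⟨m1, z1⟩ := mv (pt 0 3 3) (by rw [pt_two]; norm_num)
  obtain ⟨m2, z2⟩ := mv (pt 1 1 0) (by rw [pt_two]; norm_num)
  obtain ⟨pi, ii⟩ := infty_arc hO m1
  obtain ⟨pp, ip⟩ := pos_arc hO m2
  obtain ⟨pn, hin⟩ := neg_arc hO m2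
  have hall : PolySys (tri A B C ∪ (pathSet [pt (-1) (-1) (-2), Q, pt 1 (-1) (-2)] ∪ O)) :=
    hS.tri_union_of_low (nonCol_of_xzDet hD) (hlow Q h (by linarith) hQh) hA hB hC
  have e1 : ∀ (X : E3), tri A B C ∪ (pathSet [pt (-1) (-1) (-2), X, pt 1 (-1) (-2)] ∪ O) =
      pathSet [pt (-1) (-1) (-2), X, pt 1 (-1) (-2)] ∪ (O ∪ tri A B C) := fun X => by
    rw [Finset.union_comm, Finset.union_assoc]
  rw [e1] at hall ⊢
  -- The cap is lowered beneath the triangle to height `-1`, which frees the space above it. Then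
  -- the triangle can move to the position of the circle of the smoothing.
  obtain ⟨q1, q2⟩ := cap_move (h := h) (Q' := pt 0 (-1) (-1)) hall (pt_two _ _ _) (pt_two _ _ _)
    (by
      intro e he x hx h0 h1
      rcases Finset.mem_union.1 he with he | he
      · exact ht e he x hx h0
      · exact absurd (tri_above hA hB hC e he x hx) (not_lt.2 h1)) hQ hQh
    (by rw [pt_two]; norm_num) (by rwa [pt_two])
  rw [← e1] at q1
  obtain ⟨q3, q4⟩ := tri_connect (h := -1) (P' := pt (-1) 1 0) (Q' := pt 1 1 0) (T' := pt 0 3 3)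
    q1 hD (by simp only [xzDet, pt_zero, pt_two]; norm_num)
    (hlow _ (-1) (by norm_num) (by rw [pt_two])) (by linarith) (by linarith) (by linarith)
    (by rw [pt_two]; norm_num) (by rw [pt_two]; norm_num) (by rw [pt_two]; norm_num)
  rw [tri_eq_pathSet, Finset.union_comm, Finset.union_assoc] at q3
  obtain ⟨pz, iz⟩ := zero_arc hO q3
  have hiso := q2.trans ((by rw [← e1]; exact q4 : AmbientIsotopic _ _).trans
    (by rw [tri_eq_pathSet, Finset.union_comm, Finset.union_assoc]; exact iz :
      AmbientIsotopic (body (tri (pt (-1) 1 0) (pt 1 1 0) (pt 0 3 3) ∪ _)) _))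
  refine (hZ.iff hiso).2 ?_
  rw [body_zero_arc]
  have lp := pp.isPolygonalLink
  have ln := pn.isPolygonalLink
  have li := pi.isPolygonalLink
  have lz := pz.isPolygonalLink
  have zp := hZ.iso ip z2
  have zn := hZ.iso hin z2
  have zi := hZ.iso ii z1
  rw [body_pos_arc] at lp zp
  rw [body_neg_arc] at ln zn
  rw [body_infty_arc] at li zi
  rw [body_zero_arc] at lz
  exact hZ.zero (isStandardQuadruple_of_union (curlFrame_inter hO) lp ln li lz) zp zn zi
end frame
end

end

section
open Set Topology Filter
open scoped Classical
noncomputable section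
attribute [local instance] sym2DecEq

/-! ### A trivial component above a link -/

section trivial_component
variable {O R : Finset (Sym2 E3)} {Z : Set E3 → Prop}

theorem pathSet_three_symm (a b c : E3) : pathSet [a, b, c] = pathSet [c, b, a] := by
  simp only [pathSet]
  rw [Sym2.eq_swap (a := c) (b := b), Sym2.eq_swap (a := b) (b := a)]
  ext e
  simp only [Finset.mem_insert, Finset.notMem_empty, or_false]
  tauto

/-- A horizontal similarity combined with a vertical translation moves the feet of the cap to their
standard places. In the end `tri_connect` brings the triangle to the prescribed position. -/
theorem SkeinClosed.curl_of_cap (hZ : SkeinClosed Z) {Y₁ Q Y₂ A B C : E3} {ℓ h : ℝ}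
    (hS : PolySys (pathSet [Y₁, Q, Y₂] ∪ O)) (h1 : Y₁ 2 = ℓ) (h2 : Y₂ 2 = ℓ) (hY : Y₁ ≠ Y₂)
    (hO : ∀ e ∈ O, ∀ x ∈ eseg e, x 2 ≤ ℓ)
    (ht : ∀ e ∈ O, ∀ x ∈ eseg e, ℓ ≤ x 2 → x = Y₁ ∨ x = Y₂)
    (hQ : ℓ < Q 2) (hZS : Z (body (pathSet [Y₁, Q, Y₂] ∪ O))) (hD : xzDet A B C ≠ 0)
    (hQh : Q 2 ≤ h) (hA : h < A 2) (hB : h < B 2) (hC : h < C 2) :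
    Z (body (tri A B C ∪ (pathSet [Y₁, Q, Y₂] ∪ O))) := by
  -- The order of the feet makes the trace `2 * F₀ 0` nonnegative, as `exists_isotopy_affine`
  -- demands.
  wlog h12 : Y₁ 0 ≤ Y₂ 0 generalizing Y₁ Y₂
  · rw [pathSet_three_symm] at hS hZS ⊢
    exact this hS h2 h1 hY.symm (fun e he x hx h => (ht e he x hx h).symm) hZS (le_of_not_ge h12)
  have hlow : ∀ e ∈ pathSet [Y₁, Q, Y₂] ∪ O, ∀ x ∈ eseg e, x 2 ≤ Q 2 := by
    intro e he x hx
    simp only [pathSet, Finset.mem_union, Finset.mem_insert, Finset.notMem_empty, or_false] at he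
    rcases he with (rfl | rfl) | he
    · refine le_of_mem_eseg (ℓ := coord 2) (fun v hv => ?_) hx
      rw [coord_apply]
      rcases Sym2.mem_iff.1 hv with rfl | rfl <;> linarith
    · refine le_of_mem_eseg (ℓ := coord 2) (fun v hv => ?_) hx
      rw [coord_apply]
      rcases Sym2.mem_iff.1 hv with rfl | rfl <;> linarith
    · exact (hO e he x hx).trans hQ.le
  set F₀ : E3 := (1 / 2 : ℝ) • (Y₂ - Y₁) with hF₀
  have f0 : F₀ 0 = (Y₂ 0 - Y₁ 0) / 2 := by simp [hF₀]; ring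
  have f2 : F₀ 2 = 0 := by simp [hF₀, h1, h2]
  have hdet : 0 < F₀ 0 ^ 2 + F₀ 1 ^ 2 := by
    have hne : ¬ (F₀ 0 = 0 ∧ F₀ 1 = 0) := by
      rintro ⟨e0, e1⟩
      have : F₀ = 0 := by
        ext i; fin_cases i
        · exact e0
        · exact e1
        · exact f2
      rw [hF₀, smul_eq_zero] at this
      exact hY (sub_eq_zero.1 (this.resolve_left (by norm_num))).symm
    by_contra hcon
    exact hne ⟨by nlinarith [sq_nonneg (F₀ 0), sq_nonneg (F₀ 1)],
      by nlinarith [sq_nonneg (F₀ 0), sq_nonneg (F₀ 1)]⟩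
  set F₁ : E3 := pt (-F₀ 1) (F₀ 0) 0 with hF₁
  obtain ⟨Ψ, iΨ, hΨ⟩ := exists_isotopy_affine (Y₁ + F₀ + F₁ + (2 : ℝ) • ez) F₀ F₁ one_pos
    (by rw [hF₁, pt_zero, pt_one]; nlinarith) (by rw [hF₁, pt_one, f0]; linarith)
  have lΨ : LnMap Ψ := by
    intro U T t
    have hc : ∀ i, (ln U T t) i = (1 - t) * U i + t * T i := fun i => by simp [ln]
    rw [hΨ, hΨ, hΨ, hc, hc, hc]
    simp only [ln]
    module
  have hz : ∀ x, Ψ x 2 = ℓ + 2 + x 2 := by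
    intro x
    rw [hΨ]
    simp [h1, f2, hF₁, pt_two, ez]
  have hx : ∀ x, Ψ x 0 = Y₁ 0 + F₀ 0 + F₁ 0 + x 0 * F₀ 0 + x 1 * F₁ 0 := by
    intro x
    rw [hΨ]
    simp [ez]
    ring
  have v1 : Ψ (pt (-1) (-1) (-2)) = Y₁ := by
    rw [hΨ, pt_zero, pt_one, pt_two]; module
  have v2 : Ψ (pt 1 (-1) (-2)) = Y₂ := by
    rw [hΨ, pt_zero, pt_one, pt_two, hF₀]; module
  have s1 : Ψ.symm Y₁ = pt (-1) (-1) (-2) := by rw [Homeomorph.symm_apply_eq, v1]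
  have s2 : Ψ.symm Y₂ = pt 1 (-1) (-2) := by rw [Homeomorph.symm_apply_eq, v2]
  have hsymm : ∀ x, Ψ.symm x 2 = x 2 - ℓ - 2 := by
    intro x
    have := hz (Ψ.symm x)
    rw [Ψ.apply_symm_apply] at this
    linarith
  set O' := O.image (Sym2.map Ψ.symm) with hO'
  have himg : (pathSet [Y₁, Q, Y₂] ∪ O).image (Sym2.map Ψ.symm) =
      pathSet [pt (-1) (-1) (-2), Ψ.symm Q, pt 1 (-1) (-2)] ∪ O' := by
    rw [Finset.image_union]
    simp [pathSet, Finset.image_insert, s1, s2, hO']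
  have hback : (pathSet [pt (-1) (-1) (-2), Ψ.symm Q, pt 1 (-1) (-2)] ∪ O').image (Sym2.map Ψ) =
      pathSet [Y₁, Q, Y₂] ∪ O := by
    rw [← himg, Finset.image_image, ← Sym2.map_comp]
    have : (Ψ ∘ Ψ.symm : E3 → E3) = id := by ext1 x; simp
    rw [this, Sym2.map_id, Finset.image_id]
  have hS' := (hS.image_ln lΨ.symm Ψ.symm.injective).1
  rw [himg] at hS'
  have hO'mem : ∀ e ∈ O', ∀ x ∈ eseg e, ∃ e₀ ∈ O, Ψ x ∈ eseg e₀ := by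
    intro e he x hx
    obtain ⟨e₀, he₀, rfl⟩ := Finset.mem_image.1 he
    rw [lΨ.symm.eseg_map] at hx
    obtain ⟨y, hy, rfl⟩ := hx
    exact ⟨e₀, he₀, by rwa [Ψ.apply_symm_apply]⟩
  have hZ' : Z (body (pathSet [pt (-1) (-1) (-2), Ψ.symm Q, pt 1 (-1) (-2)] ∪ O')) := by
    refine (hZ.iff (hS'.image_homeo iΨ lΨ).2).2 ?_
    rwa [hback]
  -- This number is the determinant `xzDet` of the image of the auxiliary triangle. The image must
  -- not be seen edge-on if it is to be connected to `A B C`.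
  obtain ⟨lam, hlam⟩ : ∃ lam : ℝ, F₀ 0 + lam * F₁ 0 ≠ 0 := by
    by_cases hf : F₀ 0 = 0
    · refine ⟨1, ?_⟩
      rw [hf, hF₁, pt_zero]
      intro h0
      rw [hf] at hdet
      nlinarith
    · exact ⟨0, by simpa using hf⟩
  set k := max (h - ℓ - 2) (-1) with hk
  have k1 : h - ℓ - 2 ≤ k := le_max_left _ _
  have k2 : -1 ≤ k := le_max_right _ _
  have hQk : Ψ.symm Q 2 ≤ k := by rw [hsymm]; linarith
  have hQl : -2 < Ψ.symm Q 2 := by rw [hsymm]; linarith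
  have det0 : xzDet (pt 0 0 (k + 1)) (pt 1 lam (k + 1)) (pt 0 0 (k + 2)) ≠ 0 := by
    simp only [xzDet, pt_zero, pt_two]; norm_num
  have key := hZ.curl_of_standard hS'
    (fun e he x hx => by
      obtain ⟨e₀, he₀, h0⟩ := hO'mem e he x hx
      have := hO e₀ he₀ _ h0
      rw [hz] at this
      linarith)
    (fun e he x hx hge => by
      obtain ⟨e₀, he₀, h0⟩ := hO'mem e he x hx
      rw [← v1, ← v2] at ht
      rcases ht e₀ he₀ _ h0 (by rw [hz]; linarith) with h3 | h3
      · exact .inl (Ψ.injective h3)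
      · exact .inr (Ψ.injective h3)) hQl hZ' det0 k2 hQk (by rw [pt_two]; linarith)
    (by rw [pt_two]; linarith) (by rw [pt_two]; linarith)
  have hpoly : PolySys (tri (pt 0 0 (k + 1)) (pt 1 lam (k + 1)) (pt 0 0 (k + 2)) ∪
      (pathSet [pt (-1) (-1) (-2), Ψ.symm Q, pt 1 (-1) (-2)] ∪ O')) := by
    refine hS'.tri_union_of_low (h := k) (nonCol_of_xzDet det0) ?_ (by rw [pt_two]; linarith)
      (by rw [pt_two]; linarith) (by rw [pt_two]; linarith)
    intro e he x hx
    rw [← himg] at he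
    obtain ⟨e₀, he₀, rfl⟩ := Finset.mem_image.1 he
    rw [lΨ.symm.eseg_map] at hx
    obtain ⟨y, hy, rfl⟩ := hx
    have := hlow e₀ he₀ y hy
    rw [hsymm]
    linarith
  obtain ⟨q1, q2⟩ := hpoly.image_homeo iΨ lΨ
  have htri : (tri (pt 0 0 (k + 1)) (pt 1 lam (k + 1)) (pt 0 0 (k + 2)) ∪
      (pathSet [pt (-1) (-1) (-2), Ψ.symm Q, pt 1 (-1) (-2)] ∪ O')).image (Sym2.map Ψ) =
      tri (Ψ (pt 0 0 (k + 1))) (Ψ (pt 1 lam (k + 1))) (Ψ (pt 0 0 (k + 2))) ∪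
        (pathSet [Y₁, Q, Y₂] ∪ O) := by
    rw [Finset.image_union, hback]
    simp [tri, Finset.image_insert]
  rw [htri] at q1 q2
  refine hZ.iso (tri_connect q1 ?_ hD (fun e he x hx => (hlow e he x hx).trans hQh) ?_ ?_ ?_ hA hB
    hC).2 (hZ.iso q2 key)
  · simp only [xzDet, hz, hx, pt_zero, pt_one, pt_two]
    intro h0
    apply hlam
    linear_combination h0
  all_goals
    rw [hz, pt_two]
    linarith

/-- If `Q` is the unique highest vertex, a horizontal cut slightly below it separates a cap with top
`Q` from the rest. -/
theorem SkeinClosed.curl_of_top (hZ : SkeinClosed Z) (hR : PolySys R) {Q A B C : E3} {h : ℝ}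
    (hQ : ∃ e ∈ R, Q ∈ e) (htop : ∀ e ∈ R, ∀ v ∈ e, v ≠ Q → v 2 < Q 2) (hZR : Z (body R))
    (hD : xzDet A B C ≠ 0) (hQh : Q 2 ≤ h) (hA : h < A 2) (hB : h < B 2) (hC : h < C 2) :
    Z (body (tri A B C ∪ R)) := by
  obtain ⟨e₁, he₁, hQ₁⟩ := hQ
  obtain ⟨e₂, he₂, hne, hQ₂, hall⟩ := exists_other (fun e he => hR.nd he) hR.deg he₁ hQ₁
  obtain ⟨N₁, rfl⟩ := Sym2.mem_iff_exists.1 hQ₁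
  obtain ⟨N₂, rfl⟩ := Sym2.mem_iff_exists.1 hQ₂
  have hN₁ : N₁ ≠ Q := by
    have := hR.nd he₁; rw [Sym2.mk_isDiag_iff] at this; exact fun h => this h.symm
  have hN₂ : N₂ ≠ Q := by
    have := hR.nd he₂; rw [Sym2.mk_isDiag_iff] at this; exact fun h => this h.symm
  obtain ⟨m, hmQ, hm⟩ : ∃ m < Q 2, ∀ e ∈ R, ∀ v ∈ e, v ≠ Q → v 2 ≤ m := by
    obtain ⟨w, hw, hmax⟩ := Finset.exists_max_image ((verts R).filter (· ≠ Q)) (fun v => v 2)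
      ⟨N₁, Finset.mem_filter.2 ⟨mem_verts.2 ⟨_, he₁, by simp⟩, hN₁⟩⟩
    obtain ⟨hw1, hw2⟩ := Finset.mem_filter.1 hw
    obtain ⟨e, he, hwe⟩ := mem_verts.1 hw1
    exact ⟨w 2, htop e he w hwe hw2, fun e he v hv hvQ =>
      hmax v (Finset.mem_filter.2 ⟨mem_verts.2 ⟨e, he, hv⟩, hvQ⟩)⟩
  -- The level of the cut lies strictly between `Q` and all other vertices. The two edges at `Q` are
  -- subdivided there.
  obtain ⟨ℓ, hℓm, hℓQ⟩ := exists_between hmQ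
  have hcut : ∀ N : E3, N 2 ≤ m → ∃ μ : ℝ, 0 < μ ∧ μ < 1 ∧ ((1 - μ) • Q + μ • N) 2 = ℓ := by
    intro N hN
    have hpos : 0 < Q 2 - N 2 := by linarith
    refine ⟨(Q 2 - ℓ) / (Q 2 - N 2), div_pos (by linarith) hpos, (div_lt_one hpos).2 (by linarith), ?_⟩
    simp only [PiLp.add_apply, PiLp.smul_apply, smul_eq_mul]
    field_simp
    ring
  have hm₁ := hm _ he₁ N₁ (by simp) hN₁
  have hm₂ := hm _ he₂ N₂ (by simp) hN₂
  obtain ⟨μ₁, a0, a1, hy₁⟩ := hcut N₁ hm₁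
  obtain ⟨μ₂, b0, b1, hy₂⟩ := hcut N₂ hm₂
  set Y₁ := (1 - μ₁) • Q + μ₁ • N₁ with hY₁
  set Y₂ := (1 - μ₂) • Q + μ₂ • N₂ with hY₂
  have m1 : Y₁ ∈ eseg s(Q, N₁) := mem_eseg_iff.2 ⟨μ₁, a0.le, a1.le, rfl⟩
  have m2 : Y₂ ∈ eseg s(Q, N₂) := mem_eseg_iff.2 ⟨μ₂, b0.le, b1.le, rfl⟩
  have ne : ∀ {a b : E3}, a 2 < b 2 → a ≠ b := by rintro a b h rfl; exact lt_irrefl _ h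
  have n1 : Y₁ ≠ Q := ne (by rw [hy₁]; exact hℓQ)
  have n2 : N₁ ≠ Y₁ := ne (by rw [hy₁]; linarith)
  have n3 : N₂ ≠ Y₁ := ne (by rw [hy₁]; linarith)
  have hYY : Y₁ ≠ Y₂ := by
    intro hYY
    rcases Sym2.mem_iff.1 (hR.meet he₁ he₂ hne.symm m1 (hYY ▸ m2)).1 with h1 | h1
    · exact n1 h1
    · exact n2 h1.symm
  set R₀ := (R.erase s(Q, N₁)).erase s(Q, N₂) with hR₀
  have hRe : R = insert s(Q, N₁) (insert s(Q, N₂) R₀) := by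
    rw [hR₀, Finset.insert_erase (Finset.mem_erase.2 ⟨hne, he₂⟩), Finset.insert_erase he₁]
  have hR₀Q : ∀ e ∈ R₀, e ∈ R ∧ Q ∉ e := by
    intro e he
    obtain ⟨g1, g2⟩ := Finset.mem_erase.1 he
    obtain ⟨g3, g4⟩ := Finset.mem_erase.1 g2
    exact ⟨g4, fun hq => (hall e g4 hq).elim g3 g1⟩
  have hS := hR
  rw [hRe] at hS
  obtain ⟨p1, p2⟩ := hS.subdivide (by
    rw [Finset.mem_insert, not_or]
    exact ⟨hne.symm, fun h0 => (hR₀Q _ h0).2 (by simp)⟩) a0 a1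
  rw [← hY₁] at p1 p2
  have hcomm : insert s(Q, Y₁) (insert s(Y₁, N₁) (insert s(Q, N₂) R₀)) =
      insert s(Q, N₂) (insert s(Q, Y₁) (insert s(Y₁, N₁) R₀)) := by
    rw [Finset.insert_comm s(Y₁, N₁), Finset.insert_comm s(Q, Y₁)]
  rw [hcomm] at p1 p2
  obtain ⟨p3, p4⟩ := p1.subdivide (by
    rw [Finset.mem_insert, Finset.mem_insert, not_or, not_or]
    refine ⟨fun h0 => n3 ?_, fun h0 => ?_, fun h0 => (hR₀Q _ h0).2 (by simp)⟩
    · exact Sym2.congr_right.1 h0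
    · have : Q ∈ s(Y₁, N₁) := h0 ▸ Sym2.mem_mk_left Q N₂
      rcases Sym2.mem_iff.1 this with h1 | h1
      · exact n1 h1.symm
      · exact hN₁ h1.symm) b0 b1
  rw [← hY₂] at p3 p4
  set O := insert s(Y₁, N₁) (insert s(Y₂, N₂) R₀) with hO
  have hset : insert s(Q, Y₂) (insert s(Y₂, N₂) (insert s(Q, Y₁) (insert s(Y₁, N₁) R₀))) =
      pathSet [Y₁, Q, Y₂] ∪ O := by
    rw [hO]
    simp only [pathSet]
    rw [Sym2.eq_swap (a := Y₁) (b := Q)]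
    ext e
    simp only [Finset.mem_insert, Finset.mem_union, Finset.notMem_empty, or_false]
    tauto
  rw [hset] at p3 p4
  have hbody : body (pathSet [Y₁, Q, Y₂] ∪ O) = body R := by rw [p4, p2, ← hRe]
  have harm : ∀ (Y N x : E3), Y 2 = ℓ → N 2 ≤ m → x ∈ eseg s(Y, N) →
      x 2 ≤ ℓ ∧ (ℓ ≤ x 2 → x = Y) := by
    intro Y N x hY hN hx
    obtain ⟨s, s0, s1, rfl⟩ := mem_eseg_iff.1 hx
    have h2 : ln Y N s 2 = ℓ - s * (ℓ - N 2) := by simp [ln, hY]; ring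
    have h3 : 0 ≤ s * (ℓ - N 2) := mul_nonneg s0 (by linarith)
    rw [h2]
    refine ⟨by linarith, fun h4 => ?_⟩
    have : s = 0 := (mul_eq_zero.1 (by linarith : s * (ℓ - N 2) = 0)).resolve_right (by linarith)
    rw [this, ln_zero]
  have hOall : ∀ e ∈ O, ∀ x ∈ eseg e, x 2 ≤ ℓ ∧ (ℓ ≤ x 2 → x = Y₁ ∨ x = Y₂) := by
    intro e he x hx
    rw [hO, Finset.mem_insert, Finset.mem_insert] at he
    rcases he with rfl | rfl | he
    · exact ⟨(harm _ _ x hy₁ hm₁ hx).1, fun h0 => .inl ((harm _ _ x hy₁ hm₁ hx).2 h0)⟩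
    · exact ⟨(harm _ _ x hy₂ hm₂ hx).1, fun h0 => .inr ((harm _ _ x hy₂ hm₂ hx).2 h0)⟩
    · obtain ⟨g1, g2⟩ := hR₀Q e he
      have : x 2 ≤ m := le_of_mem_eseg (ℓ := coord 2)
        (fun v hv => hm e g1 v hv fun hvQ => g2 (hvQ ▸ hv)) hx
      exact ⟨by linarith, fun h0 => by linarith⟩
  have := hZ.curl_of_cap p3 hy₁ hy₂ hYY (fun e he x hx => (hOall e he x hx).1)
    (fun e he x hx => (hOall e he x hx).2) hℓQ (by rwa [hbody]) hD hQh hA hB hC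
  rwa [body_union, hbody, ← body_union] at this

/-- Raising one of the highest vertices a little makes it the unique highest one. -/
theorem SkeinClosed.curl (hZ : SkeinClosed Z) (hR : PolySys R) {A B C : E3} {h : ℝ}
    (hlow : ∀ e ∈ R, ∀ x ∈ eseg e, x 2 ≤ h) (hZR : Z (body R))
    (hD : xzDet A B C ≠ 0) (hA : h < A 2) (hB : h < B 2) (hC : h < C 2) :
    Z (body (tri A B C ∪ R)) := by
  have hall := hR.tri_union_of_low (nonCol_of_xzDet hD) hlow hA hB hC
  obtain ⟨δ₁, d1, st1⟩ := hR.emb.exists_stable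
  obtain ⟨δ₂, d2, st2⟩ := hall.emb.exists_stable
  obtain ⟨Q, hQ, hmax⟩ : ∃ Q ∈ verts R, ∀ v ∈ verts R, v 2 ≤ Q 2 := by
    refine Finset.exists_max_image (verts R) (fun v => v 2) ?_
    obtain ⟨e, he⟩ := hR.ne
    induction e with | _ a b => exact ⟨a, mem_verts.2 ⟨_, he, by simp⟩⟩
  obtain ⟨f, hf, hQf⟩ := mem_verts.1 hQ
  have hQh : Q 2 ≤ h := hlow f hf Q (mem_eseg_of_mem hQf)
  -- `ε` is below the stability radii of the link with and without the triangle, so neither changes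
  -- its isotopy class, and the raised vertex stays below the triangle.
  obtain ⟨ε, e0, e1⟩ := exists_between (show (0 : ℝ) <
    min (min δ₁ δ₂) (min (A 2 - h) (min (B 2 - h) (C 2 - h))) by
      simp only [lt_min_iff]; exact ⟨⟨d1, d2⟩, by linarith, by linarith, by linarith⟩)
  simp only [lt_min_iff] at e1
  obtain ⟨⟨e1, e2⟩, e3, e4, e5⟩ := e1
  set p : E3 → E3 := Function.update id Q (Q + ε • ez) with hp
  have hpQ : p Q = Q + ε • ez := Function.update_self ..
  have hpv : ∀ v, v ≠ Q → p v = v := fun v hv => Function.update_of_ne hv ..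
  have hez : ‖ez‖ = 1 := by simp [ez, EuclideanSpace.norm_eq, Fin.sum_univ_three]
  have hnorm : ∀ v, ‖p v - id v‖ ≤ ε := by
    intro v
    by_cases hv : v = Q
    · rw [hv, hpQ, id, add_sub_cancel_left, norm_smul, hez, mul_one, Real.norm_of_nonneg e0.le]
    · rw [hpv v hv, id, sub_self, norm_zero]; exact e0.le
  obtain ⟨g1, g2⟩ := st1 p fun e _ v _ => (hnorm v).trans_lt e1
  obtain ⟨-, g4⟩ := st2 p fun e _ v _ => (hnorm v).trans_lt e2
  have hR' := g1.poly_image hR.ne hR.deg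
  have htri : (tri A B C ∪ R).image (Sym2.map p) = tri A B C ∪ R.image (Sym2.map p) := by
    have ne : ∀ {a : E3}, h < a 2 → p a = a := fun ha => hpv _ fun hh => by rw [hh] at ha; linarith
    rw [Finset.image_union]
    simp [tri, Finset.image_insert, ne hA, ne hB, ne hC]
  rw [← body_image, ← body_image, Sym2.map_id, Finset.image_id] at g2 g4
  rw [htri] at g4
  have hp2 : (p Q) 2 = Q 2 + ε := by rw [hpQ]; simp [ez]
  refine hZ.iso g4.symm (hZ.curl_of_top (h := h + ε) hR' (Q := p Q) ?_ ?_ (hZ.iso g2 hZR) hD ?_ ?_ ?_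
    ?_)
  · exact ⟨_, Finset.mem_image_of_mem _ hf, Sym2.mem_map.2 ⟨Q, hQf, rfl⟩⟩
  · intro e he v hv hne
    obtain ⟨e', he', rfl⟩ := Finset.mem_image.1 he
    obtain ⟨w, hw, rfl⟩ := Sym2.mem_map.1 hv
    have hwQ : w ≠ Q := fun hh => hne (by rw [hh])
    rw [hpv w hwQ, hp2]
    linarith [hmax w (mem_verts.2 ⟨e', he', hw⟩)]
  · rw [hp2]; linarith
  · linarith
  · linarith
  · linarith

end trivial_component
end

end

section
open Set Topology Filter
open scoped Classical
noncomputable section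
attribute [local instance] sym2DecEq

/-! ### All links -/

section all_links
variable {Z : Set E3 → Prop}

theorem unknot_eq_body : unknot.1 = body (tri (pt 0 0 0) (pt 1 0 0) (pt 0 1 0)) := by
  simp only [unknot, triangleEdges, body, tri, pt]
  simp [eseg, edgeSegment]

/-- The triangle of the unknot is horizontal, so its determinant `xzDet` is zero and `tri_connect`
does not apply. It is tilted by raising one corner before it is connected to the given triangle. The
rest is empty, and `k` is any height below everything. -/
theorem SkeinClosed.triangle (hZ : SkeinClosed Z) {A B C : E3} (hD : xzDet A B C ≠ 0) :
    Z (body (tri A B C)) := by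
  obtain ⟨k, k1, k2, k3, k4⟩ : ∃ k : ℝ, k ≤ -1 ∧ k < A 2 ∧ k < B 2 ∧ k < C 2 := by
    refine ⟨min (-1) (min (A 2) (min (B 2) (C 2)) - 1), min_le_left _ _, ?_, ?_, ?_⟩ <;>
      refine (min_le_right _ _).trans_lt (sub_lt_iff_lt_add.2 ?_) <;>
      refine lt_of_le_of_lt ?_ (lt_add_one _) <;> simp
  have hn : ∀ t : ℝ, NonCol (pt 0 0 0) (pt 1 0 0) (pt 0 1 t) := by
    intro t a b h
    have h0 := congrArg (fun v : E3 => v 0) h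
    have h1 := congrArg (fun v : E3 => v 1) h
    simp only [PiLp.add_apply, PiLp.smul_apply, PiLp.sub_apply, smul_eq_mul, PiLp.zero_apply,
      pt_zero, pt_one] at h0 h1
    exact ⟨by linarith, by linarith⟩
  have hc : Continuous fun t : ℝ => pt 0 1 t := by
    refine (PiLp.continuous_toLp 2 _).comp (continuous_pi fun i => ?_)
    fin_cases i <;> simp <;> fun_prop
  obtain ⟨h1, h2⟩ := tri_motion (R := ∅) (P := fun _ => pt 0 0 0) (Q := fun _ => pt 1 0 0)
    (T := fun t => pt 0 1 t) (h := k) continuous_const continuous_const hc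
    (by rw [Finset.union_empty]; exact polySys_tri (hn 0)) (fun t _ => hn t) (by simp)
    (fun t ht => by
      simp only [pt_two]
      exact ⟨by linarith, by linarith, by linarith [ht.1]⟩)
  have h3 := (tri_connect h1 (by simp [xzDet, pt_zero, pt_two]) hD (by simp)
    (by rw [pt_two]; linarith) (by rw [pt_two]; linarith) (by rw [pt_two]; linarith) k2 k3 k4).2
  simp only [Finset.union_empty] at h2 h3
  have h0 := hZ.unknot
  rw [unknot_eq_body] at h0
  exact hZ.iso h3 (hZ.iso h2 h0)

theorem Good.mono {P R : Finset (Sym2 (ℝ × ℝ))} {z : ℝ × ℝ → ℝ} (h : Good z P) (hR : R ⊆ P) :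
    Good z R := fun e he e' he' hne => h e (hR he) e' (hR he') hne

theorem cnum_sys_le (z : ℝ × ℝ → ℝ) (P : Finset (Sym2 (ℝ × ℝ))) :
    cnum (sys z P) proj ≤ cnum P id :=
  cnum_image_le (lift_injective z) (Φ := id) (fun _ _ _ => rfl) fun v => proj_lift z v

/-- The induction is lexicographic, on the number of crossings and the number of edges. Smoothings
lower the first number. Removing a component does not raise the first and lowers the second. -/
theorem SkeinClosed.polySys (hZ : SkeinClosed Z) : ∀ S, PolySys S → Z (body S) := by
  suffices h : ∀ m n S, PolySys S → cnum S proj = m → S.card = n → Z (body S) from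
    fun S hS => h _ _ S hS rfl rfl
  intro m
  induction m using Nat.strong_induction_on with | _ m ihm =>
  intro n
  induction n using Nat.strong_induction_on with | _ n ihn =>
  intro S hS hm hn
  obtain ⟨P, z, hP, hz, hne, hfst, hiso, hcn, hcard⟩ := hS.exists_generic
  obtain ⟨R, hRP, hdeg, A, B, C, h, -, hD, hlow, hA, hB, hC, hiff⟩ :=
    hP.exists_top_triangle hZ hz hne hfst fun S' hS' hlt => ihm _ (by omega) _ S' hS' rfl rfl
  refine (hZ.iff hiso).2 (hiff.2 ?_)
  -- If nothing is left besides the triangle, the link is the unknot.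
  rcases R.eq_empty_or_nonempty with rfl | hR
  · have : sys z ∅ = ∅ := rfl
    rw [this, Finset.union_empty]
    exact hZ.triangle hD
  · have hpoly : PolySys (sys z R) :=
      (hz.mono hRP.1).polySys (fun e he => hP.nd e (hRP.1 he)) hdeg hR
    refine hZ.curl hpoly hlow ?_ hD hA hB hC
    have c1 := (cnum_sys_le z R).trans (cnum_mono hRP.1 id)
    have c2 : (sys z R).card < n := by
      have h1 : (sys z R).card ≤ R.card := Finset.card_image_le
      have h2 := Finset.card_lt_card hRP
      omega
    rcases (c1.trans hcn).lt_or_eq with h1 | h1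
    · exact ihm _ (by omega) _ _ hpoly rfl rfl
    · exact ihn _ c2 _ hpoly (by omega) rfl

end all_links
end

end

theorem mainTheorem8 {R : Type*} [CommRing R] (a b c d : R)
    (ha : IsUnit a) (hb : IsUnit b) (hc : IsUnit c) (hd : IsUnit d)
    (f f' : Link → R) (hf : IsLinkInvariant f) (hf' : IsLinkInvariant f')
    (hskein : SatisfiesSkein a b c d f) (hskein' : SatisfiesSkein a b c d f')
    (hunknot : f unknot = f' unknot) :
    ∀ L : Link, f L = f' L := by
  rintro ⟨L, hL⟩
  have hZ := skeinClosed_eq a b c d ha hb hd f f' hf hf' hskein hskein' hunknot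
  obtain ⟨_, ⟨S, hS, rfl⟩, hiso⟩ := id hL
  have h := hZ.polySys _ (PolySys.of_isClosedPolygonSystem hS)
  have hbody : body hS.finite.toFinset = ⋃ e ∈ S, edgeSegment e := by
    simp [body, eseg, edgeSegment]
  rw [hbody] at h
  exact hZ.iso hiso.symm h hL
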